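/- Notation. For $\delta>0$ let $w_\delta(x)=(1+|x|)^{-\delta}$ on $\mathbb{R}^3$ and $L^p_{w_\delta}=L^p(\mathbb{R}^3,w_\delta\,dx)$. Norms of vectors and of $3\times3$ tensors are Euclidean; $(\nabla u)_{i,j}=\partial_i u_j$ and $(\nabla\cdot F)_j=\sum_i\partial_iF_{i,j}$. $R_i=\partial_i/\sqrt{-\Delta}$ are the Riesz transforms. All derivatives are in the sense of distributions. Statement. Let $0<\gamma\le 2$. There is a constant $C_\gamma>0$, depending only on $\gamma$, such that the following holds. Let $0<T<+\infty$, let $u_0\in L^2_{w_\gamma}(\mathbb{R}^3)$ be a divergence-free vector field, let $F=(F_{i,j})_{1\le i,j\le 3}\in L^2((0,T),L^2_{w_\gamma})$ be a tensor and let $b\in L^3((0,T),L^3_{w_{3\gamma/2}})$ be a time-dependent vector field with $\nabla\cdot b=0$. Let $u$ be a solution on $(0,T)\times\mathbb{R}^3$ of $$\partial_t u=\Delta u-(b\cdot\nabla)u-\nabla p+\nabla\cdot F,\qquad \nabla\cdot u=0,\qquad u(0,\cdot)=u_0,$$ such that: 1. $u\in L^\infty((0,T),L^2_{w_\gamma})$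 and $\nabla u\in L^2((0,T),L^2_{w_\gamma})$; 2. $p=\sum_{i,j}R_iR_j(b_iu_j-F_{i,j})$, where $\sum_{i,j}R_iR_j(b_iu_j)\in L^3((0,T),L^{6/5}_{w_{6\gamma/5}})$ and $\sum_{i,j}R_iR_jF_{i,j}\in L^2((0,T),L^2_{w_\gamma})$; 3. $t\mapsto u(t,\cdot)$ is weakly continuous from $[0,T)$ to $L^2_{w_\gamma}$, and $\lim_{t\to0^+}\|u(t,\cdot)-u_0\|_{L^2_{w_\gamma}}=0$; 4. there is a non-negative locally finite measure $\mu$ on $(0,T)\times\mathbb{R}^3$ such that $$\partial_t\Big(\frac{|u|^2}2\Big)=\Delta\Big(\frac{|u|^2}2\Big)-|\nabla u|^2-\nabla\cdot\Big(\frac{|u|^2}2\,b\Big)-\nabla\cdot(pu)+u\cdot(\nabla\cdot F)-\mu,$$ where $u\cdot(\nabla\cdot F)=\sum_{i,j}\big(\partial_i(F_{i,j}u_j)-F_{i,j}\,\partial_iu_j\big)$. Then $$\sup_{0<t<T}\|u(t,\cdot)\|_{L^2_{w_\gamma}}\le\big(\|u_0\|_{L^2_{w_\gamma}}+C_\gamma\|F\|_{L^2((0,T),L^2_{w_\gamma})}\big)\,e^{C_\gamma\left(T+T^{1/3}\|b\|^2_{L^3((0,T),L^3_{w_{3\gamma/2}})}\right)}$$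 and $$\|\nabla u\|_{L^2((0,T),L^2_{w_\gamma})}\le\big(\|u_0\|_{L^2_{w_\gamma}}+C_\gamma\|F\|_{L^2((0,T),L^2_{w_\gamma})}\big)\,e^{C_\gamma\left(T+T^{1/3}\|b\|^2_{L^3((0,T),L^3_{w_{3\gamma/2}})}\right)}.$$ -/

import Mathlib

open MeasureTheory Set Filter Topology TopologicalSpace
open scoped ENNReal Distributions FourierTransform

namespace WeightedAD

noncomputable section

/-- Three-dimensional Euclidean space. -/
abbrev E3 : Type := EuclideanSpace ℝ (Fin 3)

/-- `3 × 3` tensors, with the Euclidean (Frobenius) norm. -/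
abbrev Tensor3 : Type := EuclideanSpace ℝ (Fin 3 × Fin 3)

/-- The weight `w_δ(x) = (1 + |x|)^{-δ}`. -/
def weight (δ : ℝ) (x : E3) : ℝ := 1 / (1 + ‖x‖) ^ δ

/-- The measure `w_δ(x) dx`. -/
def weightMeasure (δ : ℝ) : Measure E3 :=
  volume.withDensity (fun x => ENNReal.ofReal (weight δ x))

/-- The norm of `L^p_{w_δ} = L^p(w_δ dx)`. -/
def wNorm {V : Type*} [NormedAddCommGroup V] (p : ℝ≥0∞) (δ : ℝ) (f : E3 → V) : ℝ≥0∞ :=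
  eLpNorm f p (weightMeasure δ)

/-- The norm of `L^q((0,T), L^p_{w_δ})`. -/
def mixedNorm {V : Type*} [NormedAddCommGroup V] (q : ℝ≥0∞) (T : ℝ) (p : ℝ≥0∞) (δ : ℝ)
    (f : ℝ → E3 → V) : ℝ≥0∞ :=
  eLpNorm (fun t => wNorm p δ (f t)) q (volume.restrict (Ioo 0 T))

/-- The open set `(0,T) × ℝ³` of space-time. -/
def strip (T : ℝ) : Opens (ℝ × E3) := ⟨Ioo 0 T ×ˢ univ, isOpen_Ioo.prod isOpen_univ⟩

/-- Membership in `L^q((0,T), L^p_{w_δ})`. -/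
def MemMixed {V : Type*} [NormedAddCommGroup V] (q : ℝ≥0∞) (T : ℝ) (p : ℝ≥0∞) (δ : ℝ)
    (f : ℝ → E3 → V) : Prop :=
  AEStronglyMeasurable (fun z : ℝ × E3 => f z.1 z.2)
      (volume.restrict (strip T : Set (ℝ × E3))) ∧
    mixedNorm q T p δ f < ∞

/-- The time derivative of a function on space-time. -/
def dt (φ : ℝ × E3 → ℝ) (z : ℝ × E3) : ℝ := fderiv ℝ φ z (1, 0)

/-- The `i`-th spatial partial derivative of a function on space-time. -/
def dx (i : Fin 3) (φ : ℝ × E3 → ℝ) (z : ℝ × E3) : ℝ :=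
  fderiv ℝ φ z (0, EuclideanSpace.single i 1)

/-- The spatial Laplacian of a function on space-time. -/
def lap (φ : ℝ × E3 → ℝ) (z : ℝ × E3) : ℝ := ∑ i, dx i (dx i φ) z

/-- `∇ · v = 0` in the sense of distributions on `ℝ³`. -/
def DivFree (v : E3 → E3) : Prop :=
  ∀ φ : 𝓓((⊤ : Opens E3), ℝ),
    ∫ x, ∑ i, v x i * fderiv ℝ φ x (EuclideanSpace.single i 1) = 0

/-- `∇ · v = 0` in the sense of distributions on `(0,T) × ℝ³`. -/
def DivFreeST (T : ℝ) (v : ℝ → E3 → E3) : Prop :=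
  ∀ φ : 𝓓(strip T, ℝ), ∫ z in strip T, ∑ i, v z.1 z.2 i * dx i φ z = 0

/-- `Du` is the spatial gradient of `u` in the sense of distributions on `(0,T) × ℝ³`,
with components `Du (i, j) = ∂_i u_j`. -/
def IsWeakGradient (T : ℝ) (u : ℝ → E3 → E3) (Du : ℝ → E3 → Tensor3) : Prop :=
  ∀ (i j : Fin 3) (φ : 𝓓(strip T, ℝ)),
    ∫ z in strip T, u z.1 z.2 j * dx i φ z = - ∫ z in strip T, Du z.1 z.2 (i, j) * φ z

/-- The Fourier symbol `i ξ_i / |ξ|` of the Riesz transform `R_i = ∂_i / √(-Δ)`. -/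
def rieszSymbol (i : Fin 3) (ξ : E3) : ℂ := Complex.I * (ξ i : ℂ) / (‖ξ‖ : ℂ)

/-- `R_i R_j φ` for a test function `φ` on `ℝ³`, as a Fourier multiplier. It is real valued,
since the symbol is real and even. It is `O(|x|⁻³)` at infinity, so that it can be
integrated against every function of `L^p_{w_δ}` with `1 < p < ∞` and `0 < δ < 3`. -/
def rieszRieszTest (i j : Fin 3) (φ : E3 → ℝ) (x : E3) : ℝ :=
  (𝓕⁻ (fun ξ : E3 => rieszSymbol i ξ * rieszSymbol j ξ * 𝓕 (fun y : E3 => (φ y : ℂ)) ξ) x).re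

/-- The function `q` is `∑_{i,j} R_i R_j G_{i,j}`, where `R_i R_j` (which is symmetric) acts on
the functions of `L^p_{w_δ}` by transposition:
`⟨R_i R_j g, φ⟩ = ⟨g, R_i R_j φ⟩` for every test function `φ`. -/
def IsRieszRieszSum (G : E3 → Tensor3) (q : E3 → ℝ) : Prop :=
  ∀ φ : 𝓓((⊤ : Opens E3), ℝ),
    ∫ x, q x * φ x = ∫ x, ∑ i, ∑ j, G x (i, j) * rieszRieszTest i j φ x

/-- The tensor `b ⊗ u`, with components `b_i u_j`. -/
def tensorProd (b u : E3) : Tensor3 := WithLp.toLp 2 (fun k => b k.1 * u k.2)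

/-- The relation `p = ∑_{i,j} R_i R_j (b_i u_j - F_{i,j})` on `(0,T) × ℝ³`, where
`∑ R_i R_j (b_i u_j)` is in `L³((0,T), L^{6/5}_{w_{6γ/5}})` and `∑ R_i R_j F_{i,j}` is in
`L²((0,T), L²_{w_γ})`. -/
def IsPressure (γ T : ℝ) (F : ℝ → E3 → Tensor3) (b u : ℝ → E3 → E3) (p : ℝ → E3 → ℝ) : Prop :=
  ∃ p₁ p₂ : ℝ → E3 → ℝ,
    MemMixed 3 T (6 / 5) (6 * γ / 5) p₁ ∧
    MemMixed 2 T 2 γ p₂ ∧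
    (∀ᵐ t ∂(volume.restrict (Ioo 0 T)),
      IsRieszRieszSum (fun x => tensorProd (b t x) (u t x)) (p₁ t)) ∧
    (∀ᵐ t ∂(volume.restrict (Ioo 0 T)), IsRieszRieszSum (F t) (p₂ t)) ∧
    (∀ᵐ z ∂(volume.restrict (strip T : Set (ℝ × E3))),
      p z.1 z.2 = p₁ z.1 z.2 - p₂ z.1 z.2)

/-- The equation `∂_t u = Δu - (b · ∇)u - ∇p + ∇ · F` in the sense of distributions on
`(0,T) × ℝ³`, where `Du = ∇u`, `((b · ∇)u)_j = ∑_i b_i ∂_i u_j` and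
`(∇ · F)_j = ∑_i ∂_i F_{i,j}`. -/
def SolvesAD (T : ℝ) (F : ℝ → E3 → Tensor3) (b u : ℝ → E3 → E3) (Du : ℝ → E3 → Tensor3)
    (p : ℝ → E3 → ℝ) : Prop :=
  ∀ (j : Fin 3) (φ : 𝓓(strip T, ℝ)),
    - ∫ z in strip T, u z.1 z.2 j * dt φ z =
      (∫ z in strip T, u z.1 z.2 j * lap φ z)
      - (∫ z in strip T, (∑ i, b z.1 z.2 i * Du z.1 z.2 (i, j)) * φ z)
      + (∫ z in strip T, p z.1 z.2 * dx j φ z)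
      - ∫ z in strip T, ∑ i, F z.1 z.2 (i, j) * dx i φ z

/-- The local energy balance
`∂_t(|u|²/2) = Δ(|u|²/2) - |∇u|² - ∇·((|u|²/2) b) - ∇·(p u) + u·(∇·F) - μ`
in the sense of distributions on `(0,T) × ℝ³`, for some non-negative locally finite measure `μ`
on `(0,T) × ℝ³`; here `u·(∇·F) = ∑_{i,j} (∂_i(F_{i,j} u_j) - F_{i,j} ∂_i u_j)`. -/
def LocalEnergyBalance (T : ℝ) (F : ℝ → E3 → Tensor3) (b u : ℝ → E3 → E3)
    (Du : ℝ → E3 → Tensor3) (p : ℝ → E3 → ℝ) : Prop :=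
  ∃ μ : Measure (ℝ × E3),
    (∀ K : Set (ℝ × E3), IsCompact K → K ⊆ strip T → μ K < ∞) ∧
    ∀ φ : 𝓓(strip T, ℝ),
      - ∫ z in strip T, ‖u z.1 z.2‖ ^ 2 / 2 * dt φ z =
        (∫ z in strip T, ‖u z.1 z.2‖ ^ 2 / 2 * lap φ z)
        - (∫ z in strip T, ‖Du z.1 z.2‖ ^ 2 * φ z)
        + (∫ z in strip T, ‖u z.1 z.2‖ ^ 2 / 2 * ∑ i, b z.1 z.2 i * dx i φ z)
        + (∫ z in strip T, p z.1 z.2 * ∑ i, u z.1 z.2 i * dx i φ z)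
        - (∫ z in strip T, ∑ i, ∑ j, F z.1 z.2 (i, j) * u z.1 z.2 j * dx i φ z)
        - (∫ z in strip T, (∑ i, ∑ j, F z.1 z.2 (i, j) * Du z.1 z.2 (i, j)) * φ z)
        - ∫ z in strip T, φ z ∂μ

/-- `t ↦ u(t, ·)` is weakly continuous from `[0,T)` to `L²_{w_γ}`. -/
def WeaklyContinuous (γ T : ℝ) (u : ℝ → E3 → E3) : Prop :=
  (∀ t ∈ Ico 0 T, MemLp (u t) 2 (weightMeasure γ)) ∧
    ∀ g : E3 → E3, MemLp g 2 (weightMeasure γ) →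
      ContinuousOn (fun t => ∫ x, inner ℝ (u t x) (g x) ∂(weightMeasure γ)) (Ico 0 T)

/-- The data of the advection-diffusion problem: divergence-free `u₀ ∈ L²_{w_γ}`,
`F ∈ L²((0,T), L²_{w_γ})`, divergence-free `b ∈ L³((0,T), L³_{w_{3γ/2}})`. -/
structure IsData (γ T : ℝ) (u₀ : E3 → E3) (F : ℝ → E3 → Tensor3) (b : ℝ → E3 → E3) : Prop where
  memLp_init : MemLp u₀ 2 (weightMeasure γ)
  divFree_init : DivFree u₀
  mem_force : MemMixed 2 T 2 γ F
  mem_drift : MemMixed 3 T 3 (3 * γ / 2) b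
  divFree_drift : DivFreeST T b

/-- `u`, with spatial gradient `Du` and pressure `p`, is a solution of
`∂_t u = Δu - (b · ∇)u - ∇p + ∇ · F`, `∇ · u = 0`, `u(0, ·) = u₀` on `(0,T) × ℝ³`
in the energy class, with the regularity and the local energy balance of suitable solutions. -/
structure IsSolution (γ T : ℝ) (u₀ : E3 → E3) (F : ℝ → E3 → Tensor3) (b u : ℝ → E3 → E3)
    (Du : ℝ → E3 → Tensor3) (p : ℝ → E3 → ℝ) : Prop where
  equation : SolvesAD T F b u Du p
  divFree : DivFreeST T u
  initial : u 0 =ᵐ[volume] u₀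
  mem_velocity : MemMixed ∞ T 2 γ u
  isGradient : IsWeakGradient T u Du
  mem_gradient : MemMixed 2 T 2 γ Du
  pressure : IsPressure γ T F b u p
  weaklyContinuous : WeaklyContinuous γ T u
  tendsto_initial : Tendsto (fun t => wNorm 2 γ (u t - u₀)) (𝓝[>] 0) (𝓝 0)
  energy : LocalEnergyBalance T F b u Du p

end

end WeightedAD

namespace WeightedAD

/-! The estimate is the energy estimate with weight `w_γ`: formally, the equation is multiplied by
`w_γ u` and integrated, and every term in which a derivative falls on the weight has to be absorbed.
Let `e`, `d`, `β`, `f` be the weighted norms of `u`, `∇u`, `b`, `F` at a given time. Since `|∇w_γ| ≲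
w_{γ+1} ≤ w_{3γ/2}`, which is where `γ ≤ 2` enters, Hölder and the weighted Sobolev inequality
`‖w_{γ/2} u‖₆ ≲ e + d` bound the transport term by `β e (e + d)`. Young's inequality leaves `d²/2`
plus a multiple of `(1 + β²) e² + f²`, and Grönwall's inequality concludes; Hölder in time turns `∫
β²` into `T^{1/3} ‖b‖²`.

The pressure is the delicate term: it must be estimated by `b ⊗ u` and `F`, not by its own norm. The
operator `R_i R_j` is moved by transposition onto the test function `u · ∇Φ`, so what is needed are
bounds of `R_i R_j φ` in `L²` and `L⁶` with growing weights, powers of `ρ = 1 + |x|²`. These are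
obtained without singular integrals. The symbol is regularised to `ξ_i ξ_j / (|ξ|² + τ)`. A
coordinate commutes with this multiplier up to a multiplier of order `-1`, which is bounded
uniformly in `τ` by Hardy's inequality applied to the Fourier transform. This gives `L²` bounds with
the weight `ρ` and, for derivatives `∂_m f` only, with the weight `ρ²`. A quadratic interpolation
between weights gives the intermediate powers `ρ^θ` and `ρ^{2θ}`, used with `θ = γ/2`, and Sobolev's
inequality turns the second bound into an `L⁶` bound (`eLpNorm_rieszRiesz_six_le`). Hardy's
inequality occurs a second time, because the Hessian of the test weight is only controlled by
`w_{γ+1} / |x|`.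

The multiplication by `w_γ u` is made rigorous through the local energy balance, tested with `α(t)
Φ_n(x)`, where the `Φ_n` are smooth compactly supported approximations of `w_γ` with uniform bounds
(`exists_isTestWeight`). The measure `μ` has a favourable sign and is dropped. Weak continuity makes
the localised energy lower semicontinuous, so that the inequality holds at every time; strong
continuity at `0` gives the initial value. The remainder `d²/2` is absorbed only after `n → ∞`, when
the localised dissipation has become `d²` (`exists_energy_inequality`). -/

/-- The standard basis vectors of `ℝ³`. -/
noncomputable abbrev bvec (k : Fin 3) : E3 := EuclideanSpace.single k (1 : ℝ)

/-! ### Hardy's inequality -/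

lemma norm_sq_eq_sum (x : E3) : ‖x‖ ^ 2 = ∑ k, x k ^ 2 := by
  rw [EuclideanSpace.norm_sq_eq]; simp

lemma hasFDerivAt_coord (k : Fin 3) (x : E3) :
    HasFDerivAt (fun y : E3 => y k) (EuclideanSpace.proj k : E3 →L[ℝ] ℝ) x :=
  (EuclideanSpace.proj k : E3 →L[ℝ] ℝ).hasFDerivAt

lemma hasFDerivAt_norm_sq (x : E3) :
    HasFDerivAt (fun y : E3 => ‖y‖ ^ 2) (2 • (innerSL ℝ x)) x :=
  (hasStrictFDerivAt_norm_sq x).hasFDerivAt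

/-- Components of the vector field `x / (|x|² + τ)`, against which `|f|²` is integrated by parts in
Hardy's inequality. The parameter `τ` removes the singularity at the origin, and no constant below
depends on it. -/
lemma hasFDerivAt_hardyField {τ : ℝ} (hτ : 0 < τ) (x : E3) (k : Fin 3) :
    HasFDerivAt (fun y : E3 => y k / (‖y‖ ^ 2 + τ))
      (x k • (-((‖x‖ ^ 2 + τ) ^ 2)⁻¹ • 2 • innerSL ℝ x)
        + (‖x‖ ^ 2 + τ)⁻¹ • (EuclideanSpace.proj k : E3 →L[ℝ] ℝ)) x := by
  have h0 : ‖x‖ ^ 2 + τ ≠ 0 := by positivity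
  simp_rw [div_eq_mul_inv]
  exact (hasFDerivAt_coord k x).fun_mul
    ((hasDerivAt_inv h0).comp_hasFDerivAt x ((hasFDerivAt_norm_sq x).add_const τ))

lemma fderiv_hardyField {τ : ℝ} (hτ : 0 < τ) (x : E3) (k : Fin 3) :
    fderiv ℝ (fun y : E3 => y k / (‖y‖ ^ 2 + τ)) x (bvec k)
      = 1 / (‖x‖ ^ 2 + τ) - 2 * x k ^ 2 / (‖x‖ ^ 2 + τ) ^ 2 := by
  have h0 : ‖x‖ ^ 2 + τ ≠ 0 := by positivity
  rw [(hasFDerivAt_hardyField hτ x k).fderiv]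
  simp [EuclideanSpace.inner_single_right]
  field_simp
  ring

/-- Hardy's inequality on `ℝ³`, with a regularised weight. -/
theorem hardy_inequality {V : Type*} [NormedAddCommGroup V] [InnerProductSpace ℝ V]
    {f : E3 → V} (hf : ContDiff ℝ 1 f) (h0 : Integrable (fun x => ‖f x‖ ^ 2))
    (h1 : ∀ k, Integrable (fun x => ‖fderiv ℝ f x (bvec k)‖ ^ 2)) {τ : ℝ} (hτ : 0 < τ) :
    ∫ x, ‖f x‖ ^ 2 / (‖x‖ ^ 2 + τ) ≤ 4 * ∑ k, ∫ x, ‖fderiv ℝ f x (bvec k)‖ ^ 2 := by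
  have hdf : Differentiable ℝ f := hf.differentiable (by norm_num)
  have hcf : Continuous f := hf.continuous
  have hcd : ∀ k, Continuous fun x => fderiv ℝ f x (bvec k) := fun k =>
    (hf.continuous_fderiv (by norm_num)).clm_apply continuous_const
  have hpos : ∀ x : E3, 0 < ‖x‖ ^ 2 + τ := fun x => by positivity
  have hcx : ∀ k : Fin 3, Continuous fun x : E3 => x k := fun k =>
    (EuclideanSpace.proj k : E3 →L[ℝ] ℝ).continuous
  have hsq : ∀ x : E3, ∀ k, x k ^ 2 ≤ ‖x‖ ^ 2 := fun x k => by
    rw [norm_sq_eq_sum]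
    exact Finset.single_le_sum (f := fun k => x k ^ 2) (fun _ _ => sq_nonneg _) (Finset.mem_univ k)
  have hfn : ∀ x k, fderiv ℝ (fun y => ‖f y‖ ^ 2) x (bvec k)
      = 2 * inner ℝ (f x) (fderiv ℝ f x (bvec k)) := fun x k => by
    have := (hdf x).hasFDerivAt.norm_sq
    rw [this.fderiv]; simp
  have hia : Integrable (fun x => ‖f x‖ ^ 2 / (‖x‖ ^ 2 + τ)) := by
    refine (h0.div_const τ).mono' ?_ (Eventually.of_forall fun x => ?_)
    · exact (Continuous.div (by fun_prop) (by fun_prop)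
        (fun x => (hpos x).ne')).aestronglyMeasurable
    · rw [Real.norm_of_nonneg (by positivity)]
      gcongr
      nlinarith [sq_nonneg ‖x‖]
  have hiv : ∀ k, Integrable (fun x => fderiv ℝ (fun y => ‖f y‖ ^ 2) x (bvec k)
      * (x k / (‖x‖ ^ 2 + τ))) := fun k => by
    refine ((hia.add (h1 k))).mono' ?_ (Eventually.of_forall fun x => ?_)
    · simp_rw [hfn]
      exact (Continuous.mul (by fun_prop) (Continuous.div (hcx k) (by fun_prop)
        (fun x => (hpos x).ne'))).aestronglyMeasurable
    · rw [hfn, norm_mul, norm_mul, Real.norm_eq_abs, Real.norm_eq_abs, Real.norm_eq_abs, abs_two,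
        abs_div, abs_of_pos (hpos x), Pi.add_apply]
      have e1 := abs_real_inner_le_norm (f x) (fderiv ℝ f x (bvec k))
      set a := ‖x‖ ^ 2 + τ
      set p := ‖f x‖
      set q := ‖fderiv ℝ f x (bvec k)‖
      have e2 : |x k| ^ 2 ≤ a := by rw [sq_abs]; linarith [hsq x k]
      have e3 : (|x k| / a) ^ 2 ≤ 1 / a := by
        rw [div_pow, div_le_div_iff₀ (by have := hpos x; positivity) (hpos x)]
        nlinarith [hpos x]
      have e4 : 2 * (p * q) * (|x k| / a) ≤ p ^ 2 * (|x k| / a) ^ 2 + q ^ 2 := by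
        nlinarith [sq_nonneg (p * (|x k| / a) - q)]
      calc 2 * |inner ℝ (f x) (fderiv ℝ f x (bvec k))| * (|x k| / a)
          ≤ 2 * (p * q) * (|x k| / a) := by
            have := hpos x
            gcongr
        _ ≤ _ := e4
        _ ≤ p ^ 2 * (1 / a) + q ^ 2 := by gcongr
        _ = _ := by ring
  have hig : ∀ k, Integrable (fun x => ‖f x‖ ^ 2 *
      fderiv ℝ (fun y : E3 => y k / (‖y‖ ^ 2 + τ)) x (bvec k)) := fun k => by
    simp_rw [fderiv_hardyField hτ]
    refine (hia.const_mul 3).mono' ?_ (Eventually.of_forall fun x => ?_)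
    · have : Continuous fun x : E3 => 1 / (‖x‖ ^ 2 + τ) - 2 * x k ^ 2 / (‖x‖ ^ 2 + τ) ^ 2 := by
        have := hcx k
        exact (Continuous.div (by fun_prop) (by fun_prop) (fun x => (hpos x).ne')).sub
          (Continuous.div (by fun_prop) (by fun_prop) (fun x => (pow_pos (hpos x) 2).ne'))
      exact (Continuous.mul (by fun_prop) this).aestronglyMeasurable
    · rw [norm_mul, Real.norm_of_nonneg (by positivity : 0 ≤ ‖f x‖ ^ 2), Real.norm_eq_abs]
      have e : |1 / (‖x‖ ^ 2 + τ) - 2 * x k ^ 2 / (‖x‖ ^ 2 + τ) ^ 2| ≤ 3 * (1 / (‖x‖ ^ 2 + τ)) := by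
        have e3 : x k ^ 2 / (‖x‖ ^ 2 + τ) ^ 2 ≤ 1 / (‖x‖ ^ 2 + τ) := by
          rw [div_le_div_iff₀ (pow_pos (hpos x) 2) (hpos x)]
          nlinarith [hpos x, hsq x k]
        have e4 : 0 ≤ x k ^ 2 / (‖x‖ ^ 2 + τ) ^ 2 := by positivity
        have e5 : 0 ≤ 1 / (‖x‖ ^ 2 + τ) := by positivity
        rw [mul_div_assoc, abs_le]
        constructor <;> linarith
      calc _ ≤ ‖f x‖ ^ 2 * (3 * (1 / (‖x‖ ^ 2 + τ))) := by gcongr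
        _ = _ := by ring
  have hi0 : ∀ k, Integrable (fun x => ‖f x‖ ^ 2 * (x k / (‖x‖ ^ 2 + τ))) := fun k => by
    refine (h0.add hia).mono' ?_ (Eventually.of_forall fun x => ?_)
    · exact (Continuous.mul (by fun_prop) (Continuous.div (hcx k) (by fun_prop)
        (fun x => (hpos x).ne'))).aestronglyMeasurable
    · rw [norm_mul, Real.norm_of_nonneg (by positivity : 0 ≤ ‖f x‖ ^ 2), Real.norm_eq_abs,
        abs_div, abs_of_pos (hpos x), Pi.add_apply]
      have e2 : |x k| ≤ (‖x‖ ^ 2 + τ) + 1 := by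
        nlinarith [hsq x k, sq_abs (x k), sq_nonneg (|x k| - 1), abs_nonneg (x k)]
      calc ‖f x‖ ^ 2 * (|x k| / (‖x‖ ^ 2 + τ))
          ≤ ‖f x‖ ^ 2 * (((‖x‖ ^ 2 + τ) + 1) / (‖x‖ ^ 2 + τ)) := by gcongr
        _ = _ := by have := (hpos x).ne'; field_simp
  -- No boundary term appears, since both products and the primitive `|f|² x_k / (|x|² + τ)` are
  -- integrable.
  have ibp : ∀ k, ∫ x, ‖f x‖ ^ 2 * fderiv ℝ (fun y : E3 => y k / (‖y‖ ^ 2 + τ)) x (bvec k)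
      = - ∫ x, fderiv ℝ (fun y => ‖f y‖ ^ 2) x (bvec k) * (x k / (‖x‖ ^ 2 + τ)) := fun k =>
    integral_mul_fderiv_eq_neg_fderiv_mul_of_integrable (hiv k) (hig k) (hi0 k)
      (fun x _ => (hdf x).norm_sq ℝ)
      (fun x _ => (hasFDerivAt_hardyField hτ x k).differentiableAt)
  -- In dimension three the divergence `3 / (|x|² + τ) - 2 |x|² / (|x|² + τ)²` is at least `1 /
  -- (|x|² + τ)`.
  have lhs : ∫ x, ‖f x‖ ^ 2 / (‖x‖ ^ 2 + τ) ≤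
      ∑ k, ∫ x, ‖f x‖ ^ 2 * fderiv ℝ (fun y : E3 => y k / (‖y‖ ^ 2 + τ)) x (bvec k) := by
    rw [← integral_finsetSum _ (fun k _ => hig k)]
    refine integral_mono hia (integrable_finsetSum _ fun k _ => hig k) fun x => ?_
    simp_rw [fderiv_hardyField hτ, ← Finset.mul_sum, Finset.sum_sub_distrib, ← Finset.sum_div,
      ← Finset.mul_sum, ← norm_sq_eq_sum]
    simp only [Finset.sum_const, Finset.card_univ, Fintype.card_fin, nsmul_eq_mul, Nat.cast_ofNat]
    rw [div_eq_mul_one_div]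
    gcongr
    have : ‖x‖ ^ 2 / (‖x‖ ^ 2 + τ) ^ 2 ≤ 1 / (‖x‖ ^ 2 + τ) := by
      rw [div_le_div_iff₀ (pow_pos (hpos x) 2) (hpos x)]
      nlinarith [hpos x]
    have e : 2 * ‖x‖ ^ 2 / (‖x‖ ^ 2 + τ) ^ 2 = 2 * (‖x‖ ^ 2 / (‖x‖ ^ 2 + τ) ^ 2) := by ring
    have e' : 3 * (1 / (‖x‖ ^ 2 + τ)) = 3 * 1 / (‖x‖ ^ 2 + τ) := by ring
    linarith
  -- Young's inequality is weighted so that half of the left-hand side can be absorbed: `I ≤ I / 2 +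
  -- 2 D` gives the constant `4`.
  have rhs : ∑ k, ∫ x, ‖f x‖ ^ 2 * fderiv ℝ (fun y : E3 => y k / (‖y‖ ^ 2 + τ)) x (bvec k) ≤
      (1 / 2) * (∫ x, ‖f x‖ ^ 2 / (‖x‖ ^ 2 + τ)) +
        2 * ∑ k, ∫ x, ‖fderiv ℝ f x (bvec k)‖ ^ 2 := by
    have hiv' : ∀ k, Integrable (fun x => -(fderiv ℝ (fun y => ‖f y‖ ^ 2) x (bvec k)
      * (x k / (‖x‖ ^ 2 + τ)))) := fun k => (hiv k).neg
    simp_rw [ibp, ← integral_neg]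
    rw [← integral_finsetSum _ (fun k _ => hiv' k), Finset.mul_sum, ← integral_const_mul]
    simp_rw [← integral_const_mul]
    rw [← integral_finsetSum _ (fun k _ => (h1 k).const_mul 2), ← integral_add (hia.const_mul _)
      (integrable_finsetSum _ fun k _ => (h1 k).const_mul 2)]
    refine integral_mono (integrable_finsetSum _ fun k _ => hiv' k)
      ((hia.const_mul _).add (integrable_finsetSum _ fun k _ => (h1 k).const_mul 2)) fun x => ?_
    have e0 : ∀ k, -(fderiv ℝ (fun y => ‖f y‖ ^ 2) x (bvec k) * (x k / (‖x‖ ^ 2 + τ))) ≤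
        (1 / 2) * (‖f x‖ ^ 2 * (x k ^ 2 / (‖x‖ ^ 2 + τ) ^ 2))
          + 2 * ‖fderiv ℝ f x (bvec k)‖ ^ 2 := fun k => by
      rw [hfn]
      have e1 := abs_real_inner_le_norm (f x) (fderiv ℝ f x (bvec k))
      set a := x k / (‖x‖ ^ 2 + τ)
      set p := ‖f x‖
      set q := ‖fderiv ℝ f x (bvec k)‖
      have : x k ^ 2 / (‖x‖ ^ 2 + τ) ^ 2 = a ^ 2 := by rw [div_pow]
      rw [this]
      have e2 : -(2 * inner ℝ (f x) (fderiv ℝ f x (bvec k)) * a) ≤ 2 * (p * q) * |a| := by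
        calc _ ≤ |2 * inner ℝ (f x) (fderiv ℝ f x (bvec k)) * a| := neg_le_abs _
          _ = 2 * |inner ℝ (f x) (fderiv ℝ f x (bvec k))| * |a| := by
            rw [abs_mul, abs_mul, abs_two]
          _ ≤ _ := by gcongr
      nlinarith [sq_nonneg (p * |a| - 2 * q), sq_abs a]
    calc _ ≤ ∑ k, ((1 / 2) * (‖f x‖ ^ 2 * (x k ^ 2 / (‖x‖ ^ 2 + τ) ^ 2))
          + 2 * ‖fderiv ℝ f x (bvec k)‖ ^ 2) := Finset.sum_le_sum fun k _ => e0 k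
      _ = (1 / 2) * (‖f x‖ ^ 2 * (‖x‖ ^ 2 / (‖x‖ ^ 2 + τ) ^ 2))
          + ∑ k, 2 * ‖fderiv ℝ f x (bvec k)‖ ^ 2 := by
        rw [Finset.sum_add_distrib, ← Finset.mul_sum, ← Finset.mul_sum, ← Finset.sum_div,
          ← norm_sq_eq_sum]
      _ ≤ _ := by
        gcongr ?_ + _
        rw [div_eq_mul_one_div (‖f x‖ ^ 2)]
        refine mul_le_mul_of_nonneg_left (mul_le_mul_of_nonneg_left ?_ (by positivity))
          (by positivity)
        rw [div_le_div_iff₀ (pow_pos (hpos x) 2) (hpos x)]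
        nlinarith [hpos x]
  linarith

/-! ### Fourier multipliers on Schwartz functions and multiplication by coordinates -/

open scoped SchwartzMap LineDeriv ContDiff
open SchwartzMap

/-- `L²` norm of a Schwartz function. -/
noncomputable def sNorm (f : 𝓢(E3, ℂ)) : ℝ := ‖f.toLp 2‖

lemma sNorm_nonneg (f : 𝓢(E3, ℂ)) : 0 ≤ sNorm f := norm_nonneg _

lemma sNorm_sq (f : 𝓢(E3, ℂ)) : sNorm f ^ 2 = ∫ x, ‖f x‖ ^ 2 := by
  rw [sNorm, SchwartzMap.norm_toLp' (by norm_num) (by norm_num), ← Real.rpow_natCast,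
    ← Real.rpow_mul (integral_nonneg fun x => by positivity)]
  simp

lemma sNorm_add_le (f g : 𝓢(E3, ℂ)) : sNorm (f + g) ≤ sNorm f + sNorm g := by
  have : (f + g).toLp 2 volume = f.toLp 2 volume + g.toLp 2 volume :=
    map_add (toLpCLM ℂ ℂ 2 (volume : Measure E3)) f g
  rw [sNorm, this]; exact norm_add_le _ _

lemma sNorm_smul (c : ℂ) (f : 𝓢(E3, ℂ)) : sNorm (c • f) = ‖c‖ * sNorm f := by
  have : (c • f).toLp 2 volume = c • f.toLp 2 volume :=
    map_smul (toLpCLM ℂ ℂ 2 (volume : Measure E3)) c f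
  rw [sNorm, this]; exact norm_smul _ _

lemma integrable_norm_sq (f : 𝓢(E3, ℂ)) : Integrable fun x => ‖f x‖ ^ 2 :=
  (f.memLp 2 volume).integrable_norm_pow (by norm_num)

/-- Multiplication by the `k`-th coordinate. -/
noncomputable def coordMul (k : Fin 3) : 𝓢(E3, ℂ) →L[ℝ] 𝓢(E3, ℂ) :=
  smulLeftCLM ℂ (fun x : E3 => inner ℝ x (bvec k))

lemma inner_bvec (x : E3) (k : Fin 3) : inner ℝ x (bvec k) = x k := by
  simp [EuclideanSpace.inner_single_right]

lemma coordMul_apply (k) (f : 𝓢(E3, ℂ)) (x) : coordMul k f x = x k • f x := by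
  rw [coordMul, smulLeftCLM_apply_apply (by fun_prop), inner_bvec]

/-- Coordinates become derivatives on the Fourier side, so that polynomial weights in `x` are
measured by the smoothness of `𝓕 f`. -/
lemma fourier_coordMul (k : Fin 3) (f : 𝓢(E3, ℂ)) :
    𝓕 (coordMul k f) = (-(2 * Real.pi * Complex.I)⁻¹) • ∂_{bvec k} (𝓕 f) := by
  rw [lineDerivOp_fourier_eq, FourierTransform.fourier_smul, smul_smul]
  have : (-(2 * (Real.pi : ℂ) * Complex.I)⁻¹) * -(2 * Real.pi * Complex.I) = 1 := by
    have : (Real.pi : ℂ) ≠ 0 := by exact_mod_cast Real.pi_ne_zero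
    field_simp
  rw [this, one_smul]; rfl

lemma fourier_multiplier (g : E3 → ℝ) (f : 𝓢(E3, ℂ)) :
    𝓕 (fourierMultiplierCLM ℂ g f) = smulLeftCLM ℂ g (𝓕 f) := by
  rw [fourierMultiplierCLM_apply, FourierTransform.fourier_fourierInv_eq]

lemma lineDeriv_smulLeft {g : E3 → ℝ} {k : Fin 3} (hg : g.HasTemperateGrowth) {g' : E3 → ℝ}
    (hg' : g'.HasTemperateGrowth) (h : ∀ x, fderiv ℝ g x (bvec k) = g' x) (f : 𝓢(E3, ℂ)) :
    ∂_{bvec k} (smulLeftCLM ℂ g f) = smulLeftCLM ℂ g (∂_{bvec k} f) + smulLeftCLM ℂ g' f := by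
  ext x
  rw [lineDerivOp_apply_eq_fderiv]
  have e : (smulLeftCLM ℂ g f : E3 → ℂ) = fun x => g x • f x := by
    ext x; rw [smulLeftCLM_apply_apply hg]
  rw [e, fderiv_fun_smul (hg.1.differentiable (by simp) x) f.differentiableAt]
  simp only [_root_.add_apply, smulLeftCLM_apply_apply hg, smulLeftCLM_apply_apply hg',
    lineDerivOp_apply_eq_fderiv]
  simp [h]

/-- The commutator of a Fourier multiplier with the multiplication by a coordinate. -/
lemma coordMul_multiplier {g : E3 → ℝ} {k : Fin 3} (hg : g.HasTemperateGrowth) {g' : E3 → ℝ}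
    (hg' : g'.HasTemperateGrowth) (h : ∀ x, fderiv ℝ g x (bvec k) = g' x) (f : 𝓢(E3, ℂ)) :
    coordMul k (fourierMultiplierCLM ℂ g f) = fourierMultiplierCLM ℂ g (coordMul k f)
      + (-(2 * Real.pi * Complex.I)⁻¹) • fourierMultiplierCLM ℂ g' f := by
  -- The identity is checked after a Fourier transform, where it is the Leibniz rule for the product
  -- of the symbol and `𝓕 f`.
  have inj : Function.Injective (fun f : 𝓢(E3, ℂ) => 𝓕 f) := fun f g hfg => by
    have := congrArg (fun f : 𝓢(E3, ℂ) => 𝓕⁻ f) hfg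
    simpa using this
  apply inj
  simp only
  rw [FourierTransform.fourier_add, FourierTransform.fourier_smul, fourier_coordMul,
    fourier_multiplier, fourier_multiplier, fourier_multiplier, fourier_coordMul,
    lineDeriv_smulLeft hg hg' h, smul_add]
  congr 1
  ext x
  simp only [_root_.smul_apply, smulLeftCLM_apply_apply hg]
  rw [smul_comm]

lemma sNorm_fourier (f : 𝓢(E3, ℂ)) : sNorm (𝓕 f) = sNorm f := by
  simp [sNorm]

/-- Plancherel's identity reduces the bound to a pointwise one on the symbol. -/
lemma sNorm_multiplier_le {g : E3 → ℝ} (hg : g.HasTemperateGrowth) {C : ℝ} (hC : 0 ≤ C)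
    (h : ∀ x, |g x| ≤ C) (f : 𝓢(E3, ℂ)) :
    sNorm (fourierMultiplierCLM ℂ g f) ≤ C * sNorm f := by
  rw [← sNorm_fourier, ← sNorm_fourier f, fourier_multiplier]
  refine le_of_sq_le_sq ?_ (mul_nonneg hC (sNorm_nonneg _))
  rw [mul_pow, sNorm_sq, sNorm_sq, ← integral_const_mul]
  refine integral_mono (integrable_norm_sq _) ((integrable_norm_sq _).const_mul _) fun x => ?_
  simp only [smulLeftCLM_apply_apply hg, norm_smul, mul_pow]
  gcongr
  exact h x

/-- A multiplier of order `-1` is controlled by the `L²` norm with weight `|x|`. -/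
lemma sNorm_multiplier_hardy {g : E3 → ℝ} (hg : g.HasTemperateGrowth) {τ : ℝ} (hτ : 0 < τ)
    (h : ∀ x, g x ^ 2 ≤ 1 / (‖x‖ ^ 2 + τ)) (f : 𝓢(E3, ℂ)) :
    sNorm (fourierMultiplierCLM ℂ g f) ≤ (4 * Real.pi) * ∑ k, sNorm (coordMul k f) := by
  rw [← sNorm_fourier, fourier_multiplier]
  have hN : ∀ k, 0 ≤ sNorm (coordMul k f) := fun k => sNorm_nonneg _
  have hπ := Real.pi_pos
  refine le_of_sq_le_sq ?_ (mul_nonneg (by positivity) (Finset.sum_nonneg fun k _ => hN k))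
  have e1 : ∀ k, ∂_{bvec k} (𝓕 f) = (-(2 * Real.pi * Complex.I)) • 𝓕 (coordMul k f) := fun k => by
    rw [lineDerivOp_fourier_eq, FourierTransform.fourier_smul]; rfl
  have e2 : ∀ k, ∫ x, ‖fderiv ℝ (𝓕 f : 𝓢(E3, ℂ)) x (bvec k)‖ ^ 2
      = (2 * Real.pi * sNorm (coordMul k f)) ^ 2 := fun k => by
    have : 2 * Real.pi * sNorm (coordMul k f) = sNorm (∂_{bvec k} (𝓕 f)) := by
      rw [e1, sNorm_smul, sNorm_fourier]
      simp [abs_of_pos hπ]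
    rw [this, sNorm_sq]
    simp [lineDerivOp_apply_eq_fderiv]
  -- Hardy's inequality is used in the frequency variable: its right-hand side contains the norms of
  -- `∂_k 𝓕 f`, that is, `2π` times those of `x_k f`. The constant is `4 (2π)² = (4π)²`.
  have hardy := hardy_inequality (f := (𝓕 f : 𝓢(E3, ℂ))) ((𝓕 f : 𝓢(E3, ℂ)).smooth 1)
    (integrable_norm_sq _) (fun k => by
      simpa [lineDerivOp_apply_eq_fderiv] using integrable_norm_sq (∂_{bvec k} (𝓕 f))) hτ
  rw [sNorm_sq]
  calc _ ≤ ∫ x, ‖(𝓕 f : 𝓢(E3, ℂ)) x‖ ^ 2 / (‖x‖ ^ 2 + τ) := by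
        have hpos : ∀ x : E3, 0 < ‖x‖ ^ 2 + τ := fun x => by positivity
        refine integral_mono (integrable_norm_sq _) ?_ fun x => ?_
        · refine ((integrable_norm_sq (𝓕 f)).div_const τ).mono' ?_ (Eventually.of_forall fun x =>
              ?_)
          · have := (𝓕 f : 𝓢(E3, ℂ)).continuous
            exact (Continuous.div (by fun_prop) (by fun_prop)
              (fun x => (hpos x).ne')).aestronglyMeasurable
          · rw [Real.norm_of_nonneg (by positivity)]
            gcongr
            nlinarith [sq_nonneg ‖x‖]
        · simp only [smulLeftCLM_apply_apply hg, norm_smul, mul_pow, Real.norm_eq_abs, sq_abs]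
          rw [div_eq_mul_one_div, mul_comm]
          have := h x
          gcongr
    _ ≤ _ := hardy
    _ = (4 * Real.pi) ^ 2 * ∑ k, sNorm (coordMul k f) ^ 2 := by
        simp_rw [e2, mul_pow, ← Finset.mul_sum]; ring
    _ ≤ _ := by
        rw [mul_pow _ (∑ k, _)]
        exact mul_le_mul_of_nonneg_left (Finset.sum_sq_le_sq_sum_of_nonneg fun k _ => hN k)
          (by positivity)

/-! ### Regularised Riesz symbols and symbols of order zero -/

/-- The multiplier `1 / (τ + |ξ|²)`. -/
noncomputable def resolvent (τ : ℝ) (ξ : E3) : ℝ := 1 / (‖ξ‖ ^ 2 + τ)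

/-- The dilation by `τ^{-1/2}` reduces the claim to the function `(1 + |x|²)^{-1}`. -/
lemma resolvent_temperate {τ : ℝ} (hτ : 0 < τ) : (resolvent τ).HasTemperateGrowth := by
  have h := Function.hasTemperateGrowth_one_add_norm_sq_rpow E3 (-1)
  have h2 : Function.HasTemperateGrowth (fun x : E3 => (Real.sqrt τ)⁻¹ • x) :=
    ((Real.sqrt τ)⁻¹ • ContinuousLinearMap.id ℝ E3 : E3 →L[ℝ] E3).hasTemperateGrowth
  have h3 := (h.comp h2).mul (Function.HasTemperateGrowth.const (E := E3) τ⁻¹)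
  have e : resolvent τ = ((fun x : E3 => (1 + ‖x‖ ^ 2) ^ (-1 : ℝ)) ∘
      (fun x : E3 => (Real.sqrt τ)⁻¹ • x)) * fun _ => τ⁻¹ := by
    ext x
    have : 0 < Real.sqrt τ := Real.sqrt_pos.2 hτ
    simp only [resolvent, Pi.mul_apply, Function.comp_apply, norm_smul, mul_pow,
      Real.rpow_neg_one, norm_inv, Real.norm_of_nonneg this.le, inv_pow, Real.sq_sqrt hτ.le]
    field_simp
    ring
  rw [e]
  exact h3

lemma fderiv_resolvent {τ : ℝ} (hτ : 0 < τ) (x : E3) :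
    HasFDerivAt (resolvent τ) (-(resolvent τ x ^ 2) • 2 • innerSL ℝ x) x := by
  have h0 : ‖x‖ ^ 2 + τ ≠ 0 := by positivity
  have := (hasDerivAt_inv h0).comp_hasFDerivAt x ((hasFDerivAt_norm_sq x).add_const τ)
  have e : resolvent τ = (fun y => y⁻¹) ∘ fun x => ‖x‖ ^ 2 + τ := by
    ext y; simp [resolvent]
  have e2 : -(resolvent τ x ^ 2) = -((‖x‖ ^ 2 + τ) ^ 2)⁻¹ := by simp [resolvent]
  rw [e2, e]
  exact this

lemma resolvent_nonneg {τ : ℝ} (hτ : 0 < τ) (x : E3) : 0 ≤ resolvent τ x := by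
  unfold resolvent; positivity

lemma norm_sq_mul_resolvent_le {τ : ℝ} (hτ : 0 < τ) (x : E3) : ‖x‖ ^ 2 * resolvent τ x ≤ 1 := by
  unfold resolvent
  rw [mul_one_div, div_le_one (by positivity)]
  linarith

lemma abs_coord_le (x : E3) (k : Fin 3) : |x k| ≤ ‖x‖ := by
  simpa using PiLp.norm_apply_le x k

lemma coord_temperate (k : Fin 3) : Function.HasTemperateGrowth (fun x : E3 => x k) :=
  (EuclideanSpace.proj k : E3 →L[ℝ] ℝ).hasTemperateGrowth

/-- The multiplier `ξ_i ξ_j / (τ + |ξ|²)`. -/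
noncomputable def symbK (τ : ℝ) (i j : Fin 3) (ξ : E3) : ℝ := ξ i * ξ j * resolvent τ ξ

/-- The multiplier `ξ_j / (τ + |ξ|²)`. -/
noncomputable def symbQ (τ : ℝ) (j : Fin 3) (ξ : E3) : ℝ := ξ j * resolvent τ ξ

lemma symbK_temperate {τ : ℝ} (hτ : 0 < τ) (i j : Fin 3) :
    (symbK τ i j).HasTemperateGrowth :=
  ((coord_temperate i).mul (coord_temperate j)).mul (resolvent_temperate hτ)

lemma symbQ_temperate {τ : ℝ} (hτ : 0 < τ) (j : Fin 3) : (symbQ τ j).HasTemperateGrowth :=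
  (coord_temperate j).mul (resolvent_temperate hτ)

lemma abs_symbK_le {τ : ℝ} (hτ : 0 < τ) (i j : Fin 3) (x : E3) : |symbK τ i j x| ≤ 1 := by
  rw [symbK, abs_mul, abs_mul, abs_of_nonneg (resolvent_nonneg hτ x)]
  calc _ ≤ ‖x‖ * ‖x‖ * resolvent τ x := by
        have := resolvent_nonneg hτ x
        gcongr <;> exact abs_coord_le x _
    _ = ‖x‖ ^ 2 * resolvent τ x := by ring
    _ ≤ 1 := norm_sq_mul_resolvent_le hτ x

lemma symbQ_sq_le {τ : ℝ} (hτ : 0 < τ) (j : Fin 3) (x : E3) :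
    symbQ τ j x ^ 2 ≤ 1 / (‖x‖ ^ 2 + τ) := by
  have h0 := resolvent_nonneg hτ x
  have h1 : (x j) ^ 2 ≤ ‖x‖ ^ 2 := by
    rw [← sq_abs]; have := abs_coord_le x j; gcongr
  calc symbQ τ j x ^ 2 = x j ^ 2 * resolvent τ x * resolvent τ x := by rw [symbQ]; ring
    _ ≤ ‖x‖ ^ 2 * resolvent τ x * resolvent τ x := by gcongr
    _ ≤ 1 * resolvent τ x := by gcongr; exact norm_sq_mul_resolvent_le hτ x
    _ = _ := by rw [one_mul, resolvent]

lemma fderiv_symbK {τ : ℝ} (hτ : 0 < τ) (i j k : Fin 3) (x : E3) :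
    fderiv ℝ (symbK τ i j) x (bvec k) = (if k = i then (1 : ℝ) else 0) * symbQ τ j x
      + (if k = j then (1 : ℝ) else 0) * symbQ τ i x - 2 * (symbK τ i j x * symbQ τ k x) := by
  have h := ((hasFDerivAt_coord i x).mul (hasFDerivAt_coord j x)).mul (fderiv_resolvent hτ x)
  have e : symbK τ i j = (fun y : E3 => y i) * (fun y => y j) * resolvent τ := by
    ext; simp [symbK]
  rw [e, h.fderiv]
  simp [symbQ, symbK, EuclideanSpace.inner_single_right, Pi.single_apply, eq_comm]
  ring

lemma symbQ_abs_le {τ : ℝ} (hτ : 0 < τ) (j : Fin 3) (x : E3) :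
    |symbQ τ j x| ≤ Real.sqrt (resolvent τ x) :=
  Real.abs_le_sqrt (symbQ_sq_le hτ j x)

/-- Symbols of order zero, whose gradient is `O(|ξ|⁻¹)` uniformly in the regularisation `τ`. -/
structure IsZeroOrder (τ A : ℝ) (g : E3 → ℝ) : Prop where
  temperate : g.HasTemperateGrowth
  bound : ∀ x, |g x| ≤ A
  deriv : ∀ k, ∃ g' : E3 → ℝ, g'.HasTemperateGrowth ∧ (∀ x, fderiv ℝ g x (bvec k) = g' x) ∧
    ∀ x, |g' x| ≤ A * Real.sqrt (resolvent τ x)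

lemma IsZeroOrder.nonneg {τ A : ℝ} {g : E3 → ℝ} (h : IsZeroOrder τ A g) : 0 ≤ A :=
  (abs_nonneg _).trans (h.bound 0)

lemma IsZeroOrder.add {τ A B : ℝ} {f g : E3 → ℝ} (hf : IsZeroOrder τ A f)
    (hg : IsZeroOrder τ B g) : IsZeroOrder τ (A + B) (f + g) where
  temperate := hf.temperate.add hg.temperate
  bound x := (abs_add_le _ _).trans (add_le_add (hf.bound x) (hg.bound x))
  deriv k := by
    obtain ⟨f', hf1, hf2, hf3⟩ := hf.deriv k
    obtain ⟨g', hg1, hg2, hg3⟩ := hg.deriv k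
    refine ⟨f' + g', hf1.add hg1, fun x => ?_, fun x => ?_⟩
    · rw [fderiv_add (hf.temperate.1.differentiable (by simp) x)
        (hg.temperate.1.differentiable (by simp) x)]
      simp [hf2, hg2]
    · rw [add_mul]
      exact (abs_add_le _ _).trans (add_le_add (hf3 x) (hg3 x))

/-- The two terms of the Leibniz rule are each of size `A B`, hence the factor `2`. -/
lemma IsZeroOrder.mul {τ A B : ℝ} {f g : E3 → ℝ} (hf : IsZeroOrder τ A f)
    (hg : IsZeroOrder τ B g) : IsZeroOrder τ (2 * (A * B)) (f * g) where
  temperate := hf.temperate.mul hg.temperate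
  bound x := by
    have := mul_le_mul (hf.bound x) (hg.bound x) (abs_nonneg _) hf.nonneg
    rw [Pi.mul_apply, abs_mul]
    nlinarith [mul_nonneg hf.nonneg hg.nonneg]
  deriv k := by
    obtain ⟨f', hf1, hf2, hf3⟩ := hf.deriv k
    obtain ⟨g', hg1, hg2, hg3⟩ := hg.deriv k
    refine ⟨f * g' + g * f', (hf.temperate.mul hg1).add (hg.temperate.mul hf1), fun x => ?_,
      fun x => ?_⟩
    · rw [fderiv_mul (hf.temperate.1.differentiable (by simp) x)
        (hg.temperate.1.differentiable (by simp) x)]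
      simp [hf2, hg2]
    · have e1 := mul_le_mul (hf.bound x) (hg3 x) (abs_nonneg _) hf.nonneg
      have e2 := mul_le_mul (hg.bound x) (hf3 x) (abs_nonneg _) hg.nonneg
      rw [← abs_mul] at e1 e2
      calc |f x * g' x + g x * f' x| ≤ |f x * g' x| + |g x * f' x| := abs_add_le _ _
        _ ≤ _ := by linarith

lemma IsZeroOrder.const_mul {τ A : ℝ} {g : E3 → ℝ} (hg : IsZeroOrder τ A g) (c : ℝ) :
    IsZeroOrder τ (|c| * A) (fun x => c * g x) where
  temperate := (Function.HasTemperateGrowth.const c).mul hg.temperate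
  bound x := by rw [abs_mul]; exact mul_le_mul_of_nonneg_left (hg.bound x) (abs_nonneg _)
  deriv k := by
    obtain ⟨g', hg1, hg2, hg3⟩ := hg.deriv k
    refine ⟨fun x => c * g' x, (Function.HasTemperateGrowth.const c).mul hg1, fun x => ?_,
      fun x => ?_⟩
    · rw [fderiv_const_mul (hg.temperate.1.differentiable (by simp) x)]
      simp [hg2]
    · rw [abs_mul, mul_assoc]
      exact mul_le_mul_of_nonneg_left (hg3 x) (abs_nonneg _)

/-- The gradient of the symbol `ξ_i ξ_j / (τ + |ξ|²)`. -/
noncomputable def symbK' (τ : ℝ) (i j k : Fin 3) (x : E3) : ℝ :=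
  (if k = i then (1 : ℝ) else 0) * symbQ τ j x
      + (if k = j then (1 : ℝ) else 0) * symbQ τ i x - 2 * (symbK τ i j x * symbQ τ k x)

lemma symbK'_temperate {τ : ℝ} (hτ : 0 < τ) (i j k : Fin 3) :
    (symbK' τ i j k).HasTemperateGrowth :=
  (((Function.HasTemperateGrowth.const _).mul (symbQ_temperate hτ j)).add
    ((Function.HasTemperateGrowth.const _).mul (symbQ_temperate hτ i))).sub
    ((Function.HasTemperateGrowth.const 2).mul ((symbK_temperate hτ i j).mul (symbQ_temperate hτ
        k)))

/-- The constant `4` counts the terms of the gradient: `1 + 1` from differentiating `ξ_i ξ_j`, and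
`2` from differentiating the resolvent. -/
lemma isZeroOrder_symbK {τ : ℝ} (hτ : 0 < τ) (i j : Fin 3) : IsZeroOrder τ 4 (symbK τ i j) where
  temperate := symbK_temperate hτ i j
  bound x := (abs_symbK_le hτ i j x).trans (by norm_num)
  deriv k := by
    refine ⟨symbK' τ i j k, symbK'_temperate hτ i j k, fderiv_symbK hτ i j k, fun x => ?_⟩
    have h1 := symbQ_abs_le hτ i x
    have h2 := symbQ_abs_le hτ j x
    have h3 := symbQ_abs_le hτ k x
    have h4 := abs_symbK_le hτ i j x
    have hs := Real.sqrt_nonneg (resolvent τ x)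
    have h5 : |symbK τ i j x * symbQ τ k x| ≤ Real.sqrt (resolvent τ x) := by
      rw [abs_mul]
      calc _ ≤ 1 * Real.sqrt (resolvent τ x) := by gcongr
        _ = _ := one_mul _
    rw [abs_le] at h1 h2 h5 ⊢
    unfold symbK'
    split_ifs <;> constructor <;> linarith

/-- `ξ_m ∂_k` of the symbol `ξ_i ξ_j / (τ + |ξ|²)` is again of order zero. -/
lemma isZeroOrder_symbK'_mul {τ : ℝ} (hτ : 0 < τ) (i j k m : Fin 3) :
    IsZeroOrder τ 72 (fun x => symbK' τ i j k x * x m) := by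
  have h1 := (isZeroOrder_symbK hτ j m).const_mul (if k = i then (1 : ℝ) else 0)
  have h2 := (isZeroOrder_symbK hτ i m).const_mul (if k = j then (1 : ℝ) else 0)
  have h3 := ((isZeroOrder_symbK hτ i j).mul (isZeroOrder_symbK hτ k m)).const_mul (-2)
  have h := (h1.add h2).add h3
  -- Multiplication by `ξ_m` turns each symbol `symbQ` of order `-1` into a symbol `symbK` of order
  -- `0`, so the class is stable under sums and products suffices.
  have e : (fun x => (if k = i then (1 : ℝ) else 0) * symbK τ j m x) +
      (fun x => (if k = j then (1 : ℝ) else 0) * symbK τ i m x) +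
      (fun x => -2 * (symbK τ i j * symbK τ k m) x) = fun x => symbK' τ i j k x * x m := by
    ext x
    simp only [Pi.add_apply, Pi.mul_apply, symbK', symbQ, symbK]
    ring
  rw [e] at h
  have hb1 : |if k = i then (1 : ℝ) else 0| ≤ 1 := by split_ifs <;> simp
  have hb2 : |if k = j then (1 : ℝ) else 0| ≤ 1 := by split_ifs <;> simp
  -- `4 + 4 + 2 · (2 · 4 · 4) = 72`.
  have hA : |if k = i then (1 : ℝ) else 0| * 4 + |if k = j then (1 : ℝ) else 0| * 4
      + |(-2 : ℝ)| * (2 * (4 * 4)) ≤ 72 := by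
    rw [abs_neg, abs_two]; linarith
  refine ⟨h.temperate, fun x => (h.bound x).trans hA, fun l => ?_⟩
  obtain ⟨g', hg1, hg2, hg3⟩ := h.deriv l
  exact ⟨g', hg1, hg2, fun x => (hg3 x).trans
    (mul_le_mul_of_nonneg_right hA (Real.sqrt_nonneg _))⟩

/-! ### Weighted `L²` bounds for the regularised Riesz transforms, uniform in `τ` -/

/-- The norm of `L²((1+|x|²) dx)`, up to a constant. -/
noncomputable def sNorm1 (f : 𝓢(E3, ℂ)) : ℝ := sNorm f + ∑ k, sNorm (coordMul k f)

lemma sNorm1_nonneg (f : 𝓢(E3, ℂ)) : 0 ≤ sNorm1 f :=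
  add_nonneg (sNorm_nonneg _) (Finset.sum_nonneg fun _ _ => sNorm_nonneg _)

lemma sNorm_le_sNorm1 (f : 𝓢(E3, ℂ)) : sNorm f ≤ sNorm1 f :=
  le_add_of_nonneg_right (Finset.sum_nonneg fun _ _ => sNorm_nonneg _)

lemma sNorm_coordMul_le_sNorm1 (k : Fin 3) (f : 𝓢(E3, ℂ)) : sNorm (coordMul k f) ≤ sNorm1 f :=
  (Finset.single_le_sum (f := fun k => sNorm (coordMul k f)) (fun _ _ => sNorm_nonneg _)
    (Finset.mem_univ k)).trans (le_add_of_nonneg_left (sNorm_nonneg _))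

lemma norm_two_pi_I_inv : ‖-(2 * (Real.pi : ℂ) * Complex.I)⁻¹‖ = (2 * Real.pi)⁻¹ := by
  simp [abs_of_pos Real.pi_pos]

/-- Homogeneous form of `sNorm_multiplier_hardy`: the symbol is divided by `A`, the case `A = 0`
being trivial. -/
lemma sNorm_multiplier_hardy' {g : E3 → ℝ} (hg : g.HasTemperateGrowth) {τ A : ℝ} (hτ : 0 < τ)
    (hA : 0 ≤ A) (h : ∀ x, |g x| ≤ A * Real.sqrt (resolvent τ x)) (f : 𝓢(E3, ℂ)) :
    sNorm (fourierMultiplierCLM ℂ g f) ≤ A * (4 * Real.pi) * sNorm1 f := by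
  rcases hA.eq_or_lt with rfl | hA
  · have h0 : ∀ x, |g x| ≤ 0 := fun x => by simpa using h x
    simpa using sNorm_multiplier_le hg le_rfl h0 f
  have hg2 : (fun x => A⁻¹ * g x).HasTemperateGrowth :=
    (Function.HasTemperateGrowth.const A⁻¹).mul hg
  have e : fourierMultiplierCLM ℂ g f = (A : ℂ) • fourierMultiplierCLM ℂ (fun x =>
      A⁻¹ * g x) f := by
    have e1 : (fun x => A⁻¹ * g x) = A⁻¹ • g := rfl
    rw [e1, fourierMultiplierCLM_smul hg]
    ext x
    simp [hA.ne']
  rw [e, sNorm_smul, Complex.norm_real, Real.norm_of_nonneg hA.le, mul_assoc]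
  refine mul_le_mul_of_nonneg_left ?_ hA.le
  refine (sNorm_multiplier_hardy hg2 hτ (fun x => ?_) f).trans ?_
  · have h1 : |A⁻¹ * g x| ≤ Real.sqrt (resolvent τ x) := by
      rw [abs_mul, abs_of_pos (inv_pos.2 hA), inv_mul_le_iff₀ hA]
      exact h x
    rw [← sq_abs]
    calc _ ≤ Real.sqrt (resolvent τ x) ^ 2 := by gcongr
      _ = _ := Real.sq_sqrt (resolvent_nonneg hτ x)
  · have := Real.pi_pos
    gcongr
    exact le_add_of_nonneg_left (sNorm_nonneg _)

/-- Commuting `x_k` with the multiplier leaves the multiplier applied to `x_k f` and a multiplier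
`∂_k g` of order `-1` applied to `f`, which Hardy's inequality controls. Each coordinate costs `1 +
(4π) / (2π) = 3`, so the total is `1 + 3 · 3 = 10`. -/
lemma sNorm1_multiplier_le {g : E3 → ℝ} {τ A : ℝ} (hτ : 0 < τ) (hg : IsZeroOrder τ A g)
    (f : 𝓢(E3, ℂ)) : sNorm1 (fourierMultiplierCLM ℂ g f) ≤ 10 * A * sNorm1 f := by
  have hA := hg.nonneg
  have h0 := (sNorm_multiplier_le hg.temperate hA hg.bound f).trans
    (mul_le_mul_of_nonneg_left (sNorm_le_sNorm1 f) hA)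
  have h1 : ∀ k, sNorm (coordMul k (fourierMultiplierCLM ℂ g f)) ≤ 3 * A * sNorm1 f := fun k => by
    obtain ⟨g', hg1, hg2, hg3⟩ := hg.deriv k
    rw [coordMul_multiplier hg.temperate hg1 hg2]
    refine (sNorm_add_le _ _).trans ?_
    rw [sNorm_smul, norm_two_pi_I_inv]
    have e1 := (sNorm_multiplier_le hg.temperate hA hg.bound (coordMul k f)).trans
      (mul_le_mul_of_nonneg_left (sNorm_coordMul_le_sNorm1 k f) hA)
    have e2 := mul_le_mul_of_nonneg_left (sNorm_multiplier_hardy' hg1 hτ hA hg3 f)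
      (inv_nonneg.2 (mul_nonneg zero_le_two Real.pi_pos.le))
    have e3 : (2 * Real.pi)⁻¹ * (A * (4 * Real.pi) * sNorm1 f) = 2 * (A * sNorm1 f) := by
      have := Real.pi_ne_zero
      field_simp
      ring
    linarith
  calc sNorm1 (fourierMultiplierCLM ℂ g f)
      ≤ A * sNorm1 f + ∑ k : Fin 3, 3 * A * sNorm1 f :=
        add_le_add h0 (Finset.sum_le_sum fun k _ => h1 k)
    _ = _ := by simp; ring

/-- The operator `∂_i ∂_j (Δ - 4π²τ)⁻¹`, which approximates `-R_i R_j`. -/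
noncomputable abbrev opK (τ : ℝ) (i j : Fin 3) (f : 𝓢(E3, ℂ)) : 𝓢(E3, ℂ) :=
  fourierMultiplierCLM ℂ (symbK τ i j) f

lemma multiplier_lineDeriv {g : E3 → ℝ} (hg : g.HasTemperateGrowth) (m : Fin 3) (f : 𝓢(E3, ℂ)) :
    fourierMultiplierCLM ℂ g (∂_{bvec m} f)
      = (2 * Real.pi * Complex.I) • fourierMultiplierCLM ℂ (fun x => g x * x m) f := by
  have e : (fun x : E3 => g x * x m) = g * (fun x => inner ℝ x (bvec m)) := by
    ext x; simp [inner_bvec]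
  rw [lineDeriv_eq_fourierMultiplierCLM, e,
    ← fourierMultiplierCLM_fourierMultiplierCLM_apply hg (by fun_prop)]
  simp only [fourierMultiplierCLM_apply, FourierTransform.fourier_smul,
    ← FourierTransform.fourierInv_smul]
  congr 1
  ext x
  simp only [_root_.smul_apply, smulLeftCLM_apply_apply hg]
  rw [smul_comm]
  simp

/-- Two powers of `x` are too many for a general argument of `R_i R_j`, whose image decays only like
`|x|⁻³`; the derivative `∂_m` provides the missing cancellation. After one commutator the operator
with symbol `∂_l K` acts on `∂_m f`, which amounts to the symbol `ξ_m ∂_l K`, again of order zero,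
acting on `f`. The second coordinate is then covered by `sNorm1_multiplier_le`, with the constants
`10 · 4` and `10 · 72`. -/
lemma sNorm_coordMul_coordMul_opK_le {τ : ℝ} (hτ : 0 < τ) (i j k l m : Fin 3) (f : 𝓢(E3, ℂ)) :
    sNorm (coordMul k (coordMul l (opK τ i j (∂_{bvec m} f)))) ≤
      40 * sNorm1 (coordMul l (∂_{bvec m} f)) + 720 * sNorm1 f := by
  rw [opK, coordMul_multiplier (symbK_temperate hτ i j) (symbK'_temperate hτ i j l)
    (fderiv_symbK hτ i j l), multiplier_lineDeriv (symbK'_temperate hτ i j l), smul_smul]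
  have e1 : -(2 * (Real.pi : ℂ) * Complex.I)⁻¹ * (2 * Real.pi * Complex.I) = -1 := by
    have : (Real.pi : ℂ) ≠ 0 := by exact_mod_cast Real.pi_ne_zero
    field_simp
  rw [e1, map_add]
  refine (sNorm_add_le _ _).trans (add_le_add ?_ ?_)
  · refine (sNorm_coordMul_le_sNorm1 k _).trans ((sNorm1_multiplier_le hτ
      (isZeroOrder_symbK hτ i j) _).trans (le_of_eq (by ring)))
  · have e2 : ∀ h : 𝓢(E3, ℂ), coordMul k ((-1 : ℂ) • h) = (-1 : ℂ) • coordMul k h := fun h => by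
      ext x; simp [coordMul_apply]
    rw [e2, sNorm_smul, norm_neg, norm_one, one_mul]
    refine (sNorm_coordMul_le_sNorm1 k _).trans ((sNorm1_multiplier_le hτ
      (isZeroOrder_symbK'_mul hτ i j l m) _).trans (le_of_eq (by ring)))

lemma sNorm_coordMul_sq (k : Fin 3) (f : 𝓢(E3, ℂ)) :
    sNorm (coordMul k f) ^ 2 = ∫ x, x k ^ 2 * ‖f x‖ ^ 2 := by
  rw [sNorm_sq]
  simp [coordMul_apply, mul_pow]

lemma integrable_coord_sq (k : Fin 3) (f : 𝓢(E3, ℂ)) :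
    Integrable fun x => x k ^ 2 * ‖f x‖ ^ 2 := by
  simpa [coordMul_apply, mul_pow] using integrable_norm_sq (coordMul k f)

lemma integrable_weight_one (f : 𝓢(E3, ℂ)) : Integrable fun x => (1 + ‖x‖ ^ 2) * ‖f x‖ ^ 2 := by
  have := (integrable_norm_sq f).add (integrable_finsetSum Finset.univ
    fun k _ => integrable_coord_sq k f)
  refine this.congr (Eventually.of_forall fun x => ?_)
  simp only [Pi.add_apply]
  rw [norm_sq_eq_sum x, add_mul, Finset.sum_mul, one_mul]

lemma integral_weight_one (f : 𝓢(E3, ℂ)) :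
    ∫ x, (1 + ‖x‖ ^ 2) * ‖f x‖ ^ 2 = sNorm f ^ 2 + ∑ k, sNorm (coordMul k f) ^ 2 := by
  simp_rw [sNorm_coordMul_sq, sNorm_sq]
  rw [← integral_finsetSum _ fun k _ => integrable_coord_sq k f,
    ← integral_add (integrable_norm_sq f) (integrable_finsetSum _
      fun k _ => integrable_coord_sq k f)]
  congr with x
  rw [norm_sq_eq_sum x, add_mul, Finset.sum_mul, one_mul]

lemma sNorm1_sq_le (f : 𝓢(E3, ℂ)) : sNorm1 f ^ 2 ≤ 4 * ∫ x, (1 + ‖x‖ ^ 2) * ‖f x‖ ^ 2 := by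
  rw [integral_weight_one, sNorm1, Fin.sum_univ_three, Fin.sum_univ_three]
  set a := sNorm f
  set b := sNorm (coordMul 0 f)
  set c := sNorm (coordMul 1 f)
  set d := sNorm (coordMul 2 f)
  nlinarith [sq_nonneg (a - b), sq_nonneg (a - c), sq_nonneg (a - d), sq_nonneg (b - c),
    sq_nonneg (b - d), sq_nonneg (c - d)]

lemma integral_weight_one_le (f : 𝓢(E3, ℂ)) :
    ∫ x, (1 + ‖x‖ ^ 2) * ‖f x‖ ^ 2 ≤ sNorm1 f ^ 2 := by
  rw [integral_weight_one, sNorm1, Fin.sum_univ_three, Fin.sum_univ_three]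
  have := sNorm_nonneg f
  have h0 := sNorm_nonneg (coordMul 0 f)
  have h1 := sNorm_nonneg (coordMul 1 f)
  have h2 := sNorm_nonneg (coordMul 2 f)
  nlinarith [mul_nonneg this h0, mul_nonneg this h1, mul_nonneg this h2, mul_nonneg h0 h1,
    mul_nonneg h0 h2, mul_nonneg h1 h2]

lemma weight_two_eq (f : 𝓢(E3, ℂ)) (x : E3) : (1 + ‖x‖ ^ 2) ^ 2 * ‖f x‖ ^ 2 =
    (1 + ‖x‖ ^ 2) * ‖f x‖ ^ 2 + ∑ l, (1 + ‖x‖ ^ 2) * ‖coordMul l f x‖ ^ 2 := by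
  simp_rw [coordMul_apply, norm_smul, mul_pow, Real.norm_eq_abs, sq_abs]
  rw [← Finset.mul_sum, ← Finset.sum_mul, ← norm_sq_eq_sum]
  ring

lemma integrable_weight_two (f : 𝓢(E3, ℂ)) :
    Integrable fun x => (1 + ‖x‖ ^ 2) ^ 2 * ‖f x‖ ^ 2 := by
  simp_rw [weight_two_eq]
  exact (integrable_weight_one f).add (integrable_finsetSum _ fun l _ => integrable_weight_one _)

lemma integral_weight_two (f : 𝓢(E3, ℂ)) : ∫ x, (1 + ‖x‖ ^ 2) ^ 2 * ‖f x‖ ^ 2 =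
    (∫ x, (1 + ‖x‖ ^ 2) * ‖f x‖ ^ 2) + ∑ l, ∫ x, (1 + ‖x‖ ^ 2) * ‖coordMul l f x‖ ^ 2 := by
  simp_rw [weight_two_eq]
  rw [integral_add (integrable_weight_one f) (integrable_finsetSum _
    fun l _ => integrable_weight_one _), integral_finsetSum _ fun l _ => integrable_weight_one _]

lemma integral_opK_le {τ : ℝ} (hτ : 0 < τ) (i j : Fin 3) (f : 𝓢(E3, ℂ)) :
    ∫ x, ‖opK τ i j f x‖ ^ 2 ≤ ∫ x, ‖f x‖ ^ 2 := by
  rw [← sNorm_sq, ← sNorm_sq]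
  have := sNorm_multiplier_le (symbK_temperate hτ i j) zero_le_one (abs_symbK_le hτ i j) f
  rw [one_mul] at this
  have h0 := sNorm_nonneg (opK τ i j f)
  gcongr

/-- The constant is `(10 · 4)² · 4`, the last factor being the cost of passing from `sNorm1` to the
integral. -/
lemma integral_weight_opK_le {τ : ℝ} (hτ : 0 < τ) (i j : Fin 3) (f : 𝓢(E3, ℂ)) :
    ∫ x, (1 + ‖x‖ ^ 2) * ‖opK τ i j f x‖ ^ 2 ≤ 6400 * ∫ x, (1 + ‖x‖ ^ 2) * ‖f x‖ ^ 2 := by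
  refine (integral_weight_one_le _).trans ?_
  have h := sNorm1_multiplier_le hτ (isZeroOrder_symbK hτ i j) f
  have h0 := sNorm1_nonneg (opK τ i j f)
  have h1 := sNorm1_sq_le f
  calc _ ≤ (10 * 4 * sNorm1 f) ^ 2 := by gcongr
    _ ≤ _ := by nlinarith

/-- Since `ρ² = ρ (1 + ∑ x_l²)`, the weight `ρ²` on a function is the weight `ρ` on it and on its
products with the coordinates. The second term on the right is what the cancellation in `∂_m f`
costs. -/
lemma integral_weight_sq_opK_le {τ : ℝ} (hτ : 0 < τ) (i j m : Fin 3) (f : 𝓢(E3, ℂ)) :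
    ∫ x, (1 + ‖x‖ ^ 2) ^ 2 * ‖opK τ i j (∂_{bvec m} f) x‖ ^ 2 ≤
      10 ^ 9 * ((∫ x, (1 + ‖x‖ ^ 2) ^ 2 * ‖(∂_{bvec m} f) x‖ ^ 2)
        + ∫ x, (1 + ‖x‖ ^ 2) * ‖f x‖ ^ 2) := by
  set h := ∂_{bvec m} f
  rw [integral_weight_two]
  set I0 := ∫ x, (1 + ‖x‖ ^ 2) * ‖h x‖ ^ 2 with hI0
  set J := ∫ x, (1 + ‖x‖ ^ 2) * ‖f x‖ ^ 2 with hJ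
  have hJ1 := sNorm1_sq_le f
  have hJ0 : 0 ≤ J := integral_nonneg fun x => by positivity
  have e1 := integral_weight_opK_le hτ i j h
  have e0 := integral_opK_le hτ i j h
  have p : ∀ l, 0 ≤ ∫ x, (1 + ‖x‖ ^ 2) * ‖coordMul l h x‖ ^ 2 :=
    fun l => integral_nonneg fun x => by positivity
  have e2 : ∀ l, ∫ x, (1 + ‖x‖ ^ 2) * ‖coordMul l (opK τ i j h) x‖ ^ 2 ≤
      6400 * I0 + 6 * 1600 * 4 * (∫ x, (1 + ‖x‖ ^ 2) * ‖coordMul l h x‖ ^ 2)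
        + 6 * 720 ^ 2 * 4 * J := fun l => by
    rw [integral_weight_one]
    have a1 : sNorm (coordMul l (opK τ i j h)) ^ 2 ≤ 6400 * I0 := by
      refine le_trans ?_ e1
      rw [integral_weight_one]
      refine le_add_of_nonneg_of_le (by positivity) ?_
      exact Finset.single_le_sum (f := fun k => sNorm (coordMul k (opK τ i j h)) ^ 2)
        (fun _ _ => sq_nonneg _) (Finset.mem_univ l)
    have a2 : ∀ k, sNorm (coordMul k (coordMul l (opK τ i j h))) ^ 2 ≤
        2 * 1600 * 4 * (∫ x, (1 + ‖x‖ ^ 2) * ‖coordMul l h x‖ ^ 2) + 2 * 720 ^ 2 * 4 * J :=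
      fun k => by
        have b1 := sNorm_coordMul_coordMul_opK_le hτ i j k l m f
        have b2 := sNorm1_sq_le (coordMul l h)
        have b3 := sNorm_nonneg (coordMul k (coordMul l (opK τ i j h)))
        calc _ ≤ (40 * sNorm1 (coordMul l h) + 720 * sNorm1 f) ^ 2 := by gcongr
          _ ≤ 2 * 1600 * sNorm1 (coordMul l h) ^ 2 + 2 * 720 ^ 2 * sNorm1 f ^ 2 := by
            nlinarith [sq_nonneg (40 * sNorm1 (coordMul l h) - 720 * sNorm1 f)]
          _ ≤ _ := by linarith
    have a3 : ∑ k, sNorm (coordMul k (coordMul l (opK τ i j h))) ^ 2 ≤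
        6 * 1600 * 4 * (∫ x, (1 + ‖x‖ ^ 2) * ‖coordMul l h x‖ ^ 2) + 6 * 720 ^ 2 * 4 * J := by
      refine (Finset.sum_le_sum fun k _ => a2 k).trans (le_of_eq ?_)
      simp only [Finset.sum_const, Finset.card_univ, Fintype.card_fin, nsmul_eq_mul]
      push_cast
      ring
    linarith
  have e3 := Finset.sum_le_sum fun l (_ : l ∈ Finset.univ) => e2 l
  rw [integral_weight_two, ← hI0]
  have hI00 : 0 ≤ I0 := integral_nonneg fun x => by positivity
  simp only [Fin.sum_univ_three] at e3 ⊢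
  linarith [p 0, p 1, p 2]

/-! ### Quadratic interpolation between weights -/

lemma integrableOn_interpolation {θ : ℝ} (h0 : 0 < θ) (h1 : θ < 1) :
    IntegrableOn (fun r : ℝ => r ^ (θ - 1) / (1 + r)) (Ioi 0) := by
  have hm : ∀ s ⊆ Ioi (0 : ℝ), MeasurableSet s → AEStronglyMeasurable
      (fun r : ℝ => r ^ (θ - 1) / (1 + r)) (volume.restrict s) := fun s _ _ =>
    (Measurable.div (by fun_prop) (by fun_prop)).aestronglyMeasurable
  rw [← Ioc_union_Ioi_eq_Ioi (zero_le_one' ℝ)]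
  refine IntegrableOn.union ?_ ?_
  · have : IntegrableOn (fun r : ℝ => r ^ (θ - 1)) (Ioc 0 1) := by
      rw [← intervalIntegrable_iff_integrableOn_Ioc_of_le zero_le_one]
      exact intervalIntegral.intervalIntegrable_rpow' (by linarith)
    refine this.mono' (hm _ Ioc_subset_Ioi_self measurableSet_Ioc)
      ((ae_restrict_iff' measurableSet_Ioc).2 (Eventually.of_forall fun r hr => ?_))
    have hr0 : 0 < r := hr.1
    rw [Real.norm_of_nonneg (by positivity)]
    exact div_le_self (by positivity) (by linarith)
  · have : IntegrableOn (fun r : ℝ => r ^ (θ - 2)) (Ioi 1) :=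
      integrableOn_Ioi_rpow_of_lt (by linarith) zero_lt_one
    refine this.mono' (hm _ (Ioi_subset_Ioi zero_le_one) measurableSet_Ioi)
      ((ae_restrict_iff' measurableSet_Ioi).2 (Eventually.of_forall fun r hr => ?_))
    have hr0 : 0 < r := zero_lt_one.trans hr
    rw [Real.norm_of_nonneg (by positivity), div_le_iff₀ (by positivity)]
    have : r ^ (θ - 1) = r ^ (θ - 2) * r := by
      rw [← Real.rpow_add_one hr0.ne']; ring_nf
    rw [this]
    gcongr
    linarith

/-- The substitution `s = κ r` shows that `κ^θ` is, up to a constant independent of `κ`, a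
superposition of the parallel sums `κ s / (κ + s)` of the weights `κ` and `s`. It thus suffices to
prove weighted estimates for parallel sums. -/
lemma lintegral_interpolation {θ : ℝ} (h0 : 0 < θ) (h1 : θ < 1) :
    ∃ c : ℝ, 0 < c ∧ ∀ κ : ℝ, 0 < κ →
      ∫⁻ s in Ioi (0 : ℝ), ENNReal.ofReal (s ^ (θ - 2) * (κ * s / (κ + s)))
        = ENNReal.ofReal c * ENNReal.ofReal (κ ^ θ) := by
  have hi := integrableOn_interpolation h0 h1
  refine ⟨∫ r in Ioi (0 : ℝ), r ^ (θ - 1) / (1 + r), ?_, fun κ hκ => ?_⟩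
  · rw [setIntegral_pos_iff_support_of_nonneg_ae]
    · have : Ioi (0 : ℝ) ⊆ (Function.support fun r : ℝ => r ^ (θ - 1) / (1 + r)) ∩ Ioi 0 := by
        intro r hr
        refine ⟨?_, hr⟩
        have : (0 : ℝ) < r := hr
        simp only [Function.mem_support]
        positivity
      exact lt_of_lt_of_le (by simp) (measure_mono this)
    · exact (ae_restrict_iff' measurableSet_Ioi).2 (Eventually.of_forall fun r hr => by
        have : (0 : ℝ) < r := hr
        simp only [Pi.zero_apply]
        positivity)
    · exact hi
  · have e : ∀ s ∈ Ioi (0 : ℝ), s ^ (θ - 2) * (κ * s / (κ + s)) =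
        κ ^ (θ - 1) * ((κ⁻¹ * s) ^ (θ - 1) / (1 + κ⁻¹ * s)) := fun s hs => by
      have hs : 0 < s := hs
      rw [Real.mul_rpow (by positivity) hs.le, Real.inv_rpow hκ.le]
      have : s ^ (θ - 1) = s ^ (θ - 2) * s := by
        rw [← Real.rpow_add_one hs.ne']; ring_nf
      rw [this]
      have : 0 < κ ^ (θ - 1) := by positivity
      field_simp
    rw [setLIntegral_congr_fun measurableSet_Ioi fun s hs => congrArg ENNReal.ofReal (e s hs)]
    have hi2 : IntegrableOn (fun s : ℝ => (κ⁻¹ * s) ^ (θ - 1) / (1 + κ⁻¹ * s)) (Ioi 0) := by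
      have := (integrableOn_Ioi_comp_mul_left_iff (fun r : ℝ => r ^ (θ - 1) / (1 + r)) 0
        (inv_pos.2 hκ)).2 (by simpa using hi)
      exact this
    rw [← ofReal_integral_eq_lintegral_ofReal (hi2.const_mul _)
      ((ae_restrict_iff' measurableSet_Ioi).2 (Eventually.of_forall fun s hs => by
        have hs : (0 : ℝ) < s := hs
        simp only [Pi.zero_apply]
        positivity)), integral_const_mul,
      integral_comp_mul_left_Ioi (fun r : ℝ => r ^ (θ - 1) / (1 + r)) 0 (inv_pos.2 hκ), mul_zero,
      inv_inv, smul_eq_mul, ← ENNReal.ofReal_mul (setIntegral_nonneg measurableSet_Ioi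
        fun r hr => by have : (0 : ℝ) < r := hr; positivity)]
    congr 1
    rw [← mul_assoc, ← Real.rpow_add_one hκ.ne']
    ring_nf

/-- Interpolation between the weights `1` and `κ`. -/
lemma lintegral_weight_interpolation {κ : E3 → ℝ} (hκ : Measurable κ) (hκ0 : ∀ x, 0 < κ x)
    {P Q : E3 → ℝ≥0∞} (hP : Measurable P) (hQ : Measurable Q) {C : ℝ≥0∞}
    (h : ∀ s : ℝ, 0 < s → ∫⁻ x, ENNReal.ofReal (κ x * s / (κ x + s)) * P x ≤
      C * ∫⁻ x, ENNReal.ofReal (κ x * s / (κ x + s)) * Q x)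
    {θ : ℝ} (h0 : 0 < θ) (h1 : θ ≤ 1) :
    ∫⁻ x, ENNReal.ofReal (κ x ^ θ) * P x ≤ C * ∫⁻ x, ENNReal.ofReal (κ x ^ θ) * Q x := by
  rcases h1.lt_or_eq with h1 | rfl
  · obtain ⟨c, hc, hcκ⟩ := lintegral_interpolation h0 h1
    -- Tonelli's theorem exchanges the superposition in `s` with the integral in `x`.
    have key : ∀ R : E3 → ℝ≥0∞, Measurable R →
        ENNReal.ofReal c * ∫⁻ x, ENNReal.ofReal (κ x ^ θ) * R x =
        ∫⁻ s in Ioi (0 : ℝ), ENNReal.ofReal (s ^ (θ - 2)) *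
          ∫⁻ x, ENNReal.ofReal (κ x * s / (κ x + s)) * R x := fun R hR => by
      calc _ = ∫⁻ x, ∫⁻ s in Ioi (0 : ℝ),
            ENNReal.ofReal (s ^ (θ - 2) * (κ x * s / (κ x + s))) * R x := by
            rw [← lintegral_const_mul _ (by fun_prop)]
            refine lintegral_congr fun x => ?_
            rw [lintegral_mul_const _ (by fun_prop), hcκ _ (hκ0 x), mul_assoc]
        _ = ∫⁻ s in Ioi (0 : ℝ), ∫⁻ x,
            ENNReal.ofReal (s ^ (θ - 2) * (κ x * s / (κ x + s))) * R x := by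
            rw [lintegral_lintegral_swap]
            refine Measurable.aemeasurable ?_
            fun_prop
        _ = _ := by
            refine setLIntegral_congr_fun measurableSet_Ioi fun s hs => ?_
            have hs : (0 : ℝ) < s := hs
            rw [← lintegral_const_mul _ (by fun_prop)]
            refine lintegral_congr fun x => ?_
            rw [ENNReal.ofReal_mul (by positivity), mul_assoc]
    have hc0 : ENNReal.ofReal c ≠ 0 := by simpa using hc
    have : ENNReal.ofReal c * ∫⁻ x, ENNReal.ofReal (κ x ^ θ) * P x ≤
        ENNReal.ofReal c * (C * ∫⁻ x, ENNReal.ofReal (κ x ^ θ) * Q x) := by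
      rw [key P hP, mul_left_comm, key Q hQ, ← lintegral_const_mul _ (by fun_prop)]
      refine setLIntegral_mono (by fun_prop) fun s hs => ?_
      rw [mul_left_comm]
      gcongr
      exact h s hs
    exact (ENNReal.mul_le_mul_iff_right hc0 ENNReal.ofReal_ne_top).1 this
  -- At `θ = 1` the integral in `s` diverges. Instead `κ` is the limit of its parallel sums with `n
  -- + 1`, and Fatou's lemma applies.
  · simp only [Real.rpow_one]
    have hle : ∀ n : ℕ, ∀ x, κ x * (n + 1 : ℝ) / (κ x + (n + 1 : ℝ)) ≤ κ x := fun n x => by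
      have := hκ0 x
      rw [div_le_iff₀ (by positivity)]
      nlinarith
    have hlim : ∀ x, Tendsto (fun n : ℕ => ENNReal.ofReal
        (κ x * (n + 1 : ℝ) / (κ x + (n + 1 : ℝ))) * P x) atTop
        (𝓝 (ENNReal.ofReal (κ x) * P x)) := fun x => by
      have hx := hκ0 x
      have t1 : Tendsto (fun n : ℕ => κ x * (n + 1 : ℝ) / (κ x + (n + 1 : ℝ))) atTop
          (𝓝 (κ x * (1 - 0))) := by
        have t2 : Tendsto (fun n : ℕ => κ x / (κ x + (n + 1 : ℝ))) atTop (𝓝 0) := by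
          refine Tendsto.div_atTop tendsto_const_nhds ?_
          exact tendsto_atTop_add_const_left _ _
            (tendsto_atTop_add_const_right _ _ tendsto_natCast_atTop_atTop)
        refine (tendsto_const_nhds.mul (tendsto_const_nhds.sub t2)).congr fun n => ?_
        have : 0 < κ x + (n + 1 : ℝ) := by positivity
        field_simp
        ring
      rw [sub_zero, mul_one] at t1
      refine ENNReal.Tendsto.mul_const (ENNReal.tendsto_ofReal t1) (Or.inl ?_)
      simpa using hx
    calc ∫⁻ x, ENNReal.ofReal (κ x) * P x
        = ∫⁻ x, liminf (fun n : ℕ => ENNReal.ofReal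
          (κ x * (n + 1 : ℝ) / (κ x + (n + 1 : ℝ))) * P x) atTop :=
          lintegral_congr fun x => ((hlim x).liminf_eq).symm
      _ ≤ liminf (fun n : ℕ => ∫⁻ x, ENNReal.ofReal
          (κ x * (n + 1 : ℝ) / (κ x + (n + 1 : ℝ))) * P x) atTop :=
          lintegral_liminf_le fun n => by fun_prop
      _ ≤ liminf (fun n : ℕ => C * ∫⁻ x, ENNReal.ofReal (κ x) * Q x) atTop := by
          refine liminf_le_liminf (Eventually.of_forall fun n => ?_)
          refine (h (n + 1) (by positivity)).trans ?_
          gcongr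
          exact hle n _
      _ = _ := by simp

/-! ### Intermediate powers of the weight for the regularised Riesz transforms -/

/-- The weight `1 + |x|²`. -/
noncomputable def rho (x : E3) : ℝ := 1 + ‖x‖ ^ 2

lemma rho_pos (x : E3) : 0 < rho x := by unfold rho; positivity

lemma one_le_rho (x : E3) : 1 ≤ rho x := by unfold rho; nlinarith [sq_nonneg ‖x‖]

lemma contDiff_rho : ContDiff ℝ ∞ rho := contDiff_const.add (contDiff_norm_sq ℝ)

@[fun_prop] lemma continuous_rho : Continuous rho := contDiff_rho.continuous

@[fun_prop] lemma measurable_rho : Measurable rho := continuous_rho.measurable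

lemma hasFDerivAt_rho (x : E3) : HasFDerivAt rho (2 • innerSL ℝ x) x := by
  exact (hasFDerivAt_norm_sq x).const_add 1

lemma lintegral_ofReal_mul_enorm_sq {k : E3 → ℝ} (hk : ∀ x, 0 ≤ k x) {g : E3 → ℂ}
    (hi : Integrable fun x => k x * ‖g x‖ ^ 2) :
    ∫⁻ x, ENNReal.ofReal (k x) * ‖g x‖ₑ ^ 2 = ENNReal.ofReal (∫ x, k x * ‖g x‖ ^ 2) := by
  rw [ofReal_integral_eq_lintegral_ofReal hi (Eventually.of_forall fun x => by
    have := hk x; simp only [Pi.zero_apply]; positivity)]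
  refine lintegral_congr fun x => ?_
  rw [ENNReal.ofReal_mul (hk x), ENNReal.ofReal_pow (norm_nonneg _), ofReal_norm]

lemma contDiff_split {κ : E3 → ℝ} (hκ : ContDiff ℝ ∞ κ) (hκ0 : ∀ x, 0 < κ x) {s : ℝ} (hs : 0 < s) :
    ContDiff ℝ ∞ (fun x => s / (κ x + s)) ∧ ContDiff ℝ ∞ (fun x => κ x / (κ x + s)) :=
  ⟨contDiff_const.div (hκ.add contDiff_const) fun x => (add_pos (hκ0 x) hs).ne',
    hκ.div (hκ.add contDiff_const) fun x => (add_pos (hκ0 x) hs).ne'⟩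

lemma exists_schwartz {g : E3 → ℂ} (hg : ContDiff ℝ ∞ g) (hc : HasCompactSupport g) :
    ∃ f : 𝓢(E3, ℂ), ∀ x, f x = g x := ⟨hc.toSchwartzMap hg, fun _ => rfl⟩

/-- Splitting of a compactly supported smooth function along a weight. -/
lemma exists_split {f : 𝓢(E3, ℂ)} (hc : HasCompactSupport f) {κ : E3 → ℝ}
    (hκ : ContDiff ℝ ∞ κ) (hκ0 : ∀ x, 0 < κ x) {s : ℝ} (hs : 0 < s) :
    ∃ f₀ f₁ : 𝓢(E3, ℂ), f = f₀ + f₁ ∧ (∀ x, f₀ x = (s / (κ x + s)) • f x) ∧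
      (∀ x, f₁ x = (κ x / (κ x + s)) • f x) := by
  obtain ⟨h0, h1⟩ := contDiff_split hκ hκ0 hs
  have hf : ContDiff ℝ ∞ f := f.smooth ⊤
  obtain ⟨f₀, hf0⟩ := exists_schwartz (h0.smul hf) (hc.smul_left (f := fun x => s / (κ x + s)))
  obtain ⟨f₁, hf1⟩ := exists_schwartz (h1.smul hf) (hc.smul_left (f := fun x => κ x / (κ x + s)))
  refine ⟨f₀, f₁, ?_, hf0, hf1⟩
  ext x
  have : κ x + s ≠ 0 := (add_pos (hκ0 x) hs).ne'
  rw [_root_.add_apply, hf0, hf1]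
  simp only [Pi.smul_apply']
  rw [← add_smul, ← add_div, add_comm s, div_self this, one_smul]

lemma norm_add_sq_le {V : Type*} [NormedAddCommGroup V] (a b : V) :
    ‖a + b‖ ^ 2 ≤ 2 * ‖a‖ ^ 2 + 2 * ‖b‖ ^ 2 := by
  have := norm_add_le a b
  nlinarith [norm_nonneg (a + b), sq_nonneg (‖a‖ - ‖b‖), norm_nonneg a, norm_nonneg b]

lemma parallel_le_left {κ s : ℝ} (hκ : 0 < κ) (hs : 0 < s) : κ * s / (κ + s) ≤ κ := by
  rw [div_le_iff₀ (by positivity)]; nlinarith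

lemma parallel_le_right {κ s : ℝ} (hκ : 0 < κ) (hs : 0 < s) : κ * s / (κ + s) ≤ s := by
  rw [div_le_iff₀ (by positivity)]; nlinarith

/-- `T` maps `f₀ + f₁` to a sum: bound of the quadratic form of the parallel sum of the weights. -/
lemma integral_parallel_le {κ : E3 → ℝ} (hκ : Continuous κ) (hκ0 : ∀ x, 0 < κ x) {s : ℝ}
    (hs : 0 < s) {g g₀ g₁ : 𝓢(E3, ℂ)} (h : g = g₀ + g₁)
    (hi0 : Integrable fun x => κ x * ‖g₀ x‖ ^ 2) :
    Integrable (fun x => κ x * s / (κ x + s) * ‖g x‖ ^ 2) ∧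
    ∫ x, κ x * s / (κ x + s) * ‖g x‖ ^ 2 ≤
      2 * (∫ x, κ x * ‖g₀ x‖ ^ 2) + 2 * (s * ∫ x, ‖g₁ x‖ ^ 2) := by
  have hcont : Continuous fun x => κ x * s / (κ x + s) :=
    (hκ.mul continuous_const).div (hκ.add continuous_const) fun x => (add_pos (hκ0 x) hs).ne'
  have hk : ∀ x, 0 ≤ κ x * s / (κ x + s) := fun x => by have := hκ0 x; positivity
  have hi : Integrable (fun x => κ x * s / (κ x + s) * ‖g x‖ ^ 2) := by
    refine ((integrable_norm_sq g).const_mul s).mono' ?_ (Eventually.of_forall fun x => ?_)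
    · have := g.continuous
      exact (hcont.mul (by fun_prop)).aestronglyMeasurable
    · have := hk x
      rw [Real.norm_of_nonneg (by positivity)]
      gcongr
      exact parallel_le_right (hκ0 x) hs
  refine ⟨hi, ?_⟩
  rw [← integral_const_mul, ← integral_const_mul, ← integral_const_mul,
    ← integral_add (hi0.const_mul 2) (((integrable_norm_sq g₁).const_mul s).const_mul 2)]
  refine integral_mono hi ((hi0.const_mul 2).add
    (((integrable_norm_sq g₁).const_mul s).const_mul 2)) fun x => ?_
  have e : g x = g₀ x + g₁ x := by rw [h]; rfl
  have h1 := norm_add_sq_le (g₀ x) (g₁ x)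
  have h2 := parallel_le_left (hκ0 x) hs
  have h3 := parallel_le_right (hκ0 x) hs
  have h4 := hk x
  simp only
  rw [e]
  set k := κ x * s / (κ x + s)
  calc k * ‖g₀ x + g₁ x‖ ^ 2 ≤ k * (2 * ‖g₀ x‖ ^ 2 + 2 * ‖g₁ x‖ ^ 2) := by gcongr
    _ = 2 * (k * ‖g₀ x‖ ^ 2) + 2 * (k * ‖g₁ x‖ ^ 2) := by ring
    _ ≤ _ := by gcongr

/-- The function is split as `f₀ + f₁`; the image of `f₀` is estimated with the weight `ρ`, that of
`f₁` with the constant weight `s`. The factor `12800` is `2 · 6400`, from the square of the sum. -/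
lemma lintegral_rho_opK_le {τ : ℝ} (hτ : 0 < τ) (i j : Fin 3) {f : 𝓢(E3, ℂ)}
    (hc : HasCompactSupport f) {θ : ℝ} (h0 : 0 < θ) (h1 : θ ≤ 1) :
    ∫⁻ x, ENNReal.ofReal (rho x ^ θ) * ‖opK τ i j f x‖ₑ ^ 2 ≤
      12800 * ∫⁻ x, ENNReal.ofReal (rho x ^ θ) * ‖f x‖ₑ ^ 2 := by
  have hcf := f.continuous
  have hcK := (opK τ i j f).continuous
  refine lintegral_weight_interpolation measurable_rho rho_pos (by fun_prop) (by fun_prop)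
    (fun s hs => ?_) h0 h1
  have hk : ∀ x, 0 ≤ rho x * s / (rho x + s) := fun x => by have := rho_pos x; positivity
  obtain ⟨f₀, f₁, hf, hf0, hf1⟩ := exists_split hc contDiff_rho rho_pos hs
  have hK : opK τ i j f = opK τ i j f₀ + opK τ i j f₁ := by rw [hf]; exact map_add _ _ _
  obtain ⟨hi, hle⟩ := integral_parallel_le continuous_rho rho_pos hs hK (integrable_weight_one _)
  -- Only integrability is wanted here, and the trivial splitting `f + 0` provides it.
  obtain ⟨hi', -⟩ := integral_parallel_le continuous_rho rho_pos hs (by simp : f = f + 0)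
    (integrable_weight_one _)
  rw [lintegral_ofReal_mul_enorm_sq hk hi, lintegral_ofReal_mul_enorm_sq hk hi',
    show (12800 : ℝ≥0∞) = ENNReal.ofReal 12800 by simp, ← ENNReal.ofReal_mul (by norm_num)]
  apply ENNReal.ofReal_le_ofReal
  have b0 := integral_weight_opK_le hτ i j f₀
  have b1 := integral_opK_le hτ i j f₁
  -- Pointwise, the splitting minimises `κ |f₀|² + s |f₁|²`, and the minimum is exactly the parallel
  -- sum times `|f|²`: nothing is lost.
  have e : (∫ x, (1 + ‖x‖ ^ 2) * ‖f₀ x‖ ^ 2) + s * ∫ x, ‖f₁ x‖ ^ 2 =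
      ∫ x, rho x * s / (rho x + s) * ‖f x‖ ^ 2 := by
    rw [← integral_const_mul, ← integral_add (integrable_weight_one _)
      ((integrable_norm_sq _).const_mul _)]
    congr with x
    have : 0 < rho x + s := add_pos (rho_pos x) hs
    rw [hf0, hf1, norm_smul, norm_smul, mul_pow, mul_pow, Real.norm_eq_abs, Real.norm_eq_abs,
      sq_abs, sq_abs]
    change rho x * _ + _ = _
    field_simp
    ring
  have n1 : 0 ≤ ∫ x, ‖f₁ x‖ ^ 2 := integral_nonneg fun x => by positivity
  rw [← e]
  have b1' := mul_le_mul_of_nonneg_left b1 hs.le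
  have n2 := mul_nonneg hs.le n1
  change (∫ x, rho x * ‖opK τ i j f₀ x‖ ^ 2) ≤ _ at b0
  linarith

lemma contDiff_rho_sq : ContDiff ℝ ∞ fun x => rho x ^ 2 := contDiff_rho.pow 2

/-- The two factors of the splitting add up to `1`, so their derivatives are opposite. -/
lemma fderiv_split (s : ℝ) (hs : 0 < s) (m : Fin 3) (x : E3) :
    fderiv ℝ (fun y => s / (rho y ^ 2 + s)) x (bvec m)
      = - (s * (4 * rho x * x m) / (rho x ^ 2 + s) ^ 2) ∧
    fderiv ℝ (fun y => rho y ^ 2 / (rho y ^ 2 + s)) x (bvec m)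
      = s * (4 * rho x * x m) / (rho x ^ 2 + s) ^ 2 := by
  have h0 : rho x ^ 2 + s ≠ 0 := by positivity
  have h1 := (hasDerivAt_inv h0).comp_hasFDerivAt x (((hasFDerivAt_rho x).pow 2).add_const s)
  have h2 := h1.const_mul s
  have e : fderiv ℝ (fun y => s / (rho y ^ 2 + s)) x (bvec m)
      = - (s * (4 * rho x * x m) / (rho x ^ 2 + s) ^ 2) := by
    have e1 : (fun y => s / (rho y ^ 2 + s)) = fun y =>
        s * ((fun y => y⁻¹) ∘ fun y => rho y ^ 2 + s) y := by ext y; simp [div_eq_mul_inv]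
    rw [e1, h2.fderiv]
    simp [EuclideanSpace.inner_single_right]
    field_simp
    ring
  refine ⟨e, ?_⟩
  have e2 : (fun y => rho y ^ 2 / (rho y ^ 2 + s)) = fun y => 1 - s / (rho y ^ 2 + s) := by
    ext y
    have : 0 < rho y ^ 2 + s := by positivity
    field_simp
    ring
  rw [e2, fderiv_const_sub]
  simp only [_root_.neg_apply, e, neg_neg]

lemma coord_sq_le_rho (x : E3) (m : Fin 3) : x m ^ 2 ≤ rho x := by
  have := abs_coord_le x m
  rw [rho, ← sq_abs]
  nlinarith [abs_nonneg (x m)]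

/-- The splitting is applied to `f` and then differentiated, so the derivative of the cutting factor
contributes a multiple `c` of `f`. From `x_m² ≤ ρ` and `s ρ² ≤ (ρ² + s)²` one gets `c² (ρ² + s) ≤ 16
ρ⁻¹` times the parallel sum, which is the lower-order term on the right. The constant is `33 = 2 ·
16 + 1`. -/
lemma split_gradient_bound (x : E3) {s : ℝ} (hs : 0 < s) (m : Fin 3) (f f' : ℂ) :
    rho x ^ 2 * ‖(s / (rho x ^ 2 + s)) • f' + (-(s * (4 * rho x * x m) / (rho x ^ 2 + s) ^ 2))
        • f‖ ^ 2
      + rho x * ‖(s / (rho x ^ 2 + s)) • f‖ ^ 2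
      + s * ‖(rho x ^ 2 / (rho x ^ 2 + s)) • f' + (s * (4 * rho x * x m) / (rho x ^ 2 + s) ^ 2)
          • f‖ ^ 2
    ≤ 33 * (rho x ^ 2 * s / (rho x ^ 2 + s) * ‖f'‖ ^ 2
      + rho x ^ 2 * s / (rho x ^ 2 + s) * (rho x)⁻¹ * ‖f‖ ^ 2) := by
  have hr := rho_pos x
  have hm := coord_sq_le_rho x m
  set r := rho x
  set d := r ^ 2 + s with hd
  have hd0 : 0 < d := by positivity
  set c := s * (4 * r * x m) / d ^ 2 with hcdef
  have hc : c ^ 2 * d ≤ 16 * (r ^ 2 * s / d) * r⁻¹ := by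
    have : c ^ 2 * d = 16 * (s ^ 2 * r ^ 2 * x m ^ 2) / d ^ 3 := by
      rw [hcdef]; field_simp; ring
    rw [this, div_le_iff₀ (by positivity)]
    have e : 16 * (r ^ 2 * s / d) * r⁻¹ * d ^ 3 = 16 * (r * s * d ^ 2) := by field_simp
    rw [e]
    have e2 : s * r ^ 2 ≤ d ^ 2 := by
      rw [hd]
      nlinarith [sq_nonneg (r ^ 2), sq_nonneg s, mul_pos hs (pow_pos hr 2)]
    calc 16 * (s ^ 2 * r ^ 2 * x m ^ 2) ≤ 16 * (s ^ 2 * r ^ 2 * r) := by gcongr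
      _ = 16 * (r * s * (s * r ^ 2)) := by ring
      _ ≤ _ := by gcongr
  have n1 := norm_add_sq_le ((s / d) • f') ((-c) • f)
  have n2 := norm_add_sq_le ((r ^ 2 / d) • f') (c • f)
  simp only [norm_smul, mul_pow, Real.norm_eq_abs, sq_abs, neg_sq] at n1 n2 ⊢
  have e1 : r ^ 2 * (2 * ((s / d) ^ 2 * ‖f'‖ ^ 2)) + s * (2 * ((r ^ 2 / d) ^ 2 * ‖f'‖ ^ 2))
      = 2 * (r ^ 2 * s / d * ‖f'‖ ^ 2) := by
    field_simp
    rw [hd]; ring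
  have e2 : r ^ 2 * (2 * (c ^ 2 * ‖f‖ ^ 2)) + s * (2 * (c ^ 2 * ‖f‖ ^ 2))
      = 2 * (c ^ 2 * d) * ‖f‖ ^ 2 := by rw [hd]; ring
  have e3 : r * ((s / d) ^ 2 * ‖f‖ ^ 2) ≤ r ^ 2 * s / d * r⁻¹ * ‖f‖ ^ 2 := by
    rw [← mul_assoc]
    refine mul_le_mul_of_nonneg_right ?_ (by positivity)
    have : r ^ 2 * s / d * r⁻¹ = r * (s / d) := by field_simp
    rw [this]
    refine mul_le_mul_of_nonneg_left ?_ hr.le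
    have h1 : s / d ≤ 1 := by rw [div_le_one hd0, hd]; nlinarith [sq_nonneg r]
    have h2 : 0 ≤ s / d := by positivity
    nlinarith
  have e4 : 2 * (c ^ 2 * d) * ‖f‖ ^ 2 ≤ 2 * (16 * (r ^ 2 * s / d) * r⁻¹) * ‖f‖ ^ 2 := by gcongr
  have e5 : 0 ≤ r ^ 2 * s / d * ‖f'‖ ^ 2 := by positivity
  have m1 := mul_le_mul_of_nonneg_left n1 (sq_nonneg r)
  have m2 := mul_le_mul_of_nonneg_left n2 hs.le
  linarith

/-- The splitting is made before the derivative, because the bound with weight `ρ²` holds for `∂_m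
f₀` and not for an arbitrary part of `∂_m f`. -/
lemma lintegral_rho_opK_deriv_le {τ : ℝ} (hτ : 0 < τ) (i j m : Fin 3) {f : 𝓢(E3, ℂ)}
    (hc : HasCompactSupport f) {θ : ℝ} (h0 : 0 < θ) (h1 : θ ≤ 1) :
    ∫⁻ x, ENNReal.ofReal ((rho x ^ 2) ^ θ) * ‖opK τ i j (∂_{bvec m} f) x‖ₑ ^ 2 ≤
      10 ^ 11 * ∫⁻ x, ENNReal.ofReal ((rho x ^ 2) ^ θ) *
        (‖fderiv ℝ f x (bvec m)‖ₑ ^ 2 + ENNReal.ofReal (rho x)⁻¹ * ‖f x‖ₑ ^ 2) := by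
  have hcf := f.continuous
  have hcf' := (∂_{bvec m} f).continuous
  have hcK := (opK τ i j (∂_{bvec m} f)).continuous
  have hκ0 : ∀ x, 0 < rho x ^ 2 := fun x => pow_pos (rho_pos x) 2
  simp_rw [← lineDerivOp_apply_eq_fderiv]
  refine lintegral_weight_interpolation (by fun_prop) hκ0 (by fun_prop)
    (by fun_prop) (fun s hs => ?_) h0 h1
  have hk : ∀ x, 0 ≤ rho x ^ 2 * s / (rho x ^ 2 + s) := fun x => by have := rho_pos x; positivity
  obtain ⟨f₀, f₁, hf, hf0, hf1⟩ := exists_split hc contDiff_rho_sq hκ0 hs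
  have hK : opK τ i j (∂_{bvec m} f) =
      opK τ i j (∂_{bvec m} f₀) + opK τ i j (∂_{bvec m} f₁) := by
    rw [hf, LineDeriv.lineDerivOp_add]; exact map_add _ _ _
  have hcr : Continuous fun x => rho x ^ 2 := by fun_prop
  obtain ⟨hi, hle⟩ := integral_parallel_le hcr hκ0 hs hK (integrable_weight_two _)
  obtain ⟨hi', -⟩ := integral_parallel_le hcr hκ0 hs
    (by simp : ∂_{bvec m} f = ∂_{bvec m} f + 0) (integrable_weight_two _)
  obtain ⟨hi'', -⟩ := integral_parallel_le hcr hκ0 hs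
    (by simp : f = f + 0) (integrable_weight_two _)
  have hk2 : ∀ x, 0 ≤ rho x ^ 2 * s / (rho x ^ 2 + s) * (rho x)⁻¹ := fun x => by
    have := rho_pos x; positivity
  have hi2 : Integrable fun x => rho x ^ 2 * s / (rho x ^ 2 + s) * (rho x)⁻¹ * ‖f x‖ ^ 2 := by
    refine hi''.mono' ?_ (Eventually.of_forall fun x => ?_)
    · have c1 : Continuous fun x => rho x ^ 2 * s / (rho x ^ 2 + s) :=
        Continuous.div (by fun_prop) (by fun_prop) fun x => (add_pos (hκ0 x) hs).ne'
      have c2 : Continuous fun x => (rho x)⁻¹ :=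
        continuous_rho.inv₀ fun x => (rho_pos x).ne'
      exact ((c1.mul c2).mul (by fun_prop)).aestronglyMeasurable
    · have := hk2 x
      have h3 := hk x
      rw [Real.norm_of_nonneg (by positivity)]
      refine mul_le_mul_of_nonneg_right (mul_le_of_le_one_right h3 ?_) (by positivity)
      exact inv_le_one_of_one_le₀ (one_le_rho x)
  have split : ∫⁻ x, ENNReal.ofReal (rho x ^ 2 * s / (rho x ^ 2 + s)) *
      (‖(∂_{bvec m} f) x‖ₑ ^ 2 + ENNReal.ofReal (rho x)⁻¹ * ‖f x‖ₑ ^ 2) =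
      ENNReal.ofReal ((∫ x, rho x ^ 2 * s / (rho x ^ 2 + s) * ‖(∂_{bvec m} f) x‖ ^ 2) +
        ∫ x, rho x ^ 2 * s / (rho x ^ 2 + s) * (rho x)⁻¹ * ‖f x‖ ^ 2) := by
    rw [ENNReal.ofReal_add (integral_nonneg fun x => mul_nonneg (hk x) (by positivity))
      (integral_nonneg fun x => mul_nonneg (hk2 x) (by positivity)),
      ← lintegral_ofReal_mul_enorm_sq hk hi', ← lintegral_ofReal_mul_enorm_sq hk2 hi2,
      ← lintegral_add_left (by fun_prop)]
    refine lintegral_congr fun x => ?_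
    rw [mul_add, ENNReal.ofReal_mul (hk x), mul_assoc]
  rw [lintegral_ofReal_mul_enorm_sq hk hi, split,
    show (10 ^ 11 : ℝ≥0∞) = ENNReal.ofReal (10 ^ 11) by
      rw [ENNReal.ofReal_pow (by norm_num)]; simp, ← ENNReal.ofReal_mul (by norm_num)]
  apply ENNReal.ofReal_le_ofReal
  have b0 := integral_weight_sq_opK_le hτ i j m f₀
  have b1 := integral_opK_le hτ i j (∂_{bvec m} f₁)
  obtain ⟨hd0, hd1⟩ := contDiff_split contDiff_rho_sq hκ0 hs
  have g0 : ∀ x, (∂_{bvec m} f₀) x = (s / (rho x ^ 2 + s)) • (∂_{bvec m} f) x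
      + (-(s * (4 * rho x * x m) / (rho x ^ 2 + s) ^ 2)) • f x := fun x => by
    have e : (f₀ : E3 → ℂ) = fun x => (s / (rho x ^ 2 + s)) • f x := funext hf0
    rw [lineDerivOp_apply_eq_fderiv, e, fderiv_fun_smul (hd0.differentiable (by simp) x)
      f.differentiableAt, lineDerivOp_apply_eq_fderiv, ← (fderiv_split s hs m x).1]
    simp
  have g1 : ∀ x, (∂_{bvec m} f₁) x = (rho x ^ 2 / (rho x ^ 2 + s)) • (∂_{bvec m} f) x
      + (s * (4 * rho x * x m) / (rho x ^ 2 + s) ^ 2) • f x := fun x => by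
    have e : (f₁ : E3 → ℂ) = fun x => (rho x ^ 2 / (rho x ^ 2 + s)) • f x := funext hf1
    rw [lineDerivOp_apply_eq_fderiv, e, fderiv_fun_smul (hd1.differentiable (by simp) x)
      f.differentiableAt, lineDerivOp_apply_eq_fderiv, ← (fderiv_split s hs m x).2]
    simp
  have hsum : Integrable fun x => (1 + ‖x‖ ^ 2) ^ 2 * ‖(∂_{bvec m} f₀) x‖ ^ 2 +
      (1 + ‖x‖ ^ 2) * ‖f₀ x‖ ^ 2 := (integrable_weight_two _).add (integrable_weight_one _)
  -- Integrated form of the pointwise bound. Combined with the constants `2 · 10⁹` for `f₀` and `2`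
  -- for `f₁`, it stays below `10¹¹`.
  have key : (∫ x, (1 + ‖x‖ ^ 2) ^ 2 * ‖(∂_{bvec m} f₀) x‖ ^ 2)
      + (∫ x, (1 + ‖x‖ ^ 2) * ‖f₀ x‖ ^ 2) + s * ∫ x, ‖(∂_{bvec m} f₁) x‖ ^ 2 ≤
      33 * ((∫ x, rho x ^ 2 * s / (rho x ^ 2 + s) * ‖(∂_{bvec m} f) x‖ ^ 2) +
        ∫ x, rho x ^ 2 * s / (rho x ^ 2 + s) * (rho x)⁻¹ * ‖f x‖ ^ 2) := by
    rw [← integral_const_mul, ← integral_add hi' hi2, ← integral_const_mul,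
      ← integral_add (integrable_weight_two _) (integrable_weight_one _),
      ← integral_add hsum ((integrable_norm_sq _).const_mul _)]
    refine integral_mono (hsum.add ((integrable_norm_sq _).const_mul _))
        ((hi'.add hi2).const_mul 33) fun x => ?_
    have := split_gradient_bound x hs m (f x) ((∂_{bvec m} f) x)
    rw [← g0, ← g1, ← hf0] at this
    exact this
  have n1 : 0 ≤ s * ∫ x, ‖(∂_{bvec m} f₁) x‖ ^ 2 :=
    mul_nonneg hs.le (integral_nonneg fun x => by positivity)
  have b1' := mul_le_mul_of_nonneg_left b1 hs.le
  change (∫ x, rho x ^ 2 * ‖opK τ i j (∂_{bvec m} f₀) x‖ ^ 2) ≤ _ at b0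
  have n2 : 0 ≤ ∫ x, (1 + ‖x‖ ^ 2) ^ 2 * ‖(∂_{bvec m} f₀) x‖ ^ 2 :=
    integral_nonneg fun x => by positivity
  have n3 : 0 ≤ ∫ x, (1 + ‖x‖ ^ 2) * ‖f₀ x‖ ^ 2 := integral_nonneg fun x => by positivity
  linarith

/-! ### Sobolev's inequality -/

lemma eLpNorm_two_sq {α V : Type*} [MeasurableSpace α] [NormedAddCommGroup V] (μ : Measure α)
    (f : α → V) : eLpNorm f 2 μ ^ 2 = ∫⁻ x, ‖f x‖ₑ ^ 2 ∂μ := by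
  rw [eLpNorm_eq_lintegral_rpow_enorm_toReal (by norm_num) (by norm_num), ← ENNReal.rpow_natCast,
    ← ENNReal.rpow_mul]
  simp

lemma eLpNorm_two_le_of_sq_le {α V W : Type*} [MeasurableSpace α] [NormedAddCommGroup V]
    [NormedAddCommGroup W] {μ : Measure α} {f : α → V} {g : α → W} {C : ℝ≥0∞}
    (h : ∫⁻ x, ‖f x‖ₑ ^ 2 ∂μ ≤ C ^ 2 * ∫⁻ x, ‖g x‖ₑ ^ 2 ∂μ) :
    eLpNorm f 2 μ ≤ C * eLpNorm g 2 μ := by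
  rw [← eLpNorm_two_sq, ← eLpNorm_two_sq, ← mul_pow] at h
  exact (ENNReal.pow_le_pow_left_iff (by norm_num)).1 h

lemma enorm_clm_le_sum {V : Type*} [NormedAddCommGroup V] [NormedSpace ℝ V] (L : E3 →L[ℝ] V) :
    ‖L‖ ≤ ∑ k, ‖L (bvec k)‖ := by
  refine L.opNorm_le_bound (Finset.sum_nonneg fun _ _ => norm_nonneg _) fun x => ?_
  have e : x = ∑ k, x k • bvec k := by
    ext j
    simp [bvec, Finset.sum_apply, Pi.single_apply]
  calc ‖L x‖ = ‖∑ k, x k • L (bvec k)‖ := by conv_lhs => rw [e, map_sum]; simp only [map_smul]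
    _ ≤ ∑ k, ‖x k • L (bvec k)‖ := norm_sum_le _ _
    _ ≤ ∑ k, ‖L (bvec k)‖ * ‖x‖ := Finset.sum_le_sum fun k _ => by
        rw [norm_smul, mul_comm]
        exact mul_le_mul_of_nonneg_left (abs_coord_le x k) (norm_nonneg _)
    _ = _ := by rw [Finset.sum_mul]

/-- A Sobolev constant for `‖g‖₆ ≤ C ‖∇g‖₂` on `ℝ³`. -/
noncomputable def sobolevConst : ℝ≥0∞ :=
  eLpNormLESNormFDerivOfEqInnerConst (volume : Measure E3) 2

lemma sobolevConst_ne_top : sobolevConst ≠ ⊤ := ENNReal.coe_ne_top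

lemma eLpNorm_fderiv_le_sum {V : Type*} [NormedAddCommGroup V] [NormedSpace ℝ V]
    {g : E3 → V} (hg : ContDiff ℝ 1 g) (μ : Measure E3) :
    eLpNorm (fderiv ℝ g) 2 μ ≤ ∑ k, eLpNorm (fun x => fderiv ℝ g x (bvec k)) 2 μ := by
  have hm : ∀ k, AEStronglyMeasurable (fun x => ‖fderiv ℝ g x (bvec k)‖) μ := fun k =>
    ((hg.continuous_fderiv (by norm_num)).clm_apply
      continuous_const).norm.aestronglyMeasurable
  calc eLpNorm (fderiv ℝ g) 2 μ ≤ eLpNorm (∑ k, fun x => ‖fderiv ℝ g x (bvec k)‖) 2 μ := by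
        refine eLpNorm_mono_real fun x => ?_
        rw [Finset.sum_apply]
        exact enorm_clm_le_sum _
    _ ≤ ∑ k, eLpNorm (fun x => ‖fderiv ℝ g x (bvec k)‖) 2 μ :=
        eLpNorm_sum_le (fun k _ => hm k) (by norm_num)
    _ = _ := by simp_rw [eLpNorm_norm]

lemma sobolev_compact {V : Type*} [NormedAddCommGroup V] [InnerProductSpace ℝ V] [CompleteSpace V]
    {g : E3 → V} (hg : ContDiff ℝ 1 g) (hc : HasCompactSupport g) :
    eLpNorm g 6 volume ≤ sobolevConst * ∑ k, eLpNorm (fun x => fderiv ℝ g x (bvec k)) 2 volume := by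
  have h := eLpNorm_le_eLpNorm_fderiv_of_eq_inner (volume : Measure E3) hg hc (p := 2) (p' := 6)
    (by norm_num) (by simp) (by simp; norm_num)
  refine le_trans (by simpa using h) ?_
  unfold sobolevConst
  gcongr
  exact eLpNorm_fderiv_le_sum hg volume

/-- Smooth cutoff functions. -/
lemma exists_cutoff : ∃ C : ℝ, 0 ≤ C ∧ ∃ χ : ℕ → E3 → ℝ, (∀ n, ContDiff ℝ ∞ (χ n)) ∧
    (∀ n, HasCompactSupport (χ n)) ∧ (∀ n x, 0 ≤ χ n x) ∧ (∀ n x, χ n x ≤ 1) ∧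
    (∀ (n : ℕ) x, ‖x‖ ≤ n + 1 → χ n x = 1) ∧
    (∀ n k x, |fderiv ℝ (χ n) x (bvec k)| ≤ C / (n + 1)) := by
  let χ : ContDiffBump (0 : E3) := ⟨1, 2, one_pos, one_lt_two⟩
  have hχ : ContDiff ℝ ∞ χ := χ.contDiff
  obtain ⟨C, hC⟩ := (χ.hasCompactSupport.fderiv (𝕜 := ℝ)).exists_bound_of_continuous
    (hχ.continuous_fderiv (by simp))
  refine ⟨C, (norm_nonneg _).trans (hC 0), fun n x => χ ((n + 1 : ℝ)⁻¹ • x), fun n => ?_,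
      fun n => ?_,
    fun n x => χ.nonneg, fun n x => χ.le_one, fun n x hx => ?_, fun n k x => ?_⟩
  · exact hχ.comp (contDiff_const_smul _)
  · exact χ.hasCompactSupport.comp_smul (by positivity)
  · apply χ.one_of_mem_closedBall
    rw [mem_closedBall_zero_iff, norm_smul, norm_inv, Real.norm_of_nonneg (by positivity)]
    change _ ≤ (1 : ℝ)
    rw [inv_mul_le_iff₀ (by positivity)]
    simpa using hx
  · have h1 : HasFDerivAt (fun x : E3 => (n + 1 : ℝ)⁻¹ • x)
      ((n + 1 : ℝ)⁻¹ • ContinuousLinearMap.id ℝ E3) x :=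
      ((n + 1 : ℝ)⁻¹ • ContinuousLinearMap.id ℝ E3).hasFDerivAt
    have h2 := ((hχ.differentiable (by simp)) ((n + 1 : ℝ)⁻¹ • x)).hasFDerivAt.comp x h1
    have h3 : fderiv ℝ (fun x => χ ((n + 1 : ℝ)⁻¹ • x)) x = _ := h2.fderiv
    rw [h3]
    simp only [ContinuousLinearMap.comp_apply, FunLike.coe_smul, Pi.smul_apply,
      ContinuousLinearMap.id_apply, map_smul, smul_eq_mul, abs_mul]
    rw [abs_of_pos (by positivity), div_eq_inv_mul]
    refine mul_le_mul_of_nonneg_left ?_ (by positivity)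
    rw [← Real.norm_eq_abs]
    refine le_trans (ContinuousLinearMap.le_opNorm _ _) ?_
    simpa using hC _

/-- Sobolev's inequality for functions of class `C¹` which are in `H¹`. -/
theorem sobolev_L2 {V : Type*} [NormedAddCommGroup V] [InnerProductSpace ℝ V] [CompleteSpace V]
    {g : E3 → V} (hg : ContDiff ℝ 1 g) (h0 : MemLp g 2 volume) :
    eLpNorm g 6 volume ≤ sobolevConst * ∑ k, eLpNorm (fun x => fderiv ℝ g x (bvec k)) 2 volume := by
  obtain ⟨C, hC0, χ, hs, hc, hχ0, hχ1, hχ, hχd⟩ := exists_cutoff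
  have hs1 : ∀ n, ContDiff ℝ 1 (χ n) := fun n => (hs n).of_le (by simp)
  have hgd := hg.continuous_fderiv (by norm_num)
  have hd : ∀ n x k, fderiv ℝ (fun x => χ n x • g x) x (bvec k) =
      χ n x • fderiv ℝ g x (bvec k) + fderiv ℝ (χ n) x (bvec k) • g x := fun n x k => by
    rw [fderiv_fun_smul ((hs1 n).differentiable (by norm_num) x) (hg.differentiable (by norm_num)
        x)]
    simp
  -- The gradient of the cutoff is `O(1/n)`, so truncation costs a term that tends to `0` because
  -- `g` is in `L²`.
  have hb : ∀ n k, eLpNorm (fun x => fderiv ℝ (fun x => χ n x • g x) x (bvec k)) 2 volume ≤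
      eLpNorm (fun x => fderiv ℝ g x (bvec k)) 2 volume
        + ENNReal.ofReal (C / (n + 1)) * eLpNorm g 2 volume := fun n k => by
    simp_rw [hd]
    have hcχ := (hs1 n).continuous
    have hcd := ((hs1 n).continuous_fderiv (by norm_num)).clm_apply
      (continuous_const (y := bvec k))
    refine (eLpNorm_add_le (hcχ.smul (hgd.clm_apply continuous_const)).aestronglyMeasurable
      (hcd.smul hg.continuous).aestronglyMeasurable (by norm_num)).trans (add_le_add ?_ ?_)
    · refine eLpNorm_mono fun x => ?_
      rw [Pi.smul_apply', norm_smul, Real.norm_of_nonneg (hχ0 n x)]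
      exact mul_le_of_le_one_left (norm_nonneg _) (hχ1 n x)
    · refine eLpNorm_le_mul_eLpNorm_of_ae_le_mul (Eventually.of_forall fun x => ?_) _
      rw [Pi.smul_apply', norm_smul]
      exact mul_le_mul_of_nonneg_right (hχd n k x) (norm_nonneg _)
  have hlim : ∀ x, Tendsto (fun n => χ n x • g x) atTop (𝓝 (g x)) := fun x => by
    refine tendsto_const_nhds.congr' ?_
    filter_upwards [eventually_ge_atTop ⌈‖x‖⌉₊] with n hn
    rw [hχ n x, one_smul]
    exact (Nat.le_ceil _).trans ((Nat.cast_le.2 hn).trans (by linarith))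
  refine (Lp.eLpNorm_lim_le_liminf_eLpNorm (fun n => ((hs1 n).continuous.smul
    hg.continuous).aestronglyMeasurable) g (Eventually.of_forall hlim)).trans ?_
  have step : ∀ n, eLpNorm (fun x => χ n x • g x) 6 volume ≤ sobolevConst *
      ∑ k : Fin 3, (eLpNorm (fun x => fderiv ℝ g x (bvec k)) 2 volume
        + ENNReal.ofReal (C / (n + 1)) * eLpNorm g 2 volume) := fun n =>
    (sobolev_compact ((hs1 n).smul hg) ((hc n).smul_right)).trans (by
      gcongr with k
      exact hb n k)
  refine (liminf_le_liminf (Eventually.of_forall step)).trans ?_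
  refine le_of_eq (Tendsto.liminf_eq ?_)
  have t0 : Tendsto (fun n : ℕ => ENNReal.ofReal (C / (n + 1)) * eLpNorm g 2 volume) atTop (𝓝 0) :=
      by
    have t1 : Tendsto (fun n : ℕ => ENNReal.ofReal (C / (n + 1))) atTop (𝓝 0) := by
      rw [← ENNReal.ofReal_zero]
      refine ENNReal.tendsto_ofReal (Tendsto.div_atTop tendsto_const_nhds ?_)
      exact tendsto_atTop_add_const_right _ _ tendsto_natCast_atTop_atTop
    simpa using ENNReal.Tendsto.mul_const t1 (Or.inr h0.2.ne)
  refine ENNReal.Tendsto.const_mul ?_ (Or.inr sobolevConst_ne_top)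
  refine tendsto_finsetSum _ fun k _ => ?_
  simpa using tendsto_const_nhds.add t0

/-! ### Passage to the Riesz transforms, and duality -/

lemma lineDeriv_opK {τ : ℝ} (hτ : 0 < τ) (i j m : Fin 3) (f : 𝓢(E3, ℂ)) :
    ∂_{bvec m} (opK τ i j f) = opK τ i j (∂_{bvec m} f) := by
  rw [opK, opK, multiplier_lineDeriv (symbK_temperate hτ i j), lineDeriv_eq_fourierMultiplierCLM,
    fourierMultiplierCLM_fourierMultiplierCLM_apply (by fun_prop) (symbK_temperate hτ i j)]
  congr 3
  ext x
  simp [inner_bvec, mul_comm]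

/-- The sign comes from `i² = -1`: the regularised operators approximate `-R_i R_j`. At `ξ = 0` both
sides vanish, a quotient by zero being zero. -/
lemma rieszSymbol_mul (i j : Fin 3) (ξ : E3) :
    rieszSymbol i ξ * rieszSymbol j ξ = -((ξ i * ξ j / ‖ξ‖ ^ 2 : ℝ) : ℂ) := by
  unfold rieszSymbol
  push_cast
  have : Complex.I * ↑(ξ i) / ↑‖ξ‖ * (Complex.I * ↑(ξ j) / ↑‖ξ‖) =
    (Complex.I * Complex.I) * (ξ i * ξ j) / (‖ξ‖ ^ 2 : ℂ) := by ring
  rw [this, Complex.I_mul_I]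
  ring

lemma tendsto_symbK (i j : Fin 3) (ξ : E3) :
    Tendsto (fun n : ℕ => symbK (1 / (n + 1)) i j ξ) atTop (𝓝 (ξ i * ξ j / ‖ξ‖ ^ 2)) := by
  by_cases h : ξ = 0
  · subst h; simp [symbK]
  · have hn : ‖ξ‖ ^ 2 ≠ 0 := by simpa using h
    unfold symbK resolvent
    simp_rw [mul_one_div]
    refine Tendsto.div tendsto_const_nhds ?_ hn
    simpa using tendsto_const_nhds.add (tendsto_one_div_add_atTop_nhds_zero_nat (𝕜 := ℝ))

/-- `R_i R_j` is the limit of the regularised operators. -/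
lemma tendsto_opK (i j : Fin 3) (f : 𝓢(E3, ℂ)) (x : E3) :
    Tendsto (fun n : ℕ => opK (1 / (n + 1)) i j f x) atTop
      (𝓝 (-𝓕⁻ (fun ξ : E3 => rieszSymbol i ξ * rieszSymbol j ξ * 𝓕 (f : E3 → ℂ) ξ) x)) := by
  have hτ : ∀ n : ℕ, (0 : ℝ) < 1 / (n + 1) := fun n => by positivity
  have e : ∀ n : ℕ, opK (1 / (n + 1)) i j f x = ∫ ξ, Real.fourierChar (inner ℝ ξ x) •
      (symbK (1 / (n + 1)) i j ξ • 𝓕 f ξ) := fun n => by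
    rw [opK, fourierMultiplierCLM_apply, fourierInv_coe, Real.fourierInv_eq]
    simp_rw [smulLeftCLM_apply_apply (symbK_temperate (hτ n) i j)]
  simp_rw [e]
  rw [Real.fourierInv_eq, ← integral_neg]
  -- The symbols are bounded by `1` uniformly in `τ`, so `|𝓕 f|` dominates.
  refine tendsto_integral_of_dominated_convergence (fun ξ => ‖𝓕 f ξ‖) (fun n => ?_)
    (𝓕 f).integrable.norm (fun n => Eventually.of_forall fun ξ => ?_)
    (Eventually.of_forall fun ξ => ?_)
  · have h1 := (symbK_temperate (hτ n) i j).1.continuous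
    have h2 := (𝓕 f).continuous
    have h3 : Continuous fun ξ : E3 => Real.fourierChar (inner ℝ ξ x) :=
      Real.continuous_fourierChar.comp (by fun_prop)
    exact (h3.smul (h1.smul h2)).aestronglyMeasurable
  · rw [Circle.norm_smul, norm_smul]
    exact mul_le_of_le_one_left (norm_nonneg _) (abs_symbK_le (hτ n) i j ξ)
  · have := (tendsto_symbK i j ξ).smul_const (𝓕 f ξ)
    have h2 := this.const_smul (Real.fourierChar (inner ℝ ξ x))
    convert h2 using 2
    rw [rieszSymbol_mul, fourier_coe, ← smul_neg, Complex.real_smul]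
    congr 1
    ring

lemma exists_schwartz_ofReal {φ : E3 → ℝ} (hφ : ContDiff ℝ ∞ φ) (hc : HasCompactSupport φ) :
    ∃ f : 𝓢(E3, ℂ), (∀ x, f x = (φ x : ℂ)) ∧ HasCompactSupport f ∧
      ∀ x m, ‖fderiv ℝ f x (bvec m)‖ₑ = ‖fderiv ℝ φ x (bvec m)‖ₑ := by
  have h1 : ContDiff ℝ ∞ fun x => (φ x : ℂ) := Complex.ofRealCLM.contDiff.comp hφ
  have h2 : HasCompactSupport fun x => (φ x : ℂ) := hc.comp_left (g := Complex.ofReal) (by simp)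
  obtain ⟨f, hf⟩ := exists_schwartz h1 h2
  have e : (f : E3 → ℂ) = fun x => (φ x : ℂ) := funext hf
  refine ⟨f, hf, e ▸ h2, fun x m => ?_⟩
  have h3 := (Complex.ofRealCLM.hasFDerivAt (x := φ x)).comp x
    (hφ.differentiable (by simp) x).hasFDerivAt
  have h4 : fderiv ℝ (fun x => (φ x : ℂ)) x = _ := h3.fderiv
  rw [e, h4]
  simp [enorm]

lemma measurable_limit_opK (i j : Fin 3) (f : 𝓢(E3, ℂ)) : Measurable fun x =>
    (-𝓕⁻ (fun ξ : E3 => rieszSymbol i ξ * rieszSymbol j ξ * 𝓕 (f : E3 → ℂ) ξ) x) :=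
  measurable_of_tendsto_metrizable
    (fun n : ℕ => (opK (1 / (n + 1)) i j f).continuous.measurable)
    (tendsto_pi_nhds.2 fun x => tendsto_opK i j f x)

lemma rieszRieszTest_eq {φ : E3 → ℝ} (i j : Fin 3) {f : 𝓢(E3, ℂ)} (hf : ∀ x, f x = (φ x : ℂ))
    (x : E3) : rieszRieszTest i j φ x =
      (𝓕⁻ (fun ξ : E3 => rieszSymbol i ξ * rieszSymbol j ξ * 𝓕 (f : E3 → ℂ) ξ) x).re := by
  have e : (f : E3 → ℂ) = fun x => (φ x : ℂ) := funext hf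
  rw [rieszRieszTest, e]

lemma measurable_rieszRieszTest {φ : E3 → ℝ} (hφ : ContDiff ℝ ∞ φ) (hc : HasCompactSupport φ)
    (i j : Fin 3) : Measurable (rieszRieszTest i j φ) := by
  obtain ⟨f, hf, -, -⟩ := exists_schwartz_ofReal hφ hc
  have h := Complex.measurable_re.comp (measurable_limit_opK i j f).neg
  have e : rieszRieszTest i j φ = Complex.re ∘ (-fun x =>
      (-𝓕⁻ (fun ξ : E3 => rieszSymbol i ξ * rieszSymbol j ξ * 𝓕 (f : E3 → ℂ) ξ) x)) := by
    ext x
    simp [rieszRieszTest_eq i j hf]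
  rw [e]
  exact h

/-- Fatou's lemma carries any bound uniform in `τ` to the limit; the change of sign and the real
part do not increase the norm. -/
lemma eLpNorm_rieszRiesz_le {φ : E3 → ℝ} (i j : Fin 3) {f : 𝓢(E3, ℂ)}
    (hf : ∀ x, f x = (φ x : ℂ)) {w : E3 → ℝ} (hw : Continuous w) {p B : ℝ≥0∞}
    (h : ∀ n : ℕ, eLpNorm (fun x => w x • opK (1 / (n + 1)) i j f x) p volume ≤ B) :
    eLpNorm (fun x => w x * rieszRieszTest i j φ x) p volume ≤ B := by
  have hlim : ∀ x, Tendsto (fun n : ℕ => w x • opK (1 / (n + 1)) i j f x) atTop (𝓝 (w x •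
      (-𝓕⁻ (fun ξ : E3 => rieszSymbol i ξ * rieszSymbol j ξ * 𝓕 (f : E3 → ℂ) ξ) x))) :=
    fun x => (tendsto_opK i j f x).const_smul _
  calc _ ≤ eLpNorm (fun x => w x •
        (-𝓕⁻ (fun ξ : E3 => rieszSymbol i ξ * rieszSymbol j ξ * 𝓕 (f : E3 → ℂ) ξ) x)) p volume := by
        refine eLpNorm_mono fun x => ?_
        rw [rieszRieszTest_eq i j hf, norm_mul, norm_smul, norm_neg]
        gcongr
        exact Complex.abs_re_le_norm _
    _ ≤ liminf (fun n : ℕ => eLpNorm (fun x => w x • opK (1 / (n + 1)) i j f x) p volume) atTop :=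
        Lp.eLpNorm_lim_le_liminf_eLpNorm (fun n =>
          (hw.smul (opK _ i j f).continuous).aestronglyMeasurable) _ (Eventually.of_forall hlim)
    _ ≤ liminf (fun _ : ℕ => B) atTop := liminf_le_liminf (Eventually.of_forall h)
    _ = B := by simp

lemma continuous_rho_rpow (a : ℝ) : Continuous fun x => rho x ^ a :=
  continuous_rho.rpow_const fun x => Or.inl (rho_pos x).ne'

lemma enorm_rho_rpow_mul_sq {V : Type*} [NormedAddCommGroup V] [NormedSpace ℝ V] (a : ℝ) (x : E3)
    (v : V) : ‖rho x ^ a • v‖ₑ ^ 2 = ENNReal.ofReal (rho x ^ (2 * a)) * ‖v‖ₑ ^ 2 := by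
  have h := Real.rpow_nonneg (rho_pos x).le a
  rw [enorm_smul, mul_pow, Real.enorm_eq_ofReal h, ← ENNReal.ofReal_pow h, mul_comm 2 a,
    Real.rpow_mul (rho_pos x).le]
  norm_cast

/-- `120² ≥ 12800`. -/
lemma eLpNorm_opK_le {τ : ℝ} (hτ : 0 < τ) (i j : Fin 3) {f : 𝓢(E3, ℂ)}
    (hc : HasCompactSupport f) {θ : ℝ} (h0 : 0 < θ) (h1 : θ ≤ 1) :
    eLpNorm (fun x => rho x ^ (θ / 2) • opK τ i j f x) 2 volume ≤
      120 * eLpNorm (fun x => rho x ^ (θ / 2) • f x) 2 volume := by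
  apply eLpNorm_two_le_of_sq_le
  simp_rw [enorm_rho_rpow_mul_sq, mul_div_cancel₀ θ (two_ne_zero' ℝ)]
  refine (lintegral_rho_opK_le hτ i j hc h0 h1).trans ?_
  gcongr
  norm_num

/-- `R_i R_j` is bounded on `L²` with the weight `(1+|x|²)^θ`, `0 < θ ≤ 1`. -/
lemma eLpNorm_rieszRiesz_two_le {φ : E3 → ℝ} (hφ : ContDiff ℝ ∞ φ) (hc : HasCompactSupport φ)
    (i j : Fin 3) {θ : ℝ} (h0 : 0 < θ) (h1 : θ ≤ 1) :
    eLpNorm (fun x => rho x ^ (θ / 2) * rieszRieszTest i j φ x) 2 volume ≤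
      120 * eLpNorm (fun x => rho x ^ (θ / 2) * φ x) 2 volume := by
  obtain ⟨f, hf, hfc, -⟩ := exists_schwartz_ofReal hφ hc
  refine eLpNorm_rieszRiesz_le i j hf (continuous_rho_rpow _) fun n => ?_
  refine (eLpNorm_opK_le (by positivity) i j hfc h0 h1).trans (le_of_eq ?_)
  congr 1
  refine eLpNorm_congr_norm_ae (Eventually.of_forall fun x => ?_)
  simp [hf, norm_smul]

lemma hasFDerivAt_rho_rpow (a : ℝ) (x : E3) :
    HasFDerivAt (fun x => rho x ^ a) ((a * rho x ^ (a - 1)) • 2 • innerSL ℝ x) x :=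
  (hasFDerivAt_rho x).rpow_const (Or.inl (rho_pos x).ne')

lemma contDiff_rho_rpow (a : ℝ) : ContDiff ℝ ∞ fun x => rho x ^ a :=
  contDiff_rho.rpow_const_of_ne fun x => (rho_pos x).ne'

lemma fderiv_rho_rpow (a : ℝ) (x : E3) (m : Fin 3) :
    fderiv ℝ (fun x => rho x ^ a) x (bvec m) = 2 * a * x m * rho x ^ (a - 1) := by
  rw [(hasFDerivAt_rho_rpow a x).fderiv]
  simp [EuclideanSpace.inner_single_right]
  ring

/-- As `θ ≤ 1`, `ρ^{2θ - 1} ≤ ρ^θ`, so the lower-order term carries half the power of the main one.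
-/
lemma eLpNorm_opK_deriv_le {τ : ℝ} (hτ : 0 < τ) (i j m : Fin 3) {f : 𝓢(E3, ℂ)}
    (hc : HasCompactSupport f) {θ : ℝ} (h0 : 0 < θ) (h1 : θ ≤ 1) :
    eLpNorm (fun x => rho x ^ θ • opK τ i j (∂_{bvec m} f) x) 2 volume ≤
      10 ^ 6 * (eLpNorm (fun x => rho x ^ θ • fderiv ℝ f x (bvec m)) 2 volume +
        eLpNorm (fun x => rho x ^ (θ / 2) • f x) 2 volume) := by
  rw [← ENNReal.pow_le_pow_left_iff (n := 2) (by norm_num), mul_pow]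
  have hcf := f.continuous
  have hcr := continuous_rho_rpow
  have hcd := (∂_{bvec m} f).continuous
  have e : ∀ x, (rho x ^ 2) ^ θ = rho x ^ (2 * θ) := fun x => by
    rw [Real.rpow_mul (rho_pos x).le]; norm_cast
  calc _ ≤ 10 ^ 11 * ∫⁻ x, ENNReal.ofReal ((rho x ^ 2) ^ θ) *
        (‖fderiv ℝ f x (bvec m)‖ₑ ^ 2 + ENNReal.ofReal (rho x)⁻¹ * ‖f x‖ₑ ^ 2) := by
        rw [eLpNorm_two_sq]
        simp_rw [enorm_rho_rpow_mul_sq, ← e]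
        exact lintegral_rho_opK_deriv_le hτ i j m hc h0 h1
    _ ≤ 10 ^ 11 * ∫⁻ x, (‖rho x ^ θ • fderiv ℝ f x (bvec m)‖ₑ ^ 2 +
          ‖rho x ^ (θ / 2) • f x‖ₑ ^ 2) := by
        gcongr with x
        rw [mul_add, enorm_rho_rpow_mul_sq, enorm_rho_rpow_mul_sq, e, ← mul_assoc,
          ← ENNReal.ofReal_mul (by have := rho_pos x; positivity)]
        gcongr
        rw [← Real.rpow_neg_one, ← Real.rpow_add (rho_pos x)]
        exact Real.rpow_le_rpow_of_exponent_le (one_le_rho x) (by linarith)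
    _ = 10 ^ 11 * (eLpNorm (fun x => rho x ^ θ • fderiv ℝ f x (bvec m)) 2 volume ^ 2 +
        eLpNorm (fun x => rho x ^ (θ / 2) • f x) 2 volume ^ 2) := by
        rw [eLpNorm_two_sq, eLpNorm_two_sq, lintegral_add_right]
        have := hcr (θ / 2)
        fun_prop
    _ ≤ _ := by
        refine mul_le_mul' (by norm_num) ?_
        rw [sq, sq, sq, add_mul, mul_add, mul_add]
        gcongr
        · exact le_self_add
        · exact le_add_self

/-- The `L⁶` norm with the weight `(1+|x|²)^θ` of `R_i R_j φ` is controlled by weighted `L²` norms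
of `∇φ` and `φ`. -/
lemma eLpNorm_rieszRiesz_six_le {φ : E3 → ℝ} (hφ : ContDiff ℝ ∞ φ) (hc : HasCompactSupport φ)
    (i j : Fin 3) {θ : ℝ} (h0 : 0 < θ) (h1 : θ ≤ 1) :
    eLpNorm (fun x => rho x ^ θ * rieszRieszTest i j φ x) 6 volume ≤
      sobolevConst * 10 ^ 7 * (∑ m, eLpNorm (fun x => rho x ^ θ * fderiv ℝ φ x (bvec m)) 2 volume +
        eLpNorm (fun x => rho x ^ (θ / 2) * φ x) 2 volume) := by
  obtain ⟨f, hf, hfc, hfd⟩ := exists_schwartz_ofReal hφ hc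
  have e1 : eLpNorm (fun x => rho x ^ (θ / 2) * φ x) 2 volume =
      eLpNorm (fun x => rho x ^ (θ / 2) • f x) 2 volume := by
    refine eLpNorm_congr_norm_ae (Eventually.of_forall fun x => ?_)
    simp [hf, norm_smul]
  have e2 : ∀ m, eLpNorm (fun x => rho x ^ θ * fderiv ℝ φ x (bvec m)) 2 volume =
      eLpNorm (fun x => rho x ^ θ • fderiv ℝ f x (bvec m)) 2 volume := fun m => by
    refine eLpNorm_congr_enorm_ae (Eventually.of_forall fun x => ?_)
    rw [enorm_smul, hfd, enorm_mul]
  rw [e1]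
  simp_rw [e2]
  refine eLpNorm_rieszRiesz_le i j hf (continuous_rho_rpow _) fun n => ?_
  set τ : ℝ := 1 / (n + 1)
  have hτ : 0 < τ := by positivity
  set K := opK τ i j f with hK
  have hKs : ContDiff ℝ 1 K := K.smooth 1
  have hr1 : ContDiff ℝ 1 fun x => rho x ^ θ := (contDiff_rho_rpow θ).of_le (by simp)
  have hg : ContDiff ℝ 1 fun x => rho x ^ θ • K x := hr1.smul hKs
  -- The qualitative membership needed for Sobolev's inequality: `ρ^θ ≤ ρ` and the regularised image
  -- is a Schwartz function.
  have hmem : MemLp (fun x => rho x ^ θ • K x) 2 volume := by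
    rw [memLp_two_iff_integrable_sq_norm hg.continuous.aestronglyMeasurable]
    refine (integrable_weight_two K).mono' (hg.continuous.norm.pow 2).aestronglyMeasurable
      (Eventually.of_forall fun x => ?_)
    have hp := Real.rpow_nonneg (rho_pos x).le θ
    rw [norm_smul, Real.norm_of_nonneg (by positivity), mul_pow, Real.norm_of_nonneg hp]
    change _ ≤ rho x ^ 2 * _
    gcongr
    calc rho x ^ θ ≤ rho x ^ (1 : ℝ) := Real.rpow_le_rpow_of_exponent_le (one_le_rho x) h1
      _ = rho x := Real.rpow_one _
  refine (sobolev_L2 hg hmem).trans ?_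
  rw [mul_assoc]
  gcongr
  have hd : ∀ m x, fderiv ℝ (fun x => rho x ^ θ • K x) x (bvec m) =
      rho x ^ θ • opK τ i j (∂_{bvec m} f) x + (2 * θ * x m * rho x ^ (θ - 1)) • K x :=
          fun m x => by
    rw [fderiv_fun_smul (hr1.differentiable (by norm_num) x) (hKs.differentiable (by norm_num) x),
      ← lineDeriv_opK hτ, lineDerivOp_apply_eq_fderiv, ← fderiv_rho_rpow]
    simp [K]
  set b := eLpNorm (fun x => rho x ^ (θ / 2) • f x) 2 volume with hb
  -- When the derivative falls on the weight it produces at most `2 ρ^{θ - 1/2} ≤ 2 ρ^{θ/2}`, again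
  -- because `θ ≤ 1`; the `L²` bound with weight `ρ^{θ/2}` covers it.
  have hm : ∀ m, eLpNorm (fun x => fderiv ℝ (fun x => rho x ^ θ • K x) x (bvec m)) 2 volume ≤
      10 ^ 6 * (eLpNorm (fun x => rho x ^ θ • fderiv ℝ f x (bvec m)) 2 volume + b)
        + 2 * (120 * b) := fun m => by
    simp_rw [hd]
    have c1 : Continuous fun x => rho x ^ θ • opK τ i j (∂_{bvec m} f) x :=
      (continuous_rho_rpow θ).smul (opK τ i j (∂_{bvec m} f)).continuous
    have c3 : Continuous fun x : E3 => x m := (EuclideanSpace.proj m : E3 →L[ℝ] ℝ).continuous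
    have c2 : Continuous fun x => (2 * θ * x m * rho x ^ (θ - 1)) • K x :=
      ((continuous_const.mul c3).mul (continuous_rho_rpow _)).smul K.continuous
    refine (eLpNorm_add_le c1.aestronglyMeasurable c2.aestronglyMeasurable (by norm_num)).trans
      (add_le_add (eLpNorm_opK_deriv_le hτ i j m hfc h0 h1) ?_)
    refine le_trans (b := 2 * eLpNorm (fun x => rho x ^ (θ / 2) • K x) 2 volume) ?_ ?_
    · suffices hs : eLpNorm (fun x => (2 * θ * x m * rho x ^ (θ - 1)) • K x) 2 volume ≤
          ENNReal.ofReal 2 * eLpNorm (fun x => rho x ^ (θ / 2) • K x) 2 volume by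
        simpa using hs
      refine eLpNorm_le_mul_eLpNorm_of_ae_le_mul (Eventually.of_forall fun x => ?_) _
      have hr := rho_pos x
      rw [norm_smul, norm_smul, ← mul_assoc]
      refine mul_le_mul_of_nonneg_right ?_ (norm_nonneg _)
      rw [Real.norm_of_nonneg (Real.rpow_nonneg hr.le (θ / 2)), norm_mul, norm_mul,
        Real.norm_of_nonneg (mul_nonneg zero_le_two h0.le),
        Real.norm_of_nonneg (Real.rpow_nonneg hr.le (θ - 1))]
      have hx : ‖x m‖ ≤ rho x ^ (1 / 2 : ℝ) := by
        rw [← Real.sqrt_eq_rpow]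
        exact Real.abs_le_sqrt (coord_sq_le_rho x m)
      calc 2 * θ * ‖x m‖ * rho x ^ (θ - 1) ≤ 2 * 1 * rho x ^ (1 / 2 : ℝ) * rho x ^ (θ - 1) := by
            gcongr
        _ = 2 * rho x ^ (1 / 2 + (θ - 1)) := by rw [mul_one, mul_assoc, ← Real.rpow_add hr]
        _ ≤ 2 * rho x ^ (θ / 2) := by
            gcongr
            · exact one_le_rho x
            · linarith
    · gcongr
      exact eLpNorm_opK_le hτ i j hfc h0 h1
  refine (Finset.sum_le_sum fun m _ => hm m).trans ?_
  rw [Finset.sum_add_distrib, ← Finset.mul_sum, Finset.sum_add_distrib]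
  simp only [Finset.sum_const, Finset.card_univ, Fintype.card_fin, nsmul_eq_mul]
  set a := ∑ m, eLpNorm (fun x => rho x ^ θ • fderiv ℝ f x (bvec m)) 2 volume
  push_cast
  calc 10 ^ 6 * (a + 3 * b) + 3 * (2 * (120 * b)) = 10 ^ 6 * a + (3 * 10 ^ 6 + 720) * b := by ring
    _ ≤ 10 ^ 7 * a + 10 ^ 7 * b := by gcongr <;> norm_num
    _ = _ := by ring

/-- Duality: an estimate on `R_i R_j φ` gives an estimate on `⟨∑ R_i R_j G_{i,j}, φ⟩`. -/
lemma enorm_integral_rieszRieszSum_le {G : E3 → Tensor3} {q : E3 → ℝ} (h : IsRieszRieszSum G q)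
    (hG : AEStronglyMeasurable G volume) {φ : E3 → ℝ} (hφ : ContDiff ℝ ∞ φ)
    (hc : HasCompactSupport φ) {p p' B : ℝ≥0∞} [ENNReal.HolderTriple p p' 1] {a : ℝ}
    (hB : ∀ i j, eLpNorm (fun x => rho x ^ a * rieszRieszTest i j φ x) p' volume ≤ B) :
    ‖∫ x, q x * φ x‖ₑ ≤ 9 * (eLpNorm (fun x => rho x ^ (-a) • G x) p volume * B) := by
  let ψ : 𝓓((⊤ : Opens E3), ℝ) := ⟨φ, by exact_mod_cast hφ, hc, by simp⟩
  have h1 : ∫ x, q x * φ x = ∫ x, ∑ i, ∑ j, G x (i, j) * rieszRieszTest i j φ x := h ψ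
  have hGij : ∀ i j, AEStronglyMeasurable (fun x => rho x ^ (-a) • G x (i, j)) volume :=
    fun i j => (continuous_rho_rpow _).aestronglyMeasurable.smul
      ((EuclideanSpace.proj (i, j) : Tensor3 →L[ℝ] ℝ).continuous.comp_aestronglyMeasurable hG)
  have hR : ∀ i j, AEStronglyMeasurable (fun x => rho x ^ a * rieszRieszTest i j φ x) volume :=
    fun i j => (continuous_rho_rpow _).aestronglyMeasurable.mul
      (measurable_rieszRieszTest hφ hc i j).aestronglyMeasurable
  rw [h1]
  have hfin : ∀ i j, eLpNorm (fun x => G x (i, j) * rieszRieszTest i j φ x) 1 volume ≤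
      eLpNorm (fun x => rho x ^ (-a) • G x) p volume * B := fun i j => by
    -- The weights `ρ^{-a}` and `ρ^a` cancel, and Hölder's inequality separates the factors; the `9`
    -- in the statement counts the components of `G`.
    have e : (fun x => G x (i, j) * rieszRieszTest i j φ x) =
        (fun x => rho x ^ (-a) • G x (i, j)) • (fun x => rho x ^ a * rieszRieszTest i j φ x) := by
      ext x
      have : rho x ^ (-a) * rho x ^ a = 1 := by
        rw [← Real.rpow_add (rho_pos x)]; simp
      simp only [Pi.smul_apply', smul_eq_mul]
      linear_combination (-(G x (i, j) * rieszRieszTest i j φ x)) * this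
    rw [e]
    refine (eLpNorm_smul_le_mul_eLpNorm (p := p) (q := p') (hR i j) (hGij i j)).trans ?_
    refine mul_le_mul' (eLpNorm_mono fun x => ?_) (hB i j)
    rw [norm_smul, norm_smul]
    gcongr
    exact PiLp.norm_apply_le (G x) (i, j)
  have hm : ∀ i j, AEStronglyMeasurable (fun x => G x (i, j) * rieszRieszTest i j φ x) volume :=
    fun i j => ((EuclideanSpace.proj (i, j) : Tensor3 →L[ℝ] ℝ).continuous.comp_aestronglyMeasurable
      hG).mul (measurable_rieszRieszTest hφ hc i j).aestronglyMeasurable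
  calc _ ≤ eLpNorm (fun x => ∑ i, ∑ j, G x (i, j) * rieszRieszTest i j φ x) 1 volume := by
        rw [eLpNorm_one_eq_lintegral_enorm]
        exact enorm_integral_le_lintegral_enorm _
    _ = eLpNorm (∑ i, ∑ j, fun x => G x (i, j) * rieszRieszTest i j φ x) 1 volume := by
        congr 1
    _ ≤ ∑ i, ∑ j, eLpNorm (fun x => G x (i, j) * rieszRieszTest i j φ x) 1 volume := by
        refine (eLpNorm_sum_le (fun i _ => ?_) le_rfl).trans (Finset.sum_le_sum fun i _ =>
          eLpNorm_sum_le (fun j _ => hm i j) le_rfl)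
        exact Finset.aestronglyMeasurable_sum _ fun j _ => hm i j
    _ ≤ ∑ i : Fin 3, ∑ j : Fin 3, eLpNorm (fun x => rho x ^ (-a) • G x) p volume * B :=
        Finset.sum_le_sum fun i _ => Finset.sum_le_sum fun j _ => hfin i j
    _ = _ := by
        simp only [Finset.sum_const, Finset.card_univ, Fintype.card_fin, nsmul_eq_mul]
        rw [← mul_assoc]
        norm_num

/-! ### Mollification in `L²` -/

/-- Mollification. -/
noncomputable def moll (φ : ContDiffBump (0 : E3)) (v : E3 → ℝ) : E3 → ℝ :=
  convolution (φ.normed volume) v (ContinuousLinearMap.lsmul ℝ ℝ) volume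

lemma lintegral_sq_le_of_probability {α : Type*} [MeasurableSpace α] {ν : Measure α}
    [IsProbabilityMeasure ν] {f : α → ℝ} (hf : AEStronglyMeasurable f ν) :
    (∫⁻ x, ‖f x‖ₑ ∂ν) ^ 2 ≤ ∫⁻ x, ‖f x‖ₑ ^ 2 ∂ν := by
  rw [← eLpNorm_two_sq, ← eLpNorm_one_eq_lintegral_enorm]
  gcongr
  exact eLpNorm_le_eLpNorm_of_exponent_le (by norm_num) hf

/-- Jensen's inequality for the probability density of the mollifier, then Tonelli's theorem and the
invariance of volume under translations. -/
lemma eLpNorm_moll_le (φ : ContDiffBump (0 : E3)) {v : E3 → ℝ}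
    (hv : AEStronglyMeasurable v volume) : eLpNorm (moll φ v) 2 volume ≤ eLpNorm v 2 volume := by
  set η : E3 → ℝ≥0∞ := fun y => ENNReal.ofReal (φ.normed volume y) with hη
  have hηm : Measurable η := (φ.continuous_normed).measurable.ennreal_ofReal
  set ν : Measure E3 := volume.withDensity η
  have hη1 : ∫⁻ y, η y = 1 := by
    rw [hη, ← ofReal_integral_eq_lintegral_ofReal φ.integrable_normed
      (Eventually.of_forall fun _ => φ.nonneg_normed _), φ.integral_normed]
    simp
  have : IsProbabilityMeasure ν := ⟨by rw [withDensity_apply _ MeasurableSet.univ]; simpa using hη1⟩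
  have hq : AEStronglyMeasurable (fun z : E3 × E3 => v (z.1 - z.2)) (volume.prod volume) :=
    hv.comp_quasiMeasurePreserving (quasiMeasurePreserving_sub_of_right_invariant volume volume)
  have hx : ∀ x, AEStronglyMeasurable (fun y => v (x - y)) volume := fun x =>
    hv.comp_quasiMeasurePreserving (quasiMeasurePreserving_sub_left volume x)
  have key : ∀ x, ‖moll φ v x‖ₑ ^ 2 ≤ ∫⁻ y, η y * ‖v (x - y)‖ₑ ^ 2 := fun x => by
    have h1 : ‖moll φ v x‖ₑ ≤ ∫⁻ y, ‖v (x - y)‖ₑ ∂ν := by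
      rw [lintegral_withDensity_eq_lintegral_mul₀ hηm.aemeasurable (hx x).enorm]
      refine (enorm_integral_le_lintegral_enorm _).trans (lintegral_mono fun y => ?_)
      simp only [ContinuousLinearMap.lsmul_apply, smul_eq_mul, enorm_mul, Pi.mul_apply, hη]
      rw [Real.enorm_of_nonneg (φ.nonneg_normed y)]
    refine (pow_le_pow_left' h1 2).trans ((lintegral_sq_le_of_probability
      ((hx x).mono_ac (withDensity_absolutelyContinuous _ _))).trans_eq ?_)
    rw [lintegral_withDensity_eq_lintegral_mul₀ hηm.aemeasurable ((hx x).enorm.pow_const 2)]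
    rfl
  have h2 : eLpNorm (moll φ v) 2 volume ^ 2 ≤ eLpNorm v 2 volume ^ 2 := by
    rw [eLpNorm_two_sq, eLpNorm_two_sq]
    calc ∫⁻ x, ‖moll φ v x‖ₑ ^ 2 ≤ ∫⁻ x, ∫⁻ y, η y * ‖v (x - y)‖ₑ ^ 2 := lintegral_mono key
      _ = ∫⁻ y, ∫⁻ x, η y * ‖v (x - y)‖ₑ ^ 2 := by
          rw [lintegral_lintegral_swap]
          exact (hηm.comp measurable_snd).aemeasurable.mul (hq.enorm.pow_const 2)
      _ = ∫⁻ y, η y * ∫⁻ x, ‖v x‖ₑ ^ 2 := by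
          refine lintegral_congr fun y => ?_
          rw [lintegral_const_mul' _ _ ENNReal.ofReal_ne_top,
            lintegral_sub_right_eq_self (fun x => ‖v x‖ₑ ^ 2) y]
      _ = _ := by
          rw [lintegral_mul_const'' _ hηm.aemeasurable, hη1, one_mul]
  exact (ENNReal.pow_le_pow_left_iff (by norm_num)).1 h2

/-- The standard sequence of mollifiers. -/
noncomputable def bump (n : ℕ) : ContDiffBump (0 : E3) :=
  ⟨1 / (2 * (n + 1)), 1 / (n + 1), by positivity, by
    rw [div_lt_div_iff₀ (by positivity) (by positivity)]; linarith [(n.cast_nonneg : (0:ℝ) ≤ n)]⟩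

lemma bump_rOut (n : ℕ) : (bump n).rOut = 1 / (n + 1) := rfl

lemma moll_eq_integral (φ : ContDiffBump (0 : E3)) (v : E3 → ℝ) (x : E3) :
    moll φ v x = ∫ y, φ.normed volume (x - y) * v y := by
  rw [moll, convolution_eq_swap]
  simp

/-- A mollified value depends only on the function near the point; this is what permits the
localisation of the convergence to balls. -/
lemma moll_congr (φ : ContDiffBump (0 : E3)) {v w : E3 → ℝ} {x : E3}
    (h : ∀ y, ‖x - y‖ < φ.rOut → v y = w y) : moll φ v x = moll φ w x := by
  rw [moll_eq_integral, moll_eq_integral]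
  congr 1
  ext y
  by_cases hy : ‖x - y‖ < φ.rOut
  · rw [h y hy]
  · have : x - y ∉ Function.support (φ.normed volume) := by
      rw [φ.support_normed_eq, mem_ball_zero_iff]; exact hy
    rw [Function.notMem_support.1 this, zero_mul, zero_mul]

lemma moll_sub (φ : ContDiffBump (0 : E3)) {v w : E3 → ℝ} (hv : LocallyIntegrable v volume)
    (hw : LocallyIntegrable w volume) : moll φ (v - w) = moll φ v - moll φ w := by
  ext x
  have h := fun (u : E3 → ℝ) (hu : LocallyIntegrable u volume) =>
    (φ.hasCompactSupport_normed (μ := volume)).convolutionExists_left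
      (ContinuousLinearMap.lsmul ℝ ℝ) φ.continuous_normed hu x
  have h1 := (h v hv).integrable_swap
  have h2 := (h w hw).integrable_swap
  simp only [ContinuousLinearMap.lsmul_apply, smul_eq_mul] at h1 h2
  rw [Pi.sub_apply, moll_eq_integral, moll_eq_integral, moll_eq_integral, ← integral_sub h1 h2]
  congr 1; ext y; simp [mul_sub]

lemma contDiff_moll (φ : ContDiffBump (0 : E3)) {v : E3 → ℝ} (hv : LocallyIntegrable v volume) :
    ContDiff ℝ ∞ (moll φ v) :=
  (φ.hasCompactSupport_normed (μ := volume)).contDiff_convolution_left _ φ.contDiff_normed hv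

/-- Uniform continuity makes the difference uniformly small, and the differences all live in one
ball, of finite measure, since the mollifiers have radius at most `1`. -/
lemma tendsto_moll_of_continuous {g : E3 → ℝ} (hg : Continuous g) (hc : HasCompactSupport g) :
    Tendsto (fun n => eLpNorm (moll (bump n) g - g) 2 volume) atTop (𝓝 0) := by
  obtain ⟨R, hR⟩ := hc.isCompact.isBounded.subset_closedBall (0 : E3)
  have hg0 : ∀ y, R < ‖y‖ → g y = 0 := fun y hy => by
    by_contra h
    have := hR (subset_tsupport _ h)
    rw [mem_closedBall_zero_iff] at this
    linarith
  have hu := hc.uniformContinuous_of_continuous hg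
  set M : ℝ≥0∞ := volume (Metric.closedBall (0 : E3) (R + 1)) with hM
  have hMt : M ≠ ⊤ := measure_closedBall_lt_top.ne
  have hb : ∀ ε : ℝ, 0 < ε → ∀ᶠ n in atTop, eLpNorm (moll (bump n) g - g) 2 volume ≤
      M ^ (1 / 2 : ℝ) * ENNReal.ofReal ε := fun ε hε => by
    obtain ⟨δ, hδ, hd⟩ := Metric.uniformContinuous_iff.1 hu ε hε
    obtain ⟨N, hN⟩ := exists_nat_one_div_lt hδ
    filter_upwards [eventually_ge_atTop N] with n hn
    have hr1 : (bump n).rOut ≤ 1 := by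
      rw [bump_rOut, div_le_one (by positivity)]; linarith [(n.cast_nonneg : (0:ℝ) ≤ n)]
    have hrδ : (bump n).rOut < δ := by
      rw [bump_rOut]
      refine lt_of_le_of_lt ?_ hN
      gcongr
    have h0 : ∀ x, x ∉ Metric.closedBall (0 : E3) (R + 1) → (moll (bump n) g - g) x = 0 :=
      fun x hx => by
        rw [mem_closedBall_zero_iff, not_le] at hx
        have : moll (bump n) g x = moll (bump n) (fun _ => (0 : ℝ)) x :=
          moll_congr _ fun y hy => hg0 y (by
            have := norm_sub_norm_le x y
            linarith)
        rw [Pi.sub_apply, this, hg0 x (by linarith), moll_eq_integral]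
        simp
    have h1 : ∀ x, ‖(moll (bump n) g - g) x‖ ≤ ε := fun x => by
      rw [Pi.sub_apply, ← dist_eq_norm]
      exact ContDiffBump.dist_normed_convolution_le hg.aestronglyMeasurable fun y hy =>
        (hd (lt_trans (Metric.mem_ball.1 hy) hrδ)).le
    have e : eLpNorm (moll (bump n) g - g) 2 volume =
        eLpNorm (moll (bump n) g - g) 2 (volume.restrict (Metric.closedBall (0 : E3) (R + 1))) := by
      rw [← eLpNorm_indicator_eq_eLpNorm_restrict Metric.isClosed_closedBall.measurableSet]
      congr 1
      ext x
      by_cases hx : x ∈ Metric.closedBall (0 : E3) (R + 1)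
      · rw [indicator_of_mem hx]
      · rw [indicator_of_notMem hx, h0 x hx]
    rw [e]
    refine (eLpNorm_le_of_ae_bound (Eventually.of_forall h1)).trans_eq ?_
    simp [M]
  rw [ENNReal.tendsto_nhds_zero]
  intro ε hε
  obtain ⟨δ, hδ, hδε⟩ : ∃ δ : ℝ, 0 < δ ∧ M ^ (1 / 2 : ℝ) * ENNReal.ofReal δ ≤ ε := by
    have ht : Tendsto (fun δ : ℝ => M ^ (1 / 2 : ℝ) * ENNReal.ofReal δ) (𝓝[>] 0) (𝓝 0) := by
      have := (ENNReal.continuous_ofReal.tendsto (0 : ℝ)).mono_left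
        (nhdsWithin_le_nhds (s := Ioi 0))
      simpa using ENNReal.Tendsto.const_mul (a := M ^ (1 / 2 : ℝ)) this
        (Or.inr (ENNReal.rpow_ne_top_of_nonneg (by norm_num) hMt))
    have hs : ∀ᶠ δ : ℝ in 𝓝[>] 0, 0 < δ := self_mem_nhdsWithin
    exact (hs.and (ENNReal.tendsto_nhds_zero.1 ht ε hε)).exists
  filter_upwards [hb δ hδ] with n hn using hn.trans hδε

/-- Mollifications converge in `L²`. -/
lemma tendsto_moll {v : E3 → ℝ} (hv : MemLp v 2 volume) :
    Tendsto (fun n => eLpNorm (moll (bump n) v - v) 2 volume) atTop (𝓝 0) := by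
  rw [ENNReal.tendsto_nhds_zero]
  intro ε hε
  have h3 : ε / 3 ≠ 0 := (ENNReal.div_pos hε.ne' (by norm_num)).ne'
  -- Density of continuous compactly supported functions, and the contraction property of
  -- mollification, give three errors `ε / 3`.
  obtain ⟨g, hgc, hgv, hg, hgm⟩ := hv.exists_hasCompactSupport_eLpNorm_sub_le (by norm_num) h3
  have hvl : LocallyIntegrable v volume := hv.locallyIntegrable (by norm_num)
  filter_upwards [ENNReal.tendsto_nhds_zero.1 (tendsto_moll_of_continuous hg hgc) (ε / 3)
    (pos_iff_ne_zero.2 h3)] with n hn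
  have hcv := (contDiff_moll (bump n) hvl).continuous.aestronglyMeasurable (μ := volume)
  have hcg := (contDiff_moll (bump n) hg.locallyIntegrable).continuous.aestronglyMeasurable
    (μ := volume)
  have e : moll (bump n) v - v = (moll (bump n) (v - g) + (moll (bump n) g - g)) - (v - g) := by
    rw [moll_sub _ hvl hg.locallyIntegrable]; abel
  have hm := contDiff_moll (bump n) (hvl.sub hg.locallyIntegrable)
  rw [e]
  refine (eLpNorm_sub_le (hm.continuous.aestronglyMeasurable.add
    (hcg.sub hg.aestronglyMeasurable)) (hv.1.sub hgm.1) (by norm_num)).trans ?_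
  refine (add_le_add_left (eLpNorm_add_le hm.continuous.aestronglyMeasurable
    (hcg.sub hg.aestronglyMeasurable) (by norm_num)) _).trans ?_
  calc _ ≤ ε / 3 + ε / 3 + ε / 3 := by
        gcongr
        exact (eLpNorm_moll_le _ (hv.1.sub hgm.1)).trans hgv
    _ = ε := ENNReal.add_thirds ε

/-- Mollifications converge in `L²` of balls. -/
lemma tendsto_moll_ball {v : E3 → ℝ}
    (hv : ∀ R : ℝ, MemLp v 2 (volume.restrict (Metric.ball (0 : E3) R))) (R : ℝ) :
    Tendsto (fun n => eLpNorm (moll (bump n) v - v) 2 (volume.restrict (Metric.ball (0 : E3) R)))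
      atTop (𝓝 0) := by
  set B := Metric.ball (0 : E3) (R + 1)
  have hw : MemLp (B.indicator v) 2 volume :=
    (memLp_indicator_iff_restrict measurableSet_ball).2 (hv (R + 1))
  refine tendsto_of_tendsto_of_tendsto_of_le_of_le tendsto_const_nhds (tendsto_moll hw)
    (fun n => zero_le) fun n => ?_
  refine le_trans ?_ (eLpNorm_mono_measure _
    (Measure.restrict_le_self (s := Metric.ball (0 : E3) R)))
  refine (eLpNorm_congr_ae ?_).le
  filter_upwards [ae_restrict_mem measurableSet_ball] with x hx
  rw [mem_ball_zero_iff] at hx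
  -- On the ball of radius `R` only the values in the ball of radius `R + 1` matter, so the
  -- truncation is invisible.
  have h1 : moll (bump n) v x = moll (bump n) (B.indicator v) x := moll_congr _ fun y hy => by
    have hr1 : (bump n).rOut ≤ 1 := by
      rw [bump_rOut, div_le_one (by positivity)]; linarith [(n.cast_nonneg : (0:ℝ) ≤ n)]
    rw [indicator_of_mem]
    rw [mem_ball_zero_iff]
    have := norm_sub_norm_le y x
    rw [norm_sub_rev] at this
    linarith
  rw [Pi.sub_apply, Pi.sub_apply, h1, indicator_of_mem (s := B)]
  rw [mem_ball_zero_iff]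
  linarith

/-! ### Functions of class `H¹` with compact support and of class `H¹_loc` -/

/-- `f n` is a sequence of smooth functions, supported in a fixed ball, which converges to `v`
in `H¹`, the partial derivatives of `v` being `Dv k`. -/
structure H1Approx (R : ℝ) (f : ℕ → E3 → ℝ) (v : E3 → ℝ) (Dv : Fin 3 → E3 → ℝ) : Prop where
  memLp : MemLp v 2 volume
  memLp_deriv : ∀ k, MemLp (Dv k) 2 volume
  eq_zero : ∀ x, R < ‖x‖ → v x = 0
  deriv_eq_zero : ∀ k x, R < ‖x‖ → Dv k x = 0
  contDiff : ∀ n, ContDiff ℝ ∞ (f n)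
  approx_eq_zero : ∀ n x, R < ‖x‖ → f n x = 0
  tendsto : Tendsto (fun n => eLpNorm (f n - v) 2 volume) atTop (𝓝 0)
  tendsto_deriv : ∀ k, Tendsto (fun n =>
    eLpNorm ((fun x => fderiv ℝ (f n) x (bvec k)) - Dv k) 2 volume) atTop (𝓝 0)

/-- `v ∈ H¹(ℝ³)` with compact support, as a limit of test functions. -/
def H1c (v : E3 → ℝ) (Dv : Fin 3 → E3 → ℝ) : Prop := ∃ R f, H1Approx R f v Dv

/-- `v ∈ H¹_loc(ℝ³)`, as a limit of smooth functions. -/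
structure H1loc (v : E3 → ℝ) (Dv : Fin 3 → E3 → ℝ) : Prop where
  memLp : ∀ R : ℝ, MemLp v 2 (volume.restrict (Metric.ball (0 : E3) R))
  memLp_deriv : ∀ k, ∀ R : ℝ, MemLp (Dv k) 2 (volume.restrict (Metric.ball (0 : E3) R))
  exists_approx : ∃ f : ℕ → E3 → ℝ, (∀ n, ContDiff ℝ ∞ (f n)) ∧
    (∀ R : ℝ, Tendsto (fun n => eLpNorm (f n - v) 2 (volume.restrict (Metric.ball (0 : E3) R)))
      atTop (𝓝 0)) ∧
    ∀ k, ∀ R : ℝ, Tendsto (fun n => eLpNorm ((fun x => fderiv ℝ (f n) x (bvec k)) - Dv k) 2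
      (volume.restrict (Metric.ball (0 : E3) R))) atTop (𝓝 0)

lemma fderiv_eq_zero_of_outside {f : E3 → ℝ} {R : ℝ} (h : ∀ x, R < ‖x‖ → f x = 0) {x : E3}
    (hx : R < ‖x‖) : fderiv ℝ f x = 0 := by
  have : f =ᶠ[𝓝 x] fun _ => 0 := by
    filter_upwards [(isOpen_lt continuous_const continuous_norm).mem_nhds hx] with y hy using h y hy
  rw [this.fderiv_eq]
  simp

lemma hasCompactSupport_of_outside {f : E3 → ℝ} {R : ℝ} (h : ∀ x, R < ‖x‖ → f x = 0) :
    HasCompactSupport f :=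
  HasCompactSupport.intro (isCompact_closedBall (0 : E3) R) fun x hx => h x (by
    rwa [mem_closedBall_zero_iff, not_le] at hx)

lemma exists_outside_of_hasCompactSupport {f : E3 → ℝ} (h : HasCompactSupport f) :
    ∃ R : ℝ, ∀ x, R < ‖x‖ → f x = 0 := by
  obtain ⟨R, hR⟩ := h.isCompact.isBounded.subset_closedBall (0 : E3)
  refine ⟨R, fun y hy => ?_⟩
  by_contra h
  have := hR (subset_tsupport _ h)
  rw [mem_closedBall_zero_iff] at this
  linarith

lemma eLpNorm_mul_le_of_outside {g h : E3 → ℝ} {R C : ℝ} (hg : ∀ x, R < ‖x‖ → g x = 0)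
    (hC : ∀ x, ‖g x‖ ≤ C) (p : ℝ≥0∞) : eLpNorm (fun x => g x * h x) p volume ≤
      ENNReal.ofReal C * eLpNorm h p (volume.restrict (Metric.ball (0 : E3) (R + 1))) := by
  have e : (fun x => g x * h x) = (Metric.ball (0 : E3) (R + 1)).indicator fun x => g x * h x := by
    ext x
    by_cases hx : x ∈ Metric.ball (0 : E3) (R + 1)
    · rw [indicator_of_mem hx]
    · rw [indicator_of_notMem hx, hg x, zero_mul]
      rw [mem_ball_zero_iff] at hx
      linarith
  rw [e, eLpNorm_indicator_eq_eLpNorm_restrict measurableSet_ball]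
  refine eLpNorm_le_mul_eLpNorm_of_ae_le_mul (Eventually.of_forall fun x => ?_) _
  rw [norm_mul]
  exact mul_le_mul_of_nonneg_right (hC x) (norm_nonneg _)

lemma tendsto_zero_of_le_add {a b c : ℕ → ℝ≥0∞} (h : ∀ n, a n ≤ b n + c n)
    (hb : Tendsto b atTop (𝓝 0)) (hc : Tendsto c atTop (𝓝 0)) : Tendsto a atTop (𝓝 0) :=
  tendsto_of_tendsto_of_tendsto_of_le_of_le tendsto_const_nhds (by simpa using hb.add hc)
    (fun _ => zero_le) h

lemma memLp_mul_of_outside {g h : E3 → ℝ} {R C : ℝ} (hg : ∀ x, R < ‖x‖ → g x = 0)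
    (hC : ∀ x, ‖g x‖ ≤ C) (hgc : Continuous g) {p : ℝ≥0∞}
    (hh : ∀ R : ℝ, MemLp h p (volume.restrict (Metric.ball (0 : E3) R))) :
    MemLp (fun x => g x * h x) p volume := by
  refine ⟨?_, (eLpNorm_mul_le_of_outside hg hC p).trans_lt
    (ENNReal.mul_lt_top ENNReal.ofReal_lt_top (hh (R + 1)).2)⟩
  have hm : AEStronglyMeasurable h volume := by
    have : (volume : Measure E3) = volume.restrict (⋃ n : ℕ, Metric.ball (0 : E3) n) := by
      rw [Metric.iUnion_ball_nat, Measure.restrict_univ]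
    rw [this]
    exact (aestronglyMeasurable_iUnion_iff).2 fun n => (hh n).1
  exact hgc.aestronglyMeasurable.mul hm

/-- Localisation of a function of class `H¹_loc`. -/
lemma H1loc.mul {v : E3 → ℝ} {Dv : Fin 3 → E3 → ℝ} (hv : H1loc v Dv) {g : E3 → ℝ}
    (hg : ContDiff ℝ ∞ g) (hc : HasCompactSupport g) :
    H1c (fun x => g x * v x) (fun k x => g x * Dv k x + fderiv ℝ g x (bvec k) * v x) := by
  obtain ⟨f, hf, hf0, hf1⟩ := hv.exists_approx
  obtain ⟨R, hR⟩ := exists_outside_of_hasCompactSupport hc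
  obtain ⟨C, hC⟩ := hc.exists_bound_of_continuous hg.continuous
  have hgd : ∀ k, Continuous fun x => fderiv ℝ g x (bvec k) := fun k =>
    (hg.continuous_fderiv (by simp)).clm_apply continuous_const
  have hRd : ∀ k x, R < ‖x‖ → fderiv ℝ g x (bvec k) = 0 := fun k x hx => by
    rw [fderiv_eq_zero_of_outside hR hx]; rfl
  have hCd : ∀ k, ∃ C, ∀ x, ‖fderiv ℝ g x (bvec k)‖ ≤ C := fun k =>
    (hasCompactSupport_of_outside (hRd k)).exists_bound_of_continuous (hgd k)
  choose D hD using hCd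
  have hcf : ∀ n, Continuous (f n) := fun n => (hf n).continuous
  have hcd : ∀ n k, Continuous fun x => fderiv ℝ (f n) x (bvec k) := fun n k =>
    ((hf n).continuous_fderiv (by simp)).clm_apply continuous_const
  have hm0 := memLp_mul_of_outside hR hC hg.continuous hv.memLp
  have hm1 : ∀ k, MemLp (fun x => g x * Dv k x) 2 volume := fun k =>
    memLp_mul_of_outside hR hC hg.continuous (hv.memLp_deriv k)
  have hm2 : ∀ k, MemLp (fun x => fderiv ℝ g x (bvec k) * v x) 2 volume := fun k =>
    memLp_mul_of_outside (hRd k) (hD k) (hgd k) hv.memLp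
  have ht : ∀ (C : ℝ) (a : ℕ → ℝ≥0∞), Tendsto a atTop (𝓝 0) →
      Tendsto (fun n => ENNReal.ofReal C * a n) atTop (𝓝 0) := fun C a ha => by
    simpa using ENNReal.Tendsto.const_mul ha (Or.inr ENNReal.ofReal_ne_top)
  refine ⟨R, fun n x => g x * f n x, hm0, fun k => (hm1 k).add (hm2 k), fun x hx => ?_,
    fun k x hx => ?_, fun n => hg.mul (hf n), fun n x hx => ?_, ?_, fun k => ?_⟩
  · rw [hR x hx, zero_mul]
  · rw [hR x hx, hRd k x hx]; ring
  · rw [hR x hx, zero_mul]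
  · refine tendsto_of_tendsto_of_tendsto_of_le_of_le tendsto_const_nhds (ht C _ (hf0 (R + 1)))
      (fun _ => zero_le) fun n => ?_
    have e : ((fun x => g x * f n x) - fun x => g x * v x) = fun x => g x * (f n - v) x := by
      ext x; simp [mul_sub]
    rw [e]
    exact eLpNorm_mul_le_of_outside hR hC 2
  · refine tendsto_zero_of_le_add (fun n => ?_) (ht C _ (hf1 k (R + 1))) (ht (D k) _ (hf0 (R + 1)))
    have e : ((fun x => fderiv ℝ (fun x => g x * f n x) x (bvec k)) -
        fun x => g x * Dv k x + fderiv ℝ g x (bvec k) * v x) =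
        (fun x => g x * ((fun x => fderiv ℝ (f n) x (bvec k)) - Dv k) x) +
        fun x => fderiv ℝ g x (bvec k) * (f n - v) x := by
      ext x
      have h1 := (hg.differentiable (by simp) x)
      have h2 := ((hf n).differentiable (by simp) x)
      rw [Pi.sub_apply, Pi.add_apply, fderiv_fun_mul h1 h2]
      simp
      ring
    rw [e]
    have m1 : AEStronglyMeasurable
        (fun x => g x * ((fun x => fderiv ℝ (f n) x (bvec k)) - Dv k) x) volume := by
      have := ((hg.continuous.mul (hcd n k)).aestronglyMeasurable (μ := volume)).sub (hm1 k).1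
      refine this.congr (Eventually.of_forall fun x => ?_)
      simp [mul_sub]
    have m2 : AEStronglyMeasurable (fun x => fderiv ℝ g x (bvec k) * (f n - v) x) volume := by
      have := (((hgd k).mul (hcf n)).aestronglyMeasurable (μ := volume)).sub (hm2 k).1
      refine this.congr (Eventually.of_forall fun x => ?_)
      simp [mul_sub]
    refine (eLpNorm_add_le m1 m2 (by norm_num)).trans (add_le_add ?_ ?_)
    · exact eLpNorm_mul_le_of_outside hR hC 2
    · exact eLpNorm_mul_le_of_outside (hRd k) (hD k) 2

lemma H1Approx.continuous {R : ℝ} {f : ℕ → E3 → ℝ} {v : E3 → ℝ} {Dv : Fin 3 → E3 → ℝ}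
    (h : H1Approx R f v Dv) (n : ℕ) : Continuous (f n) := (h.contDiff n).continuous

lemma H1Approx.continuous_deriv {R : ℝ} {f : ℕ → E3 → ℝ} {v : E3 → ℝ} {Dv : Fin 3 → E3 → ℝ}
    (h : H1Approx R f v Dv) (n : ℕ) (k : Fin 3) : Continuous fun x => fderiv ℝ (f n) x (bvec k) :=
  ((h.contDiff n).continuous_fderiv (by simp)).clm_apply continuous_const

lemma H1Approx.add {R R' : ℝ} {f f' : ℕ → E3 → ℝ} {v v' : E3 → ℝ} {Dv Dv' : Fin 3 → E3 → ℝ}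
    (h : H1Approx R f v Dv) (h' : H1Approx R' f' v' Dv') :
    H1Approx (max R R') (fun n x => f n x + f' n x) (fun x => v x + v' x)
      (fun k x => Dv k x + Dv' k x) where
  memLp := h.memLp.add h'.memLp
  memLp_deriv k := (h.memLp_deriv k).add (h'.memLp_deriv k)
  eq_zero x hx := by
    rw [max_lt_iff] at hx
    rw [h.eq_zero x hx.1, h'.eq_zero x hx.2, add_zero]
  deriv_eq_zero k x hx := by
    rw [max_lt_iff] at hx
    rw [h.deriv_eq_zero k x hx.1, h'.deriv_eq_zero k x hx.2, add_zero]
  contDiff n := (h.contDiff n).add (h'.contDiff n)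
  approx_eq_zero n x hx := by
    rw [max_lt_iff] at hx
    rw [h.approx_eq_zero n x hx.1, h'.approx_eq_zero n x hx.2, add_zero]
  tendsto := by
    refine tendsto_zero_of_le_add (fun n => ?_) h.tendsto h'.tendsto
    have e : ((fun x => f n x + f' n x) - fun x => v x + v' x) = (f n - v) + (f' n - v') := by
      ext x; simp; ring
    rw [e]
    exact eLpNorm_add_le ((h.continuous n).aestronglyMeasurable.sub h.memLp.1)
      ((h'.continuous n).aestronglyMeasurable.sub h'.memLp.1) (by norm_num)
  tendsto_deriv k := by
    refine tendsto_zero_of_le_add (fun n => ?_) (h.tendsto_deriv k) (h'.tendsto_deriv k)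
    have e : ((fun x => fderiv ℝ (fun x => f n x + f' n x) x (bvec k)) -
        fun x => Dv k x + Dv' k x) = ((fun x => fderiv ℝ (f n) x (bvec k)) - Dv k) +
          ((fun x => fderiv ℝ (f' n) x (bvec k)) - Dv' k) := by
      ext x
      have h1 := ((h.contDiff n).differentiable (by simp) x)
      have h2 := ((h'.contDiff n).differentiable (by simp) x)
      rw [Pi.sub_apply, Pi.add_apply, fderiv_fun_add h1 h2]
      simp
      ring
    rw [e]
    exact eLpNorm_add_le ((h.continuous_deriv n k).aestronglyMeasurable.sub (h.memLp_deriv k).1)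
      ((h'.continuous_deriv n k).aestronglyMeasurable.sub (h'.memLp_deriv k).1) (by norm_num)

lemma H1c.add {v v' : E3 → ℝ} {Dv Dv' : Fin 3 → E3 → ℝ} (h : H1c v Dv) (h' : H1c v' Dv') :
    H1c (fun x => v x + v' x) (fun k x => Dv k x + Dv' k x) := by
  obtain ⟨R, f, hf⟩ := h
  obtain ⟨R', f', hf'⟩ := h'
  exact ⟨_, _, hf.add hf'⟩

lemma H1Approx.hasCompactSupport {R : ℝ} {f : ℕ → E3 → ℝ} {v : E3 → ℝ} {Dv : Fin 3 → E3 → ℝ}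
    (h : H1Approx R f v Dv) (n : ℕ) : HasCompactSupport (f n) :=
  hasCompactSupport_of_outside (h.approx_eq_zero n)

lemma H1Approx.tendsto_eLpNorm_deriv {R : ℝ} {f : ℕ → E3 → ℝ} {v : E3 → ℝ} {Dv : Fin 3 → E3 → ℝ}
    (h : H1Approx R f v Dv) (c : ℝ≥0∞) (hc : c ≠ ⊤) :
    Tendsto (fun n => c * ∑ k, (eLpNorm ((fun x => fderiv ℝ (f n) x (bvec k)) - Dv k) 2 volume +
      eLpNorm (Dv k) 2 volume)) atTop (𝓝 (c * ∑ k, eLpNorm (Dv k) 2 volume)) := by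
  refine ENNReal.Tendsto.const_mul ?_ (Or.inr hc)
  refine tendsto_finsetSum _ fun k _ => ?_
  simpa using (h.tendsto_deriv k).add_const (eLpNorm (Dv k) 2 volume)

lemma H1Approx.eLpNorm_deriv_le {R : ℝ} {f : ℕ → E3 → ℝ} {v : E3 → ℝ} {Dv : Fin 3 → E3 → ℝ}
    (h : H1Approx R f v Dv) (n : ℕ) (k : Fin 3) :
    eLpNorm (fun x => fderiv ℝ (f n) x (bvec k)) 2 volume ≤
      eLpNorm ((fun x => fderiv ℝ (f n) x (bvec k)) - Dv k) 2 volume +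
      eLpNorm (Dv k) 2 volume := by
  have := eLpNorm_add_le (p := 2) (((h.continuous_deriv n k).aestronglyMeasurable
    (μ := volume)).sub (h.memLp_deriv k).1) (h.memLp_deriv k).1 (by norm_num)
  simpa using this

/-- Convergence in `L²` gives an almost everywhere convergent subsequence, along which Fatou's lemma
applies to the `L⁶` norms. -/
lemma H1Approx.eLpNorm_six_le {R : ℝ} {f : ℕ → E3 → ℝ} {v : E3 → ℝ} {Dv : Fin 3 → E3 → ℝ}
    (h : H1Approx R f v Dv) :
    eLpNorm v 6 volume ≤ sobolevConst * ∑ k, eLpNorm (Dv k) 2 volume := by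
  have hm : TendstoInMeasure volume f atTop v := tendstoInMeasure_of_tendsto_eLpNorm (p := 2)
    (by norm_num) (fun n => (h.continuous n).aestronglyMeasurable) h.memLp.1 h.tendsto
  obtain ⟨ns, hns, hae⟩ := hm.exists_seq_tendsto_ae
  refine (Lp.eLpNorm_lim_le_liminf_eLpNorm
    (fun n => (h.continuous (ns n)).aestronglyMeasurable) v hae).trans ?_
  have ht := (h.tendsto_eLpNorm_deriv sobolevConst sobolevConst_ne_top).comp hns.tendsto_atTop
  rw [← ht.liminf_eq]
  refine liminf_le_liminf (Eventually.of_forall fun n => ?_)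
  refine (sobolev_compact ((h.contDiff (ns n)).of_le (by simp)) (h.hasCompactSupport _)).trans ?_
  exact mul_le_mul_right (Finset.sum_le_sum fun k _ => h.eLpNorm_deriv_le (ns n) k) _

/-- Sobolev's inequality in `H¹`. -/
lemma H1c.eLpNorm_six_le {v : E3 → ℝ} {Dv : Fin 3 → E3 → ℝ} (h : H1c v Dv) :
    eLpNorm v 6 volume ≤ sobolevConst * ∑ k, eLpNorm (Dv k) 2 volume :=
  let ⟨_, _, h⟩ := h; h.eLpNorm_six_le

lemma H1Approx.sub_apply {R : ℝ} {f : ℕ → E3 → ℝ} {v : E3 → ℝ} {Dv : Fin 3 → E3 → ℝ}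
    (h : H1Approx R f v Dv) (m : ℕ) : H1Approx R (fun n => f n - f m) (v - f m)
      (fun k => Dv k - fun x => fderiv ℝ (f m) x (bvec k)) where
  memLp := h.memLp.sub ((h.continuous m).memLp_of_hasCompactSupport (h.hasCompactSupport m))
  memLp_deriv k := (h.memLp_deriv k).sub ((h.continuous_deriv m k).memLp_of_hasCompactSupport
    (hasCompactSupport_of_outside (R := R) fun x hx => by
      rw [fderiv_eq_zero_of_outside (h.approx_eq_zero m) hx]; rfl))
  eq_zero x hx := by simp [h.eq_zero x hx, h.approx_eq_zero m x hx]
  deriv_eq_zero k x hx := by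
    simp [h.deriv_eq_zero k x hx, fderiv_eq_zero_of_outside (h.approx_eq_zero m) hx]
  contDiff n := (h.contDiff n).sub (h.contDiff m)
  approx_eq_zero n x hx := by simp [h.approx_eq_zero n x hx, h.approx_eq_zero m x hx]
  tendsto := by simpa using h.tendsto
  tendsto_deriv k := by
    refine (h.tendsto_deriv k).congr fun n => ?_
    congr 1
    ext x
    have h1 := ((h.contDiff n).differentiable (by simp) x)
    have h2 := ((h.contDiff m).differentiable (by simp) x)
    simp [fderiv_sub h1 h2]

/-- Sobolev's inequality for `v - f n`, which is itself a limit of test functions supported in the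
same ball. -/
lemma H1Approx.tendsto_six {R : ℝ} {f : ℕ → E3 → ℝ} {v : E3 → ℝ} {Dv : Fin 3 → E3 → ℝ}
    (h : H1Approx R f v Dv) : Tendsto (fun n => eLpNorm (v - f n) 6 volume) atTop (𝓝 0) := by
  have ht : Tendsto (fun n => sobolevConst *
      ∑ k, eLpNorm ((fun x => fderiv ℝ (f n) x (bvec k)) - Dv k) 2 volume) atTop (𝓝 0) := by
    have := ENNReal.Tendsto.const_mul (tendsto_finsetSum Finset.univ fun k _ => h.tendsto_deriv k)
      (Or.inr sobolevConst_ne_top)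
    simpa using this
  refine tendsto_of_tendsto_of_tendsto_of_le_of_le tendsto_const_nhds ht (fun _ => zero_le)
    fun n => ?_
  refine (h.sub_apply n).eLpNorm_six_le.trans_eq ?_
  simp_rw [eLpNorm_sub_comm (Dv _)]

lemma continuous_hardyWeight {τ : ℝ} (hτ : 0 < τ) :
    Continuous fun x : E3 => (Real.sqrt (‖x‖ ^ 2 + τ))⁻¹ :=
  Continuous.inv₀ (by fun_prop) fun x => (Real.sqrt_pos.2 (by positivity)).ne'

lemma eLpNorm_hardy_smooth {f : E3 → ℝ} (hf : ContDiff ℝ ∞ f) (hc : HasCompactSupport f) {τ : ℝ}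
    (hτ : 0 < τ) : eLpNorm (fun x => (Real.sqrt (‖x‖ ^ 2 + τ))⁻¹ * f x) 2 volume ≤
      2 * ∑ k, eLpNorm (fun x => fderiv ℝ f x (bvec k)) 2 volume := by
  have hcd : ∀ k, Continuous fun x => fderiv ℝ f x (bvec k) := fun k =>
    (hf.continuous_fderiv (by simp)).clm_apply continuous_const
  have hcs : ∀ k, HasCompactSupport fun x => fderiv ℝ f x (bvec k) := fun k => by
    obtain ⟨R, hR⟩ := exists_outside_of_hasCompactSupport hc
    exact hasCompactSupport_of_outside (R := R) fun x hx => by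
      rw [fderiv_eq_zero_of_outside hR hx]; rfl
  have hi0 : Integrable (fun x => ‖f x‖ ^ 2) :=
    (memLp_two_iff_integrable_sq_norm hf.continuous.aestronglyMeasurable).1
      (hf.continuous.memLp_of_hasCompactSupport hc)
  have hi1 : ∀ k, Integrable (fun x => ‖fderiv ℝ f x (bvec k)‖ ^ 2) := fun k =>
    (memLp_two_iff_integrable_sq_norm (hcd k).aestronglyMeasurable).1
      ((hcd k).memLp_of_hasCompactSupport (hcs k))
  have h := hardy_inequality (hf.of_le (by simp)) hi0 hi1 hτ
  have hsq : eLpNorm (fun x => (Real.sqrt (‖x‖ ^ 2 + τ))⁻¹ * f x) 2 volume ^ 2 ≤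
      (2 * ∑ k, eLpNorm (fun x => fderiv ℝ f x (bvec k)) 2 volume) ^ 2 := by
    have e1 : eLpNorm (fun x => (Real.sqrt (‖x‖ ^ 2 + τ))⁻¹ * f x) 2 volume ^ 2 =
        ENNReal.ofReal (∫ x, ‖f x‖ ^ 2 / (‖x‖ ^ 2 + τ)) := by
      rw [eLpNorm_two_sq, ofReal_integral_eq_lintegral_ofReal]
      · refine lintegral_congr fun x => ?_
        have : 0 < ‖x‖ ^ 2 + τ := by positivity
        rw [← ofReal_norm, ← ENNReal.ofReal_pow (norm_nonneg _), norm_mul, mul_pow, norm_inv,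
          Real.norm_of_nonneg (Real.sqrt_nonneg _), inv_pow, Real.sq_sqrt this.le]
        congr 1
        field_simp
      · refine (hi0.mul_const τ⁻¹).mono' ?_ (Eventually.of_forall fun x => ?_)
        · exact Continuous.aestronglyMeasurable (Continuous.div (hf.continuous.norm.pow 2)
            (by fun_prop) fun x => by positivity)
        · rw [Real.norm_of_nonneg (by positivity), div_eq_mul_inv]
          gcongr
          nlinarith [sq_nonneg ‖x‖]
      · exact Eventually.of_forall fun x => by simp only [Pi.zero_apply]; positivity
    have e2 : ∀ k, ENNReal.ofReal (∫ x, ‖fderiv ℝ f x (bvec k)‖ ^ 2) =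
        eLpNorm (fun x => fderiv ℝ f x (bvec k)) 2 volume ^ 2 := fun k => by
      rw [eLpNorm_two_sq, ofReal_integral_eq_lintegral_ofReal (hi1 k)
        (Eventually.of_forall fun x => by simp only [Pi.zero_apply]; positivity)]
      refine lintegral_congr fun x => ?_
      rw [← ofReal_norm, ← ENNReal.ofReal_pow (norm_nonneg _)]
    rw [e1]
    refine (ENNReal.ofReal_le_ofReal h).trans ?_
    rw [ENNReal.ofReal_mul (by norm_num), ENNReal.ofReal_sum_of_nonneg
      (fun k _ => integral_nonneg fun x => by positivity)]
    simp_rw [e2]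
    rw [mul_pow]
    refine mul_le_mul' (by norm_num) ?_
    exact Finset.sum_sq_le_sq_sum_of_nonneg (fun _ _ => zero_le)
  exact (ENNReal.pow_le_pow_left_iff (by norm_num)).1 hsq

/-- For fixed `τ > 0` the weight is bounded by `τ^{-1/2}`, so convergence in `L²` is enough to pass
to the limit; `τ` is sent to `0` afterwards. -/
lemma H1Approx.eLpNorm_hardy_le {R : ℝ} {f : ℕ → E3 → ℝ} {v : E3 → ℝ} {Dv : Fin 3 → E3 → ℝ}
    (h : H1Approx R f v Dv) {τ : ℝ} (hτ : 0 < τ) :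
    eLpNorm (fun x => (Real.sqrt (‖x‖ ^ 2 + τ))⁻¹ * v x) 2 volume ≤
      2 * ∑ k, eLpNorm (Dv k) 2 volume := by
  have hw := continuous_hardyWeight hτ
  have hC : ∀ x : E3, ‖(Real.sqrt (‖x‖ ^ 2 + τ))⁻¹‖ ≤ (Real.sqrt τ)⁻¹ := fun x => by
    rw [Real.norm_of_nonneg (by positivity)]
    exact inv_anti₀ (Real.sqrt_pos.2 hτ) (Real.sqrt_le_sqrt (by nlinarith [sq_nonneg ‖x‖]))
  have hle : ∀ n, eLpNorm (fun x => (Real.sqrt (‖x‖ ^ 2 + τ))⁻¹ * v x) 2 volume ≤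
      ENNReal.ofReal (Real.sqrt τ)⁻¹ * eLpNorm (f n - v) 2 volume +
      2 * ∑ k, (eLpNorm ((fun x => fderiv ℝ (f n) x (bvec k)) - Dv k) 2 volume +
      eLpNorm (Dv k) 2 volume) := fun n => by
    have e : (fun x => (Real.sqrt (‖x‖ ^ 2 + τ))⁻¹ * v x) =
        (fun x => (Real.sqrt (‖x‖ ^ 2 + τ))⁻¹ * (v - f n) x) +
          fun x => (Real.sqrt (‖x‖ ^ 2 + τ))⁻¹ * f n x := by
      ext x; simp; ring
    rw [e]
    refine (eLpNorm_add_le (hw.aestronglyMeasurable.mul (h.memLp.1.sub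
      (h.continuous n).aestronglyMeasurable))
      (hw.mul (h.continuous n)).aestronglyMeasurable (by norm_num)).trans (add_le_add ?_ ?_)
    · rw [eLpNorm_sub_comm (f n)]
      refine eLpNorm_le_mul_eLpNorm_of_ae_le_mul (Eventually.of_forall fun x => ?_) _
      rw [Pi.mul_apply, norm_mul]
      exact mul_le_mul_of_nonneg_right (hC x) (norm_nonneg _)
    · refine (eLpNorm_hardy_smooth (h.contDiff n) (h.hasCompactSupport n) hτ).trans ?_
      exact mul_le_mul_right (Finset.sum_le_sum fun k _ => h.eLpNorm_deriv_le n k) _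
  have ht := (ENNReal.Tendsto.const_mul (a := ENNReal.ofReal (Real.sqrt τ)⁻¹) h.tendsto
    (Or.inr ENNReal.ofReal_ne_top)).add (h.tendsto_eLpNorm_deriv 2 (by norm_num))
  rw [mul_zero, zero_add] at ht
  exact ge_of_tendsto' ht hle

/-- Hardy's inequality in `H¹`. -/
lemma H1c.eLpNorm_hardy_le {v : E3 → ℝ} {Dv : Fin 3 → E3 → ℝ} (h : H1c v Dv) :
    eLpNorm (fun x => ‖x‖⁻¹ * v x) 2 volume ≤ 2 * ∑ k, eLpNorm (Dv k) 2 volume := by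
  obtain ⟨R, f, h⟩ := h
  have hτ : ∀ n : ℕ, (0 : ℝ) < 1 / (n + 1) := fun n => by positivity
  -- Fatou's lemma as `τ = 1/(n+1) → 0`; the pointwise limit fails at most at the origin, a null
  -- set.
  refine (Lp.eLpNorm_lim_le_liminf_eLpNorm (f := fun (n : ℕ) x =>
    (Real.sqrt (‖x‖ ^ 2 + 1 / ((n : ℝ) + 1)))⁻¹ * v x)
    (fun n => (continuous_hardyWeight (hτ n)).aestronglyMeasurable.mul h.memLp.1) _ ?_).trans ?_
  · have h0 : ∀ᵐ x : E3, x ≠ 0 := by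
      rw [ae_iff]; simp
    filter_upwards [h0] with x hx
    have hx' : 0 < ‖x‖ := norm_pos_iff.2 hx
    refine Tendsto.mul_const _ (Tendsto.inv₀ ?_ hx'.ne')
    have := (tendsto_one_div_add_atTop_nhds_zero_nat (𝕜 := ℝ)).const_add (‖x‖ ^ 2)
    have := (Real.continuous_sqrt.tendsto _).comp this
    rwa [add_zero, Real.sqrt_sq hx'.le] at this
  · refine (liminf_le_liminf (v := fun _ => 2 * ∑ k, eLpNorm (Dv k) 2 volume)
      (Eventually.of_forall fun n => h.eLpNorm_hardy_le (hτ n))).trans_eq ?_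
    simp

/-- Hölder's inequality. -/
lemma enorm_integral_mul_le {α : Type*} [MeasurableSpace α] {μ : Measure α} {f g : α → ℝ}
    {p q : ℝ≥0∞} [ENNReal.HolderTriple p q 1] (hf : AEStronglyMeasurable f μ)
    (hg : AEStronglyMeasurable g μ) :
    ‖∫ x, f x * g x ∂μ‖ₑ ≤ eLpNorm f p μ * eLpNorm g q μ := by
  refine (enorm_integral_le_lintegral_enorm _).trans ?_
  have h := eLpNorm_smul_le_mul_eLpNorm (p := p) (q := q) (r := 1) hg hf
  rw [eLpNorm_one_eq_lintegral_enorm] at h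
  simpa using h

instance holderTriple_six_fifths : ENNReal.HolderTriple (6 / 5) 6 1 := ⟨by
  rw [inv_one, ENNReal.inv_div (by norm_num) (by norm_num)]
  rw [← ENNReal.toReal_eq_toReal_iff' (by simp [ENNReal.div_eq_top]) (by norm_num)]
  rw [ENNReal.toReal_add (by simp [ENNReal.div_eq_top]) (by simp)]
  simp
  norm_num⟩

/-- Both functions vanish outside the ball of radius `R`, where the weight is at most `(1 + R²)^a`;
hence plain `L²` convergence implies weighted convergence. -/
lemma H1Approx.eLpNorm_rho_le {R : ℝ} {g w : E3 → ℝ} (hg : Continuous g)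
    (hw : AEStronglyMeasurable w volume) (hg0 : ∀ x, R < ‖x‖ → g x = 0)
    (hw0 : ∀ x, R < ‖x‖ → w x = 0) {a : ℝ} (ha : 0 ≤ a) :
    eLpNorm (fun x => rho x ^ a * g x) 2 volume ≤
      ENNReal.ofReal ((1 + R ^ 2) ^ a) * eLpNorm (g - w) 2 volume +
        eLpNorm (fun x => rho x ^ a * w x) 2 volume := by
  have e : (fun x => rho x ^ a * g x) =
      (fun x => rho x ^ a * (g - w) x) + fun x => rho x ^ a * w x := by
    ext x; simp; ring
  have hr := (continuous_rho_rpow a).aestronglyMeasurable (μ := volume)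
  rw [e]
  refine (eLpNorm_add_le (hr.mul (hg.aestronglyMeasurable.sub hw)) (hr.mul hw)
    (by norm_num)).trans (add_le_add ?_ le_rfl)
  refine eLpNorm_le_mul_eLpNorm_of_ae_le_mul (Eventually.of_forall fun x => ?_) _
  rw [Pi.mul_apply, norm_mul]
  by_cases hx : R < ‖x‖
  · simp [hg0 x hx, hw0 x hx]
  · refine mul_le_mul_of_nonneg_right ?_ (norm_nonneg _)
    rw [Real.norm_of_nonneg (Real.rpow_nonneg (rho_pos x).le _)]
    refine Real.rpow_le_rpow (rho_pos x).le ?_ ha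
    unfold rho
    nlinarith [norm_nonneg x]

/-- Extension to `H¹` of an estimate of a functional on test functions. -/
lemma H1c.enorm_integral_le {v : E3 → ℝ} {Dv : Fin 3 → E3 → ℝ} (h : H1c v Dv) {q : E3 → ℝ}
    (hq : ∀ R : ℝ, MemLp q (6 / 5) (volume.restrict (Metric.ball (0 : E3) R))) {a a' : ℝ}
    (ha : 0 ≤ a) (ha' : 0 ≤ a') {K K' : ℝ≥0∞} (hK : K ≠ ⊤) (hK' : K' ≠ ⊤)
    (hφ : ∀ φ : E3 → ℝ, ContDiff ℝ ∞ φ → HasCompactSupport φ → ‖∫ x, q x * φ x‖ₑ ≤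
      K * ∑ m, eLpNorm (fun x => rho x ^ a * fderiv ℝ φ x (bvec m)) 2 volume +
        K' * eLpNorm (fun x => rho x ^ a' * φ x) 2 volume) :
    ‖∫ x, q x * v x‖ₑ ≤ K * ∑ m, eLpNorm (fun x => rho x ^ a * Dv m x) 2 volume +
        K' * eLpNorm (fun x => rho x ^ a' * v x) 2 volume := by
  obtain ⟨R, f, h⟩ := h
  set B := Metric.ball (0 : E3) (R + 1)
  -- `q` is only locally in `L^{6/5}`. It may be truncated to a slightly larger ball, as everything
  -- tested against it vanishes for `|x| > R`.
  have hqB : MemLp (B.indicator q) (6 / 5) volume :=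
    (memLp_indicator_iff_restrict measurableSet_ball).2 (hq (R + 1))
  have hB : ∀ g : E3 → ℝ, (∀ x, R < ‖x‖ → g x = 0) →
      (fun x => q x * g x) = fun x => B.indicator q x * g x := fun g hg => by
    ext x
    by_cases hx : x ∈ B
    · rw [indicator_of_mem hx]
    · rw [hg x, mul_zero, mul_zero]
      rw [mem_ball_zero_iff] at hx
      linarith
  have hf6 : ∀ n, MemLp (f n) 6 volume := fun n =>
    (h.continuous n).memLp_of_hasCompactSupport (h.hasCompactSupport n)
  have hv6 : MemLp v 6 volume := ⟨h.memLp.1, h.eLpNorm_six_le.trans_lt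
    (ENNReal.mul_lt_top sobolevConst_ne_top.lt_top (ENNReal.sum_lt_top.2 fun k _ =>
      (h.memLp_deriv k).2))⟩
  have hint : ∀ g : E3 → ℝ, MemLp g 6 volume → Integrable fun x => B.indicator q x * g x :=
    fun g hg => memLp_one_iff_integrable.1 (hg.mul hqB)
  have hd : ∀ n, ‖∫ x, q x * v x‖ₑ ≤
      eLpNorm (B.indicator q) (6 / 5) volume * eLpNorm (v - f n) 6 volume +
      (K * ∑ m, (ENNReal.ofReal ((1 + R ^ 2) ^ a) *
          eLpNorm ((fun x => fderiv ℝ (f n) x (bvec m)) - Dv m) 2 volume +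
          eLpNorm (fun x => rho x ^ a * Dv m x) 2 volume) +
        K' * (ENNReal.ofReal ((1 + R ^ 2) ^ a') * eLpNorm (f n - v) 2 volume +
          eLpNorm (fun x => rho x ^ a' * v x) 2 volume)) := fun n => by
    -- The error `v - f n` is paired with `q` by Hölder's inequality with exponents `6/5` and `6`,
    -- and tends to `0` in `L⁶` by Sobolev's inequality.
    have e : ∫ x, q x * v x = (∫ x, B.indicator q x * (v - f n) x) + ∫ x, q x * f n x := by
      rw [hB v h.eq_zero, hB (f n) (h.approx_eq_zero n), ← integral_add (hint _ (hv6.sub (hf6 n)))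
        (hint _ (hf6 n))]
      congr 1; ext x; simp; ring
    rw [e]
    refine (enorm_add_le _ _).trans (add_le_add ?_ ?_)
    · exact enorm_integral_mul_le hqB.1 (hv6.sub (hf6 n)).1
    · refine (hφ (f n) (h.contDiff n) (h.hasCompactSupport n)).trans (add_le_add ?_ ?_)
      · refine mul_le_mul_right (Finset.sum_le_sum fun m _ => ?_) _
        exact H1Approx.eLpNorm_rho_le (h.continuous_deriv n m) (h.memLp_deriv m).1
          (fun x hx => by rw [fderiv_eq_zero_of_outside (h.approx_eq_zero n) hx]; rfl)
          (h.deriv_eq_zero m) ha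
      · exact mul_le_mul_right (H1Approx.eLpNorm_rho_le (h.continuous n) h.memLp.1
          (h.approx_eq_zero n) h.eq_zero ha') _
  have t1 := ENNReal.Tendsto.const_mul (a := eLpNorm (B.indicator q) (6 / 5) volume)
    h.tendsto_six (Or.inr hqB.2.ne)
  have t2 := ENNReal.Tendsto.const_mul (a := K) (tendsto_finsetSum Finset.univ fun m _ =>
    (ENNReal.Tendsto.const_mul (a := ENNReal.ofReal ((1 + R ^ 2) ^ a)) (h.tendsto_deriv m)
      (Or.inr ENNReal.ofReal_ne_top)).add_const (eLpNorm (fun x => rho x ^ a * Dv m x) 2 volume))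
      (Or.inr hK)
  have t3 := ENNReal.Tendsto.const_mul (a := K')
    ((ENNReal.Tendsto.const_mul (a := ENNReal.ofReal ((1 + R ^ 2) ^ a')) h.tendsto
      (Or.inr ENNReal.ofReal_ne_top)).add_const (eLpNorm (fun x => rho x ^ a' * v x) 2 volume))
      (Or.inr hK')
  have ht := t1.add (t2.add t3)
  simp only [mul_zero, zero_add] at ht
  exact ge_of_tendsto' ht hd

/-! ### Weights and mixed norms -/

lemma one_add_norm_pos (x : E3) : 0 < 1 + ‖x‖ := by positivity

lemma weight_eq (δ : ℝ) (x : E3) : weight δ x = (1 + ‖x‖) ^ (-δ) := by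
  rw [weight, Real.rpow_neg (one_add_norm_pos x).le, one_div]

lemma weight_pos (δ : ℝ) (x : E3) : 0 < weight δ x := by
  rw [weight_eq]; exact Real.rpow_pos_of_pos (one_add_norm_pos x) _

lemma weight_mul (a b : ℝ) (x : E3) : weight a x * weight b x = weight (a + b) x := by
  rw [weight_eq, weight_eq, weight_eq, ← Real.rpow_add (one_add_norm_pos x), neg_add]

lemma weight_rpow (a r : ℝ) (x : E3) : weight a x ^ r = weight (a * r) x := by
  rw [weight_eq, weight_eq, ← Real.rpow_mul (one_add_norm_pos x).le, neg_mul]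

lemma weight_anti {a b : ℝ} (h : a ≤ b) (x : E3) : weight b x ≤ weight a x := by
  rw [weight_eq, weight_eq]
  exact Real.rpow_le_rpow_of_exponent_le (by linarith [norm_nonneg x]) (by linarith)

lemma continuous_weight (a : ℝ) : Continuous (weight a) := by
  have : weight a = fun x => (1 + ‖x‖) ^ (-a) := funext (weight_eq a)
  rw [this]
  exact Continuous.rpow_const (by fun_prop) fun x => Or.inl (one_add_norm_pos x).ne'

lemma measurable_ofReal_weight (a : ℝ) : Measurable fun x => ENNReal.ofReal (weight a x) :=
  (continuous_weight a).measurable.ennreal_ofReal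

lemma volume_ac_weightMeasure (a : ℝ) : (volume : Measure E3) ≪ weightMeasure a :=
  withDensity_absolutelyContinuous' (measurable_ofReal_weight a).aemeasurable
    (Eventually.of_forall fun x => (ENNReal.ofReal_pos.2 (weight_pos a x)).ne')

lemma weightMeasure_ac_volume (a : ℝ) : weightMeasure a ≪ (volume : Measure E3) :=
  withDensity_absolutelyContinuous _ _

lemma lintegral_weightMeasure (a : ℝ) (f : E3 → ℝ≥0∞) :
    ∫⁻ x, f x ∂(weightMeasure a) = ∫⁻ x, ENNReal.ofReal (weight a x) * f x := by
  rw [weightMeasure, lintegral_withDensity_eq_lintegral_mul_non_measurable _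
    (measurable_ofReal_weight a) (Eventually.of_forall fun _ => ENNReal.ofReal_lt_top)]
  rfl

/-- A weighted norm as an unweighted one. -/
lemma wNorm_eq {V : Type*} [NormedAddCommGroup V] [NormedSpace ℝ V] {p : ℝ≥0∞} (hp0 : p ≠ 0)
    (hp : p ≠ ⊤) {δ a : ℝ} (ha : a * p.toReal = δ) (f : E3 → V) :
    wNorm p δ f = eLpNorm (fun x => weight a x • f x) p volume := by
  rw [wNorm, eLpNorm_eq_lintegral_rpow_enorm_toReal hp0 hp,
    eLpNorm_eq_lintegral_rpow_enorm_toReal hp0 hp, lintegral_weightMeasure]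
  congr 1
  refine lintegral_congr fun x => ?_
  rw [enorm_smul, ENNReal.mul_rpow_of_nonneg _ _ ENNReal.toReal_nonneg,
    Real.enorm_of_nonneg (weight_pos a x).le, ENNReal.ofReal_rpow_of_pos (weight_pos a x),
    weight_rpow, ha]

lemma restrict_strip (T : ℝ) : (volume.restrict (strip T : Set (ℝ × E3))) =
    (volume.restrict (Ioo 0 T)).prod (volume : Measure E3) := by
  have := Measure.prod_restrict (μ := (volume : Measure ℝ)) (ν := (volume : Measure E3))
    (Ioo 0 T) univ
  rw [Measure.restrict_univ] at this
  rw [this]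
  rfl

section MemMixed

variable {V : Type*} [NormedAddCommGroup V] {q p : ℝ≥0∞} {T δ : ℝ} {f : ℝ → E3 → V}

lemma MemMixed.aestronglyMeasurable (h : MemMixed q T p δ f) :
    AEStronglyMeasurable (fun z : ℝ × E3 => f z.1 z.2)
      ((volume.restrict (Ioo 0 T)).prod (volume : Measure E3)) := by
  rw [← restrict_strip]
  exact h.1

lemma MemMixed.ae_slice (h : MemMixed q T p δ f) :
    ∀ᵐ t ∂(volume.restrict (Ioo 0 T)), AEStronglyMeasurable (f t) volume :=
  h.aestronglyMeasurable.prodMk_left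

lemma aemeasurable_wNorm (hf : AEStronglyMeasurable (fun z : ℝ × E3 => f z.1 z.2)
    ((volume.restrict (Ioo 0 T)).prod (volume : Measure E3))) (hp0 : p ≠ 0) (hp : p ≠ ⊤) :
    AEMeasurable (fun t => wNorm p δ (f t)) (volume.restrict (Ioo 0 T)) := by
  have e : (fun t => wNorm p δ (f t)) = fun t =>
      (∫⁻ x, ENNReal.ofReal (weight δ x) * ‖f t x‖ₑ ^ p.toReal) ^ (1 / p.toReal) := by
    ext t
    rw [wNorm, eLpNorm_eq_lintegral_rpow_enorm_toReal hp0 hp, lintegral_weightMeasure]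
  rw [e]
  refine AEMeasurable.pow_const (AEMeasurable.lintegral_prod_right' (f := fun z : ℝ × E3 =>
    ENNReal.ofReal (weight δ z.2) * ‖f z.1 z.2‖ₑ ^ p.toReal) ?_) _
  exact ((measurable_ofReal_weight δ).comp measurable_snd).aemeasurable.mul
    (hf.enorm.pow_const _)

lemma MemMixed.aemeasurable (h : MemMixed q T p δ f) (hp0 : p ≠ 0) (hp : p ≠ ⊤) :
    AEMeasurable (fun t => wNorm p δ (f t)) (volume.restrict (Ioo 0 T)) :=
  aemeasurable_wNorm h.aestronglyMeasurable hp0 hp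

lemma MemMixed.ae_lt_top (h : MemMixed q T p δ f) (hq0 : q ≠ 0) (hp0 : p ≠ 0) (hp : p ≠ ⊤) :
    ∀ᵐ t ∂(volume.restrict (Ioo 0 T)), wNorm p δ (f t) < ⊤ := by
  have h2 := h.2
  unfold mixedNorm at h2
  by_cases hq : q = ⊤
  · subst hq
    rw [eLpNorm_exponent_top] at h2
    filter_upwards [ae_le_eLpNormEssSup (f := fun t => wNorm p δ (f t))
      (μ := volume.restrict (Ioo 0 T))] with t ht
    exact lt_of_le_of_lt ht h2
  · rw [eLpNorm_eq_lintegral_rpow_enorm_toReal hq0 hq] at h2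
    have hq' : 0 < q.toReal := ENNReal.toReal_pos hq0 hq
    have h3 : ∫⁻ t in Ioo 0 T, wNorm p δ (f t) ^ q.toReal < ⊤ := by
      by_contra hc
      rw [not_lt, top_le_iff] at hc
      simp only [enorm_eq_self] at h2
      rw [hc, ENNReal.top_rpow_of_pos (by positivity)] at h2
      exact lt_irrefl _ h2
    filter_upwards [ae_lt_top' ((h.aemeasurable hp0 hp).pow_const _) h3.ne] with t ht
    by_contra hc
    rw [not_lt, top_le_iff] at hc
    rw [hc, ENNReal.top_rpow_of_pos hq'] at ht
    exact lt_irrefl _ ht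

lemma MemMixed.lintegral_pow (hq0 : q ≠ 0) (hq : q ≠ ⊤) :
    ∫⁻ t in Ioo 0 T, wNorm p δ (f t) ^ q.toReal = mixedNorm q T p δ f ^ q.toReal := by
  have hq' : 0 < q.toReal := ENNReal.toReal_pos hq0 hq
  rw [mixedNorm, eLpNorm_eq_lintegral_rpow_enorm_toReal hq0 hq, ← ENNReal.rpow_mul]
  simp only [enorm_eq_self]
  rw [one_div_mul_cancel hq'.ne', ENNReal.rpow_one]

lemma MemMixed.lintegral_lt_top (h : MemMixed q T p δ f) (hq : 1 ≤ q) (hp0 : p ≠ 0) (hp : p ≠ ⊤) :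
    ∫⁻ t in Ioo 0 T, wNorm p δ (f t) < ⊤ := by
  have := eLpNorm_le_eLpNorm_mul_rpow_measure_univ (μ := volume.restrict (Ioo 0 T)) hq
    (h.aemeasurable hp0 hp).aestronglyMeasurable
  rw [eLpNorm_one_eq_lintegral_enorm] at this
  simp only [enorm_eq_self] at this
  refine this.trans_lt (ENNReal.mul_lt_top h.2 ?_)
  refine ENNReal.rpow_lt_top_of_nonneg ?_ (by simp)
  simp only [ENNReal.toReal_one, div_one, one_div, sub_nonneg]
  by_cases h : q = ⊤
  · simp [h]
  · have : 1 ≤ q.toReal := by simpa using ENNReal.toReal_mono h hq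
    exact inv_le_one_of_one_le₀ this

end MemMixed

/-- Integrability on the strip from a bound on time slices. -/
lemma integrable_strip {T : ℝ} {f : ℝ × E3 → ℝ}
    (hf : AEStronglyMeasurable f ((volume.restrict (Ioo 0 T)).prod (volume : Measure E3)))
    {Λ : ℝ → ℝ≥0∞} (hΛ : ∫⁻ t in Ioo 0 T, Λ t < ⊤)
    (h : ∀ᵐ t ∂(volume.restrict (Ioo 0 T)), ∫⁻ x, ‖f (t, x)‖ₑ ≤ Λ t) :
    Integrable f ((volume.restrict (Ioo 0 T)).prod (volume : Measure E3)) := by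
  refine ⟨hf, ?_⟩
  rw [hasFiniteIntegral_iff_enorm, lintegral_prod _ hf.enorm]
  exact (lintegral_mono_ae h).trans_lt hΛ

/-- Hölder's inequality. -/
lemma lintegral_enorm_mul_enorm_le {α V W : Type*} [MeasurableSpace α] [NormedAddCommGroup V]
    [NormedAddCommGroup W] {μ : Measure α} {f : α → V} {g : α → W}
    {p q : ℝ≥0∞} [ENNReal.HolderTriple p q 1] (hf : AEStronglyMeasurable f μ)
    (hg : AEStronglyMeasurable g μ) :
    ∫⁻ x, ‖f x‖ₑ * ‖g x‖ₑ ∂μ ≤ eLpNorm f p μ * eLpNorm g q μ := by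
  have h := eLpNorm_smul_le_mul_eLpNorm (p := p) (q := q) (r := 1) hg.norm hf.norm
  rw [eLpNorm_one_eq_lintegral_enorm, eLpNorm_norm, eLpNorm_norm] at h
  simpa [enorm_mul] using h

lemma enorm_weight_neg_mul (a : ℝ) {V W : Type*} [NormedAddCommGroup V] [NormedSpace ℝ V]
    [NormedAddCommGroup W] [NormedSpace ℝ W] (x : E3) (v : V) (w : W) :
    ‖weight a x • v‖ₑ * ‖weight (-a) x • w‖ₑ = ‖v‖ₑ * ‖w‖ₑ := by
  have : ‖weight a x‖ₑ * ‖weight (-a) x‖ₑ = 1 := by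
    rw [← enorm_mul, weight_mul, add_neg_cancel, weight_eq]
    simp
  rw [enorm_smul, enorm_smul, mul_mul_mul_comm, this, one_mul]

lemma lintegral_mul_le_wNorm {V W : Type*} [NormedAddCommGroup V] [NormedSpace ℝ V]
    [NormedAddCommGroup W] [NormedSpace ℝ W] {f : E3 → V} {g : E3 → W}
    (hf : AEStronglyMeasurable f volume) (hg : AEStronglyMeasurable g volume)
    {p p' : ℝ≥0∞} [ENNReal.HolderTriple p p' 1] (hp0 : p ≠ 0)
    (hp : p ≠ ⊤) {δ a : ℝ} (ha : a * p.toReal = δ) :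
    ∫⁻ x, ‖f x‖ₑ * ‖g x‖ₑ ≤ wNorm p δ f * eLpNorm (fun x => weight (-a) x • g x) p' volume := by
  rw [wNorm_eq hp0 hp ha]
  refine le_trans (le_of_eq ?_) (lintegral_enorm_mul_enorm_le (p := p) (q := p')
    ((continuous_weight a).aestronglyMeasurable.smul hf)
    ((continuous_weight (-a)).aestronglyMeasurable.smul hg))
  exact lintegral_congr fun x => (enorm_weight_neg_mul a x _ _).symm

lemma memLp_ball_of_wNorm {V : Type*} [NormedAddCommGroup V] [NormedSpace ℝ V] {f : E3 → V}
    (hf : AEStronglyMeasurable f volume) {p : ℝ≥0∞} (hp0 : p ≠ 0) (hp : p ≠ ⊤) {δ : ℝ}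
    (h : wNorm p δ f < ⊤) (R : ℝ) : MemLp f p (volume.restrict (Metric.ball (0 : E3) R)) := by
  have hp' : p.toReal ≠ 0 := (ENNReal.toReal_pos hp0 hp).ne'
  set a := δ / p.toReal with ha
  rw [wNorm_eq hp0 hp (div_mul_cancel₀ δ hp')] at h
  obtain ⟨C, hC⟩ := (isCompact_closedBall (0 : E3) R).exists_bound_of_continuousOn
    (continuous_weight (-a)).continuousOn
  refine ⟨hf.restrict, ?_⟩
  have h2 : eLpNorm f p (volume.restrict (Metric.ball (0 : E3) R)) ≤
      ENNReal.ofReal C * eLpNorm (fun x => weight a x • f x) p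
        (volume.restrict (Metric.ball (0 : E3) R)) := by
    refine eLpNorm_le_mul_eLpNorm_of_ae_le_mul ?_ _
    filter_upwards [ae_restrict_mem measurableSet_ball] with x hx
    have h3 := hC x (Metric.ball_subset_closedBall hx)
    have h4 : ‖weight (-a) x‖ * ‖weight a x‖ = 1 := by
      rw [← norm_mul, weight_mul, neg_add_cancel, weight_eq]
      simp
    rw [norm_smul]
    calc ‖f x‖ = ‖weight (-a) x‖ * (‖weight a x‖ * ‖f x‖) := by rw [← mul_assoc, h4, one_mul]
      _ ≤ _ := by gcongr
  exact h2.trans_lt (ENNReal.mul_lt_top ENNReal.ofReal_lt_top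
    (lt_of_le_of_lt (eLpNorm_mono_measure _ Measure.restrict_le_self) h))

/-! ### Regularity of time slices -/

/-- The test function `α(t) ψ(x)` on the strip. -/
noncomputable def stripTest {T : ℝ} {α : ℝ → ℝ} {ψ : E3 → ℝ} (hα : ContDiff ℝ ∞ α)
    (hαc : HasCompactSupport α) (hαT : tsupport α ⊆ Ioo 0 T) (hψ : ContDiff ℝ ∞ ψ)
    (hψc : HasCompactSupport ψ) : 𝓓(strip T, ℝ) where
  toFun z := α z.1 * ψ z.2
  contDiff' := by exact_mod_cast (hα.comp contDiff_fst).mul (hψ.comp contDiff_snd)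
  hasCompactSupport' := by
    refine HasCompactSupport.intro (hαc.isCompact.prod hψc.isCompact) fun z hz => ?_
    rw [mem_prod, not_and_or] at hz
    rcases hz with hz | hz
    · rw [image_eq_zero_of_notMem_tsupport hz, zero_mul]
    · rw [image_eq_zero_of_notMem_tsupport hz, mul_zero]
  tsupport_subset' := by
    have : tsupport (fun z : ℝ × E3 => α z.1 * ψ z.2) ⊆ tsupport α ×ˢ univ := by
      refine closure_minimal (fun z hz => ⟨subset_tsupport _ fun h => hz ?_, mem_univ _⟩)
        ((isClosed_tsupport α).prod isClosed_univ)
      simp [h]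
    exact this.trans (prod_mono hαT subset_rfl)

lemma dx_mul {α : ℝ → ℝ} {ψ : E3 → ℝ} (hα : ContDiff ℝ ∞ α) (hψ : ContDiff ℝ ∞ ψ) (i : Fin 3)
    (z : ℝ × E3) : dx i (fun z => α z.1 * ψ z.2) z = α z.1 * fderiv ℝ ψ z.2 (bvec i) := by
  have h1 : HasFDerivAt (fun z : ℝ × E3 => α z.1)
      ((fderiv ℝ α z.1).comp (ContinuousLinearMap.fst ℝ ℝ E3)) z :=
    ((hα.differentiable (by simp)) z.1).hasFDerivAt.comp z hasFDerivAt_fst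
  have h2 : HasFDerivAt (fun z : ℝ × E3 => ψ z.2)
      ((fderiv ℝ ψ z.2).comp (ContinuousLinearMap.snd ℝ ℝ E3)) z :=
    ((hψ.differentiable (by simp)) z.2).hasFDerivAt.comp z hasFDerivAt_snd
  rw [dx, (h1.fun_mul h2).fderiv]
  simp

lemma dt_mul {α : ℝ → ℝ} {ψ : E3 → ℝ} (hα : ContDiff ℝ ∞ α) (hψ : ContDiff ℝ ∞ ψ)
    (z : ℝ × E3) : dt (fun z => α z.1 * ψ z.2) z = deriv α z.1 * ψ z.2 := by
  have h1 : HasFDerivAt (fun z : ℝ × E3 => α z.1)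
      ((fderiv ℝ α z.1).comp (ContinuousLinearMap.fst ℝ ℝ E3)) z :=
    ((hα.differentiable (by simp)) z.1).hasFDerivAt.comp z hasFDerivAt_fst
  have h2 : HasFDerivAt (fun z : ℝ × E3 => ψ z.2)
      ((fderiv ℝ ψ z.2).comp (ContinuousLinearMap.snd ℝ ℝ E3)) z :=
    ((hψ.differentiable (by simp)) z.2).hasFDerivAt.comp z hasFDerivAt_snd
  rw [dt, (h1.fun_mul h2).fderiv]
  simp [mul_comm]

lemma contDiff_fderiv_bvec {ψ : E3 → ℝ} (hψ : ContDiff ℝ ∞ ψ) (i : Fin 3) :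
    ContDiff ℝ ∞ fun x => fderiv ℝ ψ x (bvec i) :=
  (hψ.fderiv_right (by simp)).clm_apply contDiff_const

lemma hasCompactSupport_fderiv_bvec {ψ : E3 → ℝ} (hψ : HasCompactSupport ψ) (i : Fin 3) :
    HasCompactSupport fun x => fderiv ℝ ψ x (bvec i) := by
  obtain ⟨R, hR⟩ := exists_outside_of_hasCompactSupport hψ
  exact hasCompactSupport_of_outside (R := R) fun x hx => by
    rw [fderiv_eq_zero_of_outside hR hx]; rfl

lemma lap_mul {α : ℝ → ℝ} {ψ : E3 → ℝ} (hα : ContDiff ℝ ∞ α) (hψ : ContDiff ℝ ∞ ψ)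
    (z : ℝ × E3) : lap (fun z => α z.1 * ψ z.2) z =
      α z.1 * ∑ i, fderiv ℝ (fun x => fderiv ℝ ψ x (bvec i)) z.2 (bvec i) := by
  rw [lap, Finset.mul_sum]
  refine Finset.sum_congr rfl fun i _ => ?_
  have : dx i (fun z => α z.1 * ψ z.2) = fun z => α z.1 * fderiv ℝ ψ z.2 (bvec i) :=
    funext (dx_mul hα hψ i)
  rw [this, dx_mul hα (contDiff_fderiv_bvec hψ i)]

/-- The weak gradient of a time slice, tested against a fixed test function. -/
lemma ae_slice_weakGradient {γ T : ℝ} {u : ℝ → E3 → E3} {Du : ℝ → E3 → Tensor3}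
    (hu : MemMixed ⊤ T 2 γ u) (hD : MemMixed 2 T 2 γ Du) (hw : IsWeakGradient T u Du)
    (i j : Fin 3) {ψ : E3 → ℝ} (hψ : ContDiff ℝ ∞ ψ) (hψc : HasCompactSupport ψ) :
    ∀ᵐ t ∂(volume.restrict (Ioo 0 T)),
      ∫ x, (u t x j * fderiv ℝ ψ x (bvec i) + Du t x (i, j) * ψ x) = 0 := by
  set μT := volume.restrict (Ioo 0 T)
  set ψ' : E3 → ℝ := fun x => fderiv ℝ ψ x (bvec i)
  have hψ' : Continuous ψ' := (contDiff_fderiv_bvec hψ i).continuous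
  have hψ'c : HasCompactSupport ψ' := hasCompactSupport_fderiv_bvec hψc i
  have hint : ∀ {V : Type} [NormedAddCommGroup V] [NormedSpace ℝ V] (v : ℝ → E3 → V) (L : V →L[ℝ] ℝ)
      (q : ℝ≥0∞) (_ : 1 ≤ q) (_ : MemMixed q T 2 γ v) (g : E3 → ℝ) (_ : Continuous g)
      (_ : HasCompactSupport g),
      Integrable (fun z : ℝ × E3 => L (v z.1 z.2) * g z.2) (μT.prod volume) := by
    intro V _ _ v L q hq hv g hg hgc
    have hG : eLpNorm (fun x => weight (-(γ / 2)) x • g x) 2 volume < ⊤ :=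
      (((continuous_weight _).smul hg).memLp_of_hasCompactSupport hgc.smul_left).2
    refine integrable_strip (Λ := fun t => ‖L‖ₑ * (wNorm 2 γ (v t) *
      eLpNorm (fun x => weight (-(γ / 2)) x • g x) 2 volume)) ?_ ?_ ?_
    · exact (L.continuous.comp_aestronglyMeasurable hv.aestronglyMeasurable).mul
        (hg.comp continuous_snd).aestronglyMeasurable
    · rw [lintegral_const_mul' _ _ enorm_ne_top, lintegral_mul_const' _ _ hG.ne]
      exact ENNReal.mul_lt_top enorm_lt_top (ENNReal.mul_lt_top
        (hv.lintegral_lt_top hq (by norm_num) (by norm_num)) hG)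
    · filter_upwards [hv.ae_slice] with t ht
      refine le_trans ?_ (mul_le_mul_right (lintegral_mul_le_wNorm ht hg.aestronglyMeasurable
        (p := 2) (p' := 2) (by norm_num) (by norm_num) (by simp)) _)
      rw [← lintegral_const_mul' _ _ enorm_ne_top]
      refine lintegral_mono fun x => ?_
      rw [enorm_mul, ← mul_assoc]
      gcongr
      exact L.le_opENorm _
  have hi1 : Integrable (fun z : ℝ × E3 => u z.1 z.2 j * ψ' z.2) (μT.prod volume) :=
    hint u (EuclideanSpace.proj j) ⊤ le_top hu ψ' hψ' hψ'c
  have hi2 : Integrable (fun z : ℝ × E3 => Du z.1 z.2 (i, j) * ψ z.2) (μT.prod volume) :=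
    hint Du (EuclideanSpace.proj (i, j)) 2 (by norm_num) hD ψ hψ.continuous hψc
  have hi : Integrable (fun z : ℝ × E3 => u z.1 z.2 j * ψ' z.2 + Du z.1 z.2 (i, j) * ψ z.2)
    (μT.prod volume) := hi1.add hi2
  -- The spatial pairing is a locally integrable function of time; tested against every `α`, it
  -- gives zero by the weak gradient identity for `α(t) ψ(x)`, hence it vanishes almost everywhere.
  have hh := hi.integral_prod_left
  have hloc : LocallyIntegrableOn
      (fun t => ∫ x, (u t x j * ψ' x + Du t x (i, j) * ψ x)) (Ioo 0 T) volume :=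
    IntegrableOn.locallyIntegrableOn hh
  rw [ae_restrict_iff' measurableSet_Ioo]
  refine isOpen_Ioo.ae_eq_zero_of_integral_contDiff_smul_eq_zero hloc fun α hα hαc hαT => ?_
  have h := hw i j (stripTest hα hαc hαT hψ hψc)
  have e1 : ∀ z, dx i (stripTest hα hαc hαT hψ hψc) z = α z.1 * ψ' z.2 := dx_mul hα hψ i
  have e2 : ∀ z, (stripTest hα hαc hαT hψ hψc) z = α z.1 * ψ z.2 := fun z => rfl
  simp_rw [e1, e2] at h
  rw [restrict_strip] at h
  obtain ⟨C, hC⟩ := hαc.exists_bound_of_continuous hα.continuous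
  have hαm : AEStronglyMeasurable (fun z : ℝ × E3 => α z.1) (μT.prod volume) :=
    (hα.continuous.comp continuous_fst).aestronglyMeasurable
  have hb : ∀ᵐ z ∂(μT.prod (volume : Measure E3)), ‖α z.1‖ ≤ C :=
      Eventually.of_forall fun z => hC z.1
  have j1 := hi1.bdd_mul hαm hb
  have j2 := hi2.bdd_mul hαm hb
  have hs : ∫ z, α z.1 * (u z.1 z.2 j * ψ' z.2 + Du z.1 z.2 (i, j) * ψ z.2)
      ∂(μT.prod (volume : Measure E3)) = 0 := by
    have e : ∀ z : ℝ × E3, α z.1 * (u z.1 z.2 j * ψ' z.2 + Du z.1 z.2 (i, j) * ψ z.2) =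
      α z.1 * (u z.1 z.2 j * ψ' z.2) + α z.1 * (Du z.1 z.2 (i, j) * ψ z.2) := fun z => by ring
    simp_rw [e]
    rw [integral_add j1 j2]
    have a1 : ∫ z, α z.1 * (u z.1 z.2 j * ψ' z.2) ∂(μT.prod (volume : Measure E3)) =
        ∫ z, u z.1 z.2 j * (α z.1 * ψ' z.2) ∂(μT.prod (volume : Measure E3)) := by
      congr 1; ext z; ring
    have a2 : ∫ z, α z.1 * (Du z.1 z.2 (i, j) * ψ z.2) ∂(μT.prod (volume : Measure E3)) =
        ∫ z, Du z.1 z.2 (i, j) * (α z.1 * ψ z.2) ∂(μT.prod (volume : Measure E3)) := by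
      congr 1; ext z; ring
    rw [a1, a2, h, neg_add_cancel]
  rw [integral_prod _ (hi.bdd_mul hαm hb)] at hs
  simp_rw [integral_const_mul] at hs
  rw [← setIntegral_eq_integral_of_forall_compl_eq_zero (s := Ioo 0 T)]
  · simpa using hs
  · intro t ht
    rw [image_eq_zero_of_notMem_tsupport fun h => ht (hαT h), zero_smul]

lemma fderiv_moll (φ : ContDiffBump (0 : E3)) {v : E3 → ℝ} (hv : LocallyIntegrable v volume)
    (x : E3) (i : Fin 3) : fderiv ℝ (moll φ v) x (bvec i) =
      ∫ y, v y * fderiv ℝ (φ.normed volume) (x - y) (bvec i) := by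
  have e : moll φ v = MeasureTheory.convolution v (φ.normed volume)
      (ContinuousLinearMap.lsmul ℝ ℝ).flip volume :=
    (MeasureTheory.convolution_flip (L := ContinuousLinearMap.lsmul ℝ ℝ)).symm
  have hη : ContDiff ℝ 1 (φ.normed volume) := φ.contDiff_normed (n := 1)
  rw [e, ((φ.hasCompactSupport_normed (μ := volume)).hasFDerivAt_convolution_right _ hv hη
      x).fderiv,
    convolution_precompR_apply _ hv ((φ.hasCompactSupport_normed (μ := volume)).fderiv (𝕜 := ℝ))
      (hη.continuous_fderiv (by norm_num))]
  simp only [MeasureTheory.convolution, ContinuousLinearMap.flip_apply,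
      ContinuousLinearMap.lsmul_apply,
    smul_eq_mul]
  congr 1; ext y; ring

/-- If mollification intertwines `∂_k v` with `Dv k`, then the mollifications themselves form the
approximating sequence. -/
lemma H1loc_of_moll {v : E3 → ℝ} {Dv : Fin 3 → E3 → ℝ}
    (hv : ∀ R : ℝ, MemLp v 2 (volume.restrict (Metric.ball (0 : E3) R)))
    (hD : ∀ k, ∀ R : ℝ, MemLp (Dv k) 2 (volume.restrict (Metric.ball (0 : E3) R)))
    (hvl : LocallyIntegrable v volume)
    (h : ∀ n k x, fderiv ℝ (moll (bump n) v) x (bvec k) = moll (bump n) (Dv k) x) :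
    H1loc v Dv := by
  refine ⟨hv, hD, fun n => moll (bump n) v, fun n => contDiff_moll _ hvl,
    fun R => tendsto_moll_ball hv R, fun k R => ?_⟩
  refine (tendsto_moll_ball (hD k) R).congr fun n => ?_
  have : (fun x => fderiv ℝ (moll (bump n) v) x (bvec k)) = moll (bump n) (Dv k) := funext (h n k)
  rw [this]

lemma locallyIntegrable_of_ball {v : E3 → ℝ}
    (hv : ∀ R : ℝ, MemLp v 2 (volume.restrict (Metric.ball (0 : E3) R))) :
    LocallyIntegrable v volume := fun x => by
  refine ⟨Metric.ball 0 (‖x‖ + 1), Metric.isOpen_ball.mem_nhds (by simp), ?_⟩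
  have : IsFiniteMeasure (volume.restrict (Metric.ball (0 : E3) (‖x‖ + 1))) :=
    ⟨by rw [Measure.restrict_apply_univ]; exact measure_ball_lt_top⟩
  exact (hv _).integrable (by norm_num)

/-- Almost every time slice of the velocity is in `H¹_loc`. -/
lemma ae_slice_H1loc {γ T : ℝ} {u : ℝ → E3 → E3} {Du : ℝ → E3 → Tensor3}
    (hu : MemMixed ⊤ T 2 γ u) (hD : MemMixed 2 T 2 γ Du) (hw : IsWeakGradient T u Du) :
    ∀ᵐ t ∂(volume.restrict (Ioo 0 T)), ∀ j : Fin 3,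
      H1loc (fun x => u t x j) (fun i x => Du t x (i, j)) := by
  have hηs : ∀ n (q : E3), ContDiff ℝ ∞ fun y => (bump n).normed volume (q - y) := fun n q =>
    (bump n).contDiff_normed.comp (contDiff_const.sub contDiff_id)
  have hηc : ∀ n (q : E3), HasCompactSupport fun y => (bump n).normed volume (q - y) := fun n q =>
    ((bump n).hasCompactSupport_normed (μ := volume)).comp_homeomorph (Homeomorph.subLeft q)
  have hηd : ∀ n (q y : E3) (i : Fin 3), fderiv ℝ (fun y => (bump n).normed volume (q - y))
      y (bvec i)
      = - fderiv ℝ ((bump n).normed volume) (q - y) (bvec i) := fun n q y i => by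
    have h1 : HasFDerivAt (fun y : E3 => q - y) (-ContinuousLinearMap.id ℝ E3) y :=
      (hasFDerivAt_id y).const_sub q
    have hη : ContDiff ℝ 1 ((bump n).normed volume) := (bump n).contDiff_normed (n := 1)
    have h2 : HasFDerivAt (fun y => (bump n).normed volume (q - y))
        ((fderiv ℝ ((bump n).normed volume) (q - y)).comp (-ContinuousLinearMap.id ℝ E3)) y :=
      ((hη.differentiable (by norm_num)) (q - y)).hasFDerivAt.comp y h1
    rw [h2.fderiv]
    simp
  -- The exceptional null set of times depends on the test function. Only mollifiers centred at a
  -- dense sequence of points are tested, a countable family; continuity extends the identity to all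
  -- centres.
  have hae : ∀ᵐ t ∂(volume.restrict (Ioo 0 T)), ∀ (i j : Fin 3) (n m : ℕ),
      ∫ x, (u t x j * fderiv ℝ (fun y => (bump n).normed volume (denseSeq E3 m - y)) x (bvec i) +
        Du t x (i, j) * (bump n).normed volume (denseSeq E3 m - x)) = 0 := by
    simp only [ae_all_iff]
    exact fun i j n m => ae_slice_weakGradient hu hD hw i j (hηs n _) (hηc n _)
  filter_upwards [hae, hu.ae_slice, hD.ae_slice, hu.ae_lt_top (by norm_num) (by norm_num)
      (by norm_num),
    hD.ae_lt_top (by norm_num) (by norm_num) (by norm_num)] with t ht hut hDt hu' hD' j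
  have hv : ∀ R : ℝ, MemLp (fun x => u t x j) 2 (volume.restrict (Metric.ball (0 : E3) R)) :=
    fun R => (EuclideanSpace.proj j : E3 →L[ℝ] ℝ).comp_memLp'
      (memLp_ball_of_wNorm hut (by norm_num) (by norm_num) hu' R)
  have hDv : ∀ i, ∀ R : ℝ,
      MemLp (fun x => Du t x (i, j)) 2 (volume.restrict (Metric.ball (0 : E3) R)) :=
    fun i R => (EuclideanSpace.proj (i, j) : Tensor3 →L[ℝ] ℝ).comp_memLp'
      (memLp_ball_of_wNorm hDt (by norm_num) (by norm_num) hD' R)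
  have hvl := locallyIntegrable_of_ball hv
  refine H1loc_of_moll hv hDv hvl fun n i x => ?_
  have hc1 : Continuous fun x => fderiv ℝ (moll (bump n) fun x => u t x j) x (bvec i) :=
    (contDiff_fderiv_bvec (contDiff_moll _ hvl) i).continuous
  have hc2 : Continuous (moll (bump n) fun x => Du t x (i, j)) :=
    (contDiff_moll _ (locallyIntegrable_of_ball (hDv i))).continuous
  refine congrFun (hc1.ext_on (denseRange_denseSeq E3) hc2 ?_) x
  rintro _ ⟨m, rfl⟩
  have h := ht i j n m
  set q := denseSeq E3 m
  have hlocint : ∀ {f g : E3 → ℝ}, LocallyIntegrable f volume → Continuous g →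
      HasCompactSupport g → Integrable fun y => f y * g y := fun hf hg hgc => by
    simpa [mul_comm] using hf.integrable_smul_left_of_hasCompactSupport hg hgc
  have i1 := hlocint hvl (contDiff_fderiv_bvec (hηs n q) i).continuous
    (hasCompactSupport_fderiv_bvec (hηc n q) i)
  have i2 := hlocint (locallyIntegrable_of_ball (hDv i)) (hηs n q).continuous (hηc n q)
  rw [integral_add i1 i2] at h
  simp only [hηd] at h
  change fderiv ℝ (moll (bump n) fun x => u t x j) q (bvec i) = _
  rw [fderiv_moll _ hvl, moll_eq_integral]
  simp only [mul_neg, integral_neg] at h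
  have e : ∫ y, (bump n).normed volume (q - y) * Du t y (i, j) =
      ∫ y, Du t y (i, j) * (bump n).normed volume (q - y) := by congr 1; ext y; ring
  rw [e]
  linarith

/-! ### Weighted Sobolev and Hardy inequalities -/

lemma rho_le_sq (x : E3) : rho x ≤ (1 + ‖x‖) ^ (2 : ℝ) := by
  rw [Real.rpow_two, rho]
  nlinarith [norm_nonneg x]

lemma sq_le_two_mul_rho (x : E3) : (1 + ‖x‖) ^ (2 : ℝ) ≤ 2 * rho x := by
  rw [Real.rpow_two, rho]
  nlinarith [sq_nonneg (1 - ‖x‖)]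

lemma rho_rpow_le_weight {a : ℝ} (ha : 0 ≤ a) (x : E3) : rho x ^ a ≤ weight (-(2 * a)) x := by
  rw [weight_eq, neg_neg, Real.rpow_mul (one_add_norm_pos x).le]
  exact Real.rpow_le_rpow (rho_pos x).le (rho_le_sq x) ha

lemma weight_le_rho_rpow {a : ℝ} (ha : 0 ≤ a) (x : E3) : weight (2 * a) x ≤ rho x ^ (-a) := by
  rw [weight_eq, ← mul_neg, Real.rpow_mul (one_add_norm_pos x).le]
  exact Real.rpow_le_rpow_of_nonpos (rho_pos x) (rho_le_sq x) (by linarith)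

lemma rho_rpow_neg_le_weight {a : ℝ} (ha : 0 ≤ a) (ha' : a ≤ 1) (x : E3) :
    rho x ^ (-a) ≤ 2 * weight (2 * a) x := by
  have h1 : 0 < (1 + ‖x‖) ^ (2 : ℝ) := Real.rpow_pos_of_pos (one_add_norm_pos x) _
  have h2 : rho x ^ (-a) ≤ ((1 + ‖x‖) ^ (2 : ℝ) / 2) ^ (-a) :=
    Real.rpow_le_rpow_of_nonpos (by positivity) (by linarith [sq_le_two_mul_rho x]) (by linarith)
  refine h2.trans ?_
  rw [weight_eq, ← mul_neg, Real.rpow_mul (one_add_norm_pos x).le,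
      Real.div_rpow h1.le (by norm_num),
    div_eq_mul_inv, mul_comm, ← Real.rpow_neg (by norm_num), neg_neg]
  gcongr
  calc (2 : ℝ) ^ a ≤ 2 ^ (1 : ℝ) := Real.rpow_le_rpow_of_exponent_le (by norm_num) ha'
    _ = 2 := Real.rpow_one 2

/-- The derivative of a power of `ρ` is bounded by that power, so localising with it costs only
norms already present. -/
lemma abs_fderiv_rho_rpow_neg_le {a : ℝ} (ha : 0 ≤ a) (ha' : a ≤ 1) (x : E3) (k : Fin 3) :
    ‖fderiv ℝ (fun x => rho x ^ (-a)) x (bvec k)‖ ≤ 2 * rho x ^ (-a) := by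
  have hr := rho_pos x
  have hx : ‖x k‖ ≤ rho x := by
    rw [Real.norm_eq_abs]
    have h1 := one_le_rho x
    have h2 := coord_sq_le_rho x k
    rw [← sq_abs] at h2
    nlinarith [abs_nonneg (x k)]
  rw [fderiv_rho_rpow, norm_mul, norm_mul, Real.norm_of_nonneg (Real.rpow_nonneg hr.le (-a - 1))]
  have h2 : ‖2 * -a‖ ≤ 2 := by
    rw [Real.norm_eq_abs, abs_le]; constructor <;> linarith
  calc ‖2 * -a‖ * ‖x k‖ * rho x ^ (-a - 1) ≤ 2 * rho x * rho x ^ (-a - 1) := by gcongr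
    _ = 2 * rho x ^ (-a) := by
        rw [Real.rpow_sub_one hr.ne', mul_assoc]
        field_simp

lemma eLpNorm_smul_le_sum {m : E3 → ℝ} (hm : AEStronglyMeasurable m volume) {u : E3 → E3}
    (hu : AEStronglyMeasurable u volume) {p : ℝ≥0∞} (hp : 1 ≤ p) :
    eLpNorm (fun x => m x • u x) p volume ≤ ∑ j, eLpNorm (fun x => m x * u x j) p volume := by
  have huj : ∀ j, AEStronglyMeasurable (fun x => u x j) volume := fun j =>
    (EuclideanSpace.proj j : E3 →L[ℝ] ℝ).continuous.comp_aestronglyMeasurable hu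
  calc eLpNorm (fun x => m x • u x) p volume
      ≤ eLpNorm (∑ j, fun x => ‖m x * u x j‖) p volume := by
        refine eLpNorm_mono_real fun x => ?_
        rw [Finset.sum_apply, norm_smul]
        simp_rw [norm_mul]
        rw [← Finset.mul_sum]
        refine mul_le_mul_of_nonneg_left ?_ (norm_nonneg _)
        rw [EuclideanSpace.norm_eq]
        refine Real.sqrt_le_iff.2 ⟨Finset.sum_nonneg fun _ _ => norm_nonneg _, ?_⟩
        exact Finset.sum_sq_le_sq_sum_of_nonneg (fun _ _ => norm_nonneg _)
    _ ≤ ∑ j, eLpNorm (fun x => ‖m x * u x j‖) p volume :=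
        eLpNorm_sum_le (fun j _ => (hm.mul (huj j)).norm) hp
    _ = _ := by simp_rw [eLpNorm_norm]

/-- Global weighted estimates for functions of class `H¹_loc`, from estimates in `H¹`. -/
lemma exists_weighted_bound : ∃ A : ℝ≥0∞, A ≠ ⊤ ∧ ∀ γ : ℝ, 0 < γ → γ ≤ 2 →
    ∀ (u : E3 → E3) (Du : E3 → Tensor3), AEStronglyMeasurable u volume →
    AEStronglyMeasurable Du volume → (∀ j, H1loc (fun x => u x j) (fun i x => Du x (i, j))) →
    ∀ (m : E3 → ℝ) (p K : ℝ≥0∞), AEStronglyMeasurable m volume → 1 ≤ p →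
    (∀ v Dv, H1c v Dv → eLpNorm (fun x => m x * v x) p volume ≤
      K * ∑ k, eLpNorm (Dv k) 2 volume) →
    eLpNorm (fun x => m x • weight (γ / 2) x • u x) p volume ≤
      A * K * (wNorm 2 γ u + wNorm 2 γ Du) := by
  obtain ⟨C, hC0, χ, hs, hc, hχ0, hχ1, hχ, hχd⟩ := exists_cutoff
  refine ⟨9 * ENNReal.ofReal (2 * (C + 2)), ENNReal.mul_ne_top (by norm_num) ENNReal.ofReal_ne_top,
    fun γ h0 h2 u Du hu hDu hH m p K hm hp hK => ?_⟩
  -- `w_{γ/2}` is not smooth at the origin; `ρ^{-γ/4}` is smooth and lies between `w_{γ/2}` and `2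
  -- w_{γ/2}`.
  set κ : E3 → ℝ := fun x => rho x ^ (-(γ / 4)) with hκ
  have hκ1 : ∀ x, κ x ≤ 2 * weight (γ / 2) x := fun x => by
    have := rho_rpow_neg_le_weight (a := γ / 4) (by linarith) (by linarith) x
    rwa [show 2 * (γ / 4) = γ / 2 by ring] at this
  have hκ2 : ∀ x, weight (γ / 2) x ≤ κ x := fun x => by
    have := weight_le_rho_rpow (a := γ / 4) (by linarith) x
    rwa [show 2 * (γ / 4) = γ / 2 by ring] at this
  have hκ0 : ∀ x, 0 ≤ κ x := fun x => Real.rpow_nonneg (rho_pos x).le _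
  have hκs : ContDiff ℝ ∞ κ := contDiff_rho_rpow _
  have hκd : ∀ x k, ‖fderiv ℝ κ x (bvec k)‖ ≤ 2 * κ x := fun x k =>
    abs_fderiv_rho_rpow_neg_le (by linarith) (by linarith) x k
  set e := wNorm 2 γ u
  set d := wNorm 2 γ Du
  have he : e = eLpNorm (fun x => weight (γ / 2) x • u x) 2 volume :=
    wNorm_eq (by norm_num) (by norm_num) (by simp) u
  have hd : d = eLpNorm (fun x => weight (γ / 2) x • Du x) 2 volume :=
    wNorm_eq (by norm_num) (by norm_num) (by simp) Du
  have huj : ∀ j, AEStronglyMeasurable (fun x => u x j) volume := fun j =>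
    (EuclideanSpace.proj j : E3 →L[ℝ] ℝ).continuous.comp_aestronglyMeasurable hu
  have hDuj : ∀ i j, AEStronglyMeasurable (fun x => Du x (i, j)) volume := fun i j =>
    (EuclideanSpace.proj (i, j) : Tensor3 →L[ℝ] ℝ).continuous.comp_aestronglyMeasurable hDu
  have hg : ∀ n, ContDiff ℝ ∞ fun x => χ n x * κ x := fun n => (hs n).mul hκs
  have hgc : ∀ n, HasCompactSupport fun x => χ n x * κ x := fun n => (hc n).mul_right
  have hgd : ∀ n x k, ‖fderiv ℝ (fun x => χ n x * κ x) x (bvec k)‖ ≤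
      2 * (C + 2) * weight (γ / 2) x := fun n x k => by
    rw [fderiv_fun_mul ((hs n).differentiable (by simp) x) (hκs.differentiable (by simp) x)]
    simp only [_root_.add_apply, _root_.smul_apply, smul_eq_mul]
    have hCn : |fderiv ℝ (χ n) x (bvec k)| ≤ C := (hχd n k x).trans
      (div_le_self hC0 (by linarith [(n.cast_nonneg : (0:ℝ) ≤ n)]))
    calc _ ≤ ‖χ n x * fderiv ℝ κ x (bvec k)‖ + ‖κ x * fderiv ℝ (χ n) x (bvec k)‖ := norm_add_le _ _
      _ ≤ 1 * (2 * κ x) + κ x * C := by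
          rw [norm_mul, norm_mul, Real.norm_of_nonneg (hχ0 n x), Real.norm_of_nonneg (hκ0 x)]
          gcongr
          · exact hχ1 n x
          · exact hκd x k
          · exact hκ0 x
          · exact hCn
      _ = (C + 2) * κ x := by ring
      _ ≤ (C + 2) * (2 * weight (γ / 2) x) := by gcongr; exact hκ1 x
      _ = _ := by ring
  have hD : ∀ n j i, eLpNorm (fun x => χ n x * κ x * Du x (i, j) +
      fderiv ℝ (fun x => χ n x * κ x) x (bvec i) * u x j) 2 volume ≤
      ENNReal.ofReal (2 * (C + 2)) * (e + d) := fun n j i => by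
    refine (eLpNorm_add_le ((hg n).continuous.aestronglyMeasurable.mul (hDuj i j))
      ((contDiff_fderiv_bvec (hg n) i).continuous.aestronglyMeasurable.mul (huj j))
      (by norm_num)).trans ?_
    rw [add_comm e, mul_add, he, hd]
    refine add_le_add ?_ ?_
    · refine eLpNorm_le_mul_eLpNorm_of_ae_le_mul (Eventually.of_forall fun x => ?_) _
      rw [Pi.mul_apply, norm_mul, norm_mul, norm_smul, Real.norm_of_nonneg (hχ0 n x),
        Real.norm_of_nonneg (hκ0 x), Real.norm_of_nonneg (weight_pos _ x).le, ← mul_assoc]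
      refine mul_le_mul ?_ (PiLp.norm_apply_le (Du x) (i, j)) (norm_nonneg _)
        (mul_nonneg (by positivity) (weight_pos _ x).le)
      calc χ n x * κ x ≤ 1 * (2 * weight (γ / 2) x) :=
            mul_le_mul (hχ1 n x) (hκ1 x) (hκ0 x) zero_le_one
        _ ≤ 2 * (C + 2) * weight (γ / 2) x := by
            have := (weight_pos (γ / 2) x).le
            nlinarith [mul_nonneg hC0 this]
    · refine eLpNorm_le_mul_eLpNorm_of_ae_le_mul (Eventually.of_forall fun x => ?_) _
      rw [Pi.mul_apply, norm_mul, norm_smul, Real.norm_of_nonneg (weight_pos _ x).le, ← mul_assoc]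
      exact mul_le_mul (hgd n x i) (PiLp.norm_apply_le (u x) j) (norm_nonneg _)
        (mul_nonneg (by positivity) (weight_pos _ x).le)
  -- The assumed inequality is applied to `χ_n κ u_j`, which is in `H¹` with compact support. The
  -- bound does not depend on `n`, so Fatou's lemma removes the cutoff. The `9` in the constant is
  -- three derivatives times three components.
  have hn : ∀ n j, eLpNorm (fun x => m x * (χ n x * κ x * u x j)) p volume ≤
      K * (3 * (ENNReal.ofReal (2 * (C + 2)) * (e + d))) := fun n j => by
    refine (hK _ _ ((hH j).mul (hg n) (hgc n))).trans (mul_le_mul_right ?_ _)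
    refine (Finset.sum_le_sum fun i _ => hD n j i).trans_eq ?_
    simp
  have hj : ∀ j, eLpNorm (fun x => m x * κ x * u x j) p volume ≤
      K * (3 * (ENNReal.ofReal (2 * (C + 2)) * (e + d))) := fun j => by
    refine (Lp.eLpNorm_lim_le_liminf_eLpNorm
      (f := fun n x => m x * (χ n x * κ x * u x j)) (fun n => hm.mul
        ((hg n).continuous.aestronglyMeasurable.mul (huj j))) _ ?_).trans ?_
    · refine Eventually.of_forall fun x => tendsto_const_nhds.congr' ?_
      obtain ⟨N, hN⟩ := exists_nat_ge ‖x‖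
      filter_upwards [eventually_ge_atTop N] with n hn'
      rw [hχ n x (hN.trans ((Nat.cast_le.2 hn').trans (by linarith))), one_mul, mul_assoc]
    · refine (liminf_le_liminf (v := fun _ => K * (3 * (ENNReal.ofReal (2 * (C + 2)) * (e + d))))
        (Eventually.of_forall fun n => hn n j)).trans_eq ?_
      simp
  have hfin : eLpNorm (fun x => m x • weight (γ / 2) x • u x) p volume ≤
      eLpNorm (fun x => (m x * κ x) • u x) p volume := by
    refine eLpNorm_mono fun x => ?_
    rw [norm_smul, norm_smul, norm_smul, norm_mul, mul_assoc]
    rw [Real.norm_of_nonneg (weight_pos _ x).le, Real.norm_of_nonneg (hκ0 x)]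
    gcongr
    exact hκ2 x
  refine hfin.trans ((eLpNorm_smul_le_sum (hm.mul hκs.continuous.aestronglyMeasurable)
      hu hp).trans ?_)
  refine (Finset.sum_le_sum fun j _ => hj j).trans_eq ?_
  simp only [Finset.sum_const, Finset.card_univ, Fintype.card_fin, nsmul_eq_mul]
  push_cast
  ring

/-! ### Smooth compactly supported approximations of the weight -/

lemma smoothTransition_eventually_const {x : ℝ} (hx : x < 0 ∨ 1 < x) :
    ∃ c : ℝ, Real.smoothTransition =ᶠ[𝓝 x] fun _ => c := by
  rcases hx with hx | hx
  · refine ⟨0, ?_⟩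
    filter_upwards [Iio_mem_nhds hx] with y hy using Real.smoothTransition.zero_of_nonpos hy.le
  · refine ⟨1, ?_⟩
    filter_upwards [Ioi_mem_nhds hx] with y hy using Real.smoothTransition.one_of_one_le hy.le

lemma deriv_smoothTransition_eq_zero {x : ℝ} (hx : x < 0 ∨ 1 < x) :
    deriv Real.smoothTransition x = 0 ∧ deriv (deriv Real.smoothTransition) x = 0 := by
  obtain ⟨c, hc⟩ := smoothTransition_eventually_const hx
  have h1 : deriv Real.smoothTransition =ᶠ[𝓝 x] fun _ => 0 := by
    simpa using hc.deriv
  exact ⟨h1.eq_of_nhds, by simpa using h1.deriv.eq_of_nhds⟩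

lemma contDiff_deriv_smoothTransition : ContDiff ℝ ∞ (deriv Real.smoothTransition) :=
  (contDiff_infty_iff_deriv.1 Real.smoothTransition.contDiff).2

lemma exists_bound_smoothTransition : ∃ M : ℝ, 0 ≤ M ∧ ∀ x, |deriv Real.smoothTransition x| ≤ M ∧
    |deriv (deriv Real.smoothTransition) x| ≤ M := by
  have c1 := contDiff_deriv_smoothTransition.continuous
  have c2 : Continuous (deriv (deriv Real.smoothTransition)) :=
    (contDiff_infty_iff_deriv.1 contDiff_deriv_smoothTransition).2.continuous
  obtain ⟨M1, h1⟩ := isCompact_Icc.exists_bound_of_continuousOn (s := Icc (0 : ℝ) 1) c1.continuousOn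
  obtain ⟨M2, h2⟩ := isCompact_Icc.exists_bound_of_continuousOn (s := Icc (0 : ℝ) 1) c2.continuousOn
  refine ⟨max (max M1 M2) 0, le_max_right _ _, fun x => ?_⟩
  by_cases hx : x ∈ Icc (0 : ℝ) 1
  · exact ⟨(h1 x hx).trans ((le_max_left _ _).trans (le_max_left _ _)),
      (h2 x hx).trans ((le_max_right _ _).trans (le_max_left _ _))⟩
  · have h := deriv_smoothTransition_eq_zero (x := x) (by
      rw [mem_Icc, not_and_or, not_le, not_le] at hx; exact hx)
    rw [h.1, h.2]
    simp

/-- The smoothed modulus. -/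
noncomputable def smod (ε : ℝ) (x : E3) : ℝ := Real.sqrt (ε ^ 2 + ‖x‖ ^ 2)

lemma smod_sq (ε : ℝ) (x : E3) : smod ε x ^ 2 = ε ^ 2 + ‖x‖ ^ 2 := Real.sq_sqrt (by positivity)

lemma smod_pos {ε : ℝ} (hε : 0 < ε) (x : E3) : 0 < smod ε x := Real.sqrt_pos.2 (by positivity)

lemma norm_le_smod (ε : ℝ) (x : E3) : ‖x‖ ≤ smod ε x :=
  Real.le_sqrt_of_sq_le (by nlinarith [sq_nonneg ε])

lemma contDiff_smod {ε : ℝ} (hε : 0 < ε) : ContDiff ℝ ∞ (smod ε) :=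
  ContDiff.sqrt (contDiff_const.add (contDiff_norm_sq ℝ)) fun x => by positivity

lemma hasFDerivAt_smod {ε : ℝ} (hε : 0 < ε) (x : E3) :
    HasFDerivAt (smod ε) ((1 / (2 * smod ε x)) • (2 • innerSL ℝ x)) x :=
  ((hasFDerivAt_norm_sq x).const_add (ε ^ 2)).sqrt (by positivity)

lemma fderiv_comp_smod {ε : ℝ} (hε : 0 < ε) {h : ℝ → ℝ} {h' : ℝ} {x : E3}
    (hh : HasDerivAt h h' (smod ε x)) (k : Fin 3) :
    fderiv ℝ (fun x => h (smod ε x)) x (bvec k) = h' * (x k / smod ε x) := by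
  have h1 := hh.comp_hasFDerivAt x (hasFDerivAt_smod hε x)
  have h2 : fderiv ℝ (fun x => h (smod ε x)) x = _ := h1.fderiv
  have := (smod_pos hε x).ne'
  rw [h2]
  simp only [_root_.smul_apply, smul_eq_mul, innerSL_apply_apply, inner_bvec,
    nsmul_eq_mul, Nat.cast_ofNat]
  field_simp

section Radial

variable {ε : ℝ} {g g1 g2 : ℝ → ℝ}

lemma fderiv_radial (hε : 0 < ε) (hg : ∀ s, 0 < s → HasDerivAt g (g1 s) s) (k : Fin 3) :
    (fun x => fderiv ℝ (fun x => g (smod ε x)) x (bvec k)) =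
      fun x => g1 (smod ε x) / smod ε x * x k := by
  ext x
  rw [fderiv_comp_smod hε (hg _ (smod_pos hε x))]
  ring

lemma fderiv_fderiv_radial (hε : 0 < ε) (hg : ∀ s, 0 < s → HasDerivAt g (g1 s) s)
    (hg1 : ∀ s, 0 < s → HasDerivAt g1 (g2 s) s) (i k : Fin 3) (x : E3) :
    fderiv ℝ (fun x => fderiv ℝ (fun x => g (smod ε x)) x (bvec k)) x (bvec i) =
      (g2 (smod ε x) * smod ε x - g1 (smod ε x)) / smod ε x ^ 2 * (x i / smod ε x) * x k +
        g1 (smod ε x) / smod ε x * (if i = k then 1 else 0) := by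
  have hs := smod_pos hε x
  have hd : HasDerivAt (fun s => g1 s / s)
      ((g2 (smod ε x) * smod ε x - g1 (smod ε x)) / smod ε x ^ 2) (smod ε x) := by
    simpa using (hg1 _ hs).fun_div (hasDerivAt_id _) hs.ne'
  have h1 : HasFDerivAt (fun x => g1 (smod ε x) / smod ε x) _ x :=
    hd.comp_hasFDerivAt x (hasFDerivAt_smod hε x)
  have h2 := hasFDerivAt_coord k x
  rw [fderiv_radial hε hg, (h1.fun_mul h2).fderiv]
  have h3 := fderiv_comp_smod hε hd i
  rw [h1.fderiv] at h3
  simp only [_root_.add_apply, _root_.smul_apply, smul_eq_mul] at h3 ⊢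
  rw [h3]
  simp [Pi.single_apply, eq_comm]
  ring

lemma abs_fderiv_radial_le (hε : 0 < ε) (hg : ∀ s, 0 < s → HasDerivAt g (g1 s) s) (k : Fin 3)
    (x : E3) : |fderiv ℝ (fun x => g (smod ε x)) x (bvec k)| ≤ |g1 (smod ε x)| := by
  have hs := smod_pos hε x
  rw [fderiv_comp_smod hε (hg _ hs), abs_mul, abs_div, abs_of_pos hs]
  refine mul_le_of_le_one_right (abs_nonneg _) ((div_le_one hs).2 ?_)
  exact (abs_coord_le x k).trans (norm_le_smod ε x)

/-- The second derivative is `(g'' - g'/s) x_i x_k / s² + δ_{ik} g'/s`, and `|x_i|, |x_k| ≤ s`. -/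
lemma abs_fderiv_fderiv_radial_le (hε : 0 < ε) (hg : ∀ s, 0 < s → HasDerivAt g (g1 s) s)
    (hg1 : ∀ s, 0 < s → HasDerivAt g1 (g2 s) s) (i k : Fin 3) (x : E3) :
    |fderiv ℝ (fun x => fderiv ℝ (fun x => g (smod ε x)) x (bvec k)) x (bvec i)| ≤
      |g2 (smod ε x)| + 2 * (|g1 (smod ε x)| / smod ε x) := by
  rw [fderiv_fderiv_radial hε hg hg1]
  set s := smod ε x with hs'
  have hs : 0 < s := smod_pos hε x
  have hi : |x i| ≤ s := (abs_coord_le x i).trans (norm_le_smod ε x)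
  have hk : |x k| ≤ s := (abs_coord_le x k).trans (norm_le_smod ε x)
  have e : (g2 s * s - g1 s) / s ^ 2 * (x i / s) * x k = (g2 s - g1 s / s) * (x i / s * (x k / s))
      := by
    field_simp
  have h1 : |x i / s * (x k / s)| ≤ 1 := by
    rw [abs_mul, abs_div, abs_div, abs_of_pos hs]
    exact mul_le_one₀ ((div_le_one hs).2 hi) (by positivity) ((div_le_one hs).2 hk)
  have h2 : |(if i = k then 1 else 0 : ℝ)| ≤ 1 := by split_ifs <;> simp
  rw [e]
  calc _ ≤ |(g2 s - g1 s / s) * (x i / s * (x k / s))| + |g1 s / s * (if i = k then 1 else 0)| :=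
        abs_add_le _ _
    _ ≤ (|g2 s| + |g1 s / s|) * 1 + |g1 s / s| * 1 := by
        rw [abs_mul (_ - _), abs_mul (g1 s / s)]
        exact add_le_add (mul_le_mul (abs_sub _ _) h1 (abs_nonneg _) (by positivity))
          (mul_le_mul_of_nonneg_left h2 (abs_nonneg _))
    _ = _ := by rw [abs_div, abs_of_pos hs]; ring

/-- With `Q = |x|²/s² ∈ [0, 1]` the Laplacian is `g'' Q + (g'/s)(3 - Q)`. A decreasing profile makes
the second term nonpositive: the part that would be singular at the origin has the favourable sign,
and only an upper bound is needed. -/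
lemma laplacian_radial_le (hε : 0 < ε) (hg : ∀ s, 0 < s → HasDerivAt g (g1 s) s)
    (hg1 : ∀ s, 0 < s → HasDerivAt g1 (g2 s) s) (hneg : ∀ s, 0 < s → g1 s ≤ 0) (x : E3) :
    ∑ i, fderiv ℝ (fun x => fderiv ℝ (fun x => g (smod ε x)) x (bvec i)) x (bvec i) ≤
      |g2 (smod ε x)| := by
  simp_rw [fderiv_fderiv_radial hε hg hg1]
  set s := smod ε x with hs'
  have hs : 0 < s := smod_pos hε x
  have h0 := hneg s hs
  have hsq : ∑ i, x i ^ 2 ≤ s ^ 2 := by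
    rw [← norm_sq_eq_sum, smod_sq]; nlinarith [sq_nonneg ε]
  have e : ∑ i, ((g2 s * s - g1 s) / s ^ 2 * (x i / s) * x i + g1 s / s * 1) =
      g2 s * ((∑ i, x i ^ 2) / s ^ 2) + g1 s / s * (3 - (∑ i, x i ^ 2) / s ^ 2) := by
    simp only [Fin.sum_univ_three]
    field_simp
    ring
  simp only [if_true]
  rw [e]
  have hq : (∑ i, x i ^ 2) / s ^ 2 ≤ 1 := (div_le_one (by positivity)).2 hsq
  have hq0 : 0 ≤ (∑ i, x i ^ 2) / s ^ 2 := by positivity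
  set Q := (∑ i, x i ^ 2) / s ^ 2
  have h1 : g2 s * Q ≤ |g2 s| := by
    calc g2 s * Q ≤ |g2 s| * 1 := mul_le_mul (le_abs_self _) hq hq0 (abs_nonneg _)
      _ = _ := mul_one _
  have h2 : g1 s / s * (3 - Q) ≤ 0 :=
    mul_nonpos_of_nonpos_of_nonneg (div_nonpos_of_nonpos_of_nonneg h0 hs.le) (by linarith)
  linarith

end Radial

/-- The radial profile of the test functions. -/
noncomputable def prof (γ N s : ℝ) : ℝ := (1 + s) ^ (-γ) * Real.smoothTransition (2 - s / N)

/-- The derivative of `prof` in `s`; `prof2` is the second one. The cutoff factor is `1` for `s ≤ N`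
and `0` for `s ≥ 2N` when `N > 0`. -/
noncomputable def prof1 (γ N s : ℝ) : ℝ :=
  -γ * (1 + s) ^ (-γ - 1) * Real.smoothTransition (2 - s / N) +
    (1 + s) ^ (-γ) * (deriv Real.smoothTransition (2 - s / N) * (-1 / N))

noncomputable def prof2 (γ N s : ℝ) : ℝ :=
  -γ * ((-γ - 1) * (1 + s) ^ (-γ - 1 - 1)) * Real.smoothTransition (2 - s / N) +
    -γ * (1 + s) ^ (-γ - 1) * (deriv Real.smoothTransition (2 - s / N) * (-1 / N)) +
    (-γ * (1 + s) ^ (-γ - 1) * (deriv Real.smoothTransition (2 - s / N) * (-1 / N)) +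
    (1 + s) ^ (-γ) * (deriv (deriv Real.smoothTransition) (2 - s / N) * (-1 / N) * (-1 / N)))

lemma hasDerivAt_one_add_rpow (a : ℝ) {s : ℝ} (hs : 0 < s) :
    HasDerivAt (fun s : ℝ => (1 + s) ^ a) (a * (1 + s) ^ (a - 1)) s := by
  have := ((hasDerivAt_id s).const_add 1).rpow_const (p := a) (Or.inl (by simp; linarith))
  simpa using this

lemma hasDerivAt_cut (N s : ℝ) : HasDerivAt (fun s : ℝ => 2 - s / N) (-1 / N) s := by
  have := ((hasDerivAt_id s).div_const N).const_sub 2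
  simpa [neg_div] using this

lemma hasDerivAt_smoothTransition_cut (N s : ℝ) :
    HasDerivAt (fun s => Real.smoothTransition (2 - s / N))
      (deriv Real.smoothTransition (2 - s / N) * (-1 / N)) s :=
  ((Real.smoothTransition.contDiff (n := 1)).differentiable (by norm_num) _).hasDerivAt.comp s
    (hasDerivAt_cut N s)

lemma hasDerivAt_deriv_smoothTransition_cut (N s : ℝ) :
    HasDerivAt (fun s => deriv Real.smoothTransition (2 - s / N))
      (deriv (deriv Real.smoothTransition) (2 - s / N) * (-1 / N)) s :=
  (contDiff_deriv_smoothTransition.differentiable (by simp) _).hasDerivAt.comp s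
    (hasDerivAt_cut N s)

lemma hasDerivAt_prof (γ N : ℝ) {s : ℝ} (hs : 0 < s) :
    HasDerivAt (prof γ N) (prof1 γ N s) s :=
  (hasDerivAt_one_add_rpow (-γ) hs).fun_mul (hasDerivAt_smoothTransition_cut N s)

lemma hasDerivAt_prof1 (γ N : ℝ) {s : ℝ} (hs : 0 < s) :
    HasDerivAt (prof1 γ N) (prof2 γ N s) s :=
  (((hasDerivAt_one_add_rpow (-γ - 1) hs).const_mul (-γ)).fun_mul
    (hasDerivAt_smoothTransition_cut N s)).fun_add ((hasDerivAt_one_add_rpow (-γ) hs).fun_mul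
      ((hasDerivAt_deriv_smoothTransition_cut N s).mul_const (-1 / N)))

/-- Bounds for the derivatives of the cutoff, uniform in its scale. -/
lemma abs_cut_le {M : ℝ} (hM : ∀ x, |deriv Real.smoothTransition x| ≤ M ∧
    |deriv (deriv Real.smoothTransition) x| ≤ M) {N s : ℝ} (hN : 1 ≤ N) (hs : 0 < s) :
    (1 + s) * |deriv Real.smoothTransition (2 - s / N) * (-1 / N)| ≤ 3 * M ∧
    (1 + s) ^ 2 * |deriv (deriv Real.smoothTransition) (2 - s / N) * (-1 / N) * (-1 / N)| ≤
      9 * M := by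
  have hN0 : 0 < N := by linarith
  have hM0 : 0 ≤ M := (abs_nonneg _).trans (hM 0).1
  by_cases h : 2 - s / N < 0
  · obtain ⟨h1, h2⟩ := deriv_smoothTransition_eq_zero (Or.inl h)
    rw [h1, h2]
    simp [hM0]
  -- Where the derivatives of the cutoff may be nonzero one has `s ≤ 2N`, hence `(1 + s)/N ≤ 3`
  -- because `N ≥ 1`: each factor `1/N` is worth `3/(1 + s)`.
  · have h3 : s ≤ 2 * N := by
      rw [not_lt, sub_nonneg, div_le_iff₀ hN0] at h; exact h
    have h4 : (1 + s) * (1 / N) ≤ 3 := by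
      rw [mul_one_div, div_le_iff₀ hN0]; linarith
    have h5 : |(-1 / N : ℝ)| = 1 / N := by rw [abs_div, abs_neg, abs_one, abs_of_pos hN0]
    obtain ⟨m1, m2⟩ := hM (2 - s / N)
    have h0 : 0 ≤ (1 + s) * (1 / N) := by positivity
    constructor
    · rw [abs_mul, h5]
      calc _ = (1 + s) * (1 / N) * |deriv Real.smoothTransition (2 - s / N)| := by ring
        _ ≤ 3 * M := by gcongr
    · rw [abs_mul, abs_mul, h5]
      calc _ = ((1 + s) * (1 / N)) ^ 2 * |deriv (deriv Real.smoothTransition) (2 - s / N)| := by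
            ring
        _ ≤ 3 ^ 2 * M := by gcongr
        _ = _ := by norm_num

/-- Every derivative gains a factor `(1 + s)⁻¹`, uniformly in `N`, whether it falls on the power or
on the cutoff. The constant comes from the second derivative: `γ(γ + 1) ≤ 6` and `2γ · 3M + 9M ≤
21M`. -/
lemma prof_bounds {M : ℝ} (hM : ∀ x, |deriv Real.smoothTransition x| ≤ M ∧
    |deriv (deriv Real.smoothTransition) x| ≤ M) {γ N s : ℝ} (hγ : 0 < γ) (hγ' : γ ≤ 2) (hN : 1 ≤ N)
    (hs : 0 < s) : |prof1 γ N s| ≤ (6 + 21 * M) * (1 + s) ^ (-(γ + 1)) ∧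
      |prof2 γ N s| ≤ (6 + 21 * M) * (1 + s) ^ (-(γ + 2)) := by
  obtain ⟨b1, b2⟩ := abs_cut_le hM hN hs
  have hM0 : 0 ≤ M := (abs_nonneg _).trans (hM 0).1
  have ht : 0 < 1 + s := by linarith
  set σ := Real.smoothTransition (2 - s / N) with hσ
  have hσ1 : |σ| ≤ 1 := by
    rw [abs_of_nonneg (Real.smoothTransition.nonneg _)]; exact Real.smoothTransition.le_one _
  set τ1 := deriv Real.smoothTransition (2 - s / N) * (-1 / N)
  set τ2 := deriv (deriv Real.smoothTransition) (2 - s / N) * (-1 / N) * (-1 / N)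
  set P := (1 + s) ^ (-(γ + 2)) with hP
  have hP0 : 0 < P := Real.rpow_pos_of_pos ht _
  have e1 : (1 + s) ^ (-γ - 1) = P * (1 + s) := by
    rw [hP, ← Real.rpow_add_one ht.ne']; congr 1; ring
  have e0 : (1 + s) ^ (-γ) = P * (1 + s) ^ 2 := by
    rw [hP, ← Real.rpow_natCast, ← Real.rpow_add ht]; congr 1; push_cast; ring
  have e2 : (1 + s) ^ (-γ - 1 - 1) = P := by rw [hP]; congr 1; ring
  have e3 : (1 + s) ^ (-(γ + 1)) = P * (1 + s) := by rw [← e1]; congr 1; ring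
  have f1 : prof1 γ N s = P * (1 + s) * (-γ * σ + (1 + s) * τ1) := by
    rw [prof1, e1, e0]; ring
  have f2 : prof2 γ N s = P * (γ * (γ + 1) * σ - 2 * γ * ((1 + s) * τ1) + (1 + s) ^ 2 * τ2) := by
    rw [prof2, e1, e0, e2]; ring
  have a1 : |(1 + s) * τ1| ≤ 3 * M := by rwa [abs_mul, abs_of_pos ht]
  have a2 : |(1 + s) ^ 2 * τ2| ≤ 9 * M := by rwa [abs_mul, abs_of_pos (by positivity)]
  constructor
  · rw [f1, e3, abs_mul, abs_of_pos (by positivity), mul_comm]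
    refine mul_le_mul_of_nonneg_right ?_ (by positivity)
    calc |-γ * σ + (1 + s) * τ1| ≤ |-γ * σ| + |(1 + s) * τ1| := abs_add_le _ _
      _ ≤ 2 * 1 + 3 * M := by
          rw [abs_mul, abs_neg, abs_of_pos hγ]
          gcongr
      _ ≤ _ := by linarith
  · rw [f2, abs_mul, abs_of_pos hP0, mul_comm]
    refine mul_le_mul_of_nonneg_right ?_ hP0.le
    calc _ ≤ |γ * (γ + 1) * σ| + |2 * γ * ((1 + s) * τ1)| + |(1 + s) ^ 2 * τ2| :=
          (abs_add_le _ _).trans (add_le_add_left (abs_sub _ _) _)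
      _ ≤ 2 * (2 + 1) * 1 + 2 * 2 * (3 * M) + 9 * M := by
          rw [abs_mul (γ * (γ + 1)), abs_mul (2 * γ), abs_of_pos (by positivity : 0 < γ * (γ + 1)),
            abs_of_pos (by positivity : 0 < 2 * γ)]
          gcongr
      _ = _ := by ring

lemma prof1_nonpos {γ N s : ℝ} (hγ : 0 < γ) (hN : 1 ≤ N) (hs : 0 < s) : prof1 γ N s ≤ 0 := by
  have h1 : 0 ≤ deriv Real.smoothTransition (2 - s / N) :=
      Real.smoothTransition.monotone.deriv_nonneg
  have h2 := Real.smoothTransition.nonneg (2 - s / N)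
  have h3 : 0 < (1 + s) ^ (-γ - 1) := Real.rpow_pos_of_pos (by linarith) _
  have h4 : 0 < (1 + s) ^ (-γ) := Real.rpow_pos_of_pos (by linarith) _
  have hN0 : 0 < N := by linarith
  have h5 : 0 ≤ γ * (1 + s) ^ (-γ - 1) * Real.smoothTransition (2 - s / N) +
      (1 + s) ^ (-γ) * (deriv Real.smoothTransition (2 - s / N) * (1 / N)) := by positivity
  rw [prof1, neg_div]
  linarith

lemma contDiff_prof_smod (γ N : ℝ) {ε : ℝ} (hε : 0 < ε) :
    ContDiff ℝ ∞ fun x => prof γ N (smod ε x) := by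
  have hs := contDiff_smod hε
  have h1 : ContDiff ℝ ∞ fun x => (1 + smod ε x) ^ (-γ) :=
    (contDiff_const.add hs).rpow_const_of_ne fun x => by
      have := smod_pos hε x
      positivity
  exact h1.mul (Real.smoothTransition.contDiff.comp (contDiff_const.sub (hs.div_const N)))

/-- Smooth, compactly supported approximations of the weight. -/
lemma exists_testFun {γ : ℝ} (hγ : 0 < γ) (hγ' : γ ≤ 2) : ∃ C : ℝ, 0 ≤ C ∧ ∃ Φ : ℕ → E3 → ℝ,
    (∀ n, ContDiff ℝ ∞ (Φ n)) ∧ (∀ n, HasCompactSupport (Φ n)) ∧ (∀ n x, 0 ≤ Φ n x) ∧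
    (∀ n x, Φ n x ≤ weight γ x) ∧
    (∀ x, Tendsto (fun n => Φ n x) atTop (𝓝 (weight γ x))) ∧
    (∀ n k x, |fderiv ℝ (Φ n) x (bvec k)| ≤ C * weight (γ + 1) x) ∧
    (∀ n i k x, x ≠ 0 → |fderiv ℝ (fun x => fderiv ℝ (Φ n) x (bvec k)) x (bvec i)| ≤
      C * (weight (γ + 1) x * ‖x‖⁻¹)) ∧
    (∀ n x, ∑ i, fderiv ℝ (fun x => fderiv ℝ (Φ n) x (bvec i)) x (bvec i) ≤ C * weight γ x) := by
  obtain ⟨M, hM0, hM⟩ := exists_bound_smoothTransition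
  have hε : ∀ n : ℕ, (0 : ℝ) < 1 / (n + 1) := fun n => by positivity
  have hN : ∀ n : ℕ, (1 : ℝ) ≤ n + 1 := fun n => by linarith [(n.cast_nonneg : (0:ℝ) ≤ n)]
  have hw : ∀ (ε a : ℝ) (x : E3), 0 ≤ a → (1 + smod ε x) ^ (-a) ≤ weight a x := fun ε a x ha => by
    rw [weight_eq]
    exact Real.rpow_le_rpow_of_nonpos (one_add_norm_pos x) (by linarith [norm_le_smod ε x])
      (by linarith)
  set D := 6 + 21 * M
  have hD : 0 ≤ D := by positivity
  -- The smoothing scale `1/(n + 1)` tends to `0` while the cutoff radius `n + 1` tends to infinity.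
  -- The factor `3` comes from the Hessian bound `|g''| + 2 |g'|/s`.
  refine ⟨3 * D, by positivity, fun n x => prof γ (n + 1) (smod (1 / (n + 1)) x),
    fun n => contDiff_prof_smod γ _ (hε n), fun n => ?_, fun n x => ?_, fun n x => ?_, fun x => ?_,
    fun n k x => ?_, fun n i k x hx => ?_, fun n x => ?_⟩
  · refine hasCompactSupport_of_outside (R := 2 * (n + 1)) fun x hx => ?_
    have hN0 : (0 : ℝ) < n + 1 := by linarith [hN n]
    change (1 + smod _ x) ^ (-γ) * Real.smoothTransition (2 - smod _ x / (n + 1)) = 0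
    rw [Real.smoothTransition.zero_of_nonpos, mul_zero]
    rw [sub_nonpos, le_div_iff₀ hN0]
    exact hx.le.trans (norm_le_smod _ x)
  · have := smod_pos (hε n) x
    exact mul_nonneg (Real.rpow_nonneg (by positivity) _) (Real.smoothTransition.nonneg _)
  · have := smod_pos (hε n) x
    exact (mul_le_of_le_one_right (Real.rpow_nonneg (by positivity) _)
      (Real.smoothTransition.le_one _)).trans (hw _ _ _ hγ.le)
  · have h1 : Tendsto (fun n : ℕ => smod (1 / ((n : ℝ) + 1)) x) atTop (𝓝 ‖x‖) := by
      have h := tendsto_one_div_add_atTop_nhds_zero_nat (𝕜 := ℝ)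
      have h2 := (Real.continuous_sqrt.tendsto _).comp ((h.pow 2).add_const (‖x‖ ^ 2))
      rw [zero_pow two_ne_zero, zero_add, Real.sqrt_sq (norm_nonneg x)] at h2
      exact h2
    have h2 : Tendsto (fun n : ℕ => (1 + smod (1 / ((n : ℝ) + 1)) x) ^ (-γ)) atTop
        (𝓝 (weight γ x)) := by
      rw [weight_eq]
      exact (h1.const_add 1).rpow_const (Or.inl (one_add_norm_pos x).ne')
    have h3 : Tendsto (fun n : ℕ => 2 - smod (1 / ((n : ℝ) + 1)) x / ((n : ℝ) + 1)) atTop (𝓝 2)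
        := by
      have h4 := h1.mul (tendsto_one_div_add_atTop_nhds_zero_nat (𝕜 := ℝ))
      rw [mul_zero] at h4
      simpa [div_eq_mul_inv] using h4.const_sub 2
    have h5 := h2.mul ((Real.smoothTransition.continuous.tendsto 2).comp h3)
    rw [Real.smoothTransition.one_of_one_le (by norm_num), mul_one] at h5
    exact h5
  · have hs := smod_pos (hε n) x
    refine (abs_fderiv_radial_le (hε n) (fun s hs => hasDerivAt_prof γ _ hs) k x).trans ?_
    refine (prof_bounds hM hγ hγ' (hN n) hs).1.trans ?_
    have h1 := hw (1 / (n + 1)) (γ + 1) x (by linarith)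
    have h2 := (weight_pos (γ + 1) x).le
    nlinarith [mul_le_mul_of_nonneg_left h1 hD, mul_nonneg hD h2]
  · have hs := smod_pos (hε n) x
    have hx' : 0 < ‖x‖ := norm_pos_iff.2 hx
    refine (abs_fderiv_fderiv_radial_le (hε n) (fun s hs => hasDerivAt_prof γ _ hs)
      (fun s hs => hasDerivAt_prof1 γ _ hs) i k x).trans ?_
    obtain ⟨p1, p2⟩ := prof_bounds hM hγ hγ' (hN n) hs
    have hsx := norm_le_smod (1 / ((n : ℝ) + 1)) x
    set s := smod (1 / ((n : ℝ) + 1)) x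
    have h1 := hw (1 / (n + 1)) (γ + 1) x (by linarith)
    have ht : 0 < 1 + s := by linarith
    have hinv : s⁻¹ ≤ ‖x‖⁻¹ := inv_anti₀ hx' hsx
    -- One factor `(1 + s)⁻¹` of the second derivative is given up for `s⁻¹`, to match the term
    -- `g'/s`, which has no better bound uniformly in the smoothing scale.
    have e2 : (1 + s) ^ (-(γ + 2)) ≤ (1 + s) ^ (-(γ + 1)) * s⁻¹ := by
      have : (1 + s) ^ (-(γ + 2)) = (1 + s) ^ (-(γ + 1)) * (1 + s)⁻¹ := by
        rw [← Real.rpow_neg_one, ← Real.rpow_add ht]; congr 1; ring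
      rw [this]
      exact mul_le_mul_of_nonneg_left (inv_anti₀ hs (by linarith)) (Real.rpow_nonneg ht.le _)
    have hq : 0 ≤ (1 + s) ^ (-(γ + 1)) := Real.rpow_nonneg ht.le _
    calc _ ≤ D * ((1 + s) ^ (-(γ + 1)) * s⁻¹) + 2 * (D * (1 + s) ^ (-(γ + 1)) * s⁻¹) := by
          rw [div_eq_mul_inv]
          gcongr
          exact p2.trans (mul_le_mul_of_nonneg_left e2 hD)
      _ = 3 * D * ((1 + s) ^ (-(γ + 1)) * s⁻¹) := by ring
      _ ≤ 3 * D * (weight (γ + 1) x * ‖x‖⁻¹) := by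
          have := (weight_pos (γ + 1) x).le
          gcongr
  · have hs := smod_pos (hε n) x
    refine (laplacian_radial_le (hε n) (fun s hs => hasDerivAt_prof γ _ hs)
      (fun s hs => hasDerivAt_prof1 γ _ hs) (fun s hs => prof1_nonpos hγ (hN n) hs) x).trans ?_
    refine (prof_bounds hM hγ hγ' (hN n) hs).2.trans ?_
    have h1 := hw (1 / (n + 1)) (γ + 2) x (by linarith)
    have h2 := weight_anti (show γ ≤ γ + 2 by linarith) x
    have h3 := (weight_pos γ x).le
    nlinarith [mul_le_mul_of_nonneg_left (h1.trans h2) hD, mul_nonneg hD h3]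

/-- Smooth compactly supported functions comparable to the weight. -/
structure IsTestWeight (γ C : ℝ) (Φ : E3 → ℝ) : Prop where
  contDiff : ContDiff ℝ ∞ Φ
  hasCompactSupport : HasCompactSupport Φ
  nonneg : ∀ x, 0 ≤ Φ x
  le_weight : ∀ x, Φ x ≤ weight γ x
  grad_le : ∀ k x, |fderiv ℝ Φ x (bvec k)| ≤ C * weight (γ + 1) x
  hess_le : ∀ i k x, x ≠ 0 → |fderiv ℝ (fun x => fderiv ℝ Φ x (bvec k)) x (bvec i)| ≤
      C * (weight (γ + 1) x * ‖x‖⁻¹)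
  lap_le : ∀ x, ∑ i, fderiv ℝ (fun x => fderiv ℝ Φ x (bvec i)) x (bvec i) ≤ C * weight γ x

lemma exists_isTestWeight {γ : ℝ} (hγ : 0 < γ) (hγ' : γ ≤ 2) : ∃ C : ℝ, 0 ≤ C ∧ ∃ Φ : ℕ → E3 → ℝ,
    (∀ n, IsTestWeight γ C (Φ n)) ∧
    (∀ x, Tendsto (fun n => Φ n x) atTop (𝓝 (weight γ x))) := by
  obtain ⟨C, hC, Φ, h1, h2, h3, h4, h5, h6, h7, h8⟩ := exists_testFun hγ hγ'
  exact ⟨C, hC, Φ, fun n => ⟨h1 n, h2 n, h3 n, h4 n, h6 n, h7 n, h8 n⟩, h5⟩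

/-! ### Estimates of the terms of the energy balance on a time slice -/

/-- Properties of the time slices of a solution. -/
structure IsSlice (γ : ℝ) (u : E3 → E3) (Du : E3 → Tensor3) (b : E3 → E3) (F : E3 → Tensor3)
    (p₁ p₂ : E3 → ℝ) : Prop where
  u_meas : AEStronglyMeasurable u volume
  Du_meas : AEStronglyMeasurable Du volume
  b_meas : AEStronglyMeasurable b volume
  F_meas : AEStronglyMeasurable F volume
  p₁_meas : AEStronglyMeasurable p₁ volume
  p₂_meas : AEStronglyMeasurable p₂ volume
  u_lt : wNorm 2 γ u < ⊤
  Du_lt : wNorm 2 γ Du < ⊤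
  b_lt : wNorm 3 (3 * γ / 2) b < ⊤
  F_lt : wNorm 2 γ F < ⊤
  p₁_lt : wNorm (6 / 5) (6 * γ / 5) p₁ < ⊤
  p₂_lt : wNorm 2 γ p₂ < ⊤
  h1loc : ∀ j, H1loc (fun x => u x j) (fun i x => Du x (i, j))
  riesz₁ : IsRieszRieszSum (fun x => tensorProd (b x) (u x)) p₁
  riesz₂ : IsRieszRieszSum F p₂

/-- Hölder exponents for `b ⊗ u`, with `b` in `L³` and `u` in `L²`. The next two triples serve
`|u|²` in `L^{3/2}` and the transport term `b |u|²`. -/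
instance holderTriple_three_two : ENNReal.HolderTriple 3 2 (6 / 5) := ⟨by
  rw [ENNReal.inv_div (by norm_num) (by norm_num)]
  rw [← ENNReal.toReal_eq_toReal_iff' (by simp) (by simp [ENNReal.div_eq_top])]
  rw [ENNReal.toReal_add (by simp) (by simp)]
  simp
  norm_num⟩

instance holderTriple_two_six : ENNReal.HolderTriple 2 6 (3 / 2) := ⟨by
  rw [ENNReal.inv_div (by norm_num) (by norm_num)]
  rw [← ENNReal.toReal_eq_toReal_iff' (by simp) (by simp [ENNReal.div_eq_top])]
  rw [ENNReal.toReal_add (by simp) (by simp)]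
  simp
  norm_num⟩

instance holderTriple_three_three_halves : ENNReal.HolderTriple 3 (3 / 2) 1 := ⟨by
  rw [inv_one, ENNReal.inv_div (by norm_num) (by norm_num)]
  rw [← ENNReal.toReal_eq_toReal_iff' (by simp [ENNReal.div_eq_top]) (by norm_num)]
  rw [ENNReal.toReal_add (by simp) (by simp [ENNReal.div_eq_top])]
  simp
  norm_num⟩

lemma wNorm_two {V : Type*} [NormedAddCommGroup V] [NormedSpace ℝ V] (γ : ℝ) (f : E3 → V) :
    wNorm 2 γ f = eLpNorm (fun x => weight (γ / 2) x • f x) 2 volume :=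
  wNorm_eq (by norm_num) (by norm_num) (by simp) f

/-- The weight exponents are tuned to integrability: `u`, `∇u`, `F` and `b` all carry the factor
`w_{γ/2}`, and the pressure of `b ⊗ u` carries the product `w_γ` of two of them. -/
lemma wNorm_three {V : Type*} [NormedAddCommGroup V] [NormedSpace ℝ V] (γ : ℝ) (f : E3 → V) :
    wNorm 3 (3 * γ / 2) f = eLpNorm (fun x => weight (γ / 2) x • f x) 3 volume :=
  wNorm_eq (by norm_num) (by norm_num) (by simp; ring) f

lemma six_fifths_ne_top : (6 / 5 : ℝ≥0∞) ≠ ⊤ := by simp [ENNReal.div_eq_top]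

lemma six_fifths_ne_zero : (6 / 5 : ℝ≥0∞) ≠ 0 := by simp

lemma wNorm_six_fifths {V : Type*} [NormedAddCommGroup V] [NormedSpace ℝ V] (γ : ℝ) (f : E3 → V) :
    wNorm (6 / 5) (6 * γ / 5) f = eLpNorm (fun x => weight γ x • f x) (6 / 5) volume :=
  wNorm_eq six_fifths_ne_zero six_fifths_ne_top (by simp; ring) f

/-- Weighted Sobolev and Hardy inequalities for slices. -/
lemma exists_sobolev_hardy : ∃ A : ℝ≥0∞, A ≠ ⊤ ∧ ∀ γ : ℝ, 0 < γ → γ ≤ 2 →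
    ∀ (u : E3 → E3) (Du : E3 → Tensor3), AEStronglyMeasurable u volume →
    AEStronglyMeasurable Du volume → (∀ j, H1loc (fun x => u x j) (fun i x => Du x (i, j))) →
    eLpNorm (fun x => weight (γ / 2) x • u x) 6 volume ≤ A * (wNorm 2 γ u + wNorm 2 γ Du) ∧
    eLpNorm (fun x => ‖x‖⁻¹ • weight (γ / 2) x • u x) 2 volume ≤
      A * (wNorm 2 γ u + wNorm 2 γ Du) := by
  obtain ⟨A, hA, h⟩ := exists_weighted_bound
  refine ⟨A * (sobolevConst + 2), ENNReal.mul_ne_top hA (ENNReal.add_ne_top.2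
    ⟨sobolevConst_ne_top, by norm_num⟩), fun γ h0 h2 u Du hu hDu hH => ⟨?_, ?_⟩⟩
  · have := h γ h0 h2 u Du hu hDu hH (fun _ => 1) 6 sobolevConst aestronglyMeasurable_const
      (by norm_num) (fun v Dv hv => by simpa using hv.eLpNorm_six_le)
    simp only [one_smul] at this
    refine this.trans ?_
    gcongr
    exact le_self_add
  · have := h γ h0 h2 u Du hu hDu hH (fun x => ‖x‖⁻¹) 2 2
      (measurable_norm.inv.aestronglyMeasurable)
      (by norm_num) (fun v Dv hv => hv.eLpNorm_hardy_le)
    refine this.trans ?_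
    gcongr
    exact le_add_self

section Slice

variable {γ C : ℝ} {Φ : E3 → ℝ} {u : E3 → E3} {Du : E3 → Tensor3} {b : E3 → E3} {F : E3 → Tensor3}
  {p₁ p₂ : E3 → ℝ}

lemma IsTestWeight.const_nonneg (h : IsTestWeight γ C Φ) : 0 ≤ C := by
  have h1 := (abs_nonneg _).trans (h.grad_le 0 0)
  exact nonneg_of_mul_nonneg_left h1 (weight_pos _ _)

/-- The gradient of the test weight decays like `w_{γ+1}`, and any slower decay may be used. The
cubic terms need `a = 3γ/2`, which is allowed exactly when `γ ≤ 2`. -/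
lemma IsTestWeight.abs_sum_le (h : IsTestWeight γ C Φ) {a : ℝ} (ha : a ≤ γ + 1) (v x : E3) :
    ‖∑ i, v i * fderiv ℝ Φ x (bvec i)‖ ≤ 3 * C * (weight a x * ‖v‖) := by
  calc _ ≤ ∑ i, ‖v i * fderiv ℝ Φ x (bvec i)‖ := norm_sum_le _ _
    _ ≤ ∑ i : Fin 3, ‖v‖ * (C * weight a x) := Finset.sum_le_sum fun i _ => by
        rw [norm_mul]
        refine mul_le_mul (PiLp.norm_apply_le v i) ((h.grad_le i x).trans ?_) (norm_nonneg _)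
          (norm_nonneg _)
        exact mul_le_mul_of_nonneg_left (weight_anti ha x) h.const_nonneg
    _ = _ := by simp; ring

lemma IsTestWeight.abs_sum_sum_le (h : IsTestWeight γ C Φ) (hγ : γ ≤
    γ + 1) (v x : E3) (G : Tensor3) :
    ‖∑ i, ∑ j, G (i, j) * v j * fderiv ℝ Φ x (bvec i)‖ ≤ 9 * C * (weight γ x * (‖G‖ * ‖v‖)) := by
  calc _ ≤ ∑ i, ∑ j, ‖G (i, j) * v j * fderiv ℝ Φ x (bvec i)‖ :=
        (norm_sum_le _ _).trans (Finset.sum_le_sum fun i _ => norm_sum_le _ _)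
    _ ≤ ∑ i : Fin 3, ∑ j : Fin 3, ‖G‖ * ‖v‖ * (C * weight γ x) :=
        Finset.sum_le_sum fun i _ => Finset.sum_le_sum fun j _ => by
        rw [norm_mul, norm_mul]
        refine mul_le_mul (mul_le_mul (PiLp.norm_apply_le G (i, j)) (PiLp.norm_apply_le v j)
          (norm_nonneg _) (norm_nonneg _)) ((h.grad_le i x).trans ?_) (norm_nonneg _)
              (by positivity)
        exact mul_le_mul_of_nonneg_left (weight_anti hγ x) h.const_nonneg
    _ = _ := by simp; ring

lemma IsTestWeight.abs_contraction_le (h : IsTestWeight γ C Φ) (x : E3) (G H : Tensor3) :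
    ‖(∑ i, ∑ j, G (i, j) * H (i, j)) * Φ x‖ ≤ 9 * (weight γ x * (‖G‖ * ‖H‖)) := by
  rw [norm_mul, Real.norm_of_nonneg (h.nonneg x)]
  calc _ ≤ (∑ i : Fin 3, ∑ j : Fin 3, ‖G‖ * ‖H‖) * weight γ x := by
        refine mul_le_mul ?_ (h.le_weight x) (h.nonneg x) (by positivity)
        refine (norm_sum_le _ _).trans (Finset.sum_le_sum fun i _ => (norm_sum_le _ _).trans
          (Finset.sum_le_sum fun j _ => ?_))
        rw [norm_mul]
        exact mul_le_mul (PiLp.norm_apply_le G (i, j)) (PiLp.norm_apply_le H (i, j))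
          (norm_nonneg _) (norm_nonneg _)
    _ = _ := by simp; ring

/-- Weighted Cauchy-Schwarz inequality. -/
lemma lintegral_le_wNorm_mul_wNorm {V W : Type*} [NormedAddCommGroup V] [NormedSpace ℝ V]
    [NormedAddCommGroup W] [NormedSpace ℝ W] {f : E3 → V} {g : E3 → W} {h : E3 → ℝ}
    (hf : AEStronglyMeasurable f volume) (hg : AEStronglyMeasurable g volume) {c : ℝ} (hc : 0 ≤ c)
    (hh : ∀ x, ‖h x‖ ≤ c * (weight γ x * (‖f x‖ * ‖g x‖))) :
    ∫⁻ x, ‖h x‖ₑ ≤ ENNReal.ofReal c * (wNorm 2 γ f * wNorm 2 γ g) := by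
  rw [wNorm_two, wNorm_two]
  refine le_trans ?_ (mul_le_mul_right (lintegral_enorm_mul_enorm_le (p := 2) (q := 2)
    ((continuous_weight (γ / 2)).aestronglyMeasurable.smul hf)
    ((continuous_weight (γ / 2)).aestronglyMeasurable.smul hg)) _)
  rw [← lintegral_const_mul' _ _ ENNReal.ofReal_ne_top]
  refine lintegral_mono fun x => ?_
  rw [← ofReal_norm, ← ofReal_norm, ← ofReal_norm, ← ENNReal.ofReal_mul (norm_nonneg _),
    ← ENNReal.ofReal_mul hc]
  refine ENNReal.ofReal_le_ofReal ((hh x).trans_eq ?_)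
  rw [Pi.smul_apply', Pi.smul_apply', norm_smul, norm_smul,
    Real.norm_of_nonneg (weight_pos _ x).le]
  have : weight γ x = weight (γ / 2) x * weight (γ / 2) x := by rw [weight_mul]; congr 1; ring
  rw [this]
  ring

/-- The transport term. -/
lemma IsTestWeight.lintegral_transport_le (h : IsTestWeight γ C Φ) (hγ : γ ≤ 2)
    (hu : AEStronglyMeasurable u volume) (hb : AEStronglyMeasurable b volume) :
    ∫⁻ x, ‖‖u x‖ ^ 2 / 2 * ∑ i, b x i * fderiv ℝ Φ x (bvec i)‖ₑ ≤
      ENNReal.ofReal (3 * C) * (wNorm 3 (3 * γ / 2) b * (wNorm 2 γ u *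
        eLpNorm (fun x => weight (γ / 2) x • u x) 6 volume)) := by
  have hC := h.const_nonneg
  have hwu : AEStronglyMeasurable (fun x => weight (γ / 2) x • u x) volume :=
    (continuous_weight (γ / 2)).aestronglyMeasurable.smul hu
  have hwb : AEStronglyMeasurable (fun x => weight (γ / 2) x • b x) volume :=
    (continuous_weight (γ / 2)).aestronglyMeasurable.smul hb
  set v := fun x => weight (γ / 2) x • u x with hv
  have h1 := eLpNorm_smul_le_mul_eLpNorm (p := 2) (q := 6) (r := 3 / 2) hwu.norm hwu.norm
  have h2 := lintegral_enorm_mul_enorm_le (p := 3) (q := 3 / 2) hwb (hwu.norm.smul hwu.norm)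
  rw [eLpNorm_norm, eLpNorm_norm] at h1
  rw [wNorm_three, wNorm_two]
  refine le_trans ?_ (mul_le_mul_right (h2.trans (mul_le_mul_right h1 _)) _)
  rw [← lintegral_const_mul' _ _ ENNReal.ofReal_ne_top]
  refine lintegral_mono fun x => ?_
  rw [← ofReal_norm, ← ofReal_norm, ← ofReal_norm, ← ENNReal.ofReal_mul (norm_nonneg _),
    ← ENNReal.ofReal_mul (by positivity)]
  refine ENNReal.ofReal_le_ofReal ?_
  -- One factor `w_{γ/2}` for `b` and one for each `u`, in `L³`, `L²` and `L⁶`.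
  have h3 := h.abs_sum_le (a := γ / 2 + (γ / 2 + γ / 2)) (by linarith) (b x) x
  rw [norm_mul]
  have h4 : ‖(‖u x‖ ^ 2 / 2 : ℝ)‖ ≤ ‖u x‖ ^ 2 := by
    rw [Real.norm_of_nonneg (by positivity)]; linarith [sq_nonneg ‖u x‖]
  refine (mul_le_mul h4 h3 (norm_nonneg _) (by positivity)).trans_eq ?_
  rw [← weight_mul, ← weight_mul]
  simp only [Pi.smul_apply', hv, smul_eq_mul, norm_mul, norm_smul, norm_norm,
    Real.norm_of_nonneg (weight_pos _ x).le]
  ring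

/-- The pressure term. -/
lemma IsTestWeight.lintegral_pressure_le (h : IsTestWeight γ C Φ) (hγ : γ ≤ 2)
    (hu : AEStronglyMeasurable u volume) (hp₁ : AEStronglyMeasurable p₁ volume) :
    ∫⁻ x, ‖p₁ x * ∑ i, u x i * fderiv ℝ Φ x (bvec i)‖ₑ ≤
      ENNReal.ofReal (3 * C) * (wNorm (6 / 5) (6 * γ / 5) p₁ *
        eLpNorm (fun x => weight (γ / 2) x • u x) 6 volume) := by
  have hC := h.const_nonneg
  rw [wNorm_six_fifths]
  refine le_trans ?_ (mul_le_mul_right (lintegral_enorm_mul_enorm_le (p := 6 / 5) (q := 6)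
    ((continuous_weight γ).aestronglyMeasurable.smul hp₁)
    ((continuous_weight (γ / 2)).aestronglyMeasurable.smul hu)) _)
  rw [← lintegral_const_mul' _ _ ENNReal.ofReal_ne_top]
  refine lintegral_mono fun x => ?_
  rw [← ofReal_norm, ← ofReal_norm, ← ofReal_norm, ← ENNReal.ofReal_mul (norm_nonneg _),
    ← ENNReal.ofReal_mul (by positivity)]
  refine ENNReal.ofReal_le_ofReal ?_
  have h3 := h.abs_sum_le (a := γ + γ / 2) (by linarith) (u x) x
  rw [norm_mul]
  refine (mul_le_mul_of_nonneg_left h3 (norm_nonneg _)).trans_eq ?_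
  rw [← weight_mul]
  simp only [Pi.smul_apply', norm_smul, Real.norm_of_nonneg (weight_pos _ x).le]
  ring

lemma norm_tensorProd_le (v w : E3) : ‖tensorProd v w‖ ≤ ‖v‖ * ‖w‖ := by
  rw [EuclideanSpace.norm_eq, EuclideanSpace.norm_eq, EuclideanSpace.norm_eq,
    ← Real.sqrt_mul (Finset.sum_nonneg fun _ _ => by positivity), Finset.sum_mul_sum,
    ← Finset.sum_product']
  refine Real.sqrt_le_sqrt (le_of_eq ?_)
  refine Finset.sum_congr rfl fun k _ => ?_
  simp [tensorProd, mul_pow]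

/-- Hölder's inequality with `1/3 + 1/2 = 5/6`, after comparing `ρ^{-γ/2}` with `w_γ` at the cost of
the factor `2`. -/
lemma eLpNorm_tensorProd_le (h0 : 0 < γ) (h2 : γ ≤ 2) (hu : AEStronglyMeasurable u volume)
    (hb : AEStronglyMeasurable b volume) :
    eLpNorm (fun x => rho x ^ (-(γ / 2)) • tensorProd (b x) (u x)) (6 / 5) volume ≤
      ENNReal.ofReal 2 * (wNorm 3 (3 * γ / 2) b * wNorm 2 γ u) := by
  have hwu : AEStronglyMeasurable (fun x => weight (γ / 2) x • u x) volume :=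
    (continuous_weight (γ / 2)).aestronglyMeasurable.smul hu
  have hwb : AEStronglyMeasurable (fun x => weight (γ / 2) x • b x) volume :=
    (continuous_weight (γ / 2)).aestronglyMeasurable.smul hb
  have h1 := eLpNorm_smul_le_mul_eLpNorm (p := 3) (q := 2) (r := 6 / 5) hwu.norm hwb.norm
  rw [eLpNorm_norm, eLpNorm_norm] at h1
  rw [wNorm_three, wNorm_two]
  refine le_trans ?_ (mul_le_mul_right h1 _)
  refine eLpNorm_le_mul_eLpNorm_of_ae_le_mul (Eventually.of_forall fun x => ?_) _
  have h3 := rho_rpow_neg_le_weight (a := γ / 2) (by linarith) (by linarith) x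
  rw [norm_smul, Real.norm_of_nonneg (Real.rpow_nonneg (rho_pos x).le _)]
  refine (mul_le_mul h3 (norm_tensorProd_le _ _) (norm_nonneg _)
    (mul_nonneg zero_le_two (weight_pos _ x).le)).trans_eq ?_
  rw [show 2 * (γ / 2) = γ / 2 + γ / 2 by ring, ← weight_mul]
  simp only [Pi.smul_apply', smul_eq_mul, norm_mul, norm_smul, norm_norm,
    Real.norm_of_nonneg (weight_pos _ x).le]
  ring

lemma aestronglyMeasurable_tensorProd (hu : AEStronglyMeasurable u volume)
    (hb : AEStronglyMeasurable b volume) :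
    AEStronglyMeasurable (fun x => tensorProd (b x) (u x)) volume := by
  have hc : Continuous fun z : E3 × E3 => tensorProd z.1 z.2 := by
    unfold tensorProd
    fun_prop
  exact hc.comp_aestronglyMeasurable (hb.prodMk hu)

end Slice

/-! ### The pressure terms, by duality -/

section PressureBounds

variable {γ C : ℝ} {Φ : E3 → ℝ} {u : E3 → E3} {Du : E3 → Tensor3} {b : E3 → E3} {F : E3 → Tensor3}
  {p₁ p₂ : E3 → ℝ}

/-- The gradient of `u · ∇Φ`. -/
noncomputable def gradDot (Φ : E3 → ℝ) (u : E3 → E3) (Du : E3 → Tensor3) (m : Fin 3) (x : E3) : ℝ :=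
  ∑ j, (fderiv ℝ Φ x (bvec j) * Du x (m, j) +
    fderiv ℝ (fun x => fderiv ℝ Φ x (bvec j)) x (bvec m) * u x j)

/-- The pressure is tested against `u · ∇Φ`, which is not smooth. It is a sum of products of
`H¹_loc` functions with smooth compactly supported ones, so estimates known for smooth test
functions extend to it. -/
lemma H1c_dot_grad (hΦ : ContDiff ℝ ∞ Φ) (hc : HasCompactSupport Φ)
    (h : ∀ j, H1loc (fun x => u x j) (fun i x => Du x (i, j))) :
    H1c (fun x => ∑ i, u x i * fderiv ℝ Φ x (bvec i)) (gradDot Φ u Du) := by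
  have hj := fun j => (h j).mul (contDiff_fderiv_bvec hΦ j) (hasCompactSupport_fderiv_bvec hc j)
  have h3 := ((hj 0).add (hj 1)).add (hj 2)
  convert h3 using 2
  · rw [Fin.sum_univ_three]; ring
  · unfold gradDot
    simp only [Fin.sum_univ_three]

lemma IsTestWeight.abs_gradDot_le (h : IsTestWeight γ C Φ) (m : Fin 3) {x : E3} (hx : x ≠ 0) :
    ‖gradDot Φ u Du m x‖ ≤ 3 * C * (weight (γ + 1) x * (‖Du x‖ + ‖x‖⁻¹ * ‖u x‖)) := by
  unfold gradDot
  calc _ ≤ ∑ j : Fin 3, (C * weight (γ + 1) x * ‖Du x‖ +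
        C * (weight (γ + 1) x * ‖x‖⁻¹) * ‖u x‖) := by
        refine (norm_sum_le _ _).trans (Finset.sum_le_sum fun j _ => (norm_add_le _ _).trans ?_)
        rw [norm_mul, norm_mul]
        have h1 := (abs_nonneg _).trans (h.grad_le j x)
        have h2 := (abs_nonneg _).trans (h.hess_le m j x hx)
        exact add_le_add (mul_le_mul (h.grad_le j x) (PiLp.norm_apply_le (Du x) (m, j))
          (norm_nonneg _) h1) (mul_le_mul (h.hess_le m j x hx) (PiLp.norm_apply_le (u x) j)
          (norm_nonneg _) h2)
    _ = _ := by simp; ring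

/-- The growing weight is beaten by the decay of `∇Φ`: `ρ^{γ/2} w_{γ+1} ≤ w_1 ≤ w_{γ/2}`, using `γ ≤
2`. The Hessian bound holds off the origin and costs a factor `|x|⁻¹`, to be handled by Hardy's
inequality. -/
lemma IsTestWeight.eLpNorm_gradDot_le (h : IsTestWeight γ C Φ) (h0 : 0 < γ) (h2 : γ ≤ 2)
    (hu : AEStronglyMeasurable u volume) (hDu : AEStronglyMeasurable Du volume) (m : Fin 3) :
    eLpNorm (fun x => rho x ^ (γ / 2) * gradDot Φ u Du m x) 2 volume ≤ ENNReal.ofReal (3 * C) *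
      (wNorm 2 γ Du + eLpNorm (fun x => ‖x‖⁻¹ • weight (γ / 2) x • u x) 2 volume) := by
  have hC := h.const_nonneg
  have hwD : AEStronglyMeasurable (fun x => weight (γ / 2) x • Du x) volume :=
    (continuous_weight (γ / 2)).aestronglyMeasurable.smul hDu
  have hwu : AEStronglyMeasurable (fun x => ‖x‖⁻¹ • weight (γ / 2) x • u x) volume :=
    (measurable_norm.inv.aestronglyMeasurable).smul
      ((continuous_weight (γ / 2)).aestronglyMeasurable.smul hu)
  rw [wNorm_two]
  refine le_trans ?_ (mul_le_mul_right ((eLpNorm_add_le (p :=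
      2) hwD.norm hwu.norm (by norm_num)).trans_eq
    (by rw [eLpNorm_norm, eLpNorm_norm])) _)
  refine eLpNorm_le_mul_eLpNorm_of_ae_le_mul ?_ _
  have hne : ∀ᵐ x : E3, x ≠ 0 := by
    rw [ae_iff]; simp
  filter_upwards [hne] with x hx
  have h3 := h.abs_gradDot_le (u := u) (Du := Du) m hx
  have h4 : rho x ^ (γ / 2) * weight (γ + 1) x ≤ weight (γ / 2) x := by
    refine (mul_le_mul_of_nonneg_right (rho_rpow_le_weight (by linarith) x)
      (weight_pos _ x).le).trans ?_
    rw [weight_mul]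
    exact weight_anti (by linarith) x
  have hw := (weight_pos (γ / 2) x).le
  rw [norm_mul, Real.norm_of_nonneg (Real.rpow_nonneg (rho_pos x).le _), Pi.add_apply,
    Real.norm_of_nonneg (add_nonneg (norm_nonneg _) (norm_nonneg _)), norm_smul, norm_smul,
    norm_smul, norm_inv, norm_norm, Real.norm_of_nonneg hw]
  calc _ ≤ rho x ^ (γ / 2) * (3 * C * (weight (γ + 1) x * (‖Du x‖ + ‖x‖⁻¹ * ‖u x‖))) :=
        mul_le_mul_of_nonneg_left h3 (Real.rpow_nonneg (rho_pos x).le _)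
    _ = 3 * C * (rho x ^ (γ / 2) * weight (γ + 1) x * (‖Du x‖ + ‖x‖⁻¹ * ‖u x‖)) := by ring
    _ ≤ 3 * C * (weight (γ / 2) x * (‖Du x‖ + ‖x‖⁻¹ * ‖u x‖)) := by gcongr
    _ = _ := by ring

lemma IsTestWeight.eLpNorm_dot_le (h : IsTestWeight γ C Φ) (h0 : 0 < γ) :
    eLpNorm (fun x => rho x ^ (γ / 2 / 2) * ∑ i, u x i * fderiv ℝ Φ x (bvec i)) 2 volume ≤
      ENNReal.ofReal (3 * C) * wNorm 2 γ u := by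
  have hC := h.const_nonneg
  rw [wNorm_two]
  refine eLpNorm_le_mul_eLpNorm_of_ae_le_mul (Eventually.of_forall fun x => ?_) _
  have hw := (weight_pos (γ / 2) x).le
  have h3 := h.abs_sum_le (a := γ) (by linarith) (u x) x
  have h4 : rho x ^ (γ / 2 / 2) * weight γ x ≤ weight (γ / 2) x := by
    refine (mul_le_mul_of_nonneg_right (rho_rpow_le_weight (by linarith) x)
      (weight_pos _ x).le).trans ?_
    rw [weight_mul]
    exact weight_anti (by linarith) x
  rw [norm_mul, Real.norm_of_nonneg (Real.rpow_nonneg (rho_pos x).le _), norm_smul,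
    Real.norm_of_nonneg hw]
  calc _ ≤ rho x ^ (γ / 2 / 2) * (3 * C * (weight γ x * ‖u x‖)) :=
        mul_le_mul_of_nonneg_left h3 (Real.rpow_nonneg (rho_pos x).le _)
    _ = 3 * C * (rho x ^ (γ / 2 / 2) * weight γ x * ‖u x‖) := by ring
    _ ≤ 3 * C * (weight (γ / 2) x * ‖u x‖) := by gcongr

lemma eLpNorm_force_le (h0 : 0 < γ) (h2 : γ ≤ 2) :
    eLpNorm (fun x => rho x ^ (-(γ / 2 / 2)) • F x) 2 volume ≤ ENNReal.ofReal 2 * wNorm 2 γ F := by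
  rw [wNorm_two]
  refine eLpNorm_le_mul_eLpNorm_of_ae_le_mul (Eventually.of_forall fun x => ?_) _
  have h3 := rho_rpow_neg_le_weight (a := γ / 2 / 2) (by linarith) (by linarith) x
  rw [show 2 * (γ / 2 / 2) = γ / 2 by ring] at h3
  rw [norm_smul, norm_smul, Real.norm_of_nonneg (Real.rpow_nonneg (rho_pos x).le _),
    Real.norm_of_nonneg (weight_pos _ x).le, ← mul_assoc]
  gcongr

/-- The pressure of the transport term. -/
lemma IsSlice.enorm_pressure₁_le (hs : IsSlice γ u Du b F p₁ p₂) (h : IsTestWeight γ C Φ)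
    (h0 : 0 < γ) (h2 : γ ≤ 2) :
    ‖∫ x, p₁ x * ∑ i, u x i * fderiv ℝ Φ x (bvec i)‖ₑ ≤
      9 * (ENNReal.ofReal 2 * (wNorm 3 (3 * γ / 2) b * wNorm 2 γ u) * (sobolevConst * 10 ^ 7)) *
      (ENNReal.ofReal (3 * C) * (3 * (wNorm 2 γ Du +
        eLpNorm (fun x => ‖x‖⁻¹ • weight (γ / 2) x • u x) 2 volume) + wNorm 2 γ u)) := by
  set N := eLpNorm (fun x => rho x ^ (-(γ / 2)) • tensorProd (b x) (u x)) (6 / 5) volume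
  have hN : N ≤ ENNReal.ofReal 2 * (wNorm 3 (3 * γ / 2) b * wNorm 2 γ u) :=
    eLpNorm_tensorProd_le h0 h2 hs.u_meas hs.b_meas
  have hNt : N ≠ ⊤ := (hN.trans_lt (ENNReal.mul_lt_top ENNReal.ofReal_lt_top
    (ENNReal.mul_lt_top hs.b_lt hs.u_lt))).ne
  set K := 9 * (N * (sobolevConst * 10 ^ 7))
  have hK : K ≠ ⊤ := ENNReal.mul_ne_top (by norm_num) (ENNReal.mul_ne_top hNt
    (ENNReal.mul_ne_top sobolevConst_ne_top (by norm_num)))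
  -- Transposition of `R_i R_j` and the weighted `L⁶` bound, with `θ = γ/2 ≤ 1`.
  have hφ : ∀ φ : E3 → ℝ, ContDiff ℝ ∞ φ → HasCompactSupport φ → ‖∫ x, p₁ x * φ x‖ₑ ≤
      K * ∑ m, eLpNorm (fun x => rho x ^ (γ / 2) * fderiv ℝ φ x (bvec m)) 2 volume +
        K * eLpNorm (fun x => rho x ^ (γ / 2 / 2) * φ x) 2 volume := fun φ hφ hc => by
    refine (enorm_integral_rieszRieszSum_le hs.riesz₁
      (aestronglyMeasurable_tensorProd hs.u_meas hs.b_meas) hφ hc (p := 6 / 5) (p' := 6)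
      (fun i j => eLpNorm_rieszRiesz_six_le hφ hc i j (θ := γ / 2) (by linarith)
        (by linarith))).trans_eq ?_
    ring
  have hq := memLp_ball_of_wNorm hs.p₁_meas six_fifths_ne_zero six_fifths_ne_top hs.p₁_lt
  have hH := (H1c_dot_grad h.contDiff h.hasCompactSupport hs.h1loc).enorm_integral_le hq
    (a := γ / 2) (a' := γ / 2 / 2) (by linarith) (by linarith) hK hK hφ
  refine hH.trans ?_
  rw [← mul_add]
  refine mul_le_mul' ?_ ?_
  · exact mul_le_mul_right (mul_le_mul_left hN _) _
  · rw [mul_add]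
    refine add_le_add ?_ (h.eLpNorm_dot_le h0)
    refine (Finset.sum_le_sum fun m _ => h.eLpNorm_gradDot_le h0 h2 hs.u_meas hs.Du_meas m).trans_eq
        ?_
    simp
    ring

/-- The pressure of the force. -/
lemma IsSlice.enorm_pressure₂_le (hs : IsSlice γ u Du b F p₁ p₂) (h : IsTestWeight γ C Φ)
    (h0 : 0 < γ) (h2 : γ ≤ 2) :
    ‖∫ x, p₂ x * ∑ i, u x i * fderiv ℝ Φ x (bvec i)‖ₑ ≤
      9 * (ENNReal.ofReal 2 * wNorm 2 γ F * 120) * (ENNReal.ofReal (3 * C) * wNorm 2 γ u) := by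
  set N := eLpNorm (fun x => rho x ^ (-(γ / 2 / 2)) • F x) 2 volume
  have hN : N ≤ ENNReal.ofReal 2 * wNorm 2 γ F := eLpNorm_force_le h0 h2
  have hNt : N ≠ ⊤ := (hN.trans_lt (ENNReal.mul_lt_top ENNReal.ofReal_lt_top hs.F_lt)).ne
  set K := 9 * (N * 120)
  have hK : K ≠ ⊤ := ENNReal.mul_ne_top (by norm_num) (ENNReal.mul_ne_top hNt (by norm_num))
  -- Here the weighted `L²` bound suffices, so no derivative of the test function is needed and the
  -- gradient term has coefficient `0`.
  have hφ : ∀ φ : E3 → ℝ, ContDiff ℝ ∞ φ → HasCompactSupport φ → ‖∫ x, p₂ x * φ x‖ₑ ≤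
      0 * ∑ m, eLpNorm (fun x => rho x ^ (γ / 2) * fderiv ℝ φ x (bvec m)) 2 volume +
        K * eLpNorm (fun x => rho x ^ (γ / 2 / 2) * φ x) 2 volume := fun φ hφ hc => by
    refine (enorm_integral_rieszRieszSum_le hs.riesz₂ hs.F_meas hφ hc (p := 2) (p' := 2)
      (fun i j => eLpNorm_rieszRiesz_two_le hφ hc i j (θ := γ / 2) (by linarith)
        (by linarith))).trans_eq ?_
    ring
  -- On balls `L²` is contained in `L^{6/5}`, the class required by the extension to `H¹`.
  have hq : ∀ R : ℝ, MemLp p₂ (6 / 5) (volume.restrict (Metric.ball (0 : E3) R)) := fun R => by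
    have : IsFiniteMeasure (volume.restrict (Metric.ball (0 : E3) R)) :=
      ⟨by rw [Measure.restrict_apply_univ]; exact measure_ball_lt_top⟩
    refine (memLp_ball_of_wNorm hs.p₂_meas (by norm_num) (by norm_num) hs.p₂_lt R).mono_exponent ?_
    rw [ENNReal.div_le_iff (by norm_num) (by norm_num)]
    norm_num
  have hH := (H1c_dot_grad h.contDiff h.hasCompactSupport hs.h1loc).enorm_integral_le hq
    (a := γ / 2) (a' := γ / 2 / 2) (by linarith) (by linarith) ENNReal.zero_ne_top hK hφ
  refine hH.trans ?_
  rw [zero_mul, zero_add]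
  refine mul_le_mul' ?_ (h.eLpNorm_dot_le h0)
  exact mul_le_mul_right (mul_le_mul_left hN _) _

end PressureBounds

/-! ### The energy inequality on a time slice -/

/-- Bounds for the terms of the energy balance on a time slice. -/
structure SliceBounds (γ : ℝ) (B : ℝ≥0∞) (Φ : E3 → ℝ) (u : E3 → E3) (Du : E3 → Tensor3)
    (b : E3 → E3) (F : E3 → Tensor3) (p₁ p₂ : E3 → ℝ) : Prop where
  transport : ∫⁻ x, ‖‖u x‖ ^ 2 / 2 * ∑ i, b x i * fderiv ℝ Φ x (bvec i)‖ₑ ≤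
    B * (wNorm 3 (3 * γ / 2) b * wNorm 2 γ u * (wNorm 2 γ u + wNorm 2 γ Du))
  pressure₁ : ∫⁻ x, ‖p₁ x * ∑ i, u x i * fderiv ℝ Φ x (bvec i)‖ₑ ≤
    B * (wNorm (6 / 5) (6 * γ / 5) p₁ * (wNorm 2 γ u + wNorm 2 γ Du))
  pressure₂ : ∫⁻ x, ‖p₂ x * ∑ i, u x i * fderiv ℝ Φ x (bvec i)‖ₑ ≤
    B * (wNorm 2 γ p₂ * wNorm 2 γ u)
  enorm_pressure₁ : ‖∫ x, p₁ x * ∑ i, u x i * fderiv ℝ Φ x (bvec i)‖ₑ ≤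
    B * (wNorm 3 (3 * γ / 2) b * wNorm 2 γ u * (wNorm 2 γ u + wNorm 2 γ Du))
  enorm_pressure₂ : ‖∫ x, p₂ x * ∑ i, u x i * fderiv ℝ Φ x (bvec i)‖ₑ ≤
    B * (wNorm 2 γ F * wNorm 2 γ u)
  force : ∫⁻ x, ‖∑ i, ∑ j, F x (i, j) * u x j * fderiv ℝ Φ x (bvec i)‖ₑ ≤
    B * (wNorm 2 γ F * wNorm 2 γ u)
  work : ∫⁻ x, ‖(∑ i, ∑ j, F x (i, j) * Du x (i, j)) * Φ x‖ₑ ≤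
    B * (wNorm 2 γ F * wNorm 2 γ Du)

/-- Each pressure is estimated twice. The bounds on absolute values involve the norm of the pressure
itself and only serve to prove integrability on the strip; the bounds on the integrals involve `b`,
`u`, `F` alone and enter the final estimate. The constant depends on the test weight only through
`C`. -/
lemma exists_sliceBounds {γ C : ℝ} (h0 : 0 < γ) (h2 : γ ≤ 2) : ∃ B : ℝ≥0∞, B ≠ ⊤ ∧
    ∀ (Φ : E3 → ℝ) (u : E3 → E3) (Du : E3 → Tensor3) (b : E3 → E3) (F : E3 → Tensor3)
      (p₁ p₂ : E3 → ℝ), IsTestWeight γ C Φ → IsSlice γ u Du b F p₁ p₂ →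
      SliceBounds γ B Φ u Du b F p₁ p₂ := by
  obtain ⟨A, hA, hS⟩ := exists_sobolev_hardy
  set c1 := ENNReal.ofReal (3 * C) * A with hc1
  set c2 := ENNReal.ofReal (3 * C) with hc2
  set c3 := 9 * (ENNReal.ofReal 2 * (sobolevConst * 10 ^ 7)) *
    (ENNReal.ofReal (3 * C) * (3 * (1 + A) + 1)) with hc3
  set c4 := 9 * (ENNReal.ofReal 2 * 120) * ENNReal.ofReal (3 * C) with hc4
  set c5 := ENNReal.ofReal (9 * C) with hc5
  set c6 := ENNReal.ofReal 9 with hc6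
  have h1t : c1 < ⊤ := ENNReal.mul_lt_top ENNReal.ofReal_lt_top hA.lt_top
  have h3t : c3 < ⊤ := by
    refine ENNReal.mul_lt_top (ENNReal.mul_lt_top (by norm_num) (ENNReal.mul_lt_top
      ENNReal.ofReal_lt_top (ENNReal.mul_lt_top sobolevConst_ne_top.lt_top (by norm_num))))
      (ENNReal.mul_lt_top ENNReal.ofReal_lt_top (ENNReal.add_lt_top.2 ⟨ENNReal.mul_lt_top (by
          norm_num)
        (ENNReal.add_lt_top.2 ⟨by norm_num, hA.lt_top⟩), by norm_num⟩))
  have h4t : c4 < ⊤ := ENNReal.mul_lt_top (ENNReal.mul_lt_top (by norm_num) (ENNReal.mul_lt_top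
      ENNReal.ofReal_lt_top (by norm_num))) ENNReal.ofReal_lt_top
  set B := max c1 (max c2 (max c3 (max c4 (max c5 c6)))) with hB
  have b1 : c1 ≤ B := by simp only [hB, le_max_iff, le_refl, true_or, or_true]
  have b2 : c2 ≤ B := by simp only [hB, le_max_iff, le_refl, true_or, or_true]
  have b3 : c3 ≤ B := by simp only [hB, le_max_iff, le_refl, true_or, or_true]
  have b4 : c4 ≤ B := by simp only [hB, le_max_iff, le_refl, true_or, or_true]
  have b5 : c5 ≤ B := by simp only [hB, le_max_iff, le_refl, true_or, or_true]
  have b6 : c6 ≤ B := by simp only [hB, le_max_iff, le_refl, true_or, or_true]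
  refine ⟨B, (max_lt h1t (max_lt ENNReal.ofReal_lt_top (max_lt h3t (max_lt h4t
    (max_lt ENNReal.ofReal_lt_top ENNReal.ofReal_lt_top))))).ne,
    fun Φ u Du b F p₁ p₂ h hs => ?_⟩
  have hC := h.const_nonneg
  obtain ⟨s1, s2⟩ := hS γ h0 h2 u Du hs.u_meas hs.Du_meas hs.h1loc
  set e := wNorm 2 γ u
  set d := wNorm 2 γ Du
  set β := wNorm 3 (3 * γ / 2) b
  set f := wNorm 2 γ F
  refine ⟨?_, ?_, ?_, ?_, ?_, ?_, ?_⟩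
  · refine (h.lintegral_transport_le h2 hs.u_meas hs.b_meas).trans ?_
    calc _ ≤ ENNReal.ofReal (3 * C) * (β * (e * (A * (e + d)))) := by gcongr
      _ = c1 * (β * e * (e + d)) := by rw [hc1]; ring
      _ ≤ _ := mul_le_mul_left b1 _
  · refine (h.lintegral_pressure_le h2 hs.u_meas hs.p₁_meas).trans ?_
    calc _ ≤ ENNReal.ofReal (3 * C) * (wNorm (6 / 5) (6 * γ / 5) p₁ * (A * (e + d))) := by gcongr
      _ = c1 * (wNorm (6 / 5) (6 * γ / 5) p₁ * (e + d)) := by rw [hc1]; ring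
      _ ≤ _ := mul_le_mul_left b1 _
  · refine (lintegral_le_wNorm_mul_wNorm (γ := γ) hs.p₂_meas hs.u_meas (c := 3 * C) (by positivity)
      fun x => ?_).trans (mul_le_mul_left b2 _)
    rw [norm_mul]
    refine (mul_le_mul_of_nonneg_left (h.abs_sum_le (a := γ) (by linarith) (u x) x)
      (norm_nonneg _)).trans_eq (by ring)
  · refine (hs.enorm_pressure₁_le h h0 h2).trans ?_
    calc _ ≤ 9 * (ENNReal.ofReal 2 * (β * e) * (sobolevConst * 10 ^ 7)) *
          (ENNReal.ofReal (3 * C) * (3 * ((e + d) + A * (e + d)) + (e + d))) := by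
          gcongr
          · exact le_add_self
          · exact le_self_add
      _ = c3 * (β * e * (e + d)) := by rw [hc3]; ring
      _ ≤ _ := mul_le_mul_left b3 _
  · refine (hs.enorm_pressure₂_le h h0 h2).trans ?_
    calc _ = c4 * (f * e) := by rw [hc4]; ring
      _ ≤ _ := mul_le_mul_left b4 _
  · refine (lintegral_le_wNorm_mul_wNorm (γ := γ) hs.F_meas hs.u_meas (c := 9 * C) (by positivity)
      fun x => ?_).trans (mul_le_mul_left b5 _)
    exact h.abs_sum_sum_le (by linarith) (u x) x (F x)
  · exact (lintegral_le_wNorm_mul_wNorm (γ := γ) hs.F_meas hs.Du_meas (c := 9) (by norm_num)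
      fun x => h.abs_contraction_le x (F x) (Du x)).trans (mul_le_mul_left b6 _)

lemma norm_le_of_enorm_le {x : ℝ} {X : ℝ≥0∞} (hX : X ≠ ⊤) (h : ‖x‖ₑ ≤ X) : |x| ≤ X.toReal := by
  have := ENNReal.toReal_mono hX h
  rwa [toReal_enorm, Real.norm_eq_abs] at this

lemma wNorm_sq_eq_integral {V : Type*} [NormedAddCommGroup V] [NormedSpace ℝ V] {γ : ℝ} {f : E3 → V}
    (hf : AEStronglyMeasurable f volume) (h : wNorm 2 γ f < ⊤) :
    Integrable (fun x => weight γ x * ‖f x‖ ^ 2) volume ∧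
    ∫ x, weight γ x * ‖f x‖ ^ 2 = (wNorm 2 γ f).toReal ^ 2 := by
  have hm : AEStronglyMeasurable (fun x => weight (γ / 2) x • f x) volume :=
    (continuous_weight _).aestronglyMeasurable.smul hf
  have hL : MemLp (fun x => weight (γ / 2) x • f x) 2 volume := ⟨hm, by rwa [← wNorm_two]⟩
  have e : ∀ x, ‖weight (γ / 2) x • f x‖ ^ 2 = weight γ x * ‖f x‖ ^ 2 := fun x => by
    rw [norm_smul, Real.norm_of_nonneg (weight_pos _ x).le, mul_pow, sq (weight _ x), weight_mul,
      add_halves]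
  have hi := (memLp_two_iff_integrable_sq_norm hm).1 hL
  simp_rw [e] at hi
  refine ⟨hi, ?_⟩
  rw [← ENNReal.toReal_pow, wNorm_two, eLpNorm_two_sq,
    integral_eq_lintegral_of_nonneg_ae (Eventually.of_forall fun x => by
      have := (weight_pos γ x).le
      simp only [Pi.zero_apply]; positivity) hi.1]
  congr 1
  refine lintegral_congr fun x => ?_
  rw [← e, ENNReal.ofReal_pow (norm_nonneg _), ofReal_norm]

/-- The terms of the energy balance on a time slice. -/
noncomputable def slicePower (Φ : E3 → ℝ) (u : E3 → E3) (Du : E3 → Tensor3) (b : E3 → E3)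
    (F : E3 → Tensor3) (p₁ p₂ : E3 → ℝ) : ℝ :=
  (∫ x, ‖u x‖ ^ 2 / 2 * ∑ i, fderiv ℝ (fun x => fderiv ℝ Φ x (bvec i)) x (bvec i))
  - (∫ x, ‖Du x‖ ^ 2 * Φ x)
  + (∫ x, ‖u x‖ ^ 2 / 2 * ∑ i, b x i * fderiv ℝ Φ x (bvec i))
  + ((∫ x, p₁ x * ∑ i, u x i * fderiv ℝ Φ x (bvec i))
    - ∫ x, p₂ x * ∑ i, u x i * fderiv ℝ Φ x (bvec i))
  - (∫ x, ∑ i, ∑ j, F x (i, j) * u x j * fderiv ℝ Φ x (bvec i))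
  - ∫ x, (∑ i, ∑ j, F x (i, j) * Du x (i, j)) * Φ x

/-- The laplacian of a test weight. -/
noncomputable def lapl (Φ : E3 → ℝ) (x : E3) : ℝ :=
  ∑ i, fderiv ℝ (fun x => fderiv ℝ Φ x (bvec i)) x (bvec i)

lemma continuous_lapl {Φ : E3 → ℝ} (h : ContDiff ℝ ∞ Φ) : Continuous (lapl Φ) :=
  continuous_finsetSum _ fun i _ => (contDiff_fderiv_bvec (contDiff_fderiv_bvec h i) i).continuous

/-- A two-sided bound whose constant depends on `Φ`, used for integrability only. The uniform bound
is the one-sided `IsTestWeight.lap_le`. -/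
lemma exists_lapl_le {γ : ℝ} {Φ : E3 → ℝ} (h : ContDiff ℝ ∞ Φ) (hc : HasCompactSupport Φ) :
    ∃ K : ℝ, 0 ≤ K ∧ ∀ x, ‖lapl Φ x‖ ≤ K * weight γ x := by
  have h1 : Continuous fun x => lapl Φ x * weight (-γ) x :=
    (continuous_lapl h).mul (continuous_weight _)
  obtain ⟨R, hR⟩ := exists_outside_of_hasCompactSupport hc
  have h2 : HasCompactSupport fun x => lapl Φ x * weight (-γ) x := by
    refine hasCompactSupport_of_outside (R := R) fun x hx => ?_
    have h3 : ∀ i, fderiv ℝ (fun x => fderiv ℝ Φ x (bvec i)) x = 0 := fun i =>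
      fderiv_eq_zero_of_outside (R := R) (fun y hy => by
        rw [fderiv_eq_zero_of_outside hR hy]; rfl) hx
    simp [lapl, h3]
  obtain ⟨K, hK⟩ := h2.exists_bound_of_continuous h1
  refine ⟨K, (norm_nonneg _).trans (hK 0), fun x => ?_⟩
  have h4 : weight (-γ) x * weight γ x = 1 := by
    rw [weight_mul, neg_add_cancel, weight_eq]; simp
  have h5 := hK x
  rw [norm_mul, Real.norm_of_nonneg (weight_pos _ x).le] at h5
  calc ‖lapl Φ x‖ = ‖lapl Φ x‖ * weight (-γ) x * weight γ x := by rw [mul_assoc, h4, mul_one]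
    _ ≤ _ := mul_le_mul_of_nonneg_right h5 (weight_pos _ x).le

/-- The energy inequality on a time slice. -/
lemma exists_slicePower_le {γ C : ℝ} (h0 : 0 < γ) (h2 : γ ≤ 2) : ∃ B : ℝ, 0 ≤ B ∧
    ∀ (Φ : E3 → ℝ) (u : E3 → E3) (Du : E3 → Tensor3) (b : E3 → E3) (F : E3 → Tensor3)
      (p₁ p₂ : E3 → ℝ), IsTestWeight γ C Φ → IsSlice γ u Du b F p₁ p₂ →
      slicePower Φ u Du b F p₁ p₂ ≤ - (∫ x, ‖Du x‖ ^ 2 * Φ x) + (wNorm 2 γ Du).toReal ^ 2 / 2 +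
        B * ((1 + (wNorm 3 (3 * γ / 2) b).toReal ^ 2) * (wNorm 2 γ u).toReal ^ 2 +
          (wNorm 2 γ F).toReal ^ 2) := by
  obtain ⟨B, hB, hSB⟩ := exists_sliceBounds (C := C) h0 h2
  set K := B.toReal with hK
  have hK0 : 0 ≤ K := ENNReal.toReal_nonneg
  refine ⟨|C| + 20 * (K + 1) ^ 2, by positivity, fun Φ u Du b F p₁ p₂ h hs => ?_⟩
  have sb := hSB Φ u Du b F p₁ p₂ h hs
  have hut := hs.u_lt.ne
  have hDt := hs.Du_lt.ne
  have hbt := hs.b_lt.ne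
  have hFt := hs.F_lt.ne
  have hX : B * (wNorm 3 (3 * γ / 2) b * wNorm 2 γ u * (wNorm 2 γ u + wNorm 2 γ Du)) ≠ ⊤ :=
    ENNReal.mul_ne_top hB (ENNReal.mul_ne_top (ENNReal.mul_ne_top hbt hut)
      (ENNReal.add_ne_top.2 ⟨hut, hDt⟩))
  have hY : B * (wNorm 2 γ F * wNorm 2 γ u) ≠ ⊤ :=
    ENNReal.mul_ne_top hB (ENNReal.mul_ne_top hFt hut)
  have hZ : B * (wNorm 2 γ F * wNorm 2 γ Du) ≠ ⊤ :=
    ENNReal.mul_ne_top hB (ENNReal.mul_ne_top hFt hDt)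
  have t3 := norm_le_of_enorm_le hX ((enorm_integral_le_lintegral_enorm _).trans sb.transport)
  have t4 := norm_le_of_enorm_le hX sb.enorm_pressure₁
  have t4' := norm_le_of_enorm_le hY sb.enorm_pressure₂
  have t5 := norm_le_of_enorm_le hY ((enorm_integral_le_lintegral_enorm _).trans sb.force)
  have t6 := norm_le_of_enorm_le hZ ((enorm_integral_le_lintegral_enorm _).trans sb.work)
  simp only [ENNReal.toReal_mul, ENNReal.toReal_add hut hDt] at t3 t4 t4' t5 t6
  -- The diffusion term is bounded from above only, by the sign structure of the Laplacian of the
  -- test weight.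
  have t1 : ∫ x, ‖u x‖ ^ 2 / 2 * lapl Φ x ≤ |C| * (wNorm 2 γ u).toReal ^ 2 := by
    obtain ⟨hi, he⟩ := wNorm_sq_eq_integral hs.u_meas hs.u_lt
    rw [← he, ← integral_const_mul]
    obtain ⟨L, hL0, hL⟩ := exists_lapl_le (γ := γ) h.contDiff h.hasCompactSupport
    refine integral_mono ((hi.const_mul L).mono' ?_ ?_) (hi.const_mul _) fun x => ?_
    · exact (((continuous_norm.pow 2).div_const 2).comp_aestronglyMeasurable hs.u_meas).mul
        (continuous_lapl h.contDiff).aestronglyMeasurable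
    · refine Eventually.of_forall fun x => ?_
      rw [norm_mul, Real.norm_of_nonneg (by positivity)]
      have hw := (weight_pos γ x).le
      calc ‖u x‖ ^ 2 / 2 * ‖lapl Φ x‖ ≤ ‖u x‖ ^ 2 * (L * weight γ x) :=
            mul_le_mul (by linarith [sq_nonneg ‖u x‖]) (hL x) (norm_nonneg _) (by positivity)
        _ = _ := by ring
    · have hw := (weight_pos γ x).le
      have h1 : lapl Φ x ≤ |C| * weight γ x :=
        (h.lap_le x).trans (mul_le_mul_of_nonneg_right (le_abs_self C) hw)
      calc ‖u x‖ ^ 2 / 2 * lapl Φ x ≤ ‖u x‖ ^ 2 / 2 * (|C| * weight γ x) :=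
            mul_le_mul_of_nonneg_left h1 (by positivity)
        _ ≤ ‖u x‖ ^ 2 * (|C| * weight γ x) :=
            mul_le_mul_of_nonneg_right (by linarith [sq_nonneg ‖u x‖]) (by positivity)
        _ = _ := by ring
  change (∫ x, ‖u x‖ ^ 2 / 2 * lapl Φ x) - _ + _ + _ - _ - _ ≤ _
  rw [abs_le] at t3 t4 t4' t5 t6
  set e := (wNorm 2 γ u).toReal
  set d := (wNorm 2 γ Du).toReal
  set β := (wNorm 3 (3 * γ / 2) b).toReal
  set f := (wNorm 2 γ F).toReal
  -- Young's inequality. The transport and pressure terms together use `d²/4` and the work of the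
  -- force uses another `d²/4`, whence the `d²/2` in the conclusion; the factor `2` accounts for
  -- transport and pressure having the same bound.
  have q1 : 2 * (K * (β * e * d)) ≤ d ^ 2 / 4 + 4 * K ^ 2 * (β ^ 2 * e ^ 2) := by
    nlinarith [sq_nonneg (d / 2 - 2 * (K * (β * e)))]
  have q2 : 2 * (K * (β * e * e)) ≤ K * ((1 + β ^ 2) * e ^ 2) := by
    have : 0 ≤ K * ((1 - β) ^ 2 * e ^ 2) := by positivity
    linarith
  have q3 : 2 * (K * (f * e)) ≤ K * (f ^ 2 + e ^ 2) := by
    have : 0 ≤ K * (f - e) ^ 2 := by positivity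
    linarith
  have q4 : K * (f * d) ≤ d ^ 2 / 4 + K ^ 2 * f ^ 2 := by
    nlinarith [sq_nonneg (d / 2 - K * f)]
  have r1 : |C| * e ^ 2 ≤ |C| * ((1 + β ^ 2) * e ^ 2 + f ^ 2) := by
    refine mul_le_mul_of_nonneg_left ?_ (abs_nonneg C)
    have : 0 ≤ β ^ 2 * e ^ 2 := by positivity
    nlinarith [sq_nonneg f]
  have r2 : 4 * K ^ 2 * (β ^ 2 * e ^ 2) + K * ((1 + β ^ 2) * e ^ 2) + K * (f ^ 2 + e ^ 2) +
      K ^ 2 * f ^ 2 ≤ 20 * (K + 1) ^ 2 * ((1 + β ^ 2) * e ^ 2 + f ^ 2) := by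
    have p1 : 0 ≤ β ^ 2 * e ^ 2 := by positivity
    have p2 : 0 ≤ e ^ 2 := by positivity
    have p3 : 0 ≤ f ^ 2 := by positivity
    nlinarith [mul_nonneg hK0 p1, mul_nonneg hK0 p2, mul_nonneg hK0 p3,
      mul_nonneg (sq_nonneg K) p1, mul_nonneg (sq_nonneg K) p2, mul_nonneg (sq_nonneg K) p3]
  have m1 : K * (β * e * (e + d)) = K * (β * e * e) + K * (β * e * d) := by ring
  rw [add_mul]
  linarith [t3.2, t4.2, t4'.1, t5.1, t6.1]

/-! ### Grönwall's inequality -/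

lemma absolutelyContinuousOnInterval_comp_lipschitz {f g : ℝ → ℝ} {a b : ℝ} {K : NNReal} {s : Set ℝ}
    (hg : LipschitzOnWith K g s) (hf : AbsolutelyContinuousOnInterval f a b)
    (hs : MapsTo f (uIcc a b) s) : AbsolutelyContinuousOnInterval (fun x => g (f x)) a b := by
  rw [absolutelyContinuousOnInterval_iff] at hf ⊢
  intro ε hε
  obtain ⟨δ, hδ, h⟩ := hf (ε / (K + 1)) (by positivity)
  refine ⟨δ, hδ, fun E hE hl => ?_⟩
  have h1 := h E hE hl
  have hK : (0 : ℝ) < K + 1 := by positivity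
  calc _ ≤ ∑ i ∈ Finset.range E.1, (K : ℝ) * dist (f (E.2 i).1) (f (E.2 i).2) := by
        refine Finset.sum_le_sum fun i hi => hg.dist_le_mul _ (hs ?_) _ (hs ?_)
        · exact (hE.1 i hi).1
        · exact (hE.1 i hi).2
    _ = K * ∑ i ∈ Finset.range E.1, dist (f (E.2 i).1) (f (E.2 i).2) := by rw [Finset.mul_sum]
    _ ≤ K * (ε / (K + 1)) := by gcongr
    _ < (K + 1) * (ε / (K + 1)) := by gcongr; linarith
    _ = ε := by field_simp

/-- Grönwall's inequality with an integrable coefficient. -/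
lemma gronwall_integrable {k y : ℝ → ℝ} {A t : ℝ} (ht : 0 ≤ t) (hk : ∀ s, 0 ≤ k s)
    (hki : IntervalIntegrable k volume 0 t) (hkyi : IntervalIntegrable (fun s =>
        k s * y s) volume 0 t)
    (h : ∀ᵐ s ∂(volume.restrict (Ioc 0 t)), y s ≤ A + ∫ r in 0..s, k r * y r) :
    A + ∫ r in 0..t, k r * y r ≤ A * Real.exp (∫ r in 0..t, k r) := by
  set Z : ℝ → ℝ := fun s => A + ∫ r in 0..s, k r * y r with hZ
  set L : ℝ → ℝ := fun s => ∫ r in 0..s, k r with hL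
  have hLac : AbsolutelyContinuousOnInterval L 0 t :=
    hki.absolutelyContinuousOnInterval_intervalIntegral left_mem_uIcc
  have hZac : AbsolutelyContinuousOnInterval Z 0 t := by
    have h1 := hkyi.absolutelyContinuousOnInterval_intervalIntegral left_mem_uIcc
    have h2 : AbsolutelyContinuousOnInterval (fun _ : ℝ => A) 0 t :=
      (LipschitzWith.const A).lipschitzOnWith.absolutelyContinuousOnInterval
    exact h2.fun_add h1
  have hEac : AbsolutelyContinuousOnInterval (fun s => Real.exp (-L s)) 0 t := by
    obtain ⟨C, hC⟩ := hLac.exists_bound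
    have hc : ContDiffOn ℝ 1 (fun x : ℝ => Real.exp (-x)) (Icc (-C) C) :=
      (Real.contDiff_exp.comp contDiff_neg).contDiffOn
    obtain ⟨K, hK⟩ := hc.exists_lipschitzOnWith (by decide) (convex_Icc _ _) isCompact_Icc
    refine absolutelyContinuousOnInterval_comp_lipschitz (g := fun x => Real.exp (-x)) (f :=
        L) hK hLac
      fun s hs => ?_
    have := hC s hs
    rw [Real.norm_eq_abs, abs_le] at this
    exact this
  -- `k` is merely integrable, so the classical argument is run with absolutely continuous
  -- functions: `Z exp(-L)` has derivative `k (y - Z) exp(-L) ≤ 0` almost everywhere.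
  have hI := hZac.integral_deriv_mul_eq_sub hEac
  have hle : ∫ s in 0..t, (deriv Z s * Real.exp (-L s) + Z s * deriv (fun s => Real.exp (-L s)) s) ≤
      0 := by
    rw [intervalIntegral.integral_of_le ht]
    refine integral_nonpos_of_ae ?_
    have hd1 := (ae_restrict_of_ae (s := Ioc 0 t) hkyi.ae_hasDerivAt_integral)
    have hd2 := (ae_restrict_of_ae (s := Ioc 0 t) hki.ae_hasDerivAt_integral)
    filter_upwards [hd1, hd2, h, ae_restrict_mem measurableSet_Ioc] with s d1 d2 hs hmem
    have hmem' : s ∈ uIcc 0 t := by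
      rw [uIcc_of_le ht]; exact Ioc_subset_Icc_self hmem
    have e1 : deriv Z s = k s * y s := by
      have := (d1 hmem' 0 left_mem_uIcc).const_add A
      exact this.deriv
    have e2 : deriv (fun s => Real.exp (-L s)) s = Real.exp (-L s) * -k s :=
      (d2 hmem' 0 left_mem_uIcc).neg.exp.deriv
    rw [e1, e2]
    have h3 : 0 ≤ k s * Real.exp (-L s) * (Z s - y s) :=
      mul_nonneg (mul_nonneg (hk s) (Real.exp_pos _).le) (by simp only [hZ]; linarith)
    simp only [Pi.zero_apply]
    linarith
  rw [hI] at hle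
  have hL0 : L 0 = 0 := by simp [hL]
  have hZ0 : Z 0 = A := by simp [hZ]
  rw [hL0, hZ0] at hle
  simp only [neg_zero, Real.exp_zero, mul_one] at hle
  have hE : Real.exp (-L t) * Real.exp (L t) = 1 := by rw [← Real.exp_add]; simp
  calc Z t = Z t * Real.exp (-L t) * Real.exp (L t) := by rw [mul_assoc, hE, mul_one]
    _ ≤ A * Real.exp (L t) := mul_le_mul_of_nonneg_right (by linarith) (Real.exp_pos _).le

/-! ### From a distributional inequality in time to a pointwise one -/

/-- The rising edge of the time cutoff. -/
noncomputable def rise (δ τ : ℝ) : ℝ := Real.smoothTransition (τ / δ - 1)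

/-- The falling edge of the time cutoff. -/
noncomputable def fall (t δ τ : ℝ) : ℝ := Real.smoothTransition ((t + δ - τ) / δ)

lemma contDiff_rise (δ : ℝ) : ContDiff ℝ ∞ (rise δ) :=
  Real.smoothTransition.contDiff.comp ((contDiff_id.div_const δ).sub contDiff_const)

lemma contDiff_fall (t δ : ℝ) : ContDiff ℝ ∞ (fall t δ) :=
  Real.smoothTransition.contDiff.comp ((contDiff_const.sub contDiff_id).div_const δ)

lemma deriv_rise (δ τ : ℝ) : deriv (rise δ) τ = deriv Real.smoothTransition (τ / δ - 1) * (1 / δ) :=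
    by
  have h1 : HasDerivAt Real.smoothTransition (deriv Real.smoothTransition (τ / δ - 1)) (τ / δ - 1)
      :=
    ((Real.smoothTransition.contDiff (n := 1)).differentiable (by norm_num) _).hasDerivAt
  exact (h1.comp τ (((hasDerivAt_id τ).div_const δ).sub_const 1)).deriv

lemma deriv_fall (t δ τ : ℝ) :
    deriv (fall t δ) τ = deriv Real.smoothTransition ((t + δ - τ) / δ) * (-1 / δ) := by
  have h1 : HasDerivAt Real.smoothTransition (deriv Real.smoothTransition ((t + δ - τ) / δ))
      ((t + δ - τ) / δ) :=
    ((Real.smoothTransition.contDiff (n := 1)).differentiable (by norm_num) _).hasDerivAt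
  exact (h1.comp τ (((hasDerivAt_id τ).const_sub (t + δ)).div_const δ)).deriv

section TimeCutoff

variable {t δ τ : ℝ}

lemma rise_eq_zero (hδ : 0 < δ) (h : τ ≤ δ) : rise δ τ = 0 :=
  Real.smoothTransition.zero_of_nonpos (by rw [sub_nonpos, div_le_one hδ]; exact h)

lemma rise_eq_one (hδ : 0 < δ) (h : 2 * δ ≤ τ) : rise δ τ = 1 :=
  Real.smoothTransition.one_of_one_le (by
    have : 2 ≤ τ / δ := (le_div_iff₀ hδ).2 h
    linarith)

lemma fall_eq_zero (hδ : 0 < δ) (h : t + δ ≤ τ) : fall t δ τ = 0 :=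
  Real.smoothTransition.zero_of_nonpos (div_nonpos_of_nonpos_of_nonneg (by linarith) hδ.le)

lemma fall_eq_one (hδ : 0 < δ) (h : τ ≤ t) : fall t δ τ = 1 :=
  Real.smoothTransition.one_of_one_le ((le_div_iff₀ hδ).2 (by linarith))

lemma deriv_rise_eq_zero (hδ : 0 < δ) (h : 2 * δ < τ) : deriv (rise δ) τ = 0 := by
  rw [deriv_rise, (deriv_smoothTransition_eq_zero (Or.inr ?_)).1, zero_mul]
  have : 2 < τ / δ := (lt_div_iff₀ hδ).2 h
  linarith

lemma deriv_fall_eq_zero (hδ : 0 < δ) (h : τ < t ∨ t + δ < τ) : deriv (fall t δ) τ = 0 := by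
  rw [deriv_fall, (deriv_smoothTransition_eq_zero ?_).1, zero_mul]
  rcases h with h | h
  · exact Or.inr ((lt_div_iff₀ hδ).2 (by linarith))
  · exact Or.inl (div_neg_of_neg_of_pos (by linarith) hδ)

lemma deriv_rise_nonneg (hδ : 0 < δ) : 0 ≤ deriv (rise δ) τ := by
  rw [deriv_rise]
  exact mul_nonneg Real.smoothTransition.monotone.deriv_nonneg (by positivity)

lemma deriv_fall_nonpos (hδ : 0 < δ) : deriv (fall t δ) τ ≤ 0 := by
  rw [deriv_fall, neg_div, mul_neg]
  exact neg_nonpos.2 (mul_nonneg Real.smoothTransition.monotone.deriv_nonneg (by positivity))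

/-- The edges vary on `[δ, 2δ]` and `[t, t + δ]`, which are disjoint when `2δ < t`; on each of them
the other factor is `1`. -/
lemma deriv_rise_mul_fall (hδ : 0 < δ) (h : 2 * δ < t) :
    deriv (fun τ => rise δ τ * fall t δ τ) τ = deriv (rise δ) τ + deriv (fall t δ) τ := by
  have h1 := ((contDiff_rise δ).differentiable (by simp) τ)
  have h2 := ((contDiff_fall t δ).differentiable (by simp) τ)
  rw [deriv_fun_mul h1 h2]
  rcases le_or_gt τ (2 * δ) with h3 | h3
  · rw [fall_eq_one hδ (by linarith), deriv_fall_eq_zero hδ (Or.inl (by linarith))]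
    ring
  · rw [rise_eq_one hδ h3.le, deriv_rise_eq_zero hδ h3]
    ring

end TimeCutoff

/-- A differential inequality in the sense of distributions gives an integral inequality for lower
semicontinuous functions. -/
lemma le_of_weak_differential_inequality {T t e₀ : ℝ} {e h : ℝ → ℝ} (ht : t ∈ Ioo 0 T)
    (hei : IntegrableOn e (Ioo 0 T)) (hhi : IntegrableOn h (Ioo 0 T))
    (hw : ∀ α : ℝ → ℝ, ContDiff ℝ ∞ α → HasCompactSupport α → tsupport α ⊆ Ioo 0 T →
      (∀ τ, 0 ≤ α τ) → - ∫ τ in Ioo 0 T, e τ * deriv α τ ≤ ∫ τ in Ioo 0 T, α τ * h τ)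
    (hlsc : ∀ ε > 0, ∀ᶠ s in 𝓝 t, e t - ε ≤ e s)
    (hin : ∀ ε > 0, ∀ᶠ s in 𝓝[>] 0, e s ≤ e₀ + ε) :
    e t ≤ e₀ + ∫ τ in Ioc 0 t, h τ := by
  obtain ⟨ht0, htT⟩ := ht
  set α : ℝ → ℝ → ℝ := fun δ τ => rise δ τ * fall t δ τ with hα
  have hδs : Tendsto (fun n : ℕ => (1 : ℝ) / (n + 1)) atTop (𝓝 0) :=
    tendsto_one_div_add_atTop_nhds_zero_nat
  -- The cutoffs converge pointwise on `(0, T)` to the indicator of `(0, t]`, so the right-hand side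
  -- passes to the limit.
  have hlim : Tendsto (fun n : ℕ => ∫ τ in Ioo 0 T, α (1 / (n + 1)) τ * h τ) atTop
      (𝓝 (∫ τ in Ioo 0 T, (Ioc 0 t).indicator h τ)) := by
    refine tendsto_integral_of_dominated_convergence (fun τ => ‖h τ‖) (fun n => ?_) hhi.norm
      (fun n => Eventually.of_forall fun τ => ?_) ?_
    · exact ((contDiff_rise _).continuous.mul
        (contDiff_fall t _).continuous).aestronglyMeasurable.mul hhi.1
    · rw [norm_mul]
      refine mul_le_of_le_one_left (norm_nonneg _) ?_
      simp only [hα, rise, fall]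
      rw [Real.norm_of_nonneg (mul_nonneg (Real.smoothTransition.nonneg _)
        (Real.smoothTransition.nonneg _))]
      exact mul_le_one₀ (Real.smoothTransition.le_one _) (Real.smoothTransition.nonneg _)
        (Real.smoothTransition.le_one _)
    · filter_upwards [ae_restrict_mem measurableSet_Ioo] with τ hτ
      refine tendsto_const_nhds.congr' ?_
      by_cases hτt : τ ≤ t
      · filter_upwards [hδs.eventually (gt_mem_nhds (show (0 : ℝ) < τ / 2 by linarith [hτ.1]))]
          with n hn
        have hp : (0 : ℝ) < 1 / (n + 1) := by positivity
        rw [indicator_of_mem (show τ ∈ Ioc 0 t from ⟨hτ.1, hτt⟩)]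
        simp only [hα]
        rw [rise_eq_one hp (by linarith), fall_eq_one hp hτt]
        ring
      · rw [not_le] at hτt
        filter_upwards [hδs.eventually (gt_mem_nhds (show (0 : ℝ) < τ - t by linarith))]
          with n hn
        have hp : (0 : ℝ) < 1 / (n + 1) := by positivity
        rw [indicator_of_notMem (fun h => by linarith [h.2])]
        simp only [hα]
        rw [fall_eq_zero hp (by linarith)]
        ring
  have hfin : ∫ τ in Ioo 0 T, (Ioc 0 t).indicator h τ = ∫ τ in Ioc 0 t, h τ := by
    rw [setIntegral_indicator measurableSet_Ioc]
    congr 2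
    ext τ
    exact ⟨fun h => h.2, fun h => ⟨⟨h.1, lt_of_le_of_lt h.2 htT⟩, h⟩⟩
  rw [hfin] at hlim
  refine le_of_forall_pos_le_add fun ε hε => ?_
  have hε2 : 0 < ε / 2 := by linarith
  obtain ⟨r, hr, hr'⟩ := Metric.eventually_nhds_iff.1 (hlsc _ hε2)
  obtain ⟨r0, hr0, hr0'⟩ := (mem_nhdsGT_iff_exists_Ioc_subset).1 (hin _ hε2)
  have hr0 : (0:ℝ) < r0 := hr0
  have hev : ∀ᶠ n : ℕ in atTop, e t - ε ≤ e₀ + ∫ τ in Ioo 0 T, α (1 / (n + 1)) τ * h τ := by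
    -- The four conditions on `δ` separate the two edges, keep the support inside `(0, T)`, place
    -- the falling edge where lower semicontinuity is effective, and place the rising edge where the
    -- initial bound holds.
    have hmin : 0 < min (min (t / 2) (T - t)) (min r (r0 / 2)) := by
      refine lt_min (lt_min (by linarith) (by linarith)) (lt_min hr (by linarith))
    filter_upwards [hδs.eventually (gt_mem_nhds hmin)] with n hn
    rw [lt_min_iff, lt_min_iff, lt_min_iff] at hn
    obtain ⟨⟨n1, n2⟩, n3, n4⟩ := hn
    set δ : ℝ := 1 / (n + 1)
    have hδ : 0 < δ := by positivity
    have hzero : ∀ τ, τ ∉ Icc δ (t + δ) → α δ τ = 0 := fun τ hτ => by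
      rw [mem_Icc, not_and_or, not_le, not_le] at hτ
      simp only [hα]
      rcases hτ with hτ | hτ
      · rw [rise_eq_zero hδ hτ.le, zero_mul]
      · rw [fall_eq_zero hδ hτ.le, mul_zero]
    have hsupp : tsupport (α δ) ⊆ Icc δ (t + δ) :=
      closure_minimal (fun τ hτ => by_contra fun h => hτ (hzero τ h)) isClosed_Icc
    have hw1 := hw (α δ) ((contDiff_rise δ).mul (contDiff_fall t δ))
      (HasCompactSupport.intro isCompact_Icc hzero)
      (hsupp.trans fun τ hτ => ⟨by linarith [hτ.1], by linarith [hτ.2]⟩)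
      (fun τ => mul_nonneg (Real.smoothTransition.nonneg _) (Real.smoothTransition.nonneg _))
    have hd : ∀ τ, deriv (α δ) τ = deriv (rise δ) τ + deriv (fall t δ) τ := fun τ =>
      deriv_rise_mul_fall hδ (by linarith)
    have hcr : Continuous (deriv (rise δ)) := (contDiff_rise δ).continuous_deriv (by simp)
    have hcf : Continuous (deriv (fall t δ)) := (contDiff_fall t δ).continuous_deriv (by simp)
    have hbd : ∀ g : ℝ → ℝ, Continuous g → IntegrableOn (fun τ => e τ * g τ) (Ioo 0 T) :=
        fun g hg => by
      obtain ⟨C, hC⟩ := (isCompact_Icc (a := (0:ℝ)) (b := T)).exists_bound_of_continuousOn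
        hg.continuousOn
      refine Integrable.mul_bdd (c := C) hei hg.aestronglyMeasurable ?_
      filter_upwards [ae_restrict_mem measurableSet_Ioo] with τ hτ using hC τ (Ioo_subset_Icc_self
          hτ)
    have hci : ∀ g : ℝ → ℝ, Continuous g → IntegrableOn g (Ioo 0 T) := fun g hg =>
      (hg.continuousOn.integrableOn_Icc).mono_set Ioo_subset_Icc_self
    have hFTC : ∀ g : ℝ → ℝ, ContDiff ℝ ∞ g → ∫ τ in Ioo 0 T,
        deriv g τ = g T - g 0 := fun g hg => by
      rw [← integral_Ioc_eq_integral_Ioo, ← intervalIntegral.integral_of_le (by linarith)]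
      exact intervalIntegral.integral_deriv_eq_sub
        (fun x _ => hg.differentiable (by simp) x)
        ((hg.continuous_deriv (by simp)).intervalIntegrable _ _)
    -- `α'` is the difference of two probability densities, one concentrated near `0` and one just
    -- after `t`. The initial bound is averaged against the first, the lower bound by `e t - ε/2`
    -- against the second.
    have i1 : ∫ τ in Ioo 0 T, deriv (rise δ) τ = 1 := by
      rw [hFTC _ (contDiff_rise δ), rise_eq_one hδ (by linarith), rise_eq_zero hδ hδ.le, sub_zero]
    have i2 : ∫ τ in Ioo 0 T, deriv (fall t δ) τ = -1 := by
      rw [hFTC _ (contDiff_fall t δ), fall_eq_zero hδ (by linarith), fall_eq_one hδ ht0.le,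
          zero_sub]
    have u1 : ∫ τ in Ioo 0 T, e τ * deriv (rise δ) τ ≤ e₀ + ε / 2 := by
      calc _ ≤ ∫ τ in Ioo 0 T, (e₀ + ε / 2) * deriv (rise δ) τ := by
            refine setIntegral_mono_on (hbd _ hcr) ((hci _ hcr).const_mul _) measurableSet_Ioo
              fun τ hτ => ?_
            rcases le_or_gt τ (2 * δ) with h3 | h3
            · exact mul_le_mul_of_nonneg_right (hr0' ⟨hτ.1, by linarith⟩) (deriv_rise_nonneg hδ)
            · rw [deriv_rise_eq_zero hδ h3, mul_zero, mul_zero]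
        _ = _ := by rw [integral_const_mul, i1, mul_one]
    have u2 : ∫ τ in Ioo 0 T, e τ * deriv (fall t δ) τ ≤ -(e t - ε / 2) := by
      calc _ ≤ ∫ τ in Ioo 0 T, (e t - ε / 2) * deriv (fall t δ) τ := by
            refine setIntegral_mono_on (hbd _ hcf) ((hci _ hcf).const_mul _) measurableSet_Ioo
              fun τ hτ => ?_
            by_cases h3 : τ < t ∨ t + δ < τ
            · rw [deriv_fall_eq_zero hδ h3, mul_zero, mul_zero]
            · rw [not_or, not_lt, not_lt] at h3
              refine mul_le_mul_of_nonpos_right (hr' ?_) (deriv_fall_nonpos hδ)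
              rw [Real.dist_eq, abs_of_nonneg (by linarith [h3.1])]
              linarith [h3.2]
        _ = _ := by rw [integral_const_mul, i2]; ring
    have e3 : ∫ τ in Ioo 0 T, e τ * deriv (α δ) τ =
        (∫ τ in Ioo 0 T, e τ * deriv (rise δ) τ) + ∫ τ in Ioo 0 T, e τ * deriv (fall t δ) τ := by
      rw [← integral_add (hbd _ hcr) (hbd _ hcf)]
      congr 1; ext τ; rw [hd]; ring
    rw [e3] at hw1
    linarith
  have h4 := ge_of_tendsto (hlim.const_add e₀) hev
  linarith

/-! ### Integrability in space-time and separation of variables -/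

section MixedProducts

variable {V W : Type*} [NormedAddCommGroup V] [NormedAddCommGroup W] {q r p p' : ℝ≥0∞} {T δ δ' : ℝ}
  {f : ℝ → E3 → V} {g : ℝ → E3 → W}

lemma MemMixed.eLpNorm_two_lt_top (h : MemMixed q T p δ f) (hq : 2 ≤ q) (hp0 : p ≠ 0) (hp : p ≠ ⊤) :
    eLpNorm (fun t => wNorm p δ (f t)) 2 (volume.restrict (Ioo 0 T)) < ⊤ := by
  refine (eLpNorm_le_eLpNorm_mul_rpow_measure_univ (μ := volume.restrict (Ioo 0 T)) hq
    (h.aemeasurable hp0 hp).aestronglyMeasurable).trans_lt (ENNReal.mul_lt_top h.2 ?_)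
  refine ENNReal.rpow_lt_top_of_nonneg ?_ (by simp)
  simp only [ENNReal.toReal_ofNat, one_div, sub_nonneg]
  by_cases h : q = ⊤
  · simp [h]
  · have : 2 ≤ q.toReal := by simpa using ENNReal.toReal_mono h hq
    gcongr

lemma MemMixed.lintegral_mul_lt_top (hf : MemMixed q T p δ f) (hg : MemMixed r T p' δ' g)
    (hq : 2 ≤ q) (hr : 2 ≤ r) (hp0 : p ≠ 0) (hp : p ≠ ⊤) (hp0' : p' ≠ 0) (hp' : p' ≠ ⊤) :
    ∫⁻ t in Ioo 0 T, wNorm p δ (f t) * wNorm p' δ' (g t) < ⊤ := by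
  have h := ENNReal.lintegral_mul_le_Lp_mul_Lq (volume.restrict (Ioo 0 T))
    Real.HolderConjugate.two_two (hf.aemeasurable hp0 hp) (hg.aemeasurable hp0' hp')
  refine h.trans_lt (ENNReal.mul_lt_top ?_ ?_)
  · have := hf.eLpNorm_two_lt_top hq hp0 hp
    rw [eLpNorm_eq_lintegral_rpow_enorm_toReal (by norm_num) (by norm_num)] at this
    simpa using this
  · have := hg.eLpNorm_two_lt_top hr hp0' hp'
    rw [eLpNorm_eq_lintegral_rpow_enorm_toReal (by norm_num) (by norm_num)] at this
    simpa using this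

lemma MemMixed.integrable_toReal_sq (hf : MemMixed q T p δ f) (hq : 2 ≤ q) (hp0 : p ≠ 0)
    (hp : p ≠ ⊤) : IntegrableOn (fun t => (wNorm p δ (f t)).toReal ^ 2) (Ioo 0 T) := by
  simp_rw [← ENNReal.toReal_pow]
  refine integrable_toReal_of_lintegral_ne_top ((hf.aemeasurable hp0 hp).pow_const 2) ?_
  simp_rw [sq]
  exact (hf.lintegral_mul_lt_top hf hq hq hp0 hp hp0 hp).ne

lemma MemMixed.integral_toReal_sq (hf : MemMixed q T p δ f) (hq : 2 ≤ q) (hp0 : p ≠ 0)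
    (hp : p ≠ ⊤) : ∫ t in Ioo 0 T, (wNorm p δ (f t)).toReal ^ 2 =
        (mixedNorm 2 T p δ f).toReal ^ 2 := by
  simp_rw [← ENNReal.toReal_pow]
  have hq0 : q ≠ 0 := fun h => by simp [h] at hq
  rw [integral_toReal ((hf.aemeasurable hp0 hp).pow_const 2)
    ((hf.ae_lt_top hq0 hp0 hp).mono fun t ht => ENNReal.pow_lt_top ht)]
  have := MemMixed.lintegral_pow (q := 2) (p := p) (δ := δ) (T := T) (f :=
      f) (by norm_num) (by norm_num)
  simp only [ENNReal.toReal_ofNat, ENNReal.rpow_ofNat] at this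
  rw [this]

/-- Hölder's inequality in time, with `1/2 - 1/3 = 1/6`; squaring gives the power `T^{1/3}` of the
theorem. -/
lemma MemMixed.mixedNorm_two_le (hf : MemMixed 3 T p δ f) (hT : 0 < T) (hp0 : p ≠ 0) (hp : p ≠ ⊤) :
    (mixedNorm 2 T p δ f).toReal ^ 2 ≤ T ^ (1 / 3 : ℝ) * (mixedNorm 3 T p δ f).toReal ^ 2 := by
  have h := eLpNorm_le_eLpNorm_mul_rpow_measure_univ (μ := volume.restrict (Ioo 0 T))
    (show (2 : ℝ≥0∞) ≤ 3 by norm_num) (hf.aemeasurable hp0 hp).aestronglyMeasurable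
  have h1 : (volume.restrict (Ioo 0 T)) univ = ENNReal.ofReal T := by simp
  rw [h1] at h
  have h2 := ENNReal.toReal_mono (ENNReal.mul_ne_top hf.2.ne
    (ENNReal.rpow_ne_top_of_nonneg (by norm_num) ENNReal.ofReal_ne_top)) h
  rw [ENNReal.toReal_mul, ← ENNReal.toReal_rpow, ENNReal.toReal_ofReal hT.le] at h2
  calc _ ≤ ((mixedNorm 3 T p δ f).toReal * T ^ (1 / (2 : ℝ≥0∞).toReal - 1 / (3 : ℝ≥0∞).toReal))
      ^ 2 :=
        pow_le_pow_left₀ ENNReal.toReal_nonneg h2 2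
    _ = _ := by
      rw [mul_pow, ← Real.rpow_natCast (T ^ _), ← Real.rpow_mul hT.le, mul_comm]
      norm_num

lemma MemMixed.ae_le_mixedNorm_top (T : ℝ) (f : ℝ → E3 → V) :
    ∀ᵐ t ∂(volume.restrict (Ioo 0 T)), wNorm p δ (f t) ≤ mixedNorm ⊤ T p δ f := by
  rw [mixedNorm, eLpNorm_exponent_top]
  exact ae_le_eLpNormEssSup (f := fun t => wNorm p δ (f t)) (μ := volume.restrict (Ioo 0 T))

end MixedProducts

/-- The regularity of the terms of the energy balance on the strip. -/
structure SliceFamily (γ T : ℝ) (u : ℝ → E3 → E3) (Du : ℝ → E3 → Tensor3) (b : ℝ → E3 → E3)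
    (F : ℝ → E3 → Tensor3) (p₁ p₂ : ℝ → E3 → ℝ) : Prop where
  u_mem : MemMixed ⊤ T 2 γ u
  Du_mem : MemMixed 2 T 2 γ Du
  b_mem : MemMixed 3 T 3 (3 * γ / 2) b
  F_mem : MemMixed 2 T 2 γ F
  p₁_mem : MemMixed 3 T (6 / 5) (6 * γ / 5) p₁
  p₂_mem : MemMixed 2 T 2 γ p₂
  slice : ∀ᵐ t ∂(volume.restrict (Ioo 0 T)), IsSlice γ (u t) (Du t) (b t) (F t) (p₁ t) (p₂ t)

lemma IsSolution.exists_sliceFamily {γ T : ℝ} {u₀ : E3 → E3} {F : ℝ → E3 → Tensor3}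
    {b u : ℝ → E3 → E3} {Du : ℝ → E3 → Tensor3} {p : ℝ → E3 → ℝ}
    (h : IsSolution γ T u₀ F b u Du p) (hd : IsData γ T u₀ F b) :
    ∃ p₁ p₂ : ℝ → E3 → ℝ, SliceFamily γ T u Du b F p₁ p₂ ∧
      ∀ᵐ z ∂(volume.restrict (strip T : Set (ℝ × E3))), p z.1 z.2 = p₁ z.1 z.2 - p₂ z.1 z.2 := by
  obtain ⟨p₁, p₂, h1, h2, r1, r2, hp⟩ := h.pressure
  refine ⟨p₁, p₂, ⟨h.mem_velocity, h.mem_gradient, hd.mem_drift, hd.mem_force, h1, h2, ?_⟩, hp⟩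
  filter_upwards [h.mem_velocity.ae_slice, h.mem_gradient.ae_slice, hd.mem_drift.ae_slice,
    hd.mem_force.ae_slice, h1.ae_slice, h2.ae_slice,
    h.mem_velocity.ae_lt_top (by norm_num) (by norm_num) (by norm_num),
    h.mem_gradient.ae_lt_top (by norm_num) (by norm_num) (by norm_num),
    hd.mem_drift.ae_lt_top (by norm_num) (by norm_num) (by norm_num),
    hd.mem_force.ae_lt_top (by norm_num) (by norm_num) (by norm_num),
    h1.ae_lt_top (by norm_num) six_fifths_ne_zero six_fifths_ne_top,
    h2.ae_lt_top (by norm_num) (by norm_num) (by norm_num),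
    ae_slice_H1loc h.mem_velocity h.mem_gradient h.isGradient, r1, r2]
    with t a1 a2 a3 a4 a5 a6 c1 c2 c3 c4 c5 c6 d1 d2 d3
  exact ⟨a1, a2, a3, a4, a5, a6, c1, c2, c3, c4, c5, c6, d1, d2, d3⟩

lemma integral_strip_mul {T : ℝ} {g : ℝ × E3 → ℝ} {α : ℝ → ℝ}
    (hg : Integrable g ((volume.restrict (Ioo 0 T)).prod (volume : Measure E3))) (hα : Continuous α)
    (hαc : HasCompactSupport α) :
    Integrable (fun z => α z.1 * g z) ((volume.restrict (Ioo 0 T)).prod (volume : Measure E3)) ∧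
    ∫ z in strip T, α z.1 * g z = ∫ t in Ioo 0 T, α t * ∫ x, g (t, x) := by
  obtain ⟨C, hC⟩ := hαc.exists_bound_of_continuous hα
  have hi : Integrable (fun z => α z.1 * g z)
      ((volume.restrict (Ioo 0 T)).prod (volume : Measure E3)) :=
    hg.bdd_mul (hα.comp continuous_fst).aestronglyMeasurable (Eventually.of_forall fun z => hC z.1)
  refine ⟨hi, ?_⟩
  rw [restrict_strip, integral_prod _ hi]
  simp_rw [integral_const_mul]

section StripIntegrability

variable {γ C T : ℝ} {Φ : E3 → ℝ} {u : ℝ → E3 → E3} {Du : ℝ → E3 → Tensor3} {b : ℝ → E3 → E3}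
  {F : ℝ → E3 → Tensor3} {p₁ p₂ : ℝ → E3 → ℝ}

lemma MemMixed.integrable_strip_sq {V : Type*} [NormedAddCommGroup V] [NormedSpace ℝ V] {q : ℝ≥0∞}
    {v : ℝ → E3 → V} (hv : MemMixed q T 2 γ v) (hq : 2 ≤ q) {ψ : E3 → ℝ} (hψ : Continuous ψ)
    {K : ℝ} (hK : 0 ≤ K) (hψK : ∀ x, ‖ψ x‖ ≤ K * weight γ x) :
    Integrable (fun z : ℝ × E3 => ‖v z.1 z.2‖ ^ 2 * ψ z.2)
      ((volume.restrict (Ioo 0 T)).prod (volume : Measure E3)) := by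
  refine integrable_strip (Λ := fun t => ENNReal.ofReal K * (wNorm 2 γ (v t) * wNorm 2 γ (v t)))
    ?_ ?_ ?_
  · exact ((continuous_norm.pow 2).comp_aestronglyMeasurable hv.aestronglyMeasurable).mul
      (hψ.comp continuous_snd).aestronglyMeasurable
  · rw [lintegral_const_mul' _ _ ENNReal.ofReal_ne_top]
    exact ENNReal.mul_lt_top ENNReal.ofReal_lt_top (hv.lintegral_mul_lt_top hv hq hq
      (by norm_num) (by norm_num) (by norm_num) (by norm_num))
  · filter_upwards [hv.ae_slice] with t ht
    refine lintegral_le_wNorm_mul_wNorm (γ := γ) ht ht hK fun x => ?_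
    rw [norm_mul, Real.norm_of_nonneg (by positivity)]
    calc _ ≤ ‖v t x‖ ^ 2 * (K * weight γ x) := mul_le_mul_of_nonneg_left (hψK x) (by positivity)
      _ = _ := by ring

lemma aestronglyMeasurable_strip_sum {v : ℝ → E3 → E3} {p : ℝ → E3 → ℝ}
    (hv : AEStronglyMeasurable (fun z : ℝ × E3 => v z.1 z.2)
      ((volume.restrict (Ioo 0 T)).prod (volume : Measure E3)))
    (hp : AEStronglyMeasurable (fun z : ℝ × E3 => p z.1 z.2)
      ((volume.restrict (Ioo 0 T)).prod (volume : Measure E3))) (hΦ : ContDiff ℝ ∞ Φ) :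
    AEStronglyMeasurable (fun z : ℝ × E3 => p z.1 z.2 * ∑ i, v z.1 z.2 i * fderiv ℝ Φ z.2 (bvec i))
      ((volume.restrict (Ioo 0 T)).prod (volume : Measure E3)) := by
  refine hp.mul (Finset.aestronglyMeasurable_fun_sum _ fun i _ => ?_)
  exact ((EuclideanSpace.proj (𝕜 := ℝ) i).continuous.comp_aestronglyMeasurable hv).mul
    ((contDiff_fderiv_bvec hΦ i).continuous.comp continuous_snd).aestronglyMeasurable

/-- The terms of the energy balance are integrable on the strip. -/
structure StripIntegrable (T : ℝ) (Φ : E3 → ℝ) (u : ℝ → E3 → E3) (Du : ℝ → E3 → Tensor3)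
    (b : ℝ → E3 → E3) (F : ℝ → E3 → Tensor3) (p₁ p₂ : ℝ → E3 → ℝ) : Prop where
  energy : Integrable (fun z : ℝ × E3 => ‖u z.1 z.2‖ ^ 2 / 2 * Φ z.2)
    ((volume.restrict (Ioo 0 T)).prod (volume : Measure E3))
  diffusion : Integrable (fun z : ℝ × E3 => ‖u z.1 z.2‖ ^ 2 / 2 *
    ∑ i, fderiv ℝ (fun x => fderiv ℝ Φ x (bvec i)) z.2 (bvec i))
    ((volume.restrict (Ioo 0 T)).prod (volume : Measure E3))
  dissipation : Integrable (fun z : ℝ × E3 => ‖Du z.1 z.2‖ ^ 2 * Φ z.2)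
    ((volume.restrict (Ioo 0 T)).prod (volume : Measure E3))
  transport : Integrable (fun z : ℝ × E3 => ‖u z.1 z.2‖ ^ 2 / 2 *
    ∑ i, b z.1 z.2 i * fderiv ℝ Φ z.2 (bvec i))
    ((volume.restrict (Ioo 0 T)).prod (volume : Measure E3))
  pressure₁ : Integrable (fun z : ℝ × E3 => p₁ z.1 z.2 *
    ∑ i, u z.1 z.2 i * fderiv ℝ Φ z.2 (bvec i))
    ((volume.restrict (Ioo 0 T)).prod (volume : Measure E3))
  pressure₂ : Integrable (fun z : ℝ × E3 => p₂ z.1 z.2 *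
    ∑ i, u z.1 z.2 i * fderiv ℝ Φ z.2 (bvec i))
    ((volume.restrict (Ioo 0 T)).prod (volume : Measure E3))
  force : Integrable (fun z : ℝ × E3 => ∑ i, ∑ j, F z.1 z.2 (i, j) * u z.1 z.2 j *
    fderiv ℝ Φ z.2 (bvec i)) ((volume.restrict (Ioo 0 T)).prod (volume : Measure E3))
  work : Integrable (fun z : ℝ × E3 => (∑ i, ∑ j, F z.1 z.2 (i, j) * Du z.1 z.2 (i, j)) * Φ z.2)
    ((volume.restrict (Ioo 0 T)).prod (volume : Measure E3))

/-- The slice bounds are products of functions of time that are at least square integrable on `(0,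
T)`, and Tonelli's theorem integrates them. The transport bound is cubic; one factor `u` is taken
out through its essential supremum in time. -/
lemma SliceFamily.stripIntegrable (hs : SliceFamily γ T u Du b F p₁ p₂) (h0 : 0 < γ) (h2 : γ ≤ 2)
    (hΦ : IsTestWeight γ C Φ) : StripIntegrable T Φ u Du b F p₁ p₂ := by
  obtain ⟨B, hB, hSB⟩ := exists_sliceBounds (C := C) h0 h2
  have hsb : ∀ᵐ t ∂(volume.restrict (Ioo 0 T)),
      SliceBounds γ B Φ (u t) (Du t) (b t) (F t) (p₁ t) (p₂ t) :=
    hs.slice.mono fun t ht => hSB Φ _ _ _ _ _ _ hΦ ht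
  have hum := hs.u_mem.aestronglyMeasurable
  have hDm := hs.Du_mem.aestronglyMeasurable
  have hFm := hs.F_mem.aestronglyMeasurable
  have hΦm : AEStronglyMeasurable (fun z : ℝ × E3 => Φ z.2)
      ((volume.restrict (Ioo 0 T)).prod (volume : Measure E3)) :=
    (hΦ.contDiff.continuous.comp continuous_snd).aestronglyMeasurable
  have hum2 : AEStronglyMeasurable (fun z : ℝ × E3 => ‖u z.1 z.2‖ ^ 2 / 2)
      ((volume.restrict (Ioo 0 T)).prod (volume : Measure E3)) :=
    ((continuous_norm.pow 2).div_const 2).comp_aestronglyMeasurable hum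
  have hL : ∀ {ψ : E3 → ℝ}, Integrable (fun z : ℝ × E3 => ‖u z.1 z.2‖ ^ 2 * ψ z.2)
      ((volume.restrict (Ioo 0 T)).prod (volume : Measure E3)) →
      Integrable (fun z : ℝ × E3 => ‖u z.1 z.2‖ ^ 2 / 2 * ψ z.2)
      ((volume.restrict (Ioo 0 T)).prod (volume : Measure E3)) := fun {ψ} h =>
    (h.const_mul (1 / 2)).congr (Eventually.of_forall fun z => by dsimp only; ring)
  have hΦw : ∀ x, ‖Φ x‖ ≤ 1 * weight γ x := fun x => by
    rw [Real.norm_of_nonneg (hΦ.nonneg x), one_mul]; exact hΦ.le_weight x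
  have n2 : (2 : ℝ≥0∞) ≠ 0 := by norm_num
  have t2 : (2 : ℝ≥0∞) ≠ ⊤ := by norm_num
  have n3 : (3 : ℝ≥0∞) ≠ 0 := by norm_num
  have t3 : (3 : ℝ≥0∞) ≠ ⊤ := by norm_num
  have l23 : (2 : ℝ≥0∞) ≤ 3 := by norm_num
  have au := hs.u_mem.aemeasurable n2 t2
  have aD := hs.Du_mem.aemeasurable n2 t2
  have ab := hs.b_mem.aemeasurable n3 t3
  have aF := hs.F_mem.aemeasurable n2 t2
  have ap := hs.p₁_mem.aemeasurable six_fifths_ne_zero six_fifths_ne_top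
  have e1 := hs.b_mem.lintegral_mul_lt_top hs.u_mem l23 le_top n3 t3 n2 t2
  have e2 := hs.b_mem.lintegral_mul_lt_top hs.Du_mem l23 le_rfl n3 t3 n2 t2
  have e3 := hs.p₁_mem.lintegral_mul_lt_top hs.u_mem l23 le_top six_fifths_ne_zero six_fifths_ne_top
    n2 t2
  have e4 := hs.p₁_mem.lintegral_mul_lt_top hs.Du_mem l23 le_rfl six_fifths_ne_zero
    six_fifths_ne_top n2 t2
  have e5 := hs.p₂_mem.lintegral_mul_lt_top hs.u_mem le_rfl le_top n2 t2 n2 t2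
  have e6 := hs.F_mem.lintegral_mul_lt_top hs.u_mem le_rfl le_top n2 t2 n2 t2
  have e7 := hs.F_mem.lintegral_mul_lt_top hs.Du_mem le_rfl le_rfl n2 t2 n2 t2
  set M := mixedNorm ⊤ T 2 γ u with hM
  have hMt : M ≠ ⊤ := hs.u_mem.2.ne
  obtain ⟨K, hK0, hK⟩ := exists_lapl_le (γ := γ) hΦ.contDiff hΦ.hasCompactSupport
  refine ⟨hL (hs.u_mem.integrable_strip_sq le_top hΦ.contDiff.continuous zero_le_one hΦw),
    hL (hs.u_mem.integrable_strip_sq le_top (continuous_lapl hΦ.contDiff) hK0 hK),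
    hs.Du_mem.integrable_strip_sq le_rfl hΦ.contDiff.continuous zero_le_one hΦw, ?_, ?_, ?_, ?_, ?_⟩
  · refine integrable_strip (Λ := fun t => B * (M * (wNorm 3 (3 * γ / 2) (b t) * wNorm 2 γ (u t) +
      wNorm 3 (3 * γ / 2) (b t) * wNorm 2 γ (Du t)))) (aestronglyMeasurable_strip_sum (p :=
          fun t x => ‖u t x‖ ^ 2 / 2)
        hs.b_mem.aestronglyMeasurable hum2 hΦ.contDiff) ?_ ?_
    · rw [lintegral_const_mul' _ _ hB, lintegral_const_mul' _ _ hMt,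
          lintegral_add_left' (f := fun t => wNorm 3 (3 * γ / 2) (b t) * wNorm 2 γ (u t))
              (ab.mul au)]
      exact ENNReal.mul_lt_top hB.lt_top (ENNReal.mul_lt_top hMt.lt_top (ENNReal.add_lt_top.2 ⟨e1,
          e2⟩))
    · filter_upwards [hsb, MemMixed.ae_le_mixedNorm_top (p := 2) (δ := γ) T u] with t ht hMt'
      refine ht.transport.trans (mul_le_mul_right ?_ _)
      calc _ ≤ wNorm 3 (3 * γ / 2) (b t) * M * (wNorm 2 γ (u t) + wNorm 2 γ (Du t)) := by gcongr
        _ = _ := by ring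
  · refine integrable_strip (Λ := fun t => B * (wNorm (6 / 5) (6 * γ / 5) (p₁ t) * wNorm 2 γ (u t) +
      wNorm (6 / 5) (6 * γ / 5) (p₁ t) * wNorm 2 γ (Du t))) (aestronglyMeasurable_strip_sum
        hum hs.p₁_mem.aestronglyMeasurable hΦ.contDiff) ?_ ?_
    · rw [lintegral_const_mul' _ _ hB, lintegral_add_left' (f :=
          fun t => wNorm (6 / 5) (6 * γ / 5) (p₁ t) * wNorm 2 γ (u t)) (ap.mul au)]
      exact ENNReal.mul_lt_top hB.lt_top (ENNReal.add_lt_top.2 ⟨e3, e4⟩)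
    · filter_upwards [hsb] with t ht
      exact ht.pressure₁.trans_eq (by rw [mul_add])
  · refine integrable_strip (Λ := fun t => B * (wNorm 2 γ (p₂ t) * wNorm 2 γ (u t)))
      (aestronglyMeasurable_strip_sum hum hs.p₂_mem.aestronglyMeasurable hΦ.contDiff) ?_
      (hsb.mono fun t ht => ht.pressure₂)
    rw [lintegral_const_mul' _ _ hB]
    exact ENNReal.mul_lt_top hB.lt_top e5
  · refine integrable_strip (Λ := fun t => B * (wNorm 2 γ (F t) * wNorm 2 γ (u t)))
      ?_ ?_ (hsb.mono fun t ht => ht.force)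
    · refine Finset.aestronglyMeasurable_fun_sum _ fun i _ =>
        Finset.aestronglyMeasurable_fun_sum _ fun j _ => ?_
      exact (((EuclideanSpace.proj (𝕜 := ℝ) (i, j)).continuous.comp_aestronglyMeasurable hFm).mul
        ((EuclideanSpace.proj (𝕜 := ℝ) j).continuous.comp_aestronglyMeasurable hum)).mul
        ((contDiff_fderiv_bvec hΦ.contDiff i).continuous.comp continuous_snd).aestronglyMeasurable
    · rw [lintegral_const_mul' _ _ hB]
      exact ENNReal.mul_lt_top hB.lt_top e6
  · refine integrable_strip (Λ := fun t => B * (wNorm 2 γ (F t) * wNorm 2 γ (Du t)))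
      ?_ ?_ (hsb.mono fun t ht => ht.work)
    · refine AEStronglyMeasurable.mul (Finset.aestronglyMeasurable_fun_sum _ fun i _ =>
        Finset.aestronglyMeasurable_fun_sum _ fun j _ => ?_) hΦm
      exact ((EuclideanSpace.proj (𝕜 := ℝ) (i, j)).continuous.comp_aestronglyMeasurable hFm).mul
        ((EuclideanSpace.proj (𝕜 := ℝ) (i, j)).continuous.comp_aestronglyMeasurable hDm)
    · rw [lintegral_const_mul' _ _ hB]
      exact ENNReal.mul_lt_top hB.lt_top e7

lemma StripIntegrable.integrable_slicePower (h : StripIntegrable T Φ u Du b F p₁ p₂) :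
    IntegrableOn (fun t => slicePower Φ (u t) (Du t) (b t) (F t) (p₁ t) (p₂ t)) (Ioo 0 T) :=
  ((((h.diffusion.integral_prod_left.sub h.dissipation.integral_prod_left).add
    h.transport.integral_prod_left).add
    (h.pressure₁.integral_prod_left.sub h.pressure₂.integral_prod_left)).sub
    h.force.integral_prod_left).sub h.work.integral_prod_left

/-- The energy inequality for a test function with separated variables. -/
lemma StripIntegrable.energy_le {p : ℝ → E3 → ℝ} (h : StripIntegrable T Φ u Du b F p₁ p₂)
    (hE : LocalEnergyBalance T F b u Du p)
    (hp : ∀ᵐ z ∂(volume.restrict (strip T : Set (ℝ × E3))), p z.1 z.2 = p₁ z.1 z.2 - p₂ z.1 z.2)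
    (hΦ : ContDiff ℝ ∞ Φ) (hΦc : HasCompactSupport Φ) (hΦ0 : ∀ x, 0 ≤ Φ x)
    {α : ℝ → ℝ} (hα : ContDiff ℝ ∞ α) (hαc : HasCompactSupport α) (hαT : tsupport α ⊆ Ioo 0 T)
    (hα0 : ∀ t, 0 ≤ α t) :
    - ∫ t in Ioo 0 T, (∫ x, ‖u t x‖ ^ 2 / 2 * Φ x) * deriv α t ≤
      ∫ t in Ioo 0 T, α t * slicePower Φ (u t) (Du t) (b t) (F t) (p₁ t) (p₂ t) := by
  obtain ⟨μ, -, hμ⟩ := hE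
  have hb := hμ (stripTest hα hαc hαT hΦ hΦc)
  -- The defect measure enters only through the sign of its integral against a nonnegative test
  -- function.
  have hnn : 0 ≤ ∫ z in strip T, (stripTest hα hαc hαT hΦ hΦc) z ∂μ :=
    integral_nonneg fun z => mul_nonneg (hα0 _) (hΦ0 _)
  set φ := stripTest hα hαc hαT hΦ hΦc with hφ
  have z0 : ∀ z, φ z = α z.1 * Φ z.2 := fun z => rfl
  have z1 : ∀ i z, dx i φ z = α z.1 * fderiv ℝ Φ z.2 (bvec i) := fun i z => dx_mul hα hΦ i z
  have z2 : ∀ z, dt φ z = deriv α z.1 * Φ z.2 := dt_mul hα hΦ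
  have z3 : ∀ z, lap φ z = α z.1 * ∑ i, fderiv ℝ (fun x => fderiv ℝ Φ x (bvec i)) z.2 (bvec i) :=
    lap_mul hα hΦ
  have s1 : ∀ (v : E3) (z : ℝ × E3), ∑ i, v i * dx i φ z =
      α z.1 * ∑ i, v i * fderiv ℝ Φ z.2 (bvec i) := fun v z => by
    rw [Finset.mul_sum]
    exact Finset.sum_congr rfl fun i _ => by rw [z1]; ring
  have c1 := (integral_strip_mul h.energy (hα.continuous_deriv (by simp)) hαc.deriv).2
  have c2 := (integral_strip_mul h.diffusion hα.continuous hαc).2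
  have c3 := (integral_strip_mul h.dissipation hα.continuous hαc).2
  have c4 := (integral_strip_mul h.transport hα.continuous hαc).2
  have c5 := (integral_strip_mul (h.pressure₁.sub h.pressure₂) hα.continuous hαc).2
  have c6 := (integral_strip_mul h.force hα.continuous hαc).2
  have c7 := (integral_strip_mul h.work hα.continuous hαc).2
  have f1 : ∫ z in strip T, ‖u z.1 z.2‖ ^ 2 / 2 * dt φ z =
      ∫ t in Ioo 0 T, (∫ x, ‖u t x‖ ^ 2 / 2 * Φ x) * deriv α t := by
    simp_rw [mul_comm _ (deriv α _)]
    rw [← c1]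
    congr 1; ext z; rw [z2]; ring
  have f2 := Eq.trans (a := ∫ z in strip T, ‖u z.1 z.2‖ ^ 2 / 2 * lap φ z)
    (by congr 1; ext z; rw [z3]; ring) c2
  have f3 := Eq.trans (a := ∫ z in strip T, ‖Du z.1 z.2‖ ^ 2 * φ z)
    (by congr 1; ext z; rw [z0]; ring) c3
  have f4 := Eq.trans (a := ∫ z in strip T, ‖u z.1 z.2‖ ^ 2 / 2 * ∑ i, b z.1 z.2 i * dx i φ z)
    (by congr 1; ext z; rw [s1]; ring) c4
  have f5 := Eq.trans (a := ∫ z in strip T, p z.1 z.2 * ∑ i, u z.1 z.2 i * dx i φ z)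
    (integral_congr_ae (by
      filter_upwards [hp] with z hz
      rw [s1, hz, Pi.sub_apply]; ring)) c5
  have f6 := Eq.trans
    (a := ∫ z in strip T, ∑ i, ∑ j, F z.1 z.2 (i, j) * u z.1 z.2 j * dx i φ z)
    (by
      congr 1; ext z
      simp_rw [Finset.mul_sum]
      exact Finset.sum_congr rfl fun i _ => Finset.sum_congr rfl fun j _ => by rw [z1]; ring)
    c6
  have f7 := Eq.trans
    (a := ∫ z in strip T, (∑ i, ∑ j, F z.1 z.2 (i, j) * Du z.1 z.2 (i, j)) * φ z)
    (by congr 1; ext z; rw [z0]; ring) c7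
  obtain ⟨M, hM⟩ := hαc.exists_bound_of_continuous hα.continuous
  have hαI : ∀ {I : ℝ → ℝ}, Integrable I (volume.restrict (Ioo 0 T)) →
      Integrable (fun t => α t * I t) (volume.restrict (Ioo 0 T)) := fun hI =>
    hI.bdd_mul hα.continuous.aestronglyMeasurable (Eventually.of_forall hM)
  have g2 := hαI h.diffusion.integral_prod_left
  have g3 := hαI h.dissipation.integral_prod_left
  have g4 := hαI h.transport.integral_prod_left
  have g5 := hαI (h.pressure₁.sub h.pressure₂).integral_prod_left
  have g6 := hαI h.force.integral_prod_left
  have g7 := hαI h.work.integral_prod_left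
  rw [f1, f2, f3, f4, f5, f6, f7, ← integral_sub' g2 g3, ← integral_add' (g2.sub g3) g4,
    ← integral_add' ((g2.sub g3).add g4) g5, ← integral_sub' (((g2.sub g3).add g4).add g5) g6,
    ← integral_sub' ((((g2.sub g3).add g4).add g5).sub g6) g7] at hb
  refine (hb.trans_le (sub_le_self _ hnn)).trans_eq (integral_congr_ae ?_)
  -- For almost every time both pressure integrands are integrable in space, so the integral of `p₁
  -- - p₂` splits.
  filter_upwards [h.pressure₁.prod_right_ae, h.pressure₂.prod_right_ae] with t h1 h2
  simp only [slicePower, Pi.sub_apply, Pi.add_apply]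
  rw [integral_sub h1 h2]
  ring

end StripIntegrability

/-! ### Lower semicontinuity of the energy and the initial time -/

lemma integral_weightMeasure (γ : ℝ) (g : E3 → ℝ) :
    ∫ x, g x ∂(weightMeasure γ) = ∫ x, weight γ x * g x := by
  rw [weightMeasure, integral_withDensity_eq_integral_toReal_smul (measurable_ofReal_weight γ)
    (Eventually.of_forall fun x => ENNReal.ofReal_lt_top)]
  congr 1; ext x
  rw [ENNReal.toReal_ofReal (weight_pos γ x).le, smul_eq_mul]

section LowerSemicontinuity

variable {γ T t : ℝ} {u : ℝ → E3 → E3} {Φ : E3 → ℝ}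

/-- Weak continuity makes the localised energy lower semicontinuous. -/
lemma WeaklyContinuous.eventually_energy_ge (hw : WeaklyContinuous γ T u) (hΦ : Continuous Φ)
    (hΦ0 : ∀ x, 0 ≤ Φ x) (hΦw : ∀ x, Φ x ≤ weight γ x) (ht : t ∈ Ioo 0 T) {ε : ℝ} (hε : 0 < ε) :
    ∀ᶠ s in 𝓝 t, (∫ x, ‖u t x‖ ^ 2 / 2 * Φ x) - ε ≤ ∫ x, ‖u s x‖ ^ 2 / 2 * Φ x := by
  -- `ψ = Φ / w_γ` has values in `[0, 1]`, so `ψ u(t)` lies in `L²_{w_γ}` and is admissible in the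
  -- weak continuity.
  set ψ : E3 → ℝ := fun x => Φ x * weight (-γ) x with hψ
  have hψc : Continuous ψ := hΦ.mul (continuous_weight _)
  have hψ0 : ∀ x, 0 ≤ ψ x := fun x => mul_nonneg (hΦ0 x) (weight_pos _ x).le
  have hww : ∀ x, weight γ x * weight (-γ) x = 1 := fun x => by
    rw [weight_mul, add_neg_cancel, weight_eq]; simp
  have hψ1 : ∀ x, ‖ψ x‖ ≤ 1 := fun x => by
    rw [Real.norm_of_nonneg (hψ0 x), ← hww x]
    exact mul_le_mul_of_nonneg_right (hΦw x) (weight_pos _ x).le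
  have hE : ∀ s, ∫ x, ‖u s x‖ ^ 2 / 2 * Φ x = ∫ x, ψ x * (‖u s x‖ ^ 2 / 2) ∂(weightMeasure γ) :=
    fun s => by
      rw [integral_weightMeasure]
      congr 1; ext x
      calc _ = (weight γ x * weight (-γ) x) * (‖u s x‖ ^ 2 / 2 * Φ x) := by rw [hww, one_mul]
        _ = _ := by simp only [hψ]; ring
  have hg : MemLp (fun x => ψ x • u t x) 2 (weightMeasure γ) :=
    (hw.1 t (Ioo_subset_Ico_self ht)).mono
      (hψc.aestronglyMeasurable.smul (hw.1 t (Ioo_subset_Ico_self ht)).1)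
      (Eventually.of_forall fun x => by
        rw [norm_smul]; exact mul_le_of_le_one_left (norm_nonneg _) (hψ1 x))
  have hi : ∀ s ∈ Ioo 0 T, Integrable (fun x => ψ x * (‖u s x‖ ^ 2 / 2)) (weightMeasure γ) :=
    fun s hs => by
      have h1 := hw.1 s (Ioo_subset_Ico_self hs)
      exact (((memLp_two_iff_integrable_sq_norm h1.1).1 h1).div_const 2).bdd_mul
        hψc.aestronglyMeasurable (Eventually.of_forall hψ1)
  have hin : ∀ s ∈ Ioo 0 T, Integrable (fun x => inner ℝ (u s x) (ψ x • u t x)) (weightMeasure γ) :=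
    fun s hs => by
      have h1 := hw.1 s (Ioo_subset_Ico_self hs)
      exact (h1.norm.integrable_mul hg.norm).mono' (h1.1.inner hg.1)
        (Eventually.of_forall fun x => norm_inner_le_norm _ _)
  have hJ : ContinuousAt (fun s => ∫ x, inner ℝ (u s x) (ψ x • u t x) ∂(weightMeasure γ)) t :=
    (hw.2 _ hg).continuousAt (Ico_mem_nhds ht.1 ht.2)
  have hJt : ∫ x, inner ℝ (u t x) (ψ x • u t x) ∂(weightMeasure γ) =
      2 * ∫ x, ‖u t x‖ ^ 2 / 2 * Φ x := by
    rw [hE, ← integral_const_mul]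
    congr 1; ext x
    rw [real_inner_smul_right, real_inner_self_eq_norm_sq]
    ring
  have hev := hJ.eventually (lt_mem_nhds (sub_lt_self _ hε))
  filter_upwards [hev, Ioo_mem_nhds ht.1 ht.2] with s hs hsT
  rw [hJt] at hs
  -- `⟨u(s), u(t)⟩ ≤ (|u(s)|² + |u(t)|²)/2`, integrated against `ψ`. The left-hand side tends to
  -- twice the energy at `t` as `s → t`, which leaves the lower semicontinuity.
  have hle : ∫ x, inner ℝ (u s x) (ψ x • u t x) ∂(weightMeasure γ) ≤
      (∫ x, ‖u s x‖ ^ 2 / 2 * Φ x) + ∫ x, ‖u t x‖ ^ 2 / 2 * Φ x := by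
    rw [hE, hE, ← integral_add (hi s hsT) (hi t ht)]
    refine integral_mono (hin s hsT)
      ((hi s hsT).add (hi t ht)) fun x => ?_
    dsimp only
    rw [real_inner_smul_right, ← mul_add]
    refine mul_le_mul_of_nonneg_left ?_ (hψ0 x)
    have := real_inner_le_norm (u s x) (u t x)
    linarith [sq_nonneg (‖u s x‖ - ‖u t x‖)]
  linarith

lemma memLp_weightMeasure_iff {V : Type*} [NormedAddCommGroup V] {p : ℝ≥0∞} {f : E3 → V} :
    MemLp f p (weightMeasure γ) ↔ AEStronglyMeasurable f volume ∧ wNorm p γ f < ⊤ :=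
  ⟨fun h => ⟨h.1.mono_ac (volume_ac_weightMeasure γ), h.2⟩,
    fun h => ⟨h.1.mono_ac (weightMeasure_ac_volume γ), h.2⟩⟩

lemma energy_le_wNorm_sq {v : E3 → E3} (hv : MemLp v 2 (weightMeasure γ))
    (hΦ0 : ∀ x, 0 ≤ Φ x) (hΦw : ∀ x, Φ x ≤ weight γ x) :
    ∫ x, ‖v x‖ ^ 2 / 2 * Φ x ≤ (wNorm 2 γ v).toReal ^ 2 / 2 := by
  obtain ⟨hm, hl⟩ := memLp_weightMeasure_iff.1 hv
  obtain ⟨hi, he⟩ := wNorm_sq_eq_integral hm hl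
  rw [← he, ← integral_div]
  refine integral_mono_of_nonneg (Eventually.of_forall fun x => ?_) (hi.div_const 2)
    (Eventually.of_forall fun x => ?_)
  · exact mul_nonneg (by positivity) (hΦ0 x)
  · calc ‖v x‖ ^ 2 / 2 * Φ x ≤ ‖v x‖ ^ 2 / 2 * weight γ x :=
        mul_le_mul_of_nonneg_left (hΦw x) (by positivity)
      _ = _ := by ring

/-- Strong convergence to `u₀` and the triangle inequality in `L²_{w_γ}`, since the localised energy
is at most half the squared weighted norm. -/
lemma eventually_energy_le {u₀ : E3 → E3} (hw : WeaklyContinuous γ T u) (hT : 0 < T)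
    (h₀ : MemLp u₀ 2 (weightMeasure γ))
    (hlim : Tendsto (fun t => wNorm 2 γ (u t - u₀)) (𝓝[>] 0) (𝓝 0)) (hΦ0 : ∀ x, 0 ≤ Φ x) (hΦw : ∀ x, Φ x ≤ weight γ x) {ε : ℝ} (hε : 0 < ε) :
    ∀ᶠ s in 𝓝[>] 0, ∫ x, ‖u s x‖ ^ 2 / 2 * Φ x ≤ (wNorm 2 γ u₀).toReal ^ 2 / 2 + ε := by
  have h1 : Tendsto (fun s => ((wNorm 2 γ (u s - u₀)).toReal + (wNorm 2 γ u₀).toReal) ^ 2 / 2)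
      (𝓝[>] 0) (𝓝 ((0 + (wNorm 2 γ u₀).toReal) ^ 2 / 2)) := by
    have h2 := (ENNReal.tendsto_toReal ENNReal.zero_ne_top).comp hlim
    exact (((h2.add_const _).pow 2).div_const 2)
  rw [zero_add] at h1
  filter_upwards [h1.eventually (gt_mem_nhds (lt_add_of_pos_right _ hε)),
    Ioo_mem_nhdsGT hT] with s hs hsT
  have hus := hw.1 s (Ioo_subset_Ico_self hsT)
  refine (energy_le_wNorm_sq hus hΦ0 hΦw).trans (le_trans ?_ hs.le)
  have h3 : wNorm 2 γ (u s) ≤ wNorm 2 γ (u s - u₀) + wNorm 2 γ u₀ := by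
    have := eLpNorm_add_le (p := 2) (μ := weightMeasure γ) (hus.sub h₀).1 h₀.1 (by norm_num)
    rwa [sub_add_cancel] at this
  have h4 := ENNReal.toReal_mono (ENNReal.add_ne_top.2 ⟨(hus.sub h₀).2.ne, h₀.2.ne⟩) h3
  rw [ENNReal.toReal_add (hus.sub h₀).2.ne h₀.2.ne] at h4
  change _ ≤ (wNorm 2 γ (u s - u₀)).toReal + (wNorm 2 γ u₀).toReal at h4
  have := pow_le_pow_left₀ ENNReal.toReal_nonneg h4 2
  linarith

end LowerSemicontinuity

/-! ### The weighted energy inequality and the conclusion -/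

section GlobalEnergy

variable {γ T : ℝ} {u₀ : E3 → E3} {u : ℝ → E3 → E3} {Du : ℝ → E3 → Tensor3} {b : ℝ → E3 → E3}
  {F : ℝ → E3 → Tensor3} {p : ℝ → E3 → ℝ}

lemma tendsto_integral_testWeight {V : Type*} [NormedAddCommGroup V] [NormedSpace ℝ V] {v : E3 → V}
    {Φ : ℕ → E3 → ℝ} (hv : AEStronglyMeasurable v volume) (hl : wNorm 2 γ v < ⊤)
    (hΦ : ∀ n, Continuous (Φ n)) (hΦ0 : ∀ n x, 0 ≤ Φ n x) (hΦw : ∀ n x, Φ n x ≤ weight γ x)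
    (hlim : ∀ x, Tendsto (fun n => Φ n x) atTop (𝓝 (weight γ x))) :
    Tendsto (fun n => ∫ x, ‖v x‖ ^ 2 * Φ n x) atTop (𝓝 ((wNorm 2 γ v).toReal ^ 2)) := by
  obtain ⟨hi, he⟩ := wNorm_sq_eq_integral hv hl
  rw [← he]
  refine tendsto_integral_of_dominated_convergence (fun x => weight γ x * ‖v x‖ ^ 2) (fun n =>
      ?_) hi
    (fun n => Eventually.of_forall fun x => ?_) (Eventually.of_forall fun x => ?_)
  · exact ((continuous_norm.pow 2).comp_aestronglyMeasurable hv).mul (hΦ n).aestronglyMeasurable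
  · rw [Real.norm_of_nonneg (mul_nonneg (by positivity) (hΦ0 n x)), mul_comm]
    exact mul_le_mul_of_nonneg_right (hΦw n x) (by positivity)
  · have := (hlim x).const_mul (‖v x‖ ^ 2)
    rwa [mul_comm _ (weight γ x)] at this

/-- The global energy inequality in weighted spaces. -/
lemma exists_energy_inequality (h0 : 0 < γ) (h2 : γ ≤ 2) : ∃ B : ℝ, 0 ≤ B ∧
    ∀ (T : ℝ), 0 < T → ∀ (u₀ : E3 → E3) (F : ℝ → E3 → Tensor3) (b : ℝ → E3 → E3),
    IsData γ T u₀ F b → ∀ (u : ℝ → E3 → E3) (Du : ℝ → E3 → Tensor3) (p : ℝ → E3 → ℝ),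
    IsSolution γ T u₀ F b u Du p → ∀ t ∈ Ioo 0 T,
    (wNorm 2 γ (u t)).toReal ^ 2 + ∫ τ in Ioc 0 t, (wNorm 2 γ (Du τ)).toReal ^ 2 ≤
      (wNorm 2 γ u₀).toReal ^ 2 + ∫ τ in Ioc 0 t, 2 * B *
        ((1 + (wNorm 3 (3 * γ / 2) (b τ)).toReal ^ 2) * (wNorm 2 γ (u τ)).toReal ^ 2 +
          (wNorm 2 γ (F τ)).toReal ^ 2) := by
  obtain ⟨C, hC, Φ, hΦ, hΦlim⟩ := exists_isTestWeight h0 h2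
  obtain ⟨B, hB, hpow⟩ := exists_slicePower_le (C := C) h0 h2
  refine ⟨B, hB, fun T hT u₀ F b hd u Du p hs t ht => ?_⟩
  obtain ⟨p₁, p₂, hf, hp⟩ := hs.exists_sliceFamily hd
  have hsub : Ioc 0 t ⊆ Ioo 0 T := fun τ hτ => ⟨hτ.1, lt_of_le_of_lt hτ.2 ht.2⟩
  have hd2 := (hf.Du_mem.integrable_toReal_sq le_rfl (by norm_num) (by norm_num))
  have hf2 := (hf.F_mem.integrable_toReal_sq le_rfl (by norm_num) (by norm_num))
  have hu2 := (hf.u_mem.integrable_toReal_sq le_top (by norm_num) (by norm_num))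
  have hb2 := (hf.b_mem.integrable_toReal_sq (by norm_num) (by norm_num) (by norm_num))
  set M := (mixedNorm ⊤ T 2 γ u).toReal
  have hM : ∀ᵐ τ ∂(volume.restrict (Ioo 0 T)), ‖(wNorm 2 γ (u τ)).toReal ^ 2‖ ≤ M ^ 2 := by
    filter_upwards [MemMixed.ae_le_mixedNorm_top (p := 2) (δ := γ) T u] with τ hτ
    rw [Real.norm_of_nonneg (by positivity)]
    exact pow_le_pow_left₀ ENNReal.toReal_nonneg (ENNReal.toReal_mono hf.u_mem.2.ne hτ) 2
  set R : ℝ → ℝ := fun τ => B * ((1 + (wNorm 3 (3 * γ / 2) (b τ)).toReal ^ 2) *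
    (wNorm 2 γ (u τ)).toReal ^ 2 + (wNorm 2 γ (F τ)).toReal ^ 2) with hR
  have hRi : IntegrableOn R (Ioo 0 T) := by
    refine Integrable.const_mul (Integrable.add ?_ hf2) B
    exact (((integrable_const (1 : ℝ)).add hb2).mul_bdd (c := M ^ 2) hu2.1 hM)
  set d2 : ℝ → ℝ := fun τ => (wNorm 2 γ (Du τ)).toReal ^ 2 with hd2'
  have hQ : IntegrableOn (fun τ => d2 τ / 2 + R τ) (Ioc 0 t) :=
    ((hd2.div_const 2).add hRi).mono_measure (Measure.restrict_mono hsub le_rfl)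
  -- The localised dissipation has to stay on the left: the term `d²/2` on the right carries the
  -- full weight and can be absorbed only after `n → ∞`.
  have hn : ∀ n, (∫ x, ‖u t x‖ ^ 2 / 2 * Φ n x) + ∫ τ in Ioc 0 t, ∫ x, ‖Du τ x‖ ^ 2 * Φ n x ≤
      (wNorm 2 γ u₀).toReal ^ 2 / 2 + ∫ τ in Ioc 0 t, (d2 τ / 2 + R τ) := fun n => by
    have hsi := hf.stripIntegrable h0 h2 (hΦ n)
    have hD : IntegrableOn (fun τ => ∫ x, ‖Du τ x‖ ^ 2 * Φ n x) (Ioc 0 t) :=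
      hsi.dissipation.integral_prod_left.mono_measure (Measure.restrict_mono hsub le_rfl)
    have h3 := le_of_weak_differential_inequality ht hsi.energy.integral_prod_left
      hsi.integrable_slicePower
      (fun α a1 a2 a3 a4 => hsi.energy_le hs.energy hp (hΦ n).contDiff (hΦ n).hasCompactSupport
        (hΦ n).nonneg a1 a2 a3 a4)
      (fun ε hε => hs.weaklyContinuous.eventually_energy_ge (hΦ n).contDiff.continuous (hΦ n).nonneg
        (hΦ n).le_weight ht hε)
      (fun ε hε => eventually_energy_le hs.weaklyContinuous hT hd.memLp_init hs.tendsto_initial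
        (hΦ n).nonneg (hΦ n).le_weight hε)
    have h4 : ∫ τ in Ioc 0 t, slicePower (Φ n) (u τ) (Du τ) (b τ) (F τ) (p₁ τ) (p₂ τ) ≤
        ∫ τ in Ioc 0 t, ((d2 τ / 2 + R τ) - ∫ x, ‖Du τ x‖ ^ 2 * Φ n x) := by
      refine integral_mono_ae (hsi.integrable_slicePower.mono_set hsub)
        (hQ.sub hD) ?_
      filter_upwards [ae_restrict_of_ae_restrict_of_subset hsub hf.slice] with τ hτ
      have := hpow (Φ n) _ _ _ _ _ _ (hΦ n) hτ
      simp only [hR, hd2']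
      linarith
    rw [integral_sub hQ hD] at h4
    dsimp only at h3 h4
    linarith
  have hut := memLp_weightMeasure_iff.1 (hs.weaklyContinuous.1 t (Ioo_subset_Ico_self ht))
  have l1 : Tendsto (fun n => ∫ x, ‖u t x‖ ^ 2 / 2 * Φ n x) atTop
      (𝓝 ((wNorm 2 γ (u t)).toReal ^ 2 / 2)) := by
    have := (tendsto_integral_testWeight hut.1 hut.2 (fun n => (hΦ n).contDiff.continuous)
      (fun n => (hΦ n).nonneg) (fun n => (hΦ n).le_weight) hΦlim).div_const 2
    refine this.congr fun n => ?_
    rw [← integral_div]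
    congr 1; ext x; ring
  -- Two dominated convergences, in space and then in time, the latter dominated by the full
  -- weighted dissipation.
  have l2 : Tendsto (fun n => ∫ τ in Ioc 0 t, ∫ x, ‖Du τ x‖ ^ 2 * Φ n x) atTop
      (𝓝 (∫ τ in Ioc 0 t, d2 τ)) := by
    refine tendsto_integral_of_dominated_convergence d2 (fun n => ?_) (hd2.mono_set hsub)
      (fun n => ?_) ?_
    · exact ((hf.stripIntegrable h0 h2 (hΦ n)).dissipation.integral_prod_left.mono_measure
        (Measure.restrict_mono hsub le_rfl)).1
    · filter_upwards [ae_restrict_of_ae_restrict_of_subset hsub hf.slice] with τ hτ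
      obtain ⟨hi, he⟩ := wNorm_sq_eq_integral hτ.Du_meas hτ.Du_lt
      rw [Real.norm_of_nonneg (integral_nonneg fun x => mul_nonneg (by positivity)
        ((hΦ n).nonneg x))]
      refine le_trans ?_ he.le
      refine integral_mono_of_nonneg (Eventually.of_forall fun x => mul_nonneg (by positivity)
        ((hΦ n).nonneg x)) hi (Eventually.of_forall fun x => ?_)
      dsimp only
      rw [mul_comm]
      exact mul_le_mul_of_nonneg_right ((hΦ n).le_weight x) (by positivity)
    · filter_upwards [ae_restrict_of_ae_restrict_of_subset hsub hf.slice] with τ hτ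
      exact tendsto_integral_testWeight hτ.Du_meas hτ.Du_lt (fun n => (hΦ n).contDiff.continuous)
        (fun n => (hΦ n).nonneg) (fun n => (hΦ n).le_weight) hΦlim
  -- In the limit half of the dissipation cancels against `d²/2`; doubling gives the stated
  -- inequality.
  have h5 := le_of_tendsto (l1.add l2) (Eventually.of_forall hn)
  rw [integral_add ((hd2.mono_set hsub).div_const 2) (hRi.mono_set hsub), integral_div] at h5
  have h6 : ∫ τ in Ioc 0 t, 2 * B *
        ((1 + (wNorm 3 (3 * γ / 2) (b τ)).toReal ^ 2) * (wNorm 2 γ (u τ)).toReal ^ 2 +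
          (wNorm 2 γ (F τ)).toReal ^ 2) = 2 * ∫ τ in Ioc 0 t, R τ := by
    rw [← integral_const_mul]
    congr 1; ext τ; simp only [hR]; ring
  rw [h6]
  linarith

end GlobalEnergy

/-- The energy estimate in weighted spaces. -/
lemma exists_energy_estimate {γ : ℝ} (h0 : 0 < γ) (h2 : γ ≤ 2) : ∃ C : ℝ, 0 < C ∧
    ∀ (T : ℝ), 0 < T → ∀ (u₀ : E3 → E3) (F : ℝ → E3 → Tensor3) (b : ℝ → E3 → E3),
    IsData γ T u₀ F b → ∀ (u : ℝ → E3 → E3) (Du : ℝ → E3 → Tensor3) (p : ℝ → E3 → ℝ),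
    IsSolution γ T u₀ F b u Du p → ∀ t ∈ Ioo 0 T,
    (wNorm 2 γ (u t)).toReal ^ 2 + ∫ τ in 0..t, (wNorm 2 γ (Du τ)).toReal ^ 2 ≤
      (((wNorm 2 γ u₀).toReal + C * (mixedNorm 2 T 2 γ F).toReal) *
        Real.exp (C * (T + T ^ (1 / 3 : ℝ) * (mixedNorm 3 T 3 (3 * γ / 2) b).toReal ^ 2))) ^ 2 := by
  obtain ⟨B, hB, hen⟩ := exists_energy_inequality h0 h2
  -- One constant has to serve twice: `2B ≤ C` in the exponent, and `2B ≤ C²` in front of the force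
  -- once the sum is squared.
  refine ⟨2 * B + 1, by positivity, fun T hT u₀ F b hd u Du p hs t ht => ?_⟩
  have hsub : ∀ {s}, s ≤ t → Ioc 0 s ⊆ Ioo 0 T := fun hst τ hτ =>
    ⟨hτ.1, lt_of_le_of_lt (hτ.2.trans hst) ht.2⟩
  have hu := hs.mem_velocity
  have hF := hd.mem_force
  have hb := hd.mem_drift
  have hf2 := (hF.integrable_toReal_sq le_rfl (by norm_num) (by norm_num))
  have hu2 := (hu.integrable_toReal_sq le_top (by norm_num) (by norm_num))
  have hb2 := (hb.integrable_toReal_sq (by norm_num) (by norm_num) (by norm_num))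
  have hM : ∀ᵐ τ ∂(volume.restrict (Ioo 0 T)), ‖(wNorm 2 γ (u τ)).toReal ^ 2‖ ≤
      (mixedNorm ⊤ T 2 γ u).toReal ^ 2 := by
    filter_upwards [MemMixed.ae_le_mixedNorm_top (p := 2) (δ := γ) T u] with τ hτ
    rw [Real.norm_of_nonneg (by positivity)]
    exact pow_le_pow_left₀ ENNReal.toReal_nonneg (ENNReal.toReal_mono hu.2.ne hτ) 2
  set y : ℝ → ℝ := fun τ => (wNorm 2 γ (u τ)).toReal ^ 2 with hy
  set k : ℝ → ℝ := fun τ => 2 * B * (1 + (wNorm 3 (3 * γ / 2) (b τ)).toReal ^ 2) with hk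
  set f2 : ℝ → ℝ := fun τ => (wNorm 2 γ (F τ)).toReal ^ 2 with hf2'
  set E0 := (wNorm 2 γ u₀).toReal
  set f := (mixedNorm 2 T 2 γ F).toReal
  set β := (mixedNorm 3 T 3 (3 * γ / 2) b).toReal
  have hE0 : 0 ≤ E0 := ENNReal.toReal_nonneg
  have hf0 : 0 ≤ f := ENNReal.toReal_nonneg
  have hki : IntegrableOn k (Ioo 0 T) := ((integrable_const (1 : ℝ)).add hb2).const_mul (2 * B)
  have hkyi : IntegrableOn (fun τ => k τ * y τ) (Ioo 0 T) := hki.mul_bdd hu2.1 hM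
  have hk0 : ∀ s, 0 ≤ k s := fun s => by simp only [hk]; positivity
  have hd0 : ∀ s, 0 ≤ s → 0 ≤ ∫ τ in 0..s, (wNorm 2 γ (Du τ)).toReal ^ 2 := fun s hs' =>
    intervalIntegral.integral_nonneg hs' fun τ _ => by positivity
  have hF2 : ∫ τ in Ioo 0 T, f2 τ = f ^ 2 := hF.integral_toReal_sq le_rfl (by norm_num)
      (by norm_num)
  have hineq : ∀ s ∈ Ioc 0 t, y s + ∫ τ in 0..s, (wNorm 2 γ (Du τ)).toReal ^ 2 ≤
      (E0 ^ 2 + 2 * B * f ^ 2) + ∫ τ in 0..s, k τ * y τ := fun s hst => by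
    have h3 := hen T hT u₀ F b hd u Du p hs s ⟨hst.1, lt_of_le_of_lt hst.2 ht.2⟩
    rw [intervalIntegral.integral_of_le hst.1.le, intervalIntegral.integral_of_le hst.1.le]
    refine h3.trans ?_
    have h4 : ∫ τ in Ioc 0 s, 2 * B * ((1 + (wNorm 3 (3 * γ / 2) (b τ)).toReal ^ 2) *
        (wNorm 2 γ (u τ)).toReal ^ 2 + (wNorm 2 γ (F τ)).toReal ^ 2) =
        (∫ τ in Ioc 0 s, k τ * y τ) + 2 * B * ∫ τ in Ioc 0 s, f2 τ := by
      rw [← integral_const_mul, ← integral_add (hkyi.mono_set (hsub hst.2))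
        ((hf2.mono_set (hsub hst.2)).const_mul _)]
      congr 1; ext τ; simp only [hk, hy, hf2']; ring
    have h5 : ∫ τ in Ioc 0 s, f2 τ ≤ f ^ 2 := by
      rw [← hF2]
      exact setIntegral_mono_set hf2 (Eventually.of_forall fun τ => by
        simp only [hf2', Pi.zero_apply]; positivity) (hsub hst.2).eventuallyLE
    have h6 := mul_le_mul_of_nonneg_left h5 (show 0 ≤ 2 * B by positivity)
    rw [h4]
    linarith
  -- The integrated dissipation is dropped for Grönwall's inequality and recovered below, since the
  -- inequality at time `t` bounds it together with the energy by the same quantity.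
  have hgr := gronwall_integrable (A := E0 ^ 2 + 2 * B * f ^ 2) ht.1.le hk0
    ((intervalIntegrable_iff_integrableOn_Ioc_of_le ht.1.le).2 (hki.mono_set (hsub le_rfl)))
    ((intervalIntegrable_iff_integrableOn_Ioc_of_le ht.1.le).2 (hkyi.mono_set (hsub le_rfl)))
    (by
      filter_upwards [ae_restrict_mem measurableSet_Ioc] with s hst
      linarith [hineq s hst, hd0 s hst.1.le])
  have hkle : ∫ r in 0..t, k r ≤ 2 * B * (T + T ^ (1 / 3 : ℝ) * β ^ 2) := by
    rw [intervalIntegral.integral_of_le ht.1.le]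
    calc _ ≤ ∫ r in Ioo 0 T, k r := setIntegral_mono_set hki (Eventually.of_forall hk0)
          (hsub le_rfl).eventuallyLE
      _ = 2 * B * (T + (mixedNorm 2 T 3 (3 * γ / 2) b).toReal ^ 2) := by
          rw [integral_const_mul, integral_add (integrable_const _) hb2,
            hb.integral_toReal_sq (by norm_num) (by norm_num) (by norm_num)]
          simp [hT.le]
      _ ≤ _ := by
          have := hb.mixedNorm_two_le hT (by norm_num) (by norm_num)
          gcongr
  set X := T + T ^ (1 / 3 : ℝ) * β ^ 2 with hX
  have hX0 : 0 ≤ X := by positivity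
  -- The difference of the two sides is `2 E0 (2B + 1) f + (4B² + 2B + 1) f²`.
  have hA : E0 ^ 2 + 2 * B * f ^ 2 ≤ (E0 + (2 * B + 1) * f) ^ 2 := by
    have h7 : 0 ≤ E0 * ((2 * B + 1) * f) := by positivity
    have h8 : 0 ≤ (4 * B ^ 2 + 2 * B + 1) * f ^ 2 := by positivity
    linarith
  calc _ ≤ (E0 ^ 2 + 2 * B * f ^ 2) + ∫ τ in 0..t, k τ * y τ := hineq t ⟨ht.1, le_rfl⟩
    _ ≤ (E0 ^ 2 + 2 * B * f ^ 2) * Real.exp (∫ r in 0..t, k r) := hgr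
    _ ≤ (E0 + (2 * B + 1) * f) ^ 2 * Real.exp (2 * ((2 * B + 1) * X)) := by
        refine mul_le_mul hA (Real.exp_le_exp.2 (hkle.trans ?_)) (Real.exp_pos _).le (sq_nonneg _)
        nlinarith [mul_nonneg hB hX0]
    _ = _ := by rw [mul_pow, ← Real.exp_nat_mul]; norm_num

end WeightedAD

theorem mainTheorem10 (γ : ℝ) (hγ : 0 < γ) (hγ' : γ ≤ 2) :
    ∃ C : ℝ, 0 < C ∧
      ∀ (T : ℝ), 0 < T →
      ∀ (u₀ : WeightedAD.E3 → WeightedAD.E3) (F : ℝ → WeightedAD.E3 → WeightedAD.Tensor3)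
        (b : ℝ → WeightedAD.E3 → WeightedAD.E3),
        WeightedAD.IsData γ T u₀ F b →
      ∀ (u : ℝ → WeightedAD.E3 → WeightedAD.E3) (Du : ℝ → WeightedAD.E3 → WeightedAD.Tensor3)
        (p : ℝ → WeightedAD.E3 → ℝ),
        WeightedAD.IsSolution γ T u₀ F b u Du p →
        (⨆ t ∈ Ioo (0 : ℝ) T, WeightedAD.wNorm 2 γ (u t)) ≤
            (WeightedAD.wNorm 2 γ u₀ + ENNReal.ofReal C * WeightedAD.mixedNorm 2 T 2 γ F) *
              ENNReal.ofReal (Real.exp (C * (T + T ^ (1 / 3 : ℝ) *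
                (WeightedAD.mixedNorm 3 T 3 (3 * γ / 2) b).toReal ^ 2))) ∧
        WeightedAD.mixedNorm 2 T 2 γ Du ≤
            (WeightedAD.wNorm 2 γ u₀ + ENNReal.ofReal C * WeightedAD.mixedNorm 2 T 2 γ F) *
              ENNReal.ofReal (Real.exp (C * (T + T ^ (1 / 3 : ℝ) *
                (WeightedAD.mixedNorm 3 T 3 (3 * γ / 2) b).toReal ^ 2))) := by
  obtain ⟨C, hC, hest⟩ := WeightedAD.exists_energy_estimate hγ hγ'
  refine ⟨C, hC, fun T hT u₀ F b hd u Du p hs => ?_⟩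
  have h := hest T hT u₀ F b hd u Du p hs
  set E := Real.exp (C * (T + T ^ (1 / 3 : ℝ) *
    (WeightedAD.mixedNorm 3 T 3 (3 * γ / 2) b).toReal ^ 2))
  set R := ((WeightedAD.wNorm 2 γ u₀).toReal + C * (WeightedAD.mixedNorm 2 T 2 γ F).toReal) * E
    with hR
  have hR0 : 0 ≤ R := by positivity
  have hu₀ : WeightedAD.wNorm 2 γ u₀ ≠ ⊤ := hd.memLp_init.2.ne
  -- All norms of the data are finite, so the extended real bound is the real one.
  have hRe : (WeightedAD.wNorm 2 γ u₀ + ENNReal.ofReal C * WeightedAD.mixedNorm 2 T 2 γ F) *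
      ENNReal.ofReal E = ENNReal.ofReal R := by
    rw [hR, ENNReal.ofReal_mul (by positivity), ENNReal.ofReal_add (by positivity) (by positivity),
      ENNReal.ofReal_mul hC.le, ENNReal.ofReal_toReal hu₀,
      ENNReal.ofReal_toReal hd.mem_force.2.ne]
  have hD := hs.mem_gradient
  have hD2 := hD.integrable_toReal_sq le_rfl (by norm_num) (by norm_num)
  rw [hRe]
  refine ⟨iSup₂_le fun t ht => ?_, ?_⟩
  · have hut := hs.weaklyContinuous.1 t (Ioo_subset_Ico_self ht)
    refine (ENNReal.le_ofReal_iff_toReal_le hut.2.ne hR0).2 ?_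
    refine le_of_sq_le_sq ?_ hR0
    have : 0 ≤ ∫ τ in 0..t, (WeightedAD.wNorm 2 γ (Du τ)).toReal ^ 2 :=
      intervalIntegral.integral_nonneg ht.1.le fun τ _ => by positivity
    exact (le_add_of_nonneg_right this).trans (h t ht)
  · refine (ENNReal.le_ofReal_iff_toReal_le hD.2.ne hR0).2 (le_of_sq_le_sq ?_ hR0)
    rw [← hD.integral_toReal_sq le_rfl (by norm_num) (by norm_num),
      ← integral_Ioc_eq_integral_Ioo, ← intervalIntegral.integral_of_le hT.le]
    -- The estimate is known for `t < T`. The integrated dissipation is continuous up to `T`, which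
    -- gives the norm over the whole of `(0, T)` as `t → T`.
    have hc : ContinuousOn (fun t => ∫ τ in 0..t, (WeightedAD.wNorm 2 γ (Du τ)).toReal ^ 2)
        (uIcc 0 T) :=
      intervalIntegral.continuousOn_primitive_interval'
          ((intervalIntegrable_iff_integrableOn_Ioo_of_le
        hT.le).2 hD2) left_mem_uIcc
    rw [uIcc_of_le hT.le] at hc
    have hl := (hc T (right_mem_Icc.2 hT.le)).mono Ioo_subset_Icc_self
    have : (𝓝[Ioo 0 T] T).NeBot := by
      rw [← mem_closure_iff_nhdsWithin_neBot, closure_Ioo hT.ne]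
      exact right_mem_Icc.2 hT.le
    refine le_of_tendsto hl ?_
    filter_upwards [self_mem_nhdsWithin] with t ht
    exact (le_add_of_nonneg_left (sq_nonneg _)).trans (h t ht)
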